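/- Let $k$ be a field. A left bialgebroid over a unital $k$-algebra $B$ is a $k$-algebra $L$ with an algebra map $s:B\to L$ and an anti-algebra map $t:B\to L$, $t(b)=\bar b$, with commuting images, and a $B$-coring structure $\Delta(X)=X_{(1)}\otimes X_{(2)}$, $\varepsilon$ for the bimodule structure $a.X.b=s(a)t(b)X$, such that $\Delta$ is an algebra map into the Takeuchi product $L\times_B L\subseteq L\diamond_B L:=L\otimes L/\langle \bar bX\otimes Y-X\otimes bY\rangle$, $\varepsilon(1)=1$ and $\varepsilon(XY)=\varepsilon(X\varepsilon(Y))=\varepsilon(X\overline{\varepsilon(Y)})$ (elements of $B$ are viewed in $L$ through $s$). It is a left Hopf algebroid if $\lambda:L\otimes_{\overline B}L\to L\diamond_B L$, $X\otimes Y\mapsto X_{(1)}\otimes X_{(2)}Y$, is invertible, where $L\otimes_{\overline B}L=L\otimes L/\langle X\bar b\otimes Y-X\otimes\bar bY\rangle$; write $X_+\otimes X_-=\lambda^{-1}(X\otimes 1)$. A left comodule is a $B$-bimodule $M$ with a coassociative, counital map $M\to L\times_B M$, $m\mapsto m_{(-1)}\otimes m_{(0)}$, that satisfies $(a m b)_{(-1)}\otimes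 (a m b)_{(0)}=a\,m_{(-1)}\,b\otimes m_{(0)}$. A left 2-cocycle on $L$ is a $k$-linear map $\Gamma:L\otimes_{\overline B}L\to B$ with $\Gamma(\bar bX,Y)=\Gamma(X,Y)b$, $\Gamma(X,\Gamma(Y_{(1)},Z_{(1)})Y_{(2)}Z_{(2)})=\Gamma(\Gamma(X_{(1)},Y_{(1)})X_{(2)}Y_{(2)},Z)$ and $\Gamma(1,X)=\varepsilon(X)=\Gamma(X,1)$. It defines an algebra $B^\Gamma$ on the vector space $B$ by $a\cdot_\Gamma b=\Gamma(a,b)$, and $B^\Gamma$-bimodule structures $b\cdot_\Gamma m=\Gamma(b,m_{(-1)})m_{(0)}$, $m\cdot_\Gamma b=\Gamma(m_{(-1)},b)m_{(0)}$ on left comodules. $\Gamma$ is invertible if for all left comodules $M,N$ the map $\Gamma^\#:M\otimes_{B^\Gamma}N\to M\otimes_BN$, $m\otimes n\mapsto\Gamma(m_{(-1)},n_{(-1)})m_{(0)}\otimes n_{(0)}$, is invertible. For an invertible left 2-cocycle $\Gamma$ on a left Hopf algebroid $L$ over $B$, let $L^\Gamma$ be the vector space $L$ with the same unit, source and target maps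 (now on $B^\Gamma$), product $X\cdot_\Gamma Y=\Gamma(X_{(1)},Y_{(1)})X_{(2)+}Y_{(2)+}\overline{\Gamma(Y_{(2)-},X_{(2)-})}$, counit $\varepsilon^\Gamma(X)=\Gamma(X_+,X_-)$ and coproduct $\Delta^\Gamma(X)=X_{[1]}\otimes X_{[2]}$ determined by $\Gamma^\#(\Delta^\Gamma(X))=\Delta(X)$, where $\Gamma^\#:L^\Gamma\diamond_{B^\Gamma}L^\Gamma\to L\diamond_BL$, $X\otimes Y\mapsto X_+\overline{\Gamma(X_-,Y_{(1)})}\otimes Y_{(2)}$. **Theorem.** Let $\Gamma$ be an invertible left 2-cocycle on a left Hopf algebroid $L$ over $B$. 1. $L^\Gamma$ is a left Hopf algebroid over $B^\Gamma$. 2. The trivial cocycle $\hat\varepsilon(X,Y)=\varepsilon(XY)$ is an invertible left 2-cocycle on $L$, and $L^{\hat\varepsilon}=L$. 3. $\Gamma^{-1}(X,Y)=\Gamma\big(X_+Y_+,\Gamma(Y_{-(1)},X_{-(1)})Y_{-(2)}X_{-(2)}\big)$ is an invertible left 2-cocycle on $L^\Gamma$, and $(L^\Gamma)^{\Gamma^{-1}}=L$.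 4. If $\Sigma$ is an invertible left 2-cocycle on $L^\Gamma$, then $(\Sigma\circ\Gamma)(X,Y)=\Gamma(\Sigma(X_{[1]},Y_{[1]})\cdot_\Gamma X_{[2]},Y_{[2]})$ is an invertible left 2-cocycle on $L$, and $L^{\Sigma\circ\Gamma}=(L^\Gamma)^\Sigma$. Moreover, the left Hopf algebroids over $k$-algebras, with the invertible left 2-cocycles $\Gamma$ on $L$ as the morphisms $\Gamma:L\to L^\Gamma$, form a groupoid: the composite of $\Gamma:L\to L^\Gamma$ and $\Sigma:L^\Gamma\to(L^\Gamma)^\Sigma$ is $\Sigma\circ\Gamma$, the identity of $L$ is $\hat\varepsilon$, and the inverse of $\Gamma$ is $\Gamma^{-1}$. -/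

import Mathlib

open scoped TensorProduct

universe u

noncomputable section

namespace HopfAlgebroidTwist

section Linear

variable {k : Type u} [Field k]
variable {V W M N P : Type u} [AddCommGroup V] [Module k V] [AddCommGroup W] [Module k W]
  [AddCommGroup M] [Module k M] [AddCommGroup N] [Module k N]

/-- `f : V → W` induces an isomorphism `V / S ≅ W`: it is onto and its kernel is exactly `S`. -/
def InducesIso (f : V →ₗ[k] W) (S : Submodule k V) : Prop :=
  LinearMap.ker f = S ∧ Function.Surjective f

open Classical in
/-- A `k`-linear section of a surjective linear map `f` (one exists because `k` is a field;
the value is `0` if `f` is not surjective). If `f` induces an isomorphism `V / S ≅ W`, then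
`linSection f` followed by `V → V / S` is the inverse isomorphism, whatever section was chosen. -/
def linSection (f : V →ₗ[k] W) : W →ₗ[k] V :=
  if h : ∃ g : W →ₗ[k] V, f ∘ₗ g = LinearMap.id then h.choose else 0

/-- A surjective map does have its chosen section. -/
theorem linSection_spec (f : V →ₗ[k] W) (hf : Function.Surjective f) (w : W) :
    f (linSection f w) = w := by
  have h : ∃ g : W →ₗ[k] V, f ∘ₗ g = LinearMap.id :=
    LinearMap.exists_rightInverse_of_surjective f (LinearMap.range_eq_top.2 hf)
  have h2 : f ∘ₗ linSection f = LinearMap.id := by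
    unfold linSection
    rw [dif_pos h]
    exact h.choose_spec
  exact LinearMap.congr_fun h2 w

variable (k) in
/-- The relations `(m · p) ⊗ n = m ⊗ (p · n)` defining a balanced tensor product as a quotient
of `M ⊗ N`, for a "right" action `r` on `M` and a "left" action `l` on `N`. -/
def balancedRel (r : P → M → M) (l : P → N → N) : Submodule k (M ⊗[k] N) :=
  Submodule.span k {z | ∃ (p : P) (m : M) (n : N), z = r p m ⊗ₜ[k] n - m ⊗ₜ[k] l p n}

/-- The exchange `(v ⊗ m) ⊗ (w ⊗ n) ↦ (v ⊗ w) ⊗ (m ⊗ n)`. -/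
def exch : (V ⊗[k] M) ⊗[k] (W ⊗[k] N) →ₗ[k] (V ⊗[k] W) ⊗[k] (M ⊗[k] N) :=
  (TensorProduct.tensorTensorTensorComm k V M W N).toLinearMap

end Linear

/-- The raw structure maps of a left bialgebroid with underlying vector spaces `B` (base) and `L`
(total space). The coproduct takes values in `L ⋄_B L`, the quotient of `L ⊗ L` by
`t(b)X ⊗ Y = X ⊗ s(b)Y`. The axioms are in `IsLeftBialgebroid` below. -/
@[ext] structure BialgebroidData (k : Type u) [Field k] (B L : Type u)
    [AddCommGroup B] [Module k B] [AddCommGroup L] [Module k L] where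
  mulB : B →ₗ[k] B →ₗ[k] B
  oneB : B
  mulL : L →ₗ[k] L →ₗ[k] L
  oneL : L
  /-- the source map `s` -/
  src : B →ₗ[k] L
  /-- the target map `t`, written `b ↦ b̄` in the literature -/
  tgt : B →ₗ[k] L
  comul : L →ₗ[k]
    (L ⊗[k] L) ⧸ balancedRel k (fun (b : B) X => mulL (tgt b) X) (fun (b : B) Y => mulL (src b) Y)
  counit : L →ₗ[k] B

namespace BialgebroidData

variable {k : Type u} [Field k] {B L : Type u}
  [AddCommGroup B] [Module k B] [AddCommGroup L] [Module k L]
variable {M N : Type u} [AddCommGroup M] [Module k M] [AddCommGroup N] [Module k N]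
variable (H : BialgebroidData k B L)

/-- Multiplication of `L` as a map `L ⊗ L → L`. -/
def mulT : L ⊗[k] L →ₗ[k] L := TensorProduct.lift H.mulL

/-- The relations `t(b)X ⊗ m = X ⊗ b m` defining `L ⋄_B M`, for a left action of `B` on `M`. -/
def diamond (lact : B → M → M) : Submodule k (L ⊗[k] M) :=
  balancedRel k (fun (b : B) X => H.mulL (H.tgt b) X) lact

/-- The relations defining `L ⋄_B L ⋄_B M` as a quotient of `L ⊗ (L ⊗ M)`. -/
def diamond3 (lact : B → M → M) : Submodule k (L ⊗[k] (L ⊗[k] M)) :=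
  Submodule.span k
    ({z | ∃ (b : B) (X Y : L) (m : M), z = H.mulL (H.tgt b) X ⊗ₜ[k] (Y ⊗ₜ[k] m)
        - X ⊗ₜ[k] (H.mulL (H.src b) Y ⊗ₜ[k] m)} ∪
     {z | ∃ (b : B) (X Y : L) (m : M), z = X ⊗ₜ[k] (H.mulL (H.tgt b) Y ⊗ₜ[k] m)
        - X ⊗ₜ[k] (Y ⊗ₜ[k] lact b m)})

/-- The left action `b · X = s(b)X` of `B` on `L`. -/
def lactL : B →ₗ[k] L →ₗ[k] L := H.mulL ∘ₗ H.src

/-- The projection `L ⊗ L → L ⋄_B L`. -/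
def toDiamond : L ⊗[k] L →ₗ[k] (L ⊗[k] L) ⧸ H.diamond (fun b Y => H.mulL (H.src b) Y) :=
  (H.diamond (fun b Y => H.mulL (H.src b) Y)).mkQ

/-- A linear choice of representatives `X ↦ X₍₁₎ ⊗ X₍₂₎` in `L ⊗ L` of the coproduct. All
expressions formed from it below are independent of the choice for left bialgebroids. -/
def comulLift : L →ₗ[k] L ⊗[k] L := linSection H.toDiamond ∘ₗ H.comul

/-- The axioms of a left `B`-bialgebroid. -/
structure IsLeftBialgebroid : Prop where
  -- `B` and `L` are unital associative `k`-algebras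
  mulB_assoc : ∀ a b c, H.mulB (H.mulB a b) c = H.mulB a (H.mulB b c)
  oneB_mul : ∀ a, H.mulB H.oneB a = a
  mul_oneB : ∀ a, H.mulB a H.oneB = a
  mulL_assoc : ∀ X Y Z, H.mulL (H.mulL X Y) Z = H.mulL X (H.mulL Y Z)
  oneL_mul : ∀ X, H.mulL H.oneL X = X
  mul_oneL : ∀ X, H.mulL X H.oneL = X
  -- `s` is an algebra map, `t` an anti-algebra map, with commuting images
  src_one : H.src H.oneB = H.oneL
  src_mul : ∀ a b, H.src (H.mulB a b) = H.mulL (H.src a) (H.src b)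
  tgt_one : H.tgt H.oneB = H.oneL
  tgt_mul : ∀ a b, H.tgt (H.mulB a b) = H.mulL (H.tgt b) (H.tgt a)
  src_tgt : ∀ a b, H.mulL (H.src a) (H.tgt b) = H.mulL (H.tgt b) (H.src a)
  -- `Δ` and `ε` are `B`-bimodule maps for `a.X.b = s(a)t(b)X`
  comul_bimod : ∀ a b X, H.comul (H.mulL (H.mulL (H.src a) (H.tgt b)) X) =
    H.toDiamond (TensorProduct.map (H.mulL (H.src a)) (H.mulL (H.tgt b)) (H.comulLift X))
  counit_bimod : ∀ a b X, H.counit (H.mulL (H.mulL (H.src a) (H.tgt b)) X) =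
    H.mulB (H.mulB a (H.counit X)) b
  -- coring axioms: `X₍₁₎₍₁₎ ⋄ X₍₁₎₍₂₎ ⋄ X₍₂₎ = X₍₁₎ ⋄ X₍₂₎₍₁₎ ⋄ X₍₂₎₍₂₎`,
  -- `s(ε(X₍₁₎))X₍₂₎ = X = t(ε(X₍₂₎))X₍₁₎`
  coassoc : ∀ X,
    TensorProduct.assoc k L L L (TensorProduct.map H.comulLift LinearMap.id (H.comulLift X))
      - TensorProduct.map LinearMap.id H.comulLift (H.comulLift X)
      ∈ H.diamond3 (fun b Y => H.mulL (H.src b) Y)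
  counit_left : ∀ X,
    H.mulT (TensorProduct.map (H.src ∘ₗ H.counit) LinearMap.id (H.comulLift X)) = X
  counit_right : ∀ X,
    H.mulT (TensorProduct.comm k L L
      (TensorProduct.map LinearMap.id (H.tgt ∘ₗ H.counit) (H.comulLift X))) = X
  -- `Δ` lands in the Takeuchi product: `X₍₁₎t(b) ⋄ X₍₂₎ = X₍₁₎ ⋄ X₍₂₎s(b)`
  takeuchi : ∀ b X,
    H.toDiamond (TensorProduct.map (H.mulL.flip (H.tgt b)) LinearMap.id (H.comulLift X)) =
    H.toDiamond (TensorProduct.map LinearMap.id (H.mulL.flip (H.src b)) (H.comulLift X))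
  -- `Δ` is an algebra map
  comul_one : H.comul H.oneL = H.toDiamond (H.oneL ⊗ₜ[k] H.oneL)
  comul_mul : ∀ X Y, H.comul (H.mulL X Y) =
    H.toDiamond (TensorProduct.map H.mulT H.mulT (exch (H.comulLift X ⊗ₜ[k] H.comulLift Y)))
  -- `ε` is a left character
  counit_one : H.counit H.oneL = H.oneB
  counit_mul_src : ∀ X Y, H.counit (H.mulL X Y) = H.counit (H.mulL X (H.src (H.counit Y)))
  counit_mul_tgt : ∀ X Y, H.counit (H.mulL X Y) = H.counit (H.mulL X (H.tgt (H.counit Y)))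

/-- The map `λ : L ⊗ L → L ⋄_B L`, `X ⊗ Y ↦ X₍₁₎ ⋄ X₍₂₎Y`. -/
def galois : L ⊗[k] L →ₗ[k] (L ⊗[k] L) ⧸ H.diamond (fun b Y => H.mulL (H.src b) Y) :=
  H.toDiamond ∘ₗ TensorProduct.map LinearMap.id H.mulT ∘ₗ
    (TensorProduct.assoc k L L L).toLinearMap ∘ₗ TensorProduct.map H.comulLift LinearMap.id

/-- The relations `X t(b) ⊗ Y = X ⊗ t(b) Y` defining `L ⊗_{B̄} L`. -/
def barRel : Submodule k (L ⊗[k] L) :=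
  balancedRel k (fun b X => H.mulL X (H.tgt b)) (fun b Y => H.mulL (H.tgt b) Y)

/-- A left Hopf algebroid: a left bialgebroid for which `λ : L ⊗_{B̄} L → L ⋄_B L` is invertible. -/
structure IsLeftHopfAlgebroid : Prop where
  bialgebroid : H.IsLeftBialgebroid
  galois_iso : InducesIso H.galois H.barRel

/-- A linear choice of representatives `X ↦ X₊ ⊗ X₋` in `L ⊗ L` of `λ⁻¹(X ⋄ 1) ∈ L ⊗_{B̄} L`. -/
def transLift : L →ₗ[k] L ⊗[k] L :=
  linSection H.galois ∘ₗ H.toDiamond ∘ₗ (TensorProduct.mk k L L).flip H.oneL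

/-- A left comodule over `L`: a `B`-bimodule `M` with a coaction `M → L ⋄_B M`. -/
structure Comodule (M : Type u) [AddCommGroup M] [Module k M] where
  /-- `lact b m = b m` -/
  lact : B →ₗ[k] M →ₗ[k] M
  /-- `ract b m = m b` -/
  ract : B →ₗ[k] M →ₗ[k] M
  lact_one : ∀ m, lact H.oneB m = m
  lact_mul : ∀ a b m, lact (H.mulB a b) m = lact a (lact b m)
  ract_one : ∀ m, ract H.oneB m = m
  ract_mul : ∀ a b m, ract (H.mulB a b) m = ract b (ract a m)
  lact_ract : ∀ a b m, lact a (ract b m) = ract b (lact a m)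
  /-- the coaction `m ↦ m₍₋₁₎ ⋄ m₍₀₎` -/
  coact : M →ₗ[k] (L ⊗[k] M) ⧸ H.diamond (fun b m => lact b m)
  -- `δ(a m b) = s(a) m₍₋₁₎ s(b) ⋄ m₍₀₎`
  coact_bimod : ∀ a b m, coact (lact a (ract b m)) =
    (H.diamond (fun b m => lact b m)).mkQ
      (TensorProduct.map (H.mulL (H.src a) ∘ₗ H.mulL.flip (H.src b)) LinearMap.id
        (linSection (H.diamond (fun b m => lact b m)).mkQ (coact m)))
  -- `m₍₋₁₎ t(b) ⋄ m₍₀₎ = m₍₋₁₎ ⋄ m₍₀₎ b`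
  takeuchi : ∀ b m,
    (H.diamond (fun b m => lact b m)).mkQ (TensorProduct.map (H.mulL.flip (H.tgt b)) LinearMap.id
        (linSection (H.diamond (fun b m => lact b m)).mkQ (coact m))) =
    (H.diamond (fun b m => lact b m)).mkQ (TensorProduct.map LinearMap.id (ract b)
        (linSection (H.diamond (fun b m => lact b m)).mkQ (coact m)))
  coassoc : ∀ m,
    TensorProduct.assoc k L L M (TensorProduct.map H.comulLift LinearMap.id
        (linSection (H.diamond (fun b m => lact b m)).mkQ (coact m)))
      - TensorProduct.map LinearMap.id (linSection (H.diamond (fun b m => lact b m)).mkQ ∘ₗ coact)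
        (linSection (H.diamond (fun b m => lact b m)).mkQ (coact m))
      ∈ H.diamond3 (fun b m => lact b m)
  counit : ∀ m, TensorProduct.lift lact (TensorProduct.map H.counit LinearMap.id
    (linSection (H.diamond (fun b m => lact b m)).mkQ (coact m))) = m

variable {H} in
/-- A linear choice of representatives `m ↦ m₍₋₁₎ ⊗ m₍₀₎` in `L ⊗ M` of the coaction. -/
def Comodule.coactLift (C : H.Comodule M) : M →ₗ[k] L ⊗[k] M :=
  linSection (H.diamond (fun b m => C.lact b m)).mkQ ∘ₗ C.coact

/-- `X ⊗ Y ↦ Γ(X₍₁₎, Y₍₁₎) X₍₂₎ Y₍₂₎`. -/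
def leftTwist (Γ : L →ₗ[k] L →ₗ[k] B) : L ⊗[k] L →ₗ[k] L :=
  H.mulT ∘ₗ TensorProduct.map (H.src ∘ₗ TensorProduct.lift Γ) H.mulT ∘ₗ exch ∘ₗ
    TensorProduct.map H.comulLift H.comulLift

/-- A left 2-cocycle on `L`: a left `B̄`-linear map `L ⊗_{B̄} L → B` with the two cocycle
conditions, given as a bilinear map on `L × L`. -/
structure IsTwoCocycle (Γ : L →ₗ[k] L →ₗ[k] B) : Prop where
  balanced : ∀ b X Y, Γ (H.mulL X (H.tgt b)) Y = Γ X (H.mulL (H.tgt b) Y)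
  bar_linear : ∀ b X Y, Γ (H.mulL (H.tgt b) X) Y = H.mulB (Γ X Y) b
  cocycle : ∀ X Y Z, Γ X (H.leftTwist Γ (Y ⊗ₜ[k] Z)) = Γ (H.leftTwist Γ (X ⊗ₜ[k] Y)) Z
  one_left : ∀ X, Γ H.oneL X = H.counit X
  one_right : ∀ X, Γ X H.oneL = H.counit X

/-- `m ⊗ n ↦ Γ(m₍₋₁₎, n₍₋₁₎) m₍₀₎ ⊗ n₍₀₎`, for representatives `δM`, `δN` of coactions on `M`, `N`
and a left action of `B` on `M`. -/
def sharp (Γ : L →ₗ[k] L →ₗ[k] B) (δM : M →ₗ[k] L ⊗[k] M) (δN : N →ₗ[k] L ⊗[k] N)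
    (lact : B →ₗ[k] M →ₗ[k] M) : M ⊗[k] N →ₗ[k] M ⊗[k] N :=
  TensorProduct.map (TensorProduct.lift lact) LinearMap.id ∘ₗ
    (TensorProduct.assoc k B M N).symm.toLinearMap ∘ₗ
    TensorProduct.map (TensorProduct.lift Γ) LinearMap.id ∘ₗ exch ∘ₗ TensorProduct.map δM δN

variable {H} in
/-- The twisted left action `b ·_Γ m = Γ(s(b), m₍₋₁₎) m₍₀₎` of `B^Γ` on a comodule. -/
def Comodule.twLact (C : H.Comodule M) (Γ : L →ₗ[k] L →ₗ[k] B) (b : B) (m : M) : M :=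
  TensorProduct.lift C.lact (TensorProduct.map (Γ (H.src b)) LinearMap.id (C.coactLift m))

variable {H} in
/-- The twisted right action `m ·_Γ b = Γ(m₍₋₁₎, s(b)) m₍₀₎` of `B^Γ` on a comodule. -/
def Comodule.twRact (C : H.Comodule M) (Γ : L →ₗ[k] L →ₗ[k] B) (b : B) (m : M) : M :=
  TensorProduct.lift C.lact (TensorProduct.map (Γ.flip (H.src b)) LinearMap.id (C.coactLift m))

/-- An invertible left 2-cocycle: for all left comodules `M`, `N` the map
`Γ^# : M ⊗_{B^Γ} N → M ⊗_B N`, `m ⊗ n ↦ Γ(m₍₋₁₎, n₍₋₁₎) m₍₀₎ ⊗ n₍₀₎` is invertible. -/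
structure IsInvertibleTwoCocycle (Γ : L →ₗ[k] L →ₗ[k] B) : Prop where
  isTwoCocycle : H.IsTwoCocycle Γ
  sharp_iso : ∀ (M N : Type u) [AddCommGroup M] [Module k M] [AddCommGroup N] [Module k N]
    (C : H.Comodule M) (D : H.Comodule N),
    InducesIso
      ((balancedRel k (fun b m => C.ract b m) (fun b n => D.lact b n)).mkQ ∘ₗ
        sharp Γ C.coactLift D.coactLift C.lact)
      (balancedRel k (C.twRact Γ) (D.twLact Γ))

/-- `X ⊗ Y ↦ X₊ Y₊ t(Γ(Y₋, X₋))`. -/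
def rightTwist (Γ : L →ₗ[k] L →ₗ[k] B) : L ⊗[k] L →ₗ[k] L :=
  H.mulT ∘ₗ TensorProduct.map H.mulT
      (H.tgt ∘ₗ TensorProduct.lift Γ ∘ₗ (TensorProduct.comm k L L).toLinearMap) ∘ₗ
    exch ∘ₗ TensorProduct.map H.transLift H.transLift

/-- The twisted product `X ·_Γ Y = Γ(X₍₁₎, Y₍₁₎) X₍₂₎₊ Y₍₂₎₊ t(Γ(Y₍₂₎₋, X₍₂₎₋))`. -/
def twistMul (Γ : L →ₗ[k] L →ₗ[k] B) : L ⊗[k] L →ₗ[k] L :=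
  H.mulT ∘ₗ TensorProduct.map (H.src ∘ₗ TensorProduct.lift Γ) (H.rightTwist Γ) ∘ₗ exch ∘ₗ
    TensorProduct.map H.comulLift H.comulLift

/-- The map `Γ^# : L^Γ ⋄_{B^Γ} L^Γ → L ⋄_B L`, `X ⊗ Y ↦ X₊ t(Γ(X₋, Y₍₁₎)) ⋄ Y₍₂₎`, on
representatives. It is the map `sharp` for the comodules `L` with coaction `X ↦ X₋ ⋄ X₊` and left
action `b.X = X t(b)`, and `L` with its coproduct. -/
def sharpL (Γ : L →ₗ[k] L →ₗ[k] B) :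
    L ⊗[k] L →ₗ[k] (L ⊗[k] L) ⧸ H.diamond (fun b Y => H.mulL (H.src b) Y) :=
  H.toDiamond ∘ₗ sharp Γ ((TensorProduct.comm k L L).toLinearMap ∘ₗ H.transLift) H.comulLift
    (H.mulL.flip ∘ₗ H.tgt)

/-- The structure maps of the cotwist `L^Γ` over `B^Γ`, on the same vector spaces `L` and `B`. The
product of `B^Γ` is `a ·_Γ b = Γ(s(a), s(b))`, the units, the source and the target map are
unchanged, `Δ^Γ = (Γ^#)⁻¹ ∘ Δ`, and `ε^Γ(X) = Γ(X₊, X₋)`. -/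
def twist (Γ : L →ₗ[k] L →ₗ[k] B) : BialgebroidData k B L where
  mulB := Γ.compl₁₂ H.src H.src
  oneB := H.oneB
  mulL := TensorProduct.curry (H.twistMul Γ)
  oneL := H.oneL
  src := H.src
  tgt := H.tgt
  comul := Submodule.mkQ _ ∘ₗ linSection (H.sharpL Γ) ∘ₗ H.comul
  counit := TensorProduct.lift Γ ∘ₗ H.transLift

/-- The trivial 2-cocycle `(X, Y) ↦ ε(XY)`. -/
def trivialCocycle : L →ₗ[k] L →ₗ[k] B := TensorProduct.curry (H.counit ∘ₗ H.mulT)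

/-- The inverse `Γ⁻¹(X, Y) = Γ(X₊Y₊, Γ(Y₋₍₁₎, X₋₍₁₎) Y₋₍₂₎ X₋₍₂₎)`, a map on `L^Γ`. -/
def cocycleInv (Γ : L →ₗ[k] L →ₗ[k] B) : L →ₗ[k] L →ₗ[k] B :=
  TensorProduct.curry (TensorProduct.lift Γ ∘ₗ
    TensorProduct.map H.mulT (H.leftTwist Γ ∘ₗ (TensorProduct.comm k L L).toLinearMap) ∘ₗ
    exch ∘ₗ TensorProduct.map H.transLift H.transLift)

/-- The composition `(Θ ∘ Γ)(X, Y) = Γ(Θ(X₍[1]₎, Y₍[1]₎) ·_Γ X₍[2]₎, Y₍[2]₎)`, for `Γ` on `L` and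
`Θ` on `L^Γ`, where `X₍[1]₎ ⋄ X₍[2]₎ = Δ^Γ(X)`. -/
def cocycleComp (Θ Γ : L →ₗ[k] L →ₗ[k] B) : L →ₗ[k] L →ₗ[k] B :=
  TensorProduct.curry (TensorProduct.lift Γ ∘ₗ
    TensorProduct.map (H.twist Γ).mulT LinearMap.id ∘ₗ
    (TensorProduct.assoc k L L L).symm.toLinearMap ∘ₗ
    TensorProduct.map (H.src ∘ₗ TensorProduct.lift Θ) LinearMap.id ∘ₗ
    exch ∘ₗ TensorProduct.map (H.twist Γ).comulLift (H.twist Γ).comulLift)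

end BialgebroidData

/-- A left Hopf algebroid over the field `k` (over an arbitrary base algebra `B`). -/
structure LeftHopfAlgebroid (k : Type u) [Field k] where
  B : Type u
  L : Type u
  [addCommGroupB : AddCommGroup B]
  [moduleB : Module k B]
  [addCommGroupL : AddCommGroup L]
  [moduleL : Module k L]
  data : BialgebroidData k B L
  isLeftHopfAlgebroid : data.IsLeftHopfAlgebroid

attribute [instance] LeftHopfAlgebroid.addCommGroupB LeftHopfAlgebroid.moduleB
  LeftHopfAlgebroid.addCommGroupL LeftHopfAlgebroid.moduleL

/-- Morphisms of the groupoid: an invertible left 2-cocycle `Γ` on `H` is a morphism from `H` to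
the cotwist `H^Γ` (which has the same underlying vector spaces), and there are no others. -/
inductive CocycleHom {k : Type u} [Field k] :
    LeftHopfAlgebroid k → LeftHopfAlgebroid k → Type (u + 1)
  | mk {B L : Type u} [AddCommGroup B] [Module k B] [AddCommGroup L] [Module k L]
      {H H' : BialgebroidData k B L} {hH : H.IsLeftHopfAlgebroid} {hH' : H'.IsLeftHopfAlgebroid}
      (Γ : L →ₗ[k] L →ₗ[k] B) (hΓ : H.IsInvertibleTwoCocycle Γ) (htarget : H.twist Γ = H') :
      CocycleHom ⟨B, L, H, hH⟩ ⟨B, L, H', hH'⟩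

end HopfAlgebroidTwist

end

/-!
An identity between elements of a balanced tensor product such as `L ⋄_B M` holds if and only if
all linear maps on it agree on the two sides. So Sweedler's notation is made literal: `sw z f` is
`∑ f(mᵢ, nᵢ)` for a chosen representation `z = ∑ mᵢ ⊗ nᵢ`, and an identity is stated as an equality
of such sums for every test map `f` that is bilinear and balanced (`Bal`, with the variants `DBal`
for `L ⋄_B M`, `BBal` for `L ⊗_{B̄} L` and `TBal` for `L ⋄_{B^Γ} M`). A sum may then be moved past
any linear expression, and the only side conditions are linearity, left to `fun_prop` through
`IsLin`, and balancedness.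

*The twist.* Let `J(X ⊗ m) = X₊ t(Γ(X₋, m₍₋₁₎)) ⊗ m₍₀₎`, the map `L ⋄_{B^Γ} M → L ⋄_B M` that
`Γ^#` becomes when `L` carries the coaction `X ↦ X₋ ⋄ X₊`. Nearly all of the argument needs only
that `J` is invertible for all comodules `M`, which is `WInv`. The image of the coaction of `M`
under `J⁻¹` is the twisted coaction `m₍[-1]₎ ⊗ m₍[0]₎` (`tco`); for `M = L` it is `Δ^Γ`. Everything
about it follows from four identities: `tco_star`, which evaluates `X₊ ⊗ X₋ ⋆ m₍₋₁₎ ⊗ m₍₀₎` on it,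
with `⋆` the product of the left twist, and `tco_comul`, `tco_coact`, `tco_trans`, by which it is
coassociative together with the coproduct, the coaction and the translation map of `L`. They make
`M` a comodule of `L^Γ` (`isCom_tco`). The products `⋆` of the left twist, `•` of the right twist
and `·_Γ` of `L^Γ` are all obtained by twisting a pairing of comodules (`twp`), which gives their
associativity at once and, by `IsPairing.tco_twp`, the multiplicativity of `Δ^Γ`. Hence
`isLeftBialgebroid_twist`. The translation map of `L^Γ` is the twisted coaction of `L` with the
coaction `X ↦ X₋ ⋄ X₊`, whence `isLeftHopfAlgebroid_twist`.

*Composition.* The relation `(Θ ∘ Γ)^# = Γ^# Θ^#` (`sw_cocycleComp`) gives the invertibility of a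
composite, and applied to the three products it gives `L^{Θ ∘ Γ} = (L^Γ)^Θ`
(`twist_cocycleComp`). Composition is associative because a cocycle is recovered from its left
twist by the counit, and the left twists by the two composites are the same iterated twist
(`cocycleComp_assoc`).

*The inverse.* The inverse cocycle is `Γ⁻¹(X, Y) = ε^Γ(X • Y)`, and the left twist of `L^Γ` by it is
`•` (`star_cocycleInv`), so the cocycle identity is the associativity of `•`. Moreover `Γ⁻¹ ∘ Γ` and
`Γ ∘ Γ⁻¹` are trivial. This gives `(L^Γ)^{Γ⁻¹} = L`, and it would give the invertibility of
`Γ⁻¹` if every comodule of `L^Γ` were known to be the twist of one of `L`. Before that is known, an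
inverse of `J` for `Γ⁻¹` on a comodule `N` of `L^Γ` is written down (`unpull`); it uses a retraction
of the coaction of `N` (`retract`) built from a left inverse of `Δ^Γ` (`cancel`). This is
`wInv_cocycleInv`. It turns comodules of `L^Γ` into comodules of `L`, where `Γ^#` is invertible, and
the triviality of `Γ ∘ Γ⁻¹` then shows that `(Γ⁻¹)^#` is (`isInvertible_cocycleInv`).
-/

/-! ### Sweedler's notation -/

noncomputable section

namespace HopfAlgebroidTwist

section Sweedler

set_option linter.unusedSectionVars false

variable {k : Type u} [Field k]
variable {V W M N P Q : Type u} [AddCommGroup V] [Module k V] [AddCommGroup W] [Module k W]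
  [AddCommGroup M] [Module k M] [AddCommGroup N] [Module k N] [AddCommGroup P] [Module k P]
  [AddCommGroup Q] [Module k Q]

variable (k) in
/-- Linearity of an unbundled map, as a property that `fun_prop` can establish. -/
@[fun_prop]
structure IsLin (f : V → W) : Prop where
  add : ∀ x y, f (x + y) = f x + f y
  smul : ∀ (c : k) x, f (c • x) = c • f x

namespace IsLin

@[fun_prop] theorem id' : IsLin k (fun x : V => x) := ⟨fun _ _ => rfl, fun _ _ => rfl⟩

@[fun_prop] theorem coe (φ : V →ₗ[k] W) : IsLin k (fun x => φ x) := ⟨map_add φ, map_smul φ⟩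

@[fun_prop] theorem comp {f : W → M} {g : V → W} (hf : IsLin k f) (hg : IsLin k g) :
    IsLin k (fun x => f (g x)) :=
  ⟨fun x y => by rw [hg.add, hf.add], fun c x => by rw [hg.smul, hf.smul]⟩

@[fun_prop] theorem comp_coe (φ : W →ₗ[k] M) {g : V → W} (hg : IsLin k g) :
    IsLin k (fun x => φ (g x)) := (coe φ).comp hg

@[fun_prop] theorem apply_const {g : V → (W →ₗ[k] M)} (hg : IsLin k g) (w : W) :
    IsLin k (fun x => g x w) :=
  ⟨fun x y => by rw [hg.add]; rfl, fun c x => by rw [hg.smul]; rfl⟩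

@[fun_prop] theorem tmul_left {g : V → M} (hg : IsLin k g) (n : N) :
    IsLin k (fun x => g x ⊗ₜ[k] n) :=
  ⟨fun x y => by rw [hg.add, TensorProduct.add_tmul],
    fun c x => by rw [hg.smul, TensorProduct.smul_tmul']⟩

@[fun_prop] theorem tmul_right {g : V → M} (hg : IsLin k g) (n : N) :
    IsLin k (fun x => n ⊗ₜ[k] g x) :=
  ⟨fun x y => by rw [hg.add, TensorProduct.tmul_add],
    fun c x => by rw [hg.smul, TensorProduct.tmul_smul]⟩

/-- The bundled form. -/
def toLin {f : V → W} (hf : IsLin k f) : V →ₗ[k] W := ⟨⟨f, hf.add⟩, hf.smul⟩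

end IsLin

/-- The sum `∑ f(mᵢ, nᵢ)` over a chosen representation `z = ∑ mᵢ ⊗ nᵢ`. It makes Sweedler's
notation literal; it is independent of the representation for bilinear `f`. -/
def sw (z : M ⊗[k] N) (f : M → N → V) : V :=
  ∑ p ∈ (TensorProduct.exists_finset z).choose, f p.1 p.2

variable (k) in
/-- Bilinearity of an unbundled map. -/
structure IsBilin (f : M → N → V) : Prop where
  left : ∀ n, IsLin k (fun m => f m n)
  right : ∀ m, IsLin k (fun n => f m n)

/-- The linear map on the tensor product defined by a bilinear map. -/
def IsBilin.lift {f : M → N → V} (hf : IsBilin k f) : M ⊗[k] N →ₗ[k] V :=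
  TensorProduct.lift (LinearMap.mk₂ k f (fun a b n => (hf.left n).add a b)
    (fun c a n => (hf.left n).smul c a) (fun m a b => (hf.right m).add a b)
    (fun c m a => (hf.right m).smul c a))

theorem IsBilin.lift_tmul {f : M → N → V} (hf : IsBilin k f) (m : M) (n : N) :
    hf.lift (m ⊗ₜ n) = f m n := rfl

theorem sw_eq_lift (z : M ⊗[k] N) {f : M → N → V} (hf : IsBilin k f) : sw z f = hf.lift z := by
  conv_rhs => rw [(TensorProduct.exists_finset z).choose_spec, map_sum]
  rfl

theorem sw_tmul (m : M) (n : N) {f : M → N → V} (hf : IsBilin k f) : sw (m ⊗ₜ[k] n) f = f m n := by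
  rw [sw_eq_lift _ hf, hf.lift_tmul]

theorem sw_sub (z w : M ⊗[k] N) {f : M → N → V} (hf : IsBilin k f) :
    sw (z - w) f = sw z f - sw w f := by
  simp only [sw_eq_lift _ hf, map_sub]

theorem sw_congr (z : M ⊗[k] N) {f g : M → N → V} (h : ∀ m n, f m n = g m n) : sw z f = sw z g :=
  Finset.sum_congr rfl fun _ _ => h _ _

theorem sw_comm (z : M ⊗[k] N) (w : P ⊗[k] Q) (f : M → N → P → Q → V) :
    sw z (fun m n => sw w (fun p q => f m n p q)) = sw w (fun p q => sw z (fun m n => f m n p q)) :=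
  Finset.sum_comm

theorem map_sw (z : M ⊗[k] N) (f : M → N → V) {φ : V → W} (hφ : IsLin k φ) :
    φ (sw z f) = sw z (fun m n => φ (f m n)) :=
  map_sum hφ.toLin _ _

theorem map_sw_left (z : M ⊗[k] N) (f : M → N → V) {φ : V → P → W} (hφ : ∀ p, IsLin k (φ · p)) (p : P) :
    φ (sw z f) p = sw z (fun m n => φ (f m n) p) :=
  map_sw z f (hφ p)

theorem sw_mk (z : M ⊗[k] N) : sw z (fun m n => m ⊗ₜ[k] n) = z :=
  (TensorProduct.exists_finset z).choose_spec.symm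

@[fun_prop] theorem IsLin.sw_left {d : V → M ⊗[k] N} {f : M → N → W} (hd : IsLin k d)
    (h1 : ∀ n, IsLin k (fun m => f m n)) (h2 : ∀ m, IsLin k (fun n => f m n)) :
    IsLin k (fun x => sw (d x) f) := by
  have : (fun x => sw (d x) f) = fun x => (IsBilin.lift ⟨h1, h2⟩ : M ⊗[k] N →ₗ[k] W) (d x) :=
    funext fun x => sw_eq_lift _ _
  rw [this]
  fun_prop

@[fun_prop] theorem IsLin.sw_right (z : M ⊗[k] N) {f : V → M → N → W}
    (h : ∀ m n, IsLin k (fun x => f x m n)) : IsLin k (fun x => sw z (f x)) :=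
  ⟨fun x y => by
    simp only [sw]; rw [← Finset.sum_add_distrib]; exact Finset.sum_congr rfl fun p _ => (h _ _).add _ _,
   fun c x => by simp only [sw, Finset.smul_sum, (h _ _).smul]⟩

theorem map_eq_sw (φ : M ⊗[k] N →ₗ[k] V) (z : M ⊗[k] N) :
    φ z = sw z (fun m n => φ (m ⊗ₜ n)) := by
  conv_lhs => rw [← sw_mk z]
  exact map_sw z _ (IsLin.coe φ)

theorem sw_sw (z : M ⊗[k] N) (g : M → N → P ⊗[k] Q) {f : P → Q → V}
    (h1 : ∀ n, IsLin k (fun m => f m n)) (h2 : ∀ m, IsLin k (fun n => f m n)) :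
    sw (sw z g) f = sw z (fun m n => sw (g m n) f) :=
  map_sw (φ := fun w => sw w f) z g (by fun_prop)

theorem sw_sw_lin (d : W →ₗ[k] P ⊗[k] Q) {z : M ⊗[k] N} (g : M → N → W) {f : P → Q → V}
    (h1 : ∀ n, IsLin k (fun m => f m n)) (h2 : ∀ m, IsLin k (fun n => f m n)) :
    sw (d (sw z g)) f = sw z (fun m n => sw (d (g m n)) f) :=
  map_sw (φ := fun w => sw (d w) f) z g (by fun_prop)

theorem sw_map (φ : M →ₗ[k] P) (ψ : N →ₗ[k] Q) (z : M ⊗[k] N) {f : P → Q → V}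
    (h1 : ∀ n, IsLin k (fun m => f m n)) (h2 : ∀ m, IsLin k (fun n => f m n)) :
    sw (TensorProduct.map φ ψ z) f = sw z (fun m n => f (φ m) (ψ n)) := by
  rw [map_eq_sw, sw_sw _ _ h1 h2]
  exact sw_congr _ fun m n => by rw [TensorProduct.map_tmul, sw_tmul _ _ ⟨h1, h2⟩]

theorem sw_swap (z : M ⊗[k] N) {f : N → M → V}
    (h1 : ∀ n, IsLin k (fun m => f m n)) (h2 : ∀ m, IsLin k (fun n => f m n)) :
    sw (TensorProduct.comm k M N z) f = sw z (fun m n => f n m) := by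
  have : TensorProduct.comm k M N z = sw z (fun m n => n ⊗ₜ[k] m) :=
    map_eq_sw (TensorProduct.comm k M N).toLinearMap z
  rw [this, sw_sw _ _ h1 h2]
  exact sw_congr _ fun m n => sw_tmul _ _ ⟨h1, h2⟩

/-- `f` is bilinear and takes equal values on the two sides of the relations
`(m · p) ⊗ n = m ⊗ (p · n)`: it is a linear map on the balanced tensor product. -/
structure Bal {B : Type u} (r : B → M → M) (l : B → N → N) (f : M → N → V) : Prop where
  left : ∀ n, IsLin k (fun m => f m n)
  right : ∀ m, IsLin k (fun n => f m n)
  bal : ∀ b m n, f (r b m) n = f m (l b n)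

section Balanced

variable {B : Type u} {r : B → M → M} {l : B → N → N}

theorem Bal.bilin {f : M → N → V} (hf : Bal (k := k) r l f) : IsBilin k f := ⟨hf.left, hf.right⟩

theorem Bal.sw_eq_zero {f : M → N → V} (hf : Bal (k := k) r l f) {z : M ⊗[k] N}
    (hz : z ∈ balancedRel k r l) : sw z f = 0 := by
  rw [sw_eq_lift _ hf.bilin, ← LinearMap.mem_ker]
  refine Submodule.span_le.2 ?_ hz
  rintro _ ⟨p, m, n, rfl⟩
  rw [SetLike.mem_coe, LinearMap.mem_ker, map_sub, hf.bilin.lift_tmul, hf.bilin.lift_tmul, hf.bal,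
    sub_self]

theorem Bal.sw_congr {f : M → N → V} (hf : Bal (k := k) r l f) {z w : M ⊗[k] N}
    (h : z - w ∈ balancedRel k r l) : sw z f = sw w f := by
  rw [← sub_eq_zero, ← sw_sub _ _ hf.bilin, hf.sw_eq_zero h]

theorem Bal.sw_congr_mkQ {f : M → N → V} (hf : Bal (k := k) r l f) {z w : M ⊗[k] N}
    (h : (balancedRel k r l).mkQ z = (balancedRel k r l).mkQ w) : sw z f = sw w f :=
  hf.sw_congr ((Submodule.Quotient.eq _).1 h)

theorem bal_mkQ : Bal (k := k) r l (fun m n => (balancedRel k r l).mkQ (m ⊗ₜ[k] n)) where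
  left _ := by fun_prop
  right _ := by fun_prop
  bal b m n := (Submodule.Quotient.eq _).2 (Submodule.subset_span ⟨b, m, n, rfl⟩)

/-- Elements of `M ⊗ N` are congruent as soon as all balanced maps agree on them. -/
theorem mkQ_eq_of_sw {z w : M ⊗[k] N}
    (h : sw z (fun m n => (balancedRel k r l).mkQ (m ⊗ₜ[k] n)) =
      sw w (fun m n => (balancedRel k r l).mkQ (m ⊗ₜ[k] n))) :
    (balancedRel k r l).mkQ z = (balancedRel k r l).mkQ w := by
  rwa [map_eq_sw (balancedRel k r l).mkQ z, map_eq_sw (balancedRel k r l).mkQ w]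

theorem mem_of_sw {z : M ⊗[k] N}
    (h : sw z (fun m n => (balancedRel k r l).mkQ (m ⊗ₜ[k] n)) = 0) : z ∈ balancedRel k r l := by
  rw [← map_eq_sw (balancedRel k r l).mkQ z] at h
  exact (Submodule.Quotient.mk_eq_zero _).1 h

theorem mkQ_linSection (S : Submodule k V) (x : V ⧸ S) : S.mkQ (linSection S.mkQ x) = x :=
  linSection_spec _ S.mkQ_surjective x

end Balanced

end Sweedler
end HopfAlgebroidTwist
end

/-! ### Balanced maps, comodules, and the axioms of a bialgebroid -/

noncomputable section

namespace HopfAlgebroidTwist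

namespace BialgebroidData

set_option linter.unusedSectionVars false

variable {k : Type u} [Field k] {B L : Type u}
  [AddCommGroup B] [Module k B] [AddCommGroup L] [Module k L]
variable {V M N : Type u} [AddCommGroup V] [Module k V] [AddCommGroup M] [Module k M]
  [AddCommGroup N] [Module k N]
variable (H : BialgebroidData k B L)

local infixl:70 " ⬝ " => H.mulL
local notation "𝐬" => H.src
local notation "𝐭" => H.tgt

/-- `f` is a linear map on `L ⋄_B M`, for the left action `la` on `M`. -/
abbrev DBal (la : B →ₗ[k] M →ₗ[k] M) (f : L → M → V) : Prop :=
  Bal (k := k) (fun (b : B) X => H.mulL (H.tgt b) X) (fun (b : B) m => la b m) f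

/-- `f` is a linear map on `L ⋄_B L ⋄_B M`. -/
structure Bal3 (la : B →ₗ[k] M →ₗ[k] M) (f : L → L → M → V) : Prop where
  l1 : ∀ y m, IsLin k (fun x => f x y m)
  l2 : ∀ x m, IsLin k (fun y => f x y m)
  l3 : ∀ x y, IsLin k (fun m => f x y m)
  b1 : ∀ b x y m, f (H.mulL (H.tgt b) x) y m = f x (H.mulL (H.src b) y) m
  b2 : ∀ b x y m, f x (H.mulL (H.tgt b) y) m = f x y (la b m)

variable {H}

theorem Bal3.lin {la : B →ₗ[k] M →ₗ[k] M} {f : L → L → M → V} (hf : H.Bal3 la f) :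
    (∀ w : L ⊗[k] M, IsLin k (fun x => sw w (fun y m => f x y m))) ∧
      ∀ x, IsLin k (fun w : L ⊗[k] M => sw w (fun y m => f x y m)) := by
  obtain ⟨h1, h2, h3, -, -⟩ := hf
  exact ⟨fun w => by fun_prop, fun x => by fun_prop⟩

theorem Bal3.sw_eq_zero {la : B →ₗ[k] M →ₗ[k] M} {f : L → L → M → V} (hf : H.Bal3 la f)
    {z : L ⊗[k] (L ⊗[k] M)} (hz : z ∈ H.diamond3 (fun b m => la b m)) :
    sw z (fun x w => sw w (fun y m => f x y m)) = 0 := by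
  have hb : IsBilin k (fun x (w : L ⊗[k] M) => sw w (fun y m => f x y m)) := ⟨hf.lin.1, hf.lin.2⟩
  rw [sw_eq_lift _ hb, ← LinearMap.mem_ker]
  refine Submodule.span_le.2 ?_ hz
  have e : ∀ x y m, sw (y ⊗ₜ[k] m) (fun y m => f x y m) = f x y m := fun x y m =>
    sw_tmul _ _ ⟨fun _ => hf.l2 _ _, fun _ => hf.l3 _ _⟩
  rintro _ (⟨b, x, y, m, rfl⟩ | ⟨b, x, y, m, rfl⟩)
  · rw [SetLike.mem_coe, LinearMap.mem_ker, map_sub, hb.lift_tmul, hb.lift_tmul, e, e, hf.b1,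
      sub_self]
  · rw [SetLike.mem_coe, LinearMap.mem_ker, map_sub, hb.lift_tmul, hb.lift_tmul, e, e, hf.b2,
      sub_self]

variable (H) in
theorem bal3_mkQ (la : B →ₗ[k] M →ₗ[k] M) : H.Bal3 la (fun x y m =>
    (H.diamond3 (fun b m => la b m)).mkQ (x ⊗ₜ[k] (y ⊗ₜ[k] m))) where
  l1 _ _ := by fun_prop
  l2 _ _ := by fun_prop
  l3 _ _ := by fun_prop
  b1 b x y m := (Submodule.Quotient.eq _).2 (Submodule.subset_span (Or.inl ⟨b, x, y, m, rfl⟩))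
  b2 b x y m := (Submodule.Quotient.eq _).2 (Submodule.subset_span (Or.inr ⟨b, x, y, m, rfl⟩))

theorem sw_coassoc_left (d : L →ₗ[k] L ⊗[k] L) (z : L ⊗[k] M) {f : L → L → M → V}
    (h1 : ∀ y m, IsLin k (fun x => f x y m)) (h2 : ∀ x m, IsLin k (fun y => f x y m))
    (h3 : ∀ x y, IsLin k (fun m => f x y m)) :
    sw (TensorProduct.assoc k L L M (TensorProduct.map d LinearMap.id z))
      (fun x w => sw w (fun y m => f x y m)) =
    sw z (fun x m => sw (d x) (fun u v => f u v m)) := by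
  have e : TensorProduct.assoc k L L M (TensorProduct.map d LinearMap.id z) =
      sw z (fun x m => sw (d x) (fun u v => u ⊗ₜ[k] (v ⊗ₜ[k] m))) := by
    refine (map_eq_sw ((TensorProduct.assoc k L L M).toLinearMap ∘ₗ
      TensorProduct.map d LinearMap.id) z).trans (sw_congr _ fun x m => ?_)
    have := map_eq_sw ((TensorProduct.assoc k L L M).toLinearMap ∘ₗ
      (TensorProduct.mk k (L ⊗[k] L) M).flip m) (d x)
    exact this
  rw [e, sw_sw _ _ (by fun_prop) (by fun_prop)]
  refine sw_congr _ fun x m => ?_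
  rw [sw_sw _ _ (by fun_prop) (by fun_prop)]
  refine sw_congr _ fun u v => ?_
  rw [sw_tmul _ _ ⟨by fun_prop, by fun_prop⟩, sw_tmul _ _ ⟨by fun_prop, by fun_prop⟩]

theorem sw_coassoc_right (d : M →ₗ[k] L ⊗[k] M) (z : L ⊗[k] M) {f : L → L → M → V}
    (h1 : ∀ y m, IsLin k (fun x => f x y m)) (h2 : ∀ x m, IsLin k (fun y => f x y m))
    (h3 : ∀ x y, IsLin k (fun m => f x y m)) :
    sw (TensorProduct.map LinearMap.id d z) (fun x w => sw w (fun y m => f x y m)) =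
    sw z (fun x m => sw (d m) (fun y n => f x y n)) := by
  rw [sw_map _ _ _ (by fun_prop) (by fun_prop)]
  rfl

variable (H) in
/-- The axioms of a left comodule for the actions `la`, `ra` and a lift `d : M → L ⊗ M` of the
coaction, in Sweedler's notation: identities in a balanced tensor product are tested on all
balanced maps. -/
structure IsCom (la ra : B →ₗ[k] M →ₗ[k] M) (d : M →ₗ[k] L ⊗[k] M) : Prop where
  la_one : ∀ m, la H.oneB m = m
  la_mul : ∀ a b m, la (H.mulB a b) m = la a (la b m)
  ra_one : ∀ m, ra H.oneB m = m
  ra_mul : ∀ a b m, ra (H.mulB a b) m = ra b (ra a m)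
  la_ra : ∀ a b m, la a (ra b m) = ra b (la a m)
  lact : ∀ {V : Type u} [AddCommGroup V] [Module k V] {f : L → M → V}, H.DBal la f → ∀ b m,
    sw (d (la b m)) f = sw (d m) (fun x n => f (H.mulL (H.src b) x) n)
  ract : ∀ {V : Type u} [AddCommGroup V] [Module k V] {f : L → M → V}, H.DBal la f → ∀ b m,
    sw (d (ra b m)) f = sw (d m) (fun x n => f (H.mulL x (H.src b)) n)
  tak : ∀ {V : Type u} [AddCommGroup V] [Module k V] {f : L → M → V}, H.DBal la f → ∀ b m,
    sw (d m) (fun x n => f (H.mulL x (H.tgt b)) n) = sw (d m) (fun x n => f x (ra b n))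
  coassoc : ∀ {V : Type u} [AddCommGroup V] [Module k V] {f : L → L → M → V}, H.Bal3 la f → ∀ m,
    sw (d m) (fun x n => sw (H.comulLift x) (fun y z => f y z n)) =
      sw (d m) (fun x n => sw (d n) (fun y p => f x y p))
  counit : ∀ m, sw (d m) (fun x n => la (H.counit x) n) = m

variable (H) in
/-- The right action `X · b = X s(b)` of `B` on `L`. -/
def ractL : B →ₗ[k] L →ₗ[k] L := H.mulL.flip ∘ₗ H.src

variable (H) in
/-- The left action `b · X = X t(b)` of `B` on `L`, for the coaction `X ↦ X₋ ⋄ X₊`. -/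
def lactI : B →ₗ[k] L →ₗ[k] L := H.mulL.flip ∘ₗ H.tgt

variable (H) in
/-- The right action `X · b = t(b) X` of `B` on `L`, for the coaction `X ↦ X₋ ⋄ X₊`. -/
def ractI : B →ₗ[k] L →ₗ[k] L := H.mulL ∘ₗ H.tgt

theorem lactL_apply (b : B) (X : L) : H.lactL b X = 𝐬 b ⬝ X := rfl
theorem ractL_apply (b : B) (X : L) : H.ractL b X = X ⬝ 𝐬 b := rfl
theorem lactI_apply (b : B) (X : L) : H.lactI b X = X ⬝ 𝐭 b := rfl
theorem ractI_apply (b : B) (X : L) : H.ractI b X = 𝐭 b ⬝ X := rfl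

theorem toDiamond_comulLift (X : L) : H.toDiamond (H.comulLift X) = H.comul X :=
  linSection_spec _ (Submodule.mkQ_surjective _) _

theorem sw_comul_eq {f : L → L → V} (hf : H.DBal H.lactL f) {X : L} {z : L ⊗[k] L}
    (h : H.comul X = H.toDiamond z) : sw (H.comulLift X) f = sw z f :=
  hf.sw_congr_mkQ ((toDiamond_comulLift X).trans h)

theorem sw_exch {M₁ M₂ N₁ N₂ P₁ P₂ : Type u} [AddCommGroup M₁] [Module k M₁] [AddCommGroup M₂]
    [Module k M₂] [AddCommGroup N₁] [Module k N₁] [AddCommGroup N₂] [Module k N₂]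
    [AddCommGroup P₁] [Module k P₁] [AddCommGroup P₂] [Module k P₂]
    (φ : M₁ ⊗[k] N₁ →ₗ[k] P₁) (ψ : M₂ ⊗[k] N₂ →ₗ[k] P₂) (z : M₁ ⊗[k] M₂) (w : N₁ ⊗[k] N₂) :
    TensorProduct.map φ ψ (exch (z ⊗ₜ[k] w)) =
      sw z (fun a b => sw w (fun c d => φ (a ⊗ₜ c) ⊗ₜ[k] ψ (b ⊗ₜ d))) := by
  refine (map_eq_sw (TensorProduct.map φ ψ ∘ₗ exch ∘ₗ (TensorProduct.mk k _ _).flip w) z).trans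
    (sw_congr _ fun a b => ?_)
  exact map_eq_sw (TensorProduct.map φ ψ ∘ₗ exch ∘ₗ TensorProduct.mk k _ _ (a ⊗ₜ b)) w

namespace IsLeftBialgebroid

variable (hb : H.IsLeftBialgebroid)
include hb

theorem comul_src_mul {f : L → L → V} (hf : H.DBal H.lactL f) (b : B) (X : L) :
    sw (H.comulLift (𝐬 b ⬝ X)) f = sw (H.comulLift X) (fun x y => f (𝐬 b ⬝ x) y) := by
  have h := hb.comul_bimod b H.oneB X
  rw [hb.tgt_one, hb.mul_oneL] at h
  rw [sw_comul_eq hf h, sw_map _ _ _ hf.left hf.right]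
  exact sw_congr _ fun x y => by rw [hb.oneL_mul]

theorem comul_tgt_mul {f : L → L → V} (hf : H.DBal H.lactL f) (b : B) (X : L) :
    sw (H.comulLift (𝐭 b ⬝ X)) f = sw (H.comulLift X) (fun x y => f x (𝐭 b ⬝ y)) := by
  have h := hb.comul_bimod H.oneB b X
  rw [hb.src_one, hb.oneL_mul] at h
  rw [sw_comul_eq hf h, sw_map _ _ _ hf.left hf.right]
  exact sw_congr _ fun x y => by rw [hb.oneL_mul]

theorem comul_mul' {f : L → L → V} (hf : H.DBal H.lactL f) (X Y : L) :
    sw (H.comulLift (X ⬝ Y)) f =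
      sw (H.comulLift X) (fun x x' => sw (H.comulLift Y) (fun y y' => f (x ⬝ y) (x' ⬝ y'))) := by
  have hl := hf.left
  have hr := hf.right
  rw [sw_comul_eq hf (hb.comul_mul X Y), sw_exch, sw_sw _ _ hl hr]
  refine sw_congr _ fun a b => ?_
  rw [sw_sw _ _ hl hr]
  exact sw_congr _ fun c d => sw_tmul _ _ hf.bilin

theorem comul_oneL {f : L → L → V} (hf : H.DBal H.lactL f) :
    sw (H.comulLift H.oneL) f = f H.oneL H.oneL := by
  rw [sw_comul_eq hf hb.comul_one, sw_tmul _ _ hf.bilin]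

theorem comul_src {f : L → L → V} (hf : H.DBal H.lactL f) (b : B) :
    sw (H.comulLift (𝐬 b)) f = f (𝐬 b) H.oneL := by
  have hl := hf.left
  have hr := hf.right
  have := hb.comul_src_mul hf b H.oneL
  rw [hb.mul_oneL] at this
  rw [this, sw_comul_eq (f := fun x y => f (𝐬 b ⬝ x) y) ⟨by fun_prop, by fun_prop, ?_⟩ hb.comul_one,
    sw_tmul _ _ ⟨by fun_prop, by fun_prop⟩, hb.mul_oneL]
  intro c x y
  simp only [← hb.mulL_assoc, hb.src_tgt]
  rw [hb.mulL_assoc, hf.bal]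

theorem comul_tgt {f : L → L → V} (hf : H.DBal H.lactL f) (b : B) :
    sw (H.comulLift (𝐭 b)) f = f H.oneL (𝐭 b) := by
  have hl := hf.left
  have hr := hf.right
  have := hb.comul_tgt_mul hf b H.oneL
  rw [hb.mul_oneL] at this
  rw [this, sw_comul_eq (f := fun x y => f x (𝐭 b ⬝ y)) ⟨by fun_prop, by fun_prop, ?_⟩ hb.comul_one,
    sw_tmul _ _ ⟨by fun_prop, by fun_prop⟩, hb.mul_oneL]
  intro c x y
  simp only [hf.bal, lactL_apply]
  rw [← hb.mulL_assoc, ← hb.mulL_assoc, hb.src_tgt]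

theorem comul_takeuchi {f : L → L → V} (hf : H.DBal H.lactL f) (b : B) (X : L) :
    sw (H.comulLift X) (fun x y => f (x ⬝ 𝐭 b) y) =
      sw (H.comulLift X) (fun x y => f x (y ⬝ 𝐬 b)) := by
  have h := hf.sw_congr_mkQ (hb.takeuchi b X)
  rwa [sw_map _ _ _ hf.left hf.right, sw_map _ _ _ hf.left hf.right] at h

theorem comul_mul_src {f : L → L → V} (hf : H.DBal H.lactL f) (b : B) (X : L) :
    sw (H.comulLift (X ⬝ 𝐬 b)) f = sw (H.comulLift X) (fun x y => f (x ⬝ 𝐬 b) y) := by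
  have hl := hf.left
  have hr := hf.right
  rw [hb.comul_mul' hf, sw_comm]
  rw [hb.comul_src (f := fun p q => sw (H.comulLift X) fun m n => f (m ⬝ p) (n ⬝ q))
    ⟨by fun_prop, by fun_prop, ?_⟩]
  · exact sw_congr _ fun x y => by rw [hb.mul_oneL]
  · intro c x y
    have := hb.comul_takeuchi (f := fun m n => f (m ⬝ x) (n ⬝ y))
      ⟨by fun_prop, by fun_prop, fun b m n => by
        rw [hb.mulL_assoc, hf.bal, lactL_apply, lactL_apply, hb.mulL_assoc]⟩ c X
    simpa only [hb.mulL_assoc, lactL_apply] using this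

theorem comul_mul_tgt {f : L → L → V} (hf : H.DBal H.lactL f) (b : B) (X : L) :
    sw (H.comulLift (X ⬝ 𝐭 b)) f = sw (H.comulLift X) (fun x y => f x (y ⬝ 𝐭 b)) := by
  have hl := hf.left
  have hr := hf.right
  rw [hb.comul_mul' hf, sw_comm]
  rw [hb.comul_tgt (f := fun p q => sw (H.comulLift X) fun m n => f (m ⬝ p) (n ⬝ q))
    ⟨by fun_prop, by fun_prop, ?_⟩]
  · exact sw_congr _ fun x y => by rw [hb.mul_oneL]
  · intro c x y
    have := hb.comul_takeuchi (f := fun m n => f (m ⬝ x) (n ⬝ y))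
      ⟨by fun_prop, by fun_prop, fun b m n => by
        rw [hb.mulL_assoc, hf.bal, lactL_apply, lactL_apply, hb.mulL_assoc]⟩ c X
    simpa only [hb.mulL_assoc, lactL_apply] using this

theorem comul_counit_left (X : L) :
    sw (H.comulLift X) (fun x y => 𝐬 (H.counit x) ⬝ y) = X := by
  have h := hb.counit_left X
  exact (map_eq_sw (H.mulT ∘ₗ TensorProduct.map (H.src ∘ₗ H.counit) LinearMap.id :
    L ⊗[k] L →ₗ[k] L) (H.comulLift X)).symm.trans h

theorem comul_counit_right (X : L) :
    sw (H.comulLift X) (fun x y => 𝐭 (H.counit y) ⬝ x) = X := by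
  have h := hb.counit_right X
  exact (map_eq_sw (H.mulT ∘ₗ (TensorProduct.comm k L L).toLinearMap ∘ₗ
    TensorProduct.map LinearMap.id (H.tgt ∘ₗ H.counit) :
    L ⊗[k] L →ₗ[k] L) (H.comulLift X)).symm.trans h

theorem counit_src_mul (b : B) (X : L) : H.counit (𝐬 b ⬝ X) = H.mulB b (H.counit X) := by
  have := hb.counit_bimod b H.oneB X
  rwa [hb.tgt_one, hb.mul_oneL, hb.mul_oneB] at this

theorem counit_tgt_mul (b : B) (X : L) : H.counit (𝐭 b ⬝ X) = H.mulB (H.counit X) b := by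
  have := hb.counit_bimod H.oneB b X
  rwa [hb.src_one, hb.oneL_mul, hb.oneB_mul] at this

theorem counit_src (b : B) : H.counit (𝐬 b) = b := by
  have := hb.counit_src_mul b H.oneL
  rwa [hb.mul_oneL, hb.counit_one, hb.mul_oneB] at this

theorem counit_src_eq_tgt (b : B) (X : L) : H.counit (X ⬝ 𝐬 b) = H.counit (X ⬝ 𝐭 b) := by
  rw [hb.counit_mul_tgt X (𝐬 b), hb.counit_src]

/-- `L` is a comodule over itself. -/
theorem isCom_regular : H.IsCom H.lactL H.ractL H.comulLift where
  la_one m := by rw [lactL_apply, hb.src_one, hb.oneL_mul]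
  la_mul a b m := by simp only [lactL_apply, hb.src_mul, hb.mulL_assoc]
  ra_one m := by rw [ractL_apply, hb.src_one, hb.mul_oneL]
  ra_mul a b m := by simp only [ractL_apply, hb.src_mul, hb.mulL_assoc]
  la_ra a b m := by simp only [ractL_apply, lactL_apply, hb.mulL_assoc]
  lact hf b m := hb.comul_src_mul hf b m
  ract hf b m := hb.comul_mul_src hf b m
  tak hf b m := hb.comul_takeuchi hf b m
  coassoc {V _ _ f} hf m := by
    have h := hf.sw_eq_zero (hb.coassoc m)
    rw [sw_sub _ _ ⟨hf.lin.1, hf.lin.2⟩, sub_eq_zero, sw_coassoc_left _ _ hf.l1 hf.l2 hf.l3,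
      sw_coassoc_right _ _ hf.l1 hf.l2 hf.l3] at h
    exact h
  counit m := hb.comul_counit_left m

end IsLeftBialgebroid

end BialgebroidData
end HopfAlgebroidTwist
end

noncomputable section

namespace HopfAlgebroidTwist

namespace BialgebroidData

set_option linter.unusedSectionVars false

variable {k : Type u} [Field k] {B L : Type u}
  [AddCommGroup B] [Module k B] [AddCommGroup L] [Module k L]
variable {V M N : Type u} [AddCommGroup V] [Module k V] [AddCommGroup M] [Module k M]
  [AddCommGroup N] [Module k N]
variable {H : BialgebroidData k B L}

local infixl:70 " ⬝ " => H.mulL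
local notation "𝐬" => H.src
local notation "𝐭" => H.tgt

/-! ### Comodules given by lifts of the coaction -/

section

section Comodules

variable {la ra : B →ₗ[k] M →ₗ[k] M} {d d' : M →ₗ[k] L ⊗[k] M}

theorem mem_diamond3_of_sw {z w : L ⊗[k] (L ⊗[k] M)}
    (h : sw z (fun x u => sw u (fun y m => (H.diamond3 (fun b m => la b m)).mkQ
        (x ⊗ₜ[k] (y ⊗ₜ[k] m)))) =
      sw w (fun x u => sw u (fun y m => (H.diamond3 (fun b m => la b m)).mkQ
        (x ⊗ₜ[k] (y ⊗ₜ[k] m))))) :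
    z - w ∈ H.diamond3 (fun b m => la b m) := by
  have key : ∀ z : L ⊗[k] (L ⊗[k] M), sw z (fun x u => sw u (fun y m =>
      (H.diamond3 (fun b m => la b m)).mkQ (x ⊗ₜ[k] (y ⊗ₜ[k] m)))) =
      (H.diamond3 (fun b m => la b m)).mkQ z := fun z => by
    rw [map_eq_sw _ z]
    exact sw_congr _ fun x u => (map_eq_sw ((H.diamond3 (fun b m => la b m)).mkQ ∘ₗ
      TensorProduct.mk k _ _ x) u).symm
  rw [key, key] at h
  exact (Submodule.Quotient.eq _).1 h

theorem DBal.src_mul_left (hb : H.IsLeftBialgebroid) {f : L → M → V} (hf : H.DBal la f) (b : B) :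
    H.DBal la (fun x n => f (𝐬 b ⬝ x) n) :=
  have hl := hf.left
  have hr := hf.right
  ⟨by fun_prop, by fun_prop, fun c x n => by
    rw [← hb.mulL_assoc, hb.src_tgt, hb.mulL_assoc, hf.bal]⟩

theorem DBal.mul_right (hb : H.IsLeftBialgebroid) {f : L → M → V} (hf : H.DBal la f) (y : L) :
    H.DBal la (fun x n => f (x ⬝ y) n) :=
  have hl := hf.left
  have hr := hf.right
  ⟨by fun_prop, by fun_prop, fun c x n => by rw [hb.mulL_assoc, hf.bal]⟩

/-- A linear map that commutes with the left actions induces a map on `L ⋄_B M`. -/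
theorem DBal.comp_right {laN : B →ₗ[k] N →ₗ[k] N} {f : L → M → V} (hf : H.DBal la f)
    (φ : N →ₗ[k] M) (hφ : ∀ b n, φ (laN b n) = la b (φ n)) : H.DBal laN (fun x n => f x (φ n)) :=
  have hl := hf.left
  have hr := hf.right
  ⟨by fun_prop, by fun_prop, fun c x n => by rw [hf.bal, hφ]⟩

theorem IsCom.bal_coact {f : L → L → M → V} (hf : H.Bal3 la f) (h : H.IsCom la ra d) :
    H.DBal la (fun x n => sw (d n) (fun y p => f x y p)) :=
  have h1 := hf.l1
  have h2 := hf.l2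
  have h3 := hf.l3
  ⟨by fun_prop, by fun_prop, fun b x n => by
    rw [h.lact ⟨h2 x, h3 x, fun b y m => hf.b2 b x y m⟩]
    exact sw_congr _ fun y p => hf.b1 _ _ _ _⟩

theorem Bal3.bal_comul (hb : H.IsLeftBialgebroid) {f : L → L → M → V} (hf : H.Bal3 la f) :
    H.DBal la (fun x n => sw (H.comulLift x) (fun y z => f y z n)) :=
  have h1 := hf.l1
  have h2 := hf.l2
  have h3 := hf.l3
  ⟨by fun_prop, by fun_prop, fun b x n => by
    rw [hb.comul_tgt_mul ⟨fun y => h1 y n, fun y => h2 y n, fun b y m => hf.b1 b y m n⟩]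
    exact sw_congr _ fun y p => hf.b2 _ _ _ _⟩

namespace IsCom

/-- The comodule axioms do not depend on the lift of the coaction. -/
theorem congr (hb : H.IsLeftBialgebroid) (h : H.IsCom la ra d)
    (hd : ∀ {V : Type u} [AddCommGroup V] [Module k V] {f : L → M → V}, H.DBal la f → ∀ m,
      sw (d' m) f = sw (d m) f) : H.IsCom la ra d' where
  la_one := h.la_one
  la_mul := h.la_mul
  ra_one := h.ra_one
  ra_mul := h.ra_mul
  la_ra := h.la_ra
  lact hf b m := by rw [hd hf, hd (hf.src_mul_left hb b), h.lact hf]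
  ract hf b m := by rw [hd hf, hd (hf.mul_right hb _), h.ract hf]
  tak hf b m := by
    rw [hd (hf.mul_right hb _), h.tak hf,
      hd (f := fun x n => _) (hf.comp_right (ra b) fun c n => (h.la_ra c b n).symm)]
  coassoc hf m := by
    rw [hd (hf.bal_comul hb), h.coassoc hf, ← hd (h.bal_coact hf)]
    exact sw_congr _ fun x n =>
      (hd ⟨hf.l2 x, hf.l3 x, fun b y m => hf.b2 b x y m⟩ n).symm
  counit m := by
    refine (hd ⟨by fun_prop, by fun_prop, fun b x n => ?_⟩ m).trans (h.counit m)
    rw [hb.counit_tgt_mul, h.la_mul]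

/-- A comodule in the sense of `IsCom` is a comodule. -/
def toComodule (hb : H.IsLeftBialgebroid) (h : H.IsCom la ra d) : H.Comodule M :=
  let S := H.diamond (fun b m => la b m)
  have e : ∀ {V : Type u} [AddCommGroup V] [Module k V] {f : L → M → V}, H.DBal la f → ∀ m,
      sw (linSection S.mkQ (S.mkQ (d m))) f = sw (d m) f := fun hf m =>
    hf.sw_congr_mkQ (mkQ_linSection S _)
  have h' : H.IsCom la ra (linSection S.mkQ ∘ₗ S.mkQ ∘ₗ d) := h.congr hb e
  { lact := la
    ract := ra
    lact_one := h.la_one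
    lact_mul := h.la_mul
    ract_one := h.ra_one
    ract_mul := h.ra_mul
    lact_ract := h.la_ra
    coact := S.mkQ ∘ₗ d
    coact_bimod := fun a b m => by
      have hf : H.DBal la (fun x n => S.mkQ (x ⊗ₜ[k] n)) := bal_mkQ
      have hg := DBal.src_mul_left hb hf a
      refine mkQ_eq_of_sw ?_
      refine (h.lact hf a _).trans ((h.ract hg b m).trans ?_)
      rw [sw_map _ _ _ (by fun_prop) (by fun_prop)]
      exact (e (DBal.mul_right hb hg _) m).symm
    takeuchi := fun b m => by
      refine mkQ_eq_of_sw ?_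
      rw [sw_map _ _ _ (by fun_prop) (by fun_prop), sw_map _ _ _ (by fun_prop) (by fun_prop)]
      exact h'.tak bal_mkQ b m
    coassoc := fun m => by
      have hf := H.bal3_mkQ la
      refine mem_diamond3_of_sw ?_
      rw [sw_coassoc_left _ _ hf.l1 hf.l2 hf.l3, sw_coassoc_right _ _ hf.l1 hf.l2 hf.l3]
      exact h'.coassoc hf m
    counit := fun m => by
      exact (map_eq_sw (TensorProduct.lift la ∘ₗ TensorProduct.map H.counit LinearMap.id) _).trans
        (h'.counit m) }

theorem toComodule_coactLift (hb : H.IsLeftBialgebroid) (h : H.IsCom la ra d) {f : L → M → V}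
    (hf : H.DBal la f) (m : M) : sw ((h.toComodule hb).coactLift m) f = sw (d m) f :=
  hf.sw_congr_mkQ (mkQ_linSection (H.diamond (fun b m => la b m)) _)

end IsCom

theorem Comodule.isCom (hb : H.IsLeftBialgebroid) (C : H.Comodule M) :
    H.IsCom C.lact C.ract C.coactLift :=
  have e : ∀ {V : Type u} [AddCommGroup V] [Module k V] {f : L → M → V}, H.DBal C.lact f →
      ∀ m (z : L ⊗[k] M), C.coact m = (H.diamond (fun b m => C.lact b m)).mkQ z →
      sw (C.coactLift m) f = sw z f := fun hf m z h =>
    hf.sw_congr_mkQ ((mkQ_linSection (H.diamond (fun b m => C.lact b m)) _).trans h)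
  { la_one := C.lact_one
    la_mul := C.lact_mul
    ra_one := C.ract_one
    ra_mul := C.ract_mul
    la_ra := C.lact_ract
    lact := fun {V _ _ f} hf b m => by
      have h := C.coact_bimod b H.oneB m
      rw [C.ract_one] at h
      rw [e hf _ _ h, sw_map _ _ _ hf.left hf.right]
      exact sw_congr _ fun x n => by
        simp only [LinearMap.comp_apply, LinearMap.flip_apply, hb.src_one, hb.mul_oneL,
          LinearMap.id_apply]
    ract := fun {V _ _ f} hf b m => by
      have h := C.coact_bimod H.oneB b m
      rw [C.lact_one] at h
      rw [e hf _ _ h, sw_map _ _ _ hf.left hf.right]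
      exact sw_congr _ fun x n => by
        simp only [LinearMap.comp_apply, LinearMap.flip_apply, hb.src_one, hb.oneL_mul,
          LinearMap.id_apply]
    tak := fun {V _ _ f} hf b m => by
      have h := hf.sw_congr_mkQ (C.takeuchi b m)
      rwa [sw_map _ _ _ hf.left hf.right, sw_map _ _ _ hf.left hf.right] at h
    coassoc := fun {V _ _ f} hf m => by
      have h := hf.sw_eq_zero (C.coassoc m)
      rw [sw_sub _ _ ⟨hf.lin.1, hf.lin.2⟩, sub_eq_zero, sw_coassoc_left _ _ hf.l1 hf.l2 hf.l3,
        sw_coassoc_right _ _ hf.l1 hf.l2 hf.l3] at h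
      exact h
    counit := fun m => (map_eq_sw (TensorProduct.lift C.lact ∘ₗ
      TensorProduct.map H.counit LinearMap.id) _).symm.trans (C.counit m) }

end Comodules

end

/-! ### The translation map of a Hopf algebroid -/

section

variable (H) in
/-- `f` is a linear map on `L ⊗_{B̄} L`. -/
abbrev BBal (f : L → L → V) : Prop :=
  Bal (k := k) (fun (b : B) X => H.mulL X (H.tgt b)) (fun (b : B) Y => H.mulL (H.tgt b) Y) f

theorem sw_galois {f : L → L → V} (hf : H.DBal H.lactL f) {z w : L ⊗[k] L}
    (h : H.galois z = H.toDiamond w) :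
    sw z (fun x y => sw (H.comulLift x) (fun u v => f u (v ⬝ y))) = sw w f := by
  have hl := hf.left
  have hr := hf.right
  rw [← hf.sw_congr_mkQ h, LinearMap.comp_apply, sw_map _ _ _ hl hr]
  have e : TensorProduct.assoc k L L L (TensorProduct.map H.comulLift LinearMap.id z) =
      sw z (fun x m => sw (H.comulLift x) (fun u v => u ⊗ₜ[k] (v ⊗ₜ[k] m))) := by
    refine (map_eq_sw ((TensorProduct.assoc k L L L).toLinearMap ∘ₗ
      TensorProduct.map H.comulLift LinearMap.id) z).trans (sw_congr _ fun x m => ?_)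
    exact map_eq_sw ((TensorProduct.assoc k L L L).toLinearMap ∘ₗ
      (TensorProduct.mk k (L ⊗[k] L) L).flip m) (H.comulLift x)
  refine Eq.trans ?_ (congrArg (fun w => sw w (fun m n => f m (H.mulT n))) e.symm)
  rw [sw_sw _ _ (by fun_prop) (by fun_prop)]
  refine sw_congr _ fun x y => ?_
  rw [sw_sw _ _ (by fun_prop) (by fun_prop)]
  refine sw_congr _ fun u v => ?_
  rw [sw_tmul _ _ ⟨by fun_prop, by fun_prop⟩]
  rfl

namespace IsLeftHopfAlgebroid

variable (hH : H.IsLeftHopfAlgebroid)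
include hH

/-- `X₊₍₁₎ ⋄ X₊₍₂₎X₋ = X ⋄ 1`. -/
theorem trans_comul {f : L → L → V} (hf : H.DBal H.lactL f) (X : L) :
    sw (H.transLift X) (fun x y => sw (H.comulLift x) (fun u v => f u (v ⬝ y))) = f X H.oneL := by
  rw [← sw_tmul X H.oneL hf.bilin]
  exact sw_galois hf (linSection_spec _ hH.galois_iso.2 _)

/-- Injectivity of `λ`. -/
theorem sw_eq_of_galois {z w : L ⊗[k] L}
    (h : ∀ {U : Type u} [AddCommGroup U] [Module k U] {f : L → L → U}, H.DBal H.lactL f →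
      sw z (fun x y => sw (H.comulLift x) (fun u v => f u (v ⬝ y))) =
        sw w (fun x y => sw (H.comulLift x) (fun u v => f u (v ⬝ y))))
    {g : L → L → V} (hg : H.BBal g) : sw z g = sw w g := by
  -- the difference lies in the kernel of `λ`
  refine hg.sw_congr (?_ : z - w ∈ H.barRel)
  rw [← hH.galois_iso.1, LinearMap.mem_ker, map_sub, sub_eq_zero]
  obtain ⟨z', hz'⟩ := Submodule.mkQ_surjective _ (H.galois z)
  obtain ⟨w', hw'⟩ := Submodule.mkQ_surjective _ (H.galois w)
  rw [← hz', ← hw']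
  refine mkQ_eq_of_sw ?_
  have hf : H.DBal H.lactL (fun x y => H.toDiamond (x ⊗ₜ[k] y)) := bal_mkQ
  have := h hf
  rwa [sw_galois hf hz'.symm, sw_galois hf hw'.symm] at this

/-- `X₊ ⊗ X₋` is the only element of `L ⊗_{B̄} L` that satisfies `trans_comul`. -/
theorem trans_eq {z : L ⊗[k] L} {X : L}
    (h : ∀ {U : Type u} [AddCommGroup U] [Module k U] {f : L → L → U}, H.DBal H.lactL f →
      sw z (fun x y => sw (H.comulLift x) (fun u v => f u (v ⬝ y))) = f X H.oneL)
    {g : L → L → V} (hg : H.BBal g) : sw (H.transLift X) g = sw z g :=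
  hH.sw_eq_of_galois (fun hf => by rw [hH.trans_comul hf, h hf]) hg

/-- `X₍₁₎₊ ⊗ X₍₁₎₋X₍₂₎ = X ⊗ 1` -/
theorem comul_trans {g : L → L → V} (hg : H.BBal g) (X Y : L) :
    sw (H.comulLift X) (fun x y => sw (H.transLift x) (fun p q => g p (q ⬝ (y ⬝ Y)))) = g X Y := by
  have hl := hg.left
  have hr := hg.right
  have hb := hH.bialgebroid
  have := hH.sw_eq_of_galois (z := sw (H.comulLift X) (fun x y => sw (H.transLift x)
    (fun p q => p ⊗ₜ (q ⬝ (y ⬝ Y))))) (w := X ⊗ₜ Y) ?_ hg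
  · rw [sw_tmul _ _ hg.bilin, sw_sw _ _ hl hr] at this
    rw [← this]
    refine sw_congr _ fun x y => ?_
    rw [sw_sw _ _ hl hr]
    exact sw_congr _ fun p q => (sw_tmul _ _ hg.bilin).symm
  · intro U _ _ f hf
    have hfl := hf.left
    have hfr := hf.right
    rw [sw_tmul _ _ ⟨by fun_prop, by fun_prop⟩, sw_sw _ _ (by fun_prop) (by fun_prop)]
    refine sw_congr _ fun x y => ?_
    rw [sw_sw _ _ (by fun_prop) (by fun_prop)]
    have := hH.trans_comul (f := fun u v => f u (v ⬝ (y ⬝ Y))) ⟨by fun_prop, by fun_prop,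
      fun b m n => by rw [hf.bal, lactL_apply, lactL_apply, hb.mulL_assoc]⟩ x
    rw [hb.oneL_mul] at this
    rw [← this]
    refine sw_congr _ fun p q => ?_
    rw [sw_tmul _ _ ⟨by fun_prop, by fun_prop⟩]
    simp only [hb.mulL_assoc]

theorem trans_src_mul {g : L → L → V} (hg : H.BBal g) (b : B) (X : L) :
    sw (H.transLift (𝐬 b ⬝ X)) g = sw (H.transLift X) (fun p q => g (𝐬 b ⬝ p) q) := by
  have hb := hH.bialgebroid
  have hl := hg.left
  have hr := hg.right
  rw [hH.trans_eq (z := sw (H.transLift X) (fun p q => (𝐬 b ⬝ p) ⊗ₜ q)) ?_ hg, sw_sw _ _ hl hr]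
  · exact sw_congr _ fun p q => sw_tmul _ _ hg.bilin
  · intro U _ _ f hf
    have hfl := hf.left
    have hfr := hf.right
    rw [sw_sw _ _ (by fun_prop) (by fun_prop), ← hH.trans_comul (f := fun x y => f (𝐬 b ⬝ x) y)
      (hf.src_mul_left hb b)]
    refine sw_congr _ fun p q => ?_
    rw [sw_tmul _ _ ⟨by fun_prop, by fun_prop⟩, hb.comul_src_mul]
    exact ⟨by fun_prop, by fun_prop, fun b m n => by
        rw [hf.bal, lactL_apply, lactL_apply, hb.mulL_assoc]⟩

theorem trans_tgt_mul {g : L → L → V} (hg : H.BBal g) (b : B) (X : L) :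
    sw (H.transLift (𝐭 b ⬝ X)) g = sw (H.transLift X) (fun p q => g p (q ⬝ 𝐬 b)) := by
  have hb := hH.bialgebroid
  have hl := hg.left
  have hr := hg.right
  rw [hH.trans_eq (z := sw (H.transLift X) (fun p q => p ⊗ₜ (q ⬝ 𝐬 b))) ?_ hg, sw_sw _ _ hl hr]
  · exact sw_congr _ fun p q => sw_tmul _ _ hg.bilin
  · intro U _ _ f hf
    have hfl := hf.left
    have hfr := hf.right
    have := hH.trans_comul (f := fun x y => f x (y ⬝ 𝐬 b)) ⟨by fun_prop, by fun_prop,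
      fun c m n => by rw [hf.bal, lactL_apply, lactL_apply, hb.mulL_assoc]⟩ X
    rw [hb.oneL_mul] at this
    rw [sw_sw _ _ (by fun_prop) (by fun_prop), hf.bal, lactL_apply, hb.mul_oneL, ← this]
    refine sw_congr _ fun p q => ?_
    rw [sw_tmul _ _ ⟨by fun_prop, by fun_prop⟩]
    simp only [hb.mulL_assoc]

theorem trans_mul_tgt {g : L → L → V} (hg : H.BBal g) (b : B) (X : L) :
    sw (H.transLift (X ⬝ 𝐭 b)) g = sw (H.transLift X) (fun p q => g p (𝐬 b ⬝ q)) := by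
  have hb := hH.bialgebroid
  have hl := hg.left
  have hr := hg.right
  rw [hH.trans_eq (z := sw (H.transLift X) (fun p q => p ⊗ₜ (𝐬 b ⬝ q))) ?_ hg, sw_sw _ _ hl hr]
  · exact sw_congr _ fun p q => sw_tmul _ _ hg.bilin
  · intro U _ _ f hf
    have hfl := hf.left
    have hfr := hf.right
    rw [sw_sw _ _ (by fun_prop) (by fun_prop)]
    rw [← hH.trans_comul (f := fun x y => f (x ⬝ 𝐭 b) y) (hf.mul_right hb _)]
    refine sw_congr _ fun p q => ?_
    rw [sw_tmul _ _ ⟨by fun_prop, by fun_prop⟩]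
    have := hb.comul_takeuchi (f := fun u v => f u (v ⬝ q)) ⟨by fun_prop, by fun_prop,
      fun c m n => by rw [hf.bal, lactL_apply, lactL_apply, hb.mulL_assoc]⟩ b p
    simpa only [hb.mulL_assoc] using this.symm

theorem trans_mul {g : L → L → V} (hg : H.BBal g) (X Y : L) :
    sw (H.transLift (X ⬝ Y)) g =
      sw (H.transLift X) (fun p q => sw (H.transLift Y) (fun r s => g (p ⬝ r) (s ⬝ q))) := by
  have hb := hH.bialgebroid
  have hl := hg.left
  have hr := hg.right
  rw [hH.trans_eq (z := sw (H.transLift X) (fun p q => sw (H.transLift Y)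
    (fun r s => (p ⬝ r) ⊗ₜ (s ⬝ q)))) ?_ hg, sw_sw _ _ hl hr]
  · refine sw_congr _ fun p q => ?_
    rw [sw_sw _ _ hl hr]
    exact sw_congr _ fun r s => sw_tmul _ _ hg.bilin
  · intro U _ _ f hf
    have hfl := hf.left
    have hfr := hf.right
    rw [sw_sw _ _ (by fun_prop) (by fun_prop)]
    rw [← hH.trans_comul (f := fun x y => f (x ⬝ Y) y) (hf.mul_right hb _)]
    refine sw_congr _ fun p q => ?_
    rw [sw_sw _ _ (by fun_prop) (by fun_prop)]
    have e : ∀ r s, sw ((p ⬝ r) ⊗ₜ[k] (s ⬝ q)) (fun x y => sw (H.comulLift x)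
        (fun u v => f u (v ⬝ y))) = sw (H.comulLift r) (fun c d => sw (H.comulLift p)
          (fun a b => f (a ⬝ c) (b ⬝ (d ⬝ s) ⬝ q))) := fun r s => by
      rw [sw_tmul _ _ ⟨by fun_prop, by fun_prop⟩, hb.comul_mul', sw_comm]
      · simp only [hb.mulL_assoc]
      · exact ⟨by fun_prop, by fun_prop, fun b m n => by
          rw [hf.bal, lactL_apply, lactL_apply, hb.mulL_assoc]⟩
    simp only [e]
    rw [hH.trans_comul (f := fun c d => sw (H.comulLift p) (fun a b => f (a ⬝ c) (b ⬝ d ⬝ q)))]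
    · simp only [hb.mul_oneL]
    · refine ⟨by fun_prop, by fun_prop, fun c m n => ?_⟩
      have := hb.comul_takeuchi (f := fun x y => f (x ⬝ m) (y ⬝ n ⬝ q)) ⟨by fun_prop, by fun_prop,
        fun b m n => by simp only [hb.mulL_assoc, hf.bal, lactL_apply]⟩ c p
      simpa only [hb.mulL_assoc, lactL_apply] using this

theorem trans_src {g : L → L → V} (hg : H.BBal g) (b : B) :
    sw (H.transLift (𝐬 b)) g = g (𝐬 b) H.oneL := by
  have hb := hH.bialgebroid
  rw [hH.trans_eq (z := 𝐬 b ⊗ₜ H.oneL) ?_ hg, sw_tmul _ _ hg.bilin]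
  intro U _ _ f hf
  have hfl := hf.left
  have hfr := hf.right
  rw [sw_tmul _ _ ⟨by fun_prop, by fun_prop⟩, hb.comul_src, hb.mul_oneL]
  exact ⟨by fun_prop, by fun_prop, fun c m n => by
          rw [hf.bal, lactL_apply, lactL_apply, hb.mulL_assoc]⟩

theorem trans_oneL {g : L → L → V} (hg : H.BBal g) :
    sw (H.transLift H.oneL) g = g H.oneL H.oneL := by
  have := hH.trans_src hg H.oneB
  rwa [hH.bialgebroid.src_one] at this

theorem trans_tgt {g : L → L → V} (hg : H.BBal g) (b : B) :
    sw (H.transLift (𝐭 b)) g = g H.oneL (𝐬 b) := by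
  have hb := hH.bialgebroid
  have := hH.trans_tgt_mul hg b H.oneL
  have hl := hg.left
  have hr := hg.right
  rw [hb.mul_oneL] at this
  rw [this, hH.trans_oneL (g := fun p q => g p (q ⬝ 𝐬 b)), hb.oneL_mul]
  exact ⟨by fun_prop, by fun_prop, fun c m n => by rw [hg.bal, hb.mulL_assoc]⟩

theorem trans_mul_src {g : L → L → V} (hg : H.BBal g) (b : B) (X : L) :
    sw (H.transLift (X ⬝ 𝐬 b)) g = sw (H.transLift X) (fun p q => g (p ⬝ 𝐬 b) q) := by
  have hb := hH.bialgebroid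
  have hl := hg.left
  have hr := hg.right
  rw [hH.trans_mul hg]
  refine sw_congr _ fun p q => ?_
  rw [hH.trans_src (g := fun r s => g (p ⬝ r) (s ⬝ q)), hb.oneL_mul]
  exact ⟨by fun_prop, by fun_prop, fun c m n => by rw [← hb.mulL_assoc, hg.bal, hb.mulL_assoc]⟩

/-- `t(b)X₊ ⊗ X₋ = X₊ ⊗ X₋t(b)` -/
theorem trans_takeuchi {g : L → L → V} (hg : H.BBal g) (b : B) (X : L) :
    sw (H.transLift X) (fun p q => g (𝐭 b ⬝ p) q) =
      sw (H.transLift X) (fun p q => g p (q ⬝ 𝐭 b)) := by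
  have hb := hH.bialgebroid
  have hl := hg.left
  have hr := hg.right
  have := hH.sw_eq_of_galois (z := sw (H.transLift X) fun p q => (𝐭 b ⬝ p) ⊗ₜ q)
    (w := sw (H.transLift X) fun p q => p ⊗ₜ (q ⬝ 𝐭 b)) ?_ hg
  · rw [sw_sw _ _ hl hr, sw_sw _ _ hl hr] at this
    simpa only [sw_tmul _ _ hg.bilin] using this
  · intro U _ _ f hf
    have hfl := hf.left
    have hfr := hf.right
    have h1 := hH.trans_comul (f := fun x y => f x (𝐭 b ⬝ y)) ⟨by fun_prop, by fun_prop,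
      fun c m n => by rw [hf.bal, lactL_apply, lactL_apply, ← hb.mulL_assoc, ← hb.mulL_assoc,
        hb.src_tgt]⟩ X
    have h2 := hH.trans_comul (f := fun x y => f x (y ⬝ 𝐭 b)) ⟨by fun_prop, by fun_prop,
      fun c m n => by rw [hf.bal, lactL_apply, lactL_apply, hb.mulL_assoc]⟩ X
    rw [hb.mul_oneL] at h1
    rw [hb.oneL_mul] at h2
    rw [sw_sw _ _ (by fun_prop) (by fun_prop), sw_sw _ _ (by fun_prop) (by fun_prop)]
    refine Eq.trans ?_ (h1.trans (h2.symm.trans ?_))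
    · refine sw_congr _ fun p q => ?_
      rw [sw_tmul _ _ ⟨by fun_prop, by fun_prop⟩, hb.comul_tgt_mul]
      · simp only [hb.mulL_assoc]
      · exact ⟨by fun_prop, by fun_prop, fun c m n => by
          rw [hf.bal, lactL_apply, lactL_apply, hb.mulL_assoc]⟩
    · refine sw_congr _ fun p q => ?_
      rw [sw_tmul _ _ ⟨by fun_prop, by fun_prop⟩]
      simp only [hb.mulL_assoc]

/-- `X₊₍₁₎ ⊗ X₊₍₂₎ ⊗ X₋ = X₍₁₎ ⊗ X₍₂₎₊ ⊗ X₍₂₎₋` -/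
theorem trans_comul_comm {f : L → L → L → V}
    (h1 : ∀ y z, IsLin k (fun x => f x y z)) (h2 : ∀ x z, IsLin k (fun y => f x y z))
    (h3 : ∀ x y, IsLin k (fun z => f x y z))
    (b1 : ∀ b x y z, f (𝐭 b ⬝ x) y z = f x (𝐬 b ⬝ y) z)
    (b2 : ∀ b x y z, f x (y ⬝ 𝐭 b) z = f x y (𝐭 b ⬝ z)) (X : L) :
    sw (H.transLift X) (fun p q => sw (H.comulLift p) (fun u v => f u v q)) =
      sw (H.comulLift X) (fun x y => sw (H.transLift y) (fun p q => f x p q)) := by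
  have hb := hH.bialgebroid
  have hB : ∀ x w, H.BBal (fun p q => f x p (q ⬝ w)) := fun x w =>
    ⟨by fun_prop, by fun_prop, fun b m n => by rw [b2, hb.mulL_assoc]⟩
  have ht := hH.trans_comul (f := fun x z => sw (H.comulLift x) (fun u v => sw (H.transLift v)
    (fun p q => f u p (q ⬝ z)))) ⟨by fun_prop, by fun_prop, fun b m n => ?_⟩ X
  · simp only [hb.mul_oneL] at ht
    rw [← ht]
    refine sw_congr _ fun p q => ?_
    rw [hb.isCom_regular.coassoc (f := fun x y z => sw (H.transLift y)
      (fun p' q' => f x p' (q' ⬝ (z ⬝ q))))]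
    · exact sw_congr _ fun u v =>
        (hH.comul_trans (g := fun p q => f u p q) ⟨by fun_prop, by fun_prop, fun b m n => b2 _ _ _ _⟩
          v q).symm
    · refine ⟨by fun_prop, by fun_prop, by fun_prop, fun b x y m => ?_, fun b x y m => ?_⟩
      · rw [hH.trans_src_mul (hB x _)]
        exact sw_congr _ fun _ _ => b1 _ _ _ _
      · rw [hH.trans_tgt_mul (hB x _)]
        simp only [hb.mulL_assoc, lactL_apply]
  · rw [hb.comul_tgt_mul]
    · refine sw_congr _ fun u v => ?_
      rw [hH.trans_tgt_mul (hB u _)]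
      simp only [hb.mulL_assoc, lactL_apply]
    · refine ⟨by fun_prop, by fun_prop, fun b x y => ?_⟩
      rw [lactL_apply, hH.trans_src_mul (hB x _)]
      exact sw_congr _ fun _ _ => b1 _ _ _ _

/-- `X₊ ⊗ X₋₍₁₎ ⊗ X₋₍₂₎ = X₊₊ ⊗ X₋ ⊗ X₊₋` -/
theorem trans_coassoc {f : L → L → L → V}
    (h1 : ∀ y z, IsLin k (fun x => f x y z)) (h2 : ∀ x z, IsLin k (fun y => f x y z))
    (h3 : ∀ x y, IsLin k (fun z => f x y z))
    (b1 : ∀ b x y z, f (x ⬝ 𝐭 b) y z = f x y (𝐭 b ⬝ z))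
    (b2 : ∀ b x y z, f x (𝐭 b ⬝ y) z = f x y (𝐬 b ⬝ z)) (X : L) :
    sw (H.transLift X) (fun p q => sw (H.comulLift q) (fun u v => f p u v)) =
      sw (H.transLift X) (fun p q => sw (H.transLift p) (fun r s => f r q s)) := by
  have hb := hH.bialgebroid
  -- both sides equal `K(X, 1, 1)` for `K(x, y, z) = f(x₊₊, x₋y, x₊₋z)`
  let G : L → L → L → V := fun x y z => sw (H.transLift x) (fun r s => f r y (s ⬝ z))
  let K : L → L → L → V := fun x y z => sw (H.transLift x) (fun p q => G p (q ⬝ y) z)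
  have hB : ∀ y w, H.BBal (fun p q => f p y (q ⬝ w)) := fun x w =>
    ⟨by fun_prop, by fun_prop, fun b m n => by rw [b1, hb.mulL_assoc]⟩
  have hG1 : ∀ y z, IsLin k (fun x => G x y z) := by simp only [G]; fun_prop
  have hG2 : ∀ x z, IsLin k (fun y => G x y z) := by simp only [G]; fun_prop
  have hG3 : ∀ x y, IsLin k (fun z => G x y z) := by simp only [G]; fun_prop
  have hGt : ∀ b x y z, G (x ⬝ 𝐭 b) y z = G x (𝐭 b ⬝ y) z := fun b x y z => by
    simp only [G]
    rw [hH.trans_mul_tgt (hB y z)]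
    simp only [hb.mulL_assoc, b2]
  have hGs : ∀ b x y z, G (𝐭 b ⬝ x) y z = G x y (𝐬 b ⬝ z) := fun b x y z => by
    simp only [G]
    rw [hH.trans_tgt_mul (hB y z)]
    simp only [hb.mulL_assoc]
  have hGB : ∀ y z, H.BBal (fun p q => G p (q ⬝ y) z) := fun y z =>
    ⟨by fun_prop, by fun_prop, fun b m n => by rw [hGt, hb.mulL_assoc]⟩
  have hK1 : ∀ y z, IsLin k (fun x => K x y z) := by simp only [K]; fun_prop
  have hK2 : ∀ x z, IsLin k (fun y => K x y z) := by simp only [K]; fun_prop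
  have hK3 : ∀ x y, IsLin k (fun z => K x y z) := by simp only [K]; fun_prop
  have hKs : ∀ b x y z, K (𝐭 b ⬝ x) y z = K x (𝐬 b ⬝ y) z := fun b x y z => by
    simp only [K]
    rw [hH.trans_tgt_mul (hGB y z)]
    simp only [hb.mulL_assoc]
  have hKd : ∀ b x y z, K x (𝐭 b ⬝ y) z = K x y (𝐬 b ⬝ z) := fun b x y z => by
    simp only [K]
    have := hH.trans_takeuchi (hGB y z) b x
    simp only [hb.mulL_assoc, hGs] at this
    exact this.symm
  have hKD : ∀ x, H.DBal H.lactL (fun u v => K x u v) := fun x =>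
    ⟨by fun_prop, by fun_prop, fun b m n => hKd _ _ _ _⟩
  trans K X H.oneL H.oneL
  · have := hH.trans_comul (f := fun x w => sw (H.comulLift w) (fun u v => K x u v))
      ⟨by fun_prop, by fun_prop, fun b x y => by
        rw [lactL_apply, hb.comul_src_mul (hKD x)]
        simp only [hKs]⟩ X
    rw [hb.comul_oneL (hKD X)] at this
    rw [← this]
    refine sw_congr _ fun p q => ?_
    have e : ∀ u v, f p u v = sw (H.comulLift p) (fun x y => sw (H.comulLift x)
        (fun x' x'' => K x' (x'' ⬝ u) (y ⬝ v))) := fun u v => by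
      rw [← hH.comul_trans (g := fun r s => f r u s) ⟨by fun_prop, by fun_prop,
        fun b m n => b1 _ _ _ _⟩ p v]
      exact sw_congr _ fun x y => (hH.comul_trans (g := fun r s => G r s (y ⬝ v))
        ⟨by fun_prop, by fun_prop, fun b m n => hGt _ _ _ _⟩ x u).symm
    simp only [e]
    rw [sw_comm]
    have e2 : ∀ x y, sw (H.comulLift (y ⬝ q)) (fun u v => K x u v) =
        sw (H.comulLift y) (fun u v => sw (H.comulLift q) (fun u' v' => K x (u ⬝ u') (v ⬝ v'))) :=
      fun x y => hb.comul_mul' (hKD x) y q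
    simp only [e2]
    rw [← hb.isCom_regular.coassoc (f := fun x u v => sw (H.comulLift q)
      (fun u' v' => K x (u ⬝ u') (v ⬝ v')))]
    · refine sw_congr _ fun x y => ?_
      rw [sw_comm]
    · exact ⟨by fun_prop, by fun_prop, by fun_prop, fun b x y m => by
        simp only [hKs, hb.mulL_assoc], fun b x y m => by
        simp only [hKd, hb.mulL_assoc, lactL_apply]⟩
  · rw [← hH.trans_comul (f := fun x y => K x y H.oneL) ⟨by fun_prop, by fun_prop,
      fun b x y => hKs _ _ _ _⟩ X]
    refine sw_congr _ fun p q => ?_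
    have := hH.comul_trans (g := fun r s => G r s H.oneL)
        ⟨by fun_prop, by fun_prop, fun b m n => hGt _ _ _ _⟩ p q
    simp only [K]
    rw [this]
    simp only [G, hb.mul_oneL]

theorem trans_counit (X : L) :
    sw (H.transLift X) (fun p q => p ⬝ 𝐭 (H.counit q)) = X := by
  have hb := hH.bialgebroid
  have := hH.trans_comul (f := fun x y => 𝐭 (H.counit y) ⬝ x) ⟨by fun_prop, by fun_prop,
    fun b x y => by rw [lactL_apply, hb.counit_src_mul, hb.tgt_mul, hb.mulL_assoc]⟩ X
  rw [hb.counit_one, hb.tgt_one, hb.oneL_mul] at this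
  refine Eq.trans ?_ this
  refine sw_congr _ fun p q => ?_
  conv_lhs => rw [← hb.comul_counit_right (p ⬝ 𝐭 (H.counit q))]
  rw [hb.comul_mul_tgt (f := fun x y => 𝐭 (H.counit y) ⬝ x) ⟨by fun_prop, by fun_prop,
    fun b x y => by rw [lactL_apply, hb.counit_src_mul, hb.tgt_mul, hb.mulL_assoc]⟩]
  exact sw_congr _ fun u v => by rw [hb.counit_mul_tgt v q]

theorem trans_mul_self (X : L) :
    sw (H.transLift X) (fun p q => p ⬝ q) = 𝐬 (H.counit X) := by
  have hb := hH.bialgebroid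
  have := hH.trans_comul (f := fun x y => 𝐬 (H.counit x) ⬝ y) ⟨by fun_prop, by fun_prop,
    fun b x y => by rw [lactL_apply, hb.counit_tgt_mul, hb.src_mul, hb.mulL_assoc]⟩ X
  rw [hb.mul_oneL] at this
  rw [← this]
  refine sw_congr _ fun p q => ?_
  conv_lhs => rw [← hb.comul_counit_left p]
  rw [map_sw_left (φ := fun x y => x ⬝ y) _ _ (by fun_prop)]
  simp only [hb.mulL_assoc]

end IsLeftHopfAlgebroid

variable (H) in
/-- The coaction `X ↦ X₋ ⋄ X₊` on `L`. -/
def invLift : L →ₗ[k] L ⊗[k] L := (TensorProduct.comm k L L).toLinearMap ∘ₗ H.transLift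

theorem sw_invLift (X : L) {f : L → L → V} (h1 : ∀ n, IsLin k (fun m => f m n))
    (h2 : ∀ m, IsLin k (fun n => f m n)) :
    sw (H.invLift X) f = sw (H.transLift X) (fun p q => f q p) :=
  sw_swap (k := k) (H.transLift X) h1 h2

theorem DBal.inv {f : L → L → V} (hf : H.DBal H.lactI f) : H.BBal (fun p q => f q p) :=
  ⟨hf.right, hf.left, fun b m n => (hf.bal b n m).symm⟩

/-- `L` is a comodule with the coaction `X ↦ X₋ ⋄ X₊`. -/
theorem IsLeftHopfAlgebroid.isCom_inv (hH : H.IsLeftHopfAlgebroid) :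
    H.IsCom H.lactI H.ractI H.invLift where
  la_one m := by rw [lactI_apply, hH.bialgebroid.tgt_one, hH.bialgebroid.mul_oneL]
  la_mul a b m := by simp only [lactI_apply, hH.bialgebroid.tgt_mul, hH.bialgebroid.mulL_assoc]
  ra_one m := by rw [ractI_apply, hH.bialgebroid.tgt_one, hH.bialgebroid.oneL_mul]
  ra_mul a b m := by simp only [ractI_apply, hH.bialgebroid.tgt_mul, hH.bialgebroid.mulL_assoc]
  la_ra a b m := by simp only [ractI_apply, lactI_apply, hH.bialgebroid.mulL_assoc]
  lact {V _ _ f} hf b m := by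
    have hl := hf.left
    have hr := hf.right
    rw [sw_invLift _ hl hr, sw_invLift _ (by fun_prop) (by fun_prop)]
    exact hH.trans_mul_tgt hf.inv b m
  ract {V _ _ f} hf b m := by
    have hl := hf.left
    have hr := hf.right
    rw [sw_invLift _ hl hr, sw_invLift _ (by fun_prop) (by fun_prop)]
    exact hH.trans_tgt_mul hf.inv b m
  tak {V _ _ f} hf b m := by
    have hl := hf.left
    have hr := hf.right
    rw [sw_invLift _ (by fun_prop) (by fun_prop), sw_invLift _ (by fun_prop) (by fun_prop)]
    exact (hH.trans_takeuchi hf.inv b m).symm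
  coassoc {V _ _ f} hf m := by
    have h1 := hf.l1
    have h2 := hf.l2
    have h3 := hf.l3
    rw [sw_invLift _ (by fun_prop) (by fun_prop), sw_invLift _ (by fun_prop) (by fun_prop)]
    rw [hH.trans_coassoc (f := fun p u v => f u v p) (by fun_prop) (by fun_prop) (by fun_prop)
      (fun b x y z => (hf.b2 b y z x).symm) (fun b x y z => hf.b1 b y z x)]
    exact sw_congr _ fun p q => (sw_invLift _ (by fun_prop) (by fun_prop)).symm
  counit m := by
    rw [sw_invLift _ (by fun_prop) (by fun_prop)]
    exact hH.trans_counit m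

end

/-! ### Twisted pairings -/

section

/-- The bundled form of a bilinear map. -/
def _root_.HopfAlgebroidTwist.IsBilin.toLin₂ {P : Type u} [AddCommGroup P] [Module k P] {f : M → N → P}
    (hf : IsBilin k f) : M →ₗ[k] N →ₗ[k] P :=
  LinearMap.mk₂ k f (fun a b n => (hf.left n).add a b) (fun c a n => (hf.left n).smul c a)
    (fun m a b => (hf.right m).add a b) (fun c m a => (hf.right m).smul c a)

theorem sw_sharp (Γ : L →ₗ[k] L →ₗ[k] B) (d : M →ₗ[k] L ⊗[k] M) (e : N →ₗ[k] L ⊗[k] N)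
    (la : B →ₗ[k] M →ₗ[k] M) (z : M ⊗[k] N) {f : M → N → V}
    (h1 : ∀ n, IsLin k (fun m => f m n)) (h2 : ∀ m, IsLin k (fun n => f m n)) :
    sw (sharp Γ d e la z) f = sw z (fun m n => sw (d m) (fun x m' => sw (e n) (fun y n' =>
      f (la (Γ x y) m') n'))) := by
  rw [map_eq_sw (sharp Γ d e la) z, sw_sw _ _ h1 h2]
  refine sw_congr _ fun m n => ?_
  let Φ : (L ⊗[k] L) ⊗[k] (M ⊗[k] N) →ₗ[k] M ⊗[k] N :=
    TensorProduct.map (TensorProduct.lift la) LinearMap.id ∘ₗ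
      (TensorProduct.assoc k B M N).symm.toLinearMap ∘ₗ
      TensorProduct.map (TensorProduct.lift Γ) LinearMap.id
  have e1 : sharp Γ d e la (m ⊗ₜ n) =
      sw (d m) (fun x m' => sw (e n) (fun y n' => la (Γ x y) m' ⊗ₜ[k] n')) := by
    refine (map_eq_sw (Φ ∘ₗ exch ∘ₗ (TensorProduct.mk k _ _).flip (e n)) (d m)).trans
      (sw_congr _ fun a b => ?_)
    exact map_eq_sw (Φ ∘ₗ exch ∘ₗ TensorProduct.mk k _ _ (a ⊗ₜ b)) (e n)
  rw [e1, sw_sw _ _ h1 h2]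
  refine sw_congr _ fun x m' => ?_
  rw [sw_sw _ _ h1 h2]
  exact sw_congr _ fun y n' => sw_tmul _ _ ⟨h1, h2⟩

variable {P : Type u} [AddCommGroup P] [Module k P]
variable {laM raM : B →ₗ[k] M →ₗ[k] M} {d : M →ₗ[k] L ⊗[k] M}
variable {laN raN : B →ₗ[k] N →ₗ[k] N} {e : N →ₗ[k] L ⊗[k] N}
variable {laP raP : B →ₗ[k] P →ₗ[k] P} {dP : P →ₗ[k] L ⊗[k] P} {μ : M →ₗ[k] N →ₗ[k] P}
variable {Γ : L →ₗ[k] L →ₗ[k] B}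

/-- The twisted pairing `(m, n) ↦ Γ(m₍₋₁₎, n₍₋₁₎) μ(m₍₀₎, n₍₀₎)`. -/
def twp (Γ : L →ₗ[k] L →ₗ[k] B) (d : M →ₗ[k] L ⊗[k] M) (e : N →ₗ[k] L ⊗[k] N)
    (la : B →ₗ[k] P →ₗ[k] P) (μ : M →ₗ[k] N →ₗ[k] P) : M →ₗ[k] N →ₗ[k] P :=
  IsBilin.toLin₂ (f := fun m n => sw (d m) (fun x m' => sw (e n) (fun y n' =>
    la (Γ x y) (μ m' n')))) ⟨by fun_prop, by fun_prop⟩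

theorem twp_apply (m : M) (n : N) : twp Γ d e laP μ m n =
    sw (d m) (fun x m' => sw (e n) (fun y n' => laP (Γ x y) (μ m' n'))) := rfl

variable (H) in
/-- `μ` is a left `B`-linear, `B`-balanced and colinear map `M ⊗_B N → P`. -/
structure IsPairing (laM raM : B →ₗ[k] M →ₗ[k] M) (d : M →ₗ[k] L ⊗[k] M)
    (laN : B →ₗ[k] N →ₗ[k] N) (e : N →ₗ[k] L ⊗[k] N)
    (laP : B →ₗ[k] P →ₗ[k] P) (dP : P →ₗ[k] L ⊗[k] P) (μ : M →ₗ[k] N →ₗ[k] P) : Prop where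
  left : ∀ b m n, μ (laM b m) n = laP b (μ m n)
  mid : ∀ b m n, μ (raM b m) n = μ m (laN b n)
  coact : ∀ {V : Type u} [AddCommGroup V] [Module k V] {f : L → P → V}, H.DBal laP f → ∀ m n,
    sw (dP (μ m n)) f = sw (d m) (fun x m' => sw (e n) (fun y n' => f (x ⬝ y) (μ m' n')))

/-- `X ⋆ Y = Γ(X₍₁₎, Y₍₁₎) X₍₂₎ Y₍₂₎`, the product of the left twist of `L`. -/
def star (H : BialgebroidData k B L) (Γ : L →ₗ[k] L →ₗ[k] B) : L →ₗ[k] L →ₗ[k] L :=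
  TensorProduct.curry (H.leftTwist Γ)

/-- `X • Y = X₊ Y₊ t(Γ(Y₋, X₋))`, the product of the right twist of `L`. -/
def bull (H : BialgebroidData k B L) (Γ : L →ₗ[k] L →ₗ[k] B) : L →ₗ[k] L →ₗ[k] L :=
  TensorProduct.curry (H.rightTwist Γ)

theorem mulT_map_exch {M₁ M₂ N₁ N₂ : Type u} [AddCommGroup M₁] [Module k M₁] [AddCommGroup M₂]
    [Module k M₂] [AddCommGroup N₁] [Module k N₁] [AddCommGroup N₂] [Module k N₂]
    (φ : M₁ ⊗[k] N₁ →ₗ[k] L) (ψ : M₂ ⊗[k] N₂ →ₗ[k] L) (z : M₁ ⊗[k] M₂) (w : N₁ ⊗[k] N₂) :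
    H.mulT (TensorProduct.map φ ψ (exch (z ⊗ₜ[k] w))) =
      sw z (fun a b => sw w (fun c d => φ (a ⊗ₜ c) ⬝ ψ (b ⊗ₜ d))) := by
  rw [sw_exch, map_sw (φ := H.mulT) _ _ (by fun_prop)]
  refine sw_congr _ fun a b => ?_
  rw [map_sw (φ := H.mulT) _ _ (by fun_prop)]
  rfl

theorem star_apply (X Y : L) : H.star Γ X Y = sw (H.comulLift X) (fun x x' =>
    sw (H.comulLift Y) (fun y y' => 𝐬 (Γ x y) ⬝ (x' ⬝ y'))) :=
  mulT_map_exch (H.src ∘ₗ TensorProduct.lift Γ) H.mulT (H.comulLift X) (H.comulLift Y)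

theorem bull_apply (X Y : L) : H.bull Γ X Y = sw (H.transLift X) (fun p q =>
    sw (H.transLift Y) (fun r s => (p ⬝ r) ⬝ 𝐭 (Γ s q))) :=
  mulT_map_exch H.mulT _ (H.transLift X) (H.transLift Y)

theorem dot_apply (X Y : L) : (H.twist Γ).mulL X Y = sw (H.comulLift X) (fun x x' =>
    sw (H.comulLift Y) (fun y y' => 𝐬 (Γ x y) ⬝ H.bull Γ x' y')) :=
  mulT_map_exch (H.src ∘ₗ TensorProduct.lift Γ) (H.rightTwist Γ) (H.comulLift X) (H.comulLift Y)

theorem star_eq_twp : H.star Γ = twp Γ H.comulLift H.comulLift H.lactL H.mulL :=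
  LinearMap.ext₂ star_apply

theorem dot_eq_twp : (H.twist Γ).mulL = twp Γ H.comulLift H.comulLift H.lactL (H.bull Γ) :=
  LinearMap.ext₂ dot_apply

theorem bull_eq_twp : H.bull Γ = (twp Γ H.invLift H.invLift H.lactI H.mulL.flip).flip :=
  LinearMap.ext₂ fun X Y => by
    rw [bull_apply, LinearMap.flip_apply, twp_apply, sw_comm, sw_invLift _ (by fun_prop) (by fun_prop)]
    refine sw_congr _ fun r s => ?_
    rw [sw_invLift _ (by fun_prop) (by fun_prop)]
    rfl

/-- Multilinearity and the balancedness that make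
`Γ`-type expressions in `m₍₋₂₎, m₍₋₁₎, n₍₋₂₎, n₍₋₁₎, m₍₀₎, n₍₀₎` well defined. -/
structure Bal6 (H : BialgebroidData k B L) (laM raM : B →ₗ[k] M →ₗ[k] M) (laN : B →ₗ[k] N →ₗ[k] N)
    (T : L → L → L → L → M → N → V) : Prop where
  l1 : ∀ x' y y' m n, IsLin k (fun x => T x x' y y' m n)
  l2 : ∀ x y y' m n, IsLin k (fun x' => T x x' y y' m n)
  l3 : ∀ x x' y' m n, IsLin k (fun y => T x x' y y' m n)
  l4 : ∀ x x' y m n, IsLin k (fun y' => T x x' y y' m n)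
  l5 : ∀ x x' y y' n, IsLin k (fun m => T x x' y y' m n)
  l6 : ∀ x x' y y' m, IsLin k (fun n => T x x' y y' m n)
  c1 : ∀ b x x' y y' m n, T (H.mulL (H.tgt b) x) x' y y' m n = T x (H.mulL (H.src b) x') y y' m n
  c2 : ∀ b x x' y y' m n, T x (H.mulL (H.tgt b) x') y y' m n = T x x' y y' (laM b m) n
  c3 : ∀ b x x' y y' m n, T (H.mulL x (H.tgt b)) x' y y' m n = T x x' (H.mulL (H.tgt b) y) y' m n
  c4 : ∀ b x x' y y' m n, T x (H.mulL x' (H.src b)) y y' m n = T x x' y (H.mulL (H.src b) y') m n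
  c5 : ∀ b x x' y y' m n, T x (H.mulL x' (H.tgt b)) y y' m n = T x x' y (H.mulL (H.tgt b) y') m n
  c6 : ∀ b x x' y y' m n, T x x' y y' (raM b m) n = T x x' y y' m (laN b n)

/-- Coassociativity for two comodules at once. -/
theorem regroup (hb : H.IsLeftBialgebroid) (hM : H.IsCom laM raM d) (hN : H.IsCom laN raN e)
    {T : L → L → L → L → M → N → V} (hT : Bal6 H laM raM laN T) (m : M) (n : N) :
    sw (d m) (fun x m' => sw (e n) (fun y n' => sw (d m') (fun x' m'' => sw (e n') (fun y' n'' =>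
      T x x' y y' m'' n'')))) =
    sw (d m) (fun x m' => sw (e n) (fun y n' => sw (H.comulLift x) (fun x x' =>
      sw (H.comulLift y) (fun y y' => T x x' y y' m' n')))) := by
  obtain ⟨l1, l2, l3, l4, l5, l6, c1, c2, c3, c4, c5, c6⟩ := hT
  have e1 := hM.coassoc (f := fun x x' m => sw (e n) (fun y n' => sw (e n') (fun y' n'' =>
    T x x' y y' m n''))) ⟨by fun_prop, by fun_prop, by fun_prop, fun b x y m => by
      simp only [c1], fun b x y m => by simp only [c2]⟩ m
  have e2 : ∀ x m', sw (e n) (fun y n' => sw (d m') (fun x' m'' => sw (e n') (fun y' n'' =>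
      T x x' y y' m'' n''))) = sw (d m') (fun x' m'' => sw (e n) (fun y n' => sw (e n')
        (fun y' n'' => T x x' y y' m'' n''))) := fun x m' => sw_comm _ _ _
  simp only [e2]
  rw [← e1]
  have hD : ∀ y y' n x, H.DBal laM (fun x m => sw (H.comulLift x) fun x x' => T x x' y y' m n) ∧
      H.DBal H.lactL (fun x' x'' => T x' x'' y y' x n) := fun y y' n x => by
    have h2 : ∀ x, H.DBal H.lactL (fun x' x'' => T x' x'' y y' x n) := fun x =>
      ⟨by fun_prop, by fun_prop, fun b m n => c1 _ _ _ _ _ _ _⟩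
    refine ⟨⟨by fun_prop, by fun_prop, fun b m n => ?_⟩, h2 _⟩
    rw [hb.comul_tgt_mul (h2 _)]
    simp only [c2]
  have e4 := hN.coassoc (f := fun y y' n => sw (d m) (fun x m' => sw (H.comulLift x) (fun x x' =>
    T x x' y y' m' n))) ⟨by fun_prop, by fun_prop, by fun_prop, fun b y y' n => ?_,
      fun b y y' n => ?_⟩ n
  · trans sw (e n) fun y n' => sw (e n') fun y' n'' => sw (d m) fun x m' =>
      sw (H.comulLift x) fun x x' => T x x' y y' m' n''
    · have : ∀ (x : L) (m' : M), (sw (H.comulLift x) fun y z => sw (e n) fun y_1 n' =>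
          sw (e n') fun y' n'' => T y z y_1 y' m' n'') = sw (e n) fun y_1 n' =>
          sw (e n') fun y' n'' => sw (H.comulLift x) fun y z => T y z y_1 y' m' n'' := fun x m' => by
        rw [sw_comm]
        exact sw_congr _ fun _ _ => sw_comm _ _ _
      simp only [this]
      rw [sw_comm]
      exact sw_congr _ fun _ _ => sw_comm _ _ _
    · rw [← e4, sw_comm]
      refine sw_congr _ fun y n' => ?_
      rw [sw_comm]
      exact sw_congr _ fun x m' => sw_comm _ _ _
  · simp only [← c3, ← c4]
    exact sw_congr _ fun x m' => hb.comul_takeuchi (hD y y' n m').2 b x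
  · simp only [← c5, ← c6]
    rw [← hM.tak (hD y y' n 0).1]
    exact sw_congr _ fun x m' => (hb.comul_mul_tgt (hD y y' n m').2 b x).symm

end

variable {P : Type u} [AddCommGroup P] [Module k P]
variable {laM raM : B →ₗ[k] M →ₗ[k] M} {d : M →ₗ[k] L ⊗[k] M}
variable {laN raN : B →ₗ[k] N →ₗ[k] N} {e : N →ₗ[k] L ⊗[k] N}
variable {laP raP : B →ₗ[k] P →ₗ[k] P} {dP : P →ₗ[k] L ⊗[k] P} {μ : M →ₗ[k] N →ₗ[k] P}
variable {Γ : L →ₗ[k] L →ₗ[k] B}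

/-! ### The left twist -/

section

/-- The twisted pairing is colinear over the left twist:
`δ(μ_Γ(m, n)) = m₍₋₁₎ ⋆ n₍₋₁₎ ⋄ μ(m₍₀₎, n₍₀₎)`. -/
theorem IsPairing.twp_coact (hb : H.IsLeftBialgebroid) (hΓ : H.IsTwoCocycle Γ)
    (hM : H.IsCom laM raM d) (hN : H.IsCom laN raN e) (hP : H.IsCom laP raP dP)
    (hμ : H.IsPairing laM raM d laN e laP dP μ) {f : L → P → V} (hf : H.DBal laP f) (m : M) (n : N) :
    sw (dP (twp Γ d e laP μ m n)) f =
      sw (d m) (fun x m' => sw (e n) (fun y n' => f (H.star Γ x y) (μ m' n'))) := by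
  have hl := hf.left
  have hr := hf.right
  have hT : Bal6 H laM raM laN (fun x x' y y' m n => f (𝐬 (Γ x y) ⬝ (x' ⬝ y')) (μ m n)) := by
    refine ⟨by fun_prop, by fun_prop, by fun_prop, by fun_prop, by fun_prop, by fun_prop, ?_, ?_, ?_,
      ?_, ?_, ?_⟩ <;> intro b x x' y y' m n
    · simp only [hΓ.bar_linear, hb.src_mul, hb.mulL_assoc]
    · rw [hμ.left, ← hf.bal, hb.mulL_assoc, ← hb.mulL_assoc, hb.src_tgt, hb.mulL_assoc]
    · rw [hΓ.balanced]
    · rw [hb.mulL_assoc]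
    · rw [hb.mulL_assoc]
    · rw [hμ.mid]
  have e1 : ∀ x y, f (H.star Γ x y) = fun p => sw (H.comulLift x) (fun x x' =>
      sw (H.comulLift y) (fun y y' => f (𝐬 (Γ x y) ⬝ (x' ⬝ y')) p)) := fun x y => funext fun p => by
    rw [star_apply, map_sw_left (φ := f) _ _ hl]
    exact sw_congr _ fun _ _ => map_sw_left (φ := f) _ _ hl _
  simp only [e1]
  rw [← regroup hb hM hN hT, twp_apply, sw_sw_lin dP _ hl hr]
  refine sw_congr _ fun x m' => ?_
  rw [sw_sw_lin dP _ hl hr]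
  refine sw_congr _ fun y n' => ?_
  rw [hP.lact hf, hμ.coact (hf.src_mul_left hb _)]

/-- The twisted product of a comodule algebra is associative. -/
theorem IsPairing.twp_assoc {μ : M →ₗ[k] M →ₗ[k] M} (hb : H.IsLeftBialgebroid)
    (hΓ : H.IsTwoCocycle Γ) (hM : H.IsCom laM raM d)
    (hμ : H.IsPairing laM raM d laM d laM d μ) (hassoc : ∀ a b c, μ (μ a b) c = μ a (μ b c))
    (a b c : M) : twp Γ d d laM μ (twp Γ d d laM μ a b) c =
      twp Γ d d laM μ a (twp Γ d d laM μ b c) := by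
  have hD : ∀ z c', H.DBal laM (fun x m' => laM (Γ x z) (μ m' c')) := fun z c' =>
    ⟨by fun_prop, by fun_prop, fun b x m => by rw [hΓ.bar_linear, hM.la_mul, hμ.left]⟩
  rw [twp_apply (twp Γ d d laM μ a b), twp_apply a (twp Γ d d laM μ b c)]
  rw [hμ.twp_coact hb hΓ hM hM hM (f := fun x m' => sw (d c) fun y n' => laM (Γ x y) (μ m' n'))]
  swap
  · exact ⟨by fun_prop, by fun_prop, fun b x m => by simp only [(hD _ _).bal]⟩
  rw [sw_comm (d a) (d (twp Γ d d laM μ b c)), hμ.twp_coact hb hΓ hM hM hM (f := fun y n' => sw (d a) fun x m' =>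
    laM (Γ x y) (μ m' n'))]
  · rw [sw_comm]
    refine sw_congr _ fun y b' => ?_
    rw [sw_comm]
    refine sw_congr _ fun z c' => ?_
    refine sw_congr _ fun x a' => ?_
    rw [hassoc]
    congr 1
    congr 1
    exact (hΓ.cocycle x y z).symm
  · refine ⟨by fun_prop, by fun_prop, fun b x m => ?_⟩
    have := hM.tak (hD x m) b a
    simpa only [hΓ.balanced, hμ.mid] using this

namespace IsLeftBialgebroid
variable (hb : H.IsLeftBialgebroid)
include hb

theorem isPairing_mul : H.IsPairing H.lactL H.ractL H.comulLift H.lactL H.comulLift H.lactL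
    H.comulLift H.mulL where
  left b m n := by simp only [lactL_apply, hb.mulL_assoc]
  mid b m n := by simp only [lactL_apply, ractL_apply, hb.mulL_assoc]
  coact hf m n := hb.comul_mul' hf m n

variable (hΓ : H.IsTwoCocycle Γ)
include hΓ

theorem star_assoc (X Y Z : L) :
    H.star Γ (H.star Γ X Y) Z = H.star Γ X (H.star Γ Y Z) := by
  rw [star_eq_twp]
  exact hb.isPairing_mul.twp_assoc hb hΓ hb.isCom_regular hb.mulL_assoc X Y Z

theorem bal_star_left (Y : L) : H.DBal H.lactL (fun x x' => sw (H.comulLift Y)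
    (fun y y' => 𝐬 (Γ x y) ⬝ (x' ⬝ y'))) :=
  ⟨by fun_prop, by fun_prop, fun b x x' => by
    simp only [hΓ.bar_linear, hb.src_mul, lactL_apply, hb.mulL_assoc]⟩

theorem bal_star_right (X : L) : H.DBal H.lactL (fun y y' => sw (H.comulLift X)
    (fun x x' => 𝐬 (Γ x y) ⬝ (x' ⬝ y'))) :=
  ⟨by fun_prop, by fun_prop, fun b y y' => by
    simp only [← hΓ.balanced, lactL_apply]
    rw [hb.comul_takeuchi (f := fun x x' => 𝐬 (Γ x y) ⬝ (x' ⬝ y')) ⟨by fun_prop, by fun_prop,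
      fun b x x' => by simp only [hΓ.bar_linear, hb.src_mul, lactL_apply, hb.mulL_assoc]⟩]
    simp only [hb.mulL_assoc]⟩

theorem tgt_mul_star (b : B) (X Y : L) :
    H.star Γ (𝐭 b ⬝ X) Y = 𝐭 b ⬝ H.star Γ X Y := by
  rw [star_apply, hb.comul_tgt_mul (hb.bal_star_left hΓ Y), star_apply,
    map_sw (φ := fun x => 𝐭 b ⬝ x) _ _ (by fun_prop)]
  refine sw_congr _ fun x x' => ?_
  rw [map_sw (φ := fun x => 𝐭 b ⬝ x) _ _ (by fun_prop)]
  refine sw_congr _ fun y y' => ?_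
  simp only [← hb.mulL_assoc, hb.src_tgt]

theorem star_mul_tgt (b : B) (X Y : L) :
    H.star Γ X (Y ⬝ 𝐭 b) = H.star Γ X Y ⬝ 𝐭 b := by
  rw [star_apply, sw_comm, hb.comul_mul_tgt (hb.bal_star_right hΓ X), star_apply,
    sw_comm, map_sw (φ := fun x => x ⬝ 𝐭 b) _ _ (by fun_prop)]
  refine sw_congr _ fun x x' => ?_
  rw [map_sw (φ := fun x => x ⬝ 𝐭 b) _ _ (by fun_prop)]
  refine sw_congr _ fun y y' => ?_
  simp only [hb.mulL_assoc]

theorem mul_tgt_star (b : B) (X Y : L) :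
    H.star Γ (X ⬝ 𝐭 b) Y = H.star Γ X (𝐭 b ⬝ Y) := by
  rw [star_apply, hb.comul_mul_tgt (hb.bal_star_left hΓ Y), star_apply,
    sw_comm (H.comulLift X) (H.comulLift (𝐭 b ⬝ Y)),
    hb.comul_tgt_mul (hb.bal_star_right hΓ X), sw_comm (H.comulLift Y)]
  simp only [hb.mulL_assoc]

theorem oneL_star (X : L) : H.star Γ H.oneL X = X := by
  rw [star_apply, hb.comul_oneL (hb.bal_star_left hΓ X)]
  simp only [hΓ.one_left, hb.oneL_mul]
  exact hb.comul_counit_left X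

theorem star_oneL (X : L) : H.star Γ X H.oneL = X := by
  rw [star_apply, sw_comm, hb.comul_oneL (hb.bal_star_right hΓ X)]
  simp only [hΓ.one_right, hb.mul_oneL]
  exact hb.comul_counit_left X

theorem src_star (b : B) (X : L) : H.star Γ (𝐬 b) X =
    sw (H.comulLift X) (fun x x' => 𝐬 (Γ (𝐬 b) x) ⬝ x') := by
  rw [star_apply, hb.comul_src (hb.bal_star_left hΓ X)]
  simp only [hb.oneL_mul]

theorem star_src (b : B) (X : L) : H.star Γ X (𝐬 b) =
    sw (H.comulLift X) (fun x x' => 𝐬 (Γ x (𝐬 b)) ⬝ x') := by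
  rw [star_apply, sw_comm, hb.comul_src (hb.bal_star_right hΓ X)]
  simp only [hb.mul_oneL]

theorem cocycle' (X Y Z : L) : Γ X (H.star Γ Y Z) = Γ (H.star Γ X Y) Z := hΓ.cocycle X Y Z

theorem counit_star (X Y : L) : H.counit (H.star Γ X Y) = Γ X Y := by
  rw [← hΓ.one_left, hb.cocycle' hΓ, hb.oneL_star hΓ]

end IsLeftBialgebroid

/-- The twisted left action `b ·_Γ m = Γ(s(b), m₍₋₁₎) m₍₀₎`. -/
def tla (H : BialgebroidData k B L) (Γ : L →ₗ[k] L →ₗ[k] B) (la : B →ₗ[k] M →ₗ[k] M)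
    (d : M →ₗ[k] L ⊗[k] M) : B →ₗ[k] M →ₗ[k] M :=
  IsBilin.toLin₂ (f := fun b m => sw (d m) (fun x m' => la (Γ (H.src b) x) m'))
    ⟨by fun_prop, by fun_prop⟩

/-- The twisted right action `m ·_Γ b = Γ(m₍₋₁₎, s(b)) m₍₀₎`. -/
def tra (H : BialgebroidData k B L) (Γ : L →ₗ[k] L →ₗ[k] B) (la : B →ₗ[k] M →ₗ[k] M)
    (d : M →ₗ[k] L ⊗[k] M) : B →ₗ[k] M →ₗ[k] M :=
  IsBilin.toLin₂ (f := fun b m => sw (d m) (fun x m' => la (Γ x (H.src b)) m'))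
    ⟨by fun_prop, by fun_prop⟩

theorem tla_apply (b : B) (m : M) :
    H.tla Γ laM d b m = sw (d m) (fun x m' => laM (Γ (𝐬 b) x) m') := rfl

theorem tra_apply (b : B) (m : M) :
    H.tra Γ laM d b m = sw (d m) (fun x m' => laM (Γ x (𝐬 b)) m') := rfl

section
variable (hb : H.IsLeftBialgebroid) (hΓ : H.IsTwoCocycle Γ) (hM : H.IsCom laM raM d)
include hb hΓ hM

/-- The coaction of `φ(m₍₋₁₎) m₍₀₎`. -/
theorem coact_twist_aux {f : L → M → V} (hf : H.DBal laM f) (φ : L →ₗ[k] B) (m : M) :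
    sw (d (sw (d m) (fun x m' => laM (φ x) m'))) f =
      sw (d m) (fun x m' => sw (d m') (fun x' m'' => f (𝐬 (φ x) ⬝ x') m'')) := by
  rw [sw_sw_lin d _ hf.left hf.right]
  exact sw_congr _ fun x m' => hM.lact hf _ _

/-- `δ(b ·_Γ m) = s(b) ⋆ m₍₋₁₎ ⋄ m₍₀₎` -/
theorem coact_tla {f : L → M → V} (hf : H.DBal laM f) (b : B) (m : M) :
    sw (d (H.tla Γ laM d b m)) f = sw (d m) (fun x m' => f (H.star Γ (𝐬 b) x) m') := by
  have hl := hf.left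
  have hr := hf.right
  rw [tla_apply, coact_twist_aux hb hΓ hM hf (Γ (𝐬 b)), ← hM.coassoc (f := fun x x' m =>
    f (𝐬 (Γ (𝐬 b) x) ⬝ x') m)]
  · refine sw_congr _ fun x m' => ?_
    rw [hb.src_star hΓ, map_sw_left (φ := f) _ _ hl]
  · refine ⟨by fun_prop, by fun_prop, by fun_prop, fun c x y m => ?_, fun c x y m => ?_⟩
    · rw [← hΓ.balanced, hb.src_tgt, hΓ.bar_linear, hb.src_mul, hb.mulL_assoc]
    · rw [← hb.mulL_assoc, hb.src_tgt, hb.mulL_assoc, hf.bal]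

/-- `δ(m ·_Γ b) = m₍₋₁₎ ⋆ s(b) ⋄ m₍₀₎` -/
theorem coact_tra {f : L → M → V} (hf : H.DBal laM f) (b : B) (m : M) :
    sw (d (H.tra Γ laM d b m)) f = sw (d m) (fun x m' => f (H.star Γ x (𝐬 b)) m') := by
  have hl := hf.left
  have hr := hf.right
  refine (coact_twist_aux hb hΓ hM hf (Γ.flip (𝐬 b)) m).trans ?_
  simp only [LinearMap.flip_apply]
  rw [← hM.coassoc (f := fun x x' m =>
    f (𝐬 (Γ x (𝐬 b)) ⬝ x') m)]
  · refine sw_congr _ fun x m' => ?_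
    rw [hb.star_src hΓ, map_sw_left (φ := f) _ _ hl]
  · refine ⟨by fun_prop, by fun_prop, by fun_prop, fun c x y m => ?_, fun c x y m => ?_⟩
    · rw [hΓ.bar_linear, hb.src_mul, hb.mulL_assoc]
    · rw [← hb.mulL_assoc, hb.src_tgt, hb.mulL_assoc, hf.bal]

theorem bal_tra (Y : L) : H.DBal laM (fun x m => laM (Γ x Y) m) :=
  ⟨by fun_prop, by fun_prop, fun b x m => by rw [hΓ.bar_linear, hM.la_mul]⟩

theorem bal_tla' (b : B) : H.DBal laM (fun x m => laM (Γ (𝐬 b) x) m) :=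
  ⟨by fun_prop, by fun_prop, fun c x m => by
    rw [← hΓ.balanced, hb.src_tgt, hΓ.bar_linear, hM.la_mul]⟩

end

end

/-! ### The right twist and the product of `L^Γ` -/

section

section

variable (hb : H.IsLeftBialgebroid) (hΓ : H.IsTwoCocycle Γ) (hM : H.IsCom laM raM d)
  (hN : H.IsCom laN raN e) (hP : H.IsCom laP raP dP) (hμ : H.IsPairing laM raM d laN e laP dP μ)
include hΓ hP hμ

theorem bal_twp_left (n : N) : H.DBal laM (fun x m => sw (e n) (fun y n' => laP (Γ x y) (μ m n'))) :=
  ⟨by fun_prop, by fun_prop, fun b x m => by simp only [hΓ.bar_linear, hP.la_mul, hμ.left]⟩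

include hM in
theorem bal_twp_right (m : M) : H.DBal laN (fun y n => sw (d m) (fun x m' => laP (Γ x y) (μ m' n))) :=
  ⟨by fun_prop, by fun_prop, fun b y n => by
    simp only [← hΓ.balanced, ← hμ.mid]
    exact hM.tak (f := fun x m' => laP (Γ x y) (μ m' n)) ⟨by fun_prop, by fun_prop, fun b x m => by
      rw [hΓ.bar_linear, hP.la_mul, hμ.left]⟩ b m⟩

end

theorem counit_twist_apply (X : L) :
    (H.twist Γ).counit X = sw (H.transLift X) (fun p q => Γ p q) :=
  map_eq_sw (TensorProduct.lift Γ) (H.transLift X)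

theorem IsTwoCocycle.bBal (hΓ : H.IsTwoCocycle Γ) : H.BBal (fun p q => Γ p q) :=
  ⟨by fun_prop, by fun_prop, fun b p q => hΓ.balanced b p q⟩

namespace IsLeftHopfAlgebroid

variable (hH : H.IsLeftHopfAlgebroid)
include hH

theorem isPairing_inv : H.IsPairing H.lactI H.ractI H.invLift H.lactI H.invLift H.lactI
    H.invLift H.mulL.flip where
  left b m n := by simp only [lactI_apply, LinearMap.flip_apply, hH.bialgebroid.mulL_assoc]
  mid b m n := by
    simp only [lactI_apply, ractI_apply, LinearMap.flip_apply, hH.bialgebroid.mulL_assoc]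
  coact {V _ _ f} hf m n := by
    have hl := hf.left
    have hr := hf.right
    rw [LinearMap.flip_apply, sw_invLift _ hl hr, hH.trans_mul hf.inv, sw_comm,
      sw_invLift _ (by fun_prop) (by fun_prop)]
    refine sw_congr _ fun p q => ?_
    rw [sw_invLift _ (by fun_prop) (by fun_prop)]
    rfl

variable (hΓ : H.IsTwoCocycle Γ)
include hΓ

theorem bull_assoc (X Y Z : L) :
    H.bull Γ (H.bull Γ X Y) Z = H.bull Γ X (H.bull Γ Y Z) := by
  rw [bull_eq_twp]
  exact (hH.isPairing_inv.twp_assoc hH.bialgebroid hΓ hH.isCom_inv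
    (fun a b c => (hH.bialgebroid.mulL_assoc c b a).symm) Z Y X).symm

/-- `(X • Y)₊ ⊗ (X • Y)₋ = X₊Y₊ ⊗ Y₋ ⋆ X₋` -/
theorem trans_bull {g : L → L → V} (hg : H.BBal g) (X Y : L) :
    sw (H.transLift (H.bull Γ X Y)) g = sw (H.transLift X) (fun p q => sw (H.transLift Y)
      (fun r s => g (p ⬝ r) (H.star Γ s q))) := by
  have hl := hg.left
  have hr := hg.right
  have h := hH.isPairing_inv.twp_coact hH.bialgebroid hΓ hH.isCom_inv hH.isCom_inv hH.isCom_inv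
    (f := fun y x => g x y) ⟨hr, hl, fun b y x => (hg.bal b x y).symm⟩ Y X
  rw [sw_invLift _ (by fun_prop) (by fun_prop)] at h
  rw [bull_eq_twp, LinearMap.flip_apply, h, sw_comm, sw_invLift _ (by fun_prop) (by fun_prop)]
  refine sw_congr _ fun p q => ?_
  rw [sw_invLift _ (by fun_prop) (by fun_prop)]
  rfl

theorem bal_bull_left (Y : L) : H.BBal (fun p q => sw (H.transLift Y)
    (fun r s => (p ⬝ r) ⬝ 𝐭 (Γ s q))) := by
  have := bal_twp_right hΓ hH.isCom_inv hH.isCom_inv hH.isPairing_inv (Γ := Γ) Y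
  refine ⟨by fun_prop, by fun_prop, fun b p q => ?_⟩
  have h := this.bal b q p
  rw [sw_invLift _ (by fun_prop) (by fun_prop), sw_invLift _ (by fun_prop) (by fun_prop)] at h
  exact h.symm

theorem bal_bull_right (X : L) : H.BBal (fun r s => sw (H.transLift X)
    (fun p q => (p ⬝ r) ⬝ 𝐭 (Γ s q))) := by
  have := bal_twp_left hΓ hH.isCom_inv hH.isPairing_inv (Γ := Γ) X
  refine ⟨by fun_prop, by fun_prop, fun b p q => ?_⟩
  have h := this.bal b q p
  rw [sw_invLift _ (by fun_prop) (by fun_prop), sw_invLift _ (by fun_prop) (by fun_prop)] at h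
  exact h.symm

theorem src_mul_bull (b : B) (X Y : L) : H.bull Γ (𝐬 b ⬝ X) Y = 𝐬 b ⬝ H.bull Γ X Y := by
  have hb := hH.bialgebroid
  rw [bull_apply, hH.trans_src_mul (hH.bal_bull_left hΓ Y), bull_apply,
    map_sw (φ := fun x => 𝐬 b ⬝ x) _ _ (by fun_prop)]
  refine sw_congr _ fun p q => ?_
  rw [map_sw (φ := fun x => 𝐬 b ⬝ x) _ _ (by fun_prop)]
  simp only [hb.mulL_assoc]

theorem mul_src_bull (b : B) (X Y : L) : H.bull Γ (X ⬝ 𝐬 b) Y = H.bull Γ X (𝐬 b ⬝ Y) := by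
  have hb := hH.bialgebroid
  rw [bull_apply, hH.trans_mul_src (hH.bal_bull_left hΓ Y), bull_apply,
    sw_comm (H.transLift X) (H.transLift (𝐬 b ⬝ Y)),
    hH.trans_src_mul (hH.bal_bull_right hΓ X), sw_comm (H.transLift Y)]
  simp only [hb.mulL_assoc]

theorem bull_mul_src (b : B) (X Y : L) : H.bull Γ X (Y ⬝ 𝐬 b) = H.bull Γ X Y ⬝ 𝐬 b := by
  have hb := hH.bialgebroid
  rw [bull_apply, sw_comm, hH.trans_mul_src (hH.bal_bull_right hΓ X), bull_apply, sw_comm,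
    map_sw (φ := fun x => x ⬝ 𝐬 b) _ _ (by fun_prop)]
  refine sw_congr _ fun p q => ?_
  rw [map_sw (φ := fun x => x ⬝ 𝐬 b) _ _ (by fun_prop)]
  simp only [hb.mulL_assoc, hb.src_tgt]

theorem oneL_bull (X : L) : H.bull Γ H.oneL X = X := by
  rw [bull_apply, hH.trans_oneL (hH.bal_bull_left hΓ X)]
  simp only [hΓ.one_right, hH.bialgebroid.oneL_mul]
  exact hH.trans_counit X

theorem bull_oneL (X : L) : H.bull Γ X H.oneL = X := by
  rw [bull_apply, sw_comm, hH.trans_oneL (hH.bal_bull_right hΓ X)]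
  simp only [hΓ.one_left, hH.bialgebroid.mul_oneL]
  exact hH.trans_counit X

theorem tgt_bull (b : B) (X : L) : H.bull Γ (𝐭 b) X =
    sw (H.transLift X) (fun p q => p ⬝ 𝐭 (Γ q (𝐬 b))) := by
  rw [bull_apply, hH.trans_tgt (hH.bal_bull_left hΓ X)]
  simp only [hH.bialgebroid.oneL_mul]

theorem bull_tgt (b : B) (X : L) : H.bull Γ X (𝐭 b) =
    sw (H.transLift X) (fun p q => p ⬝ 𝐭 (Γ (𝐬 b) q)) := by
  rw [bull_apply, sw_comm, hH.trans_tgt (hH.bal_bull_right hΓ X)]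
  simp only [hH.bialgebroid.mul_oneL]

theorem comul_bull {f : L → L → V} (hf : H.DBal H.lactL f) (X Y : L) :
    sw (H.comulLift (H.bull Γ X Y)) f = sw (H.comulLift X) (fun x x' => sw (H.comulLift Y)
      (fun y y' => f (x ⬝ y) (H.bull Γ x' y'))) := by
  have hb := hH.bialgebroid
  have hl := hf.left
  have hr := hf.right
  have hD : ∀ b : B, H.DBal H.lactL (fun x y => f x (y ⬝ 𝐭 b)) := fun b =>
    ⟨by fun_prop, by fun_prop, fun c m n => by rw [hf.bal, lactL_apply, lactL_apply, hb.mulL_assoc]⟩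
  rw [bull_apply, sw_sw_lin H.comulLift _ hl hr]
  have e1 : ∀ p q, sw (H.comulLift (sw (H.transLift Y) (fun r s => (p ⬝ r) ⬝ 𝐭 (Γ s q)))) f =
      sw (H.comulLift p) (fun p p' => sw (H.transLift Y) (fun r s => sw (H.comulLift r) (fun r r' =>
        f (p ⬝ r) (p' ⬝ r' ⬝ 𝐭 (Γ s q))))) := fun p q => by
    rw [sw_sw_lin H.comulLift _ hl hr, sw_comm (H.comulLift p)]
    refine sw_congr _ fun r s => ?_
    rw [hb.comul_mul_tgt hf, hb.comul_mul' (hD _)]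
  have e2 : ∀ p q, sw (H.comulLift p) (fun p p' => sw (H.transLift Y) (fun r s =>
      sw (H.comulLift r) (fun r r' => f (p ⬝ r) (p' ⬝ r' ⬝ 𝐭 (Γ s q))))) =
      sw (H.comulLift p) (fun p p' => sw (H.comulLift Y) (fun y y' => sw (H.transLift y')
        (fun r s => f (p ⬝ y) (p' ⬝ r ⬝ 𝐭 (Γ s q))))) := fun p q => by
    have := hH.trans_comul_comm (f := fun x y z => sw (H.comulLift p) fun p p' =>
      f (p ⬝ x) (p' ⬝ y ⬝ 𝐭 (Γ z q))) (by fun_prop) (by fun_prop) (by fun_prop)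
      (fun b x y z => by
        have := hb.comul_takeuchi (f := fun p p' => f (p ⬝ x) (p' ⬝ y ⬝ 𝐭 (Γ z q)))
          ⟨by fun_prop, by fun_prop, fun b m n => by
            rw [hb.mulL_assoc, hf.bal]; simp only [lactL_apply, hb.mulL_assoc]⟩ b p
        simpa only [hb.mulL_assoc] using this)
      (fun b x y z => by simp only [hΓ.bar_linear, hb.tgt_mul, hb.mulL_assoc]) Y
    rw [sw_comm (H.comulLift p), sw_comm (H.comulLift p)]
    refine Eq.trans (sw_congr _ fun r s => sw_comm _ _ _) (this.trans (sw_congr _ fun r s => ?_))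
    exact sw_comm _ _ _
  simp only [e1, e2]
  rw [hH.trans_comul_comm (f := fun x y z => sw (H.comulLift Y) (fun y1 y2 =>
    sw (H.transLift y2) (fun r s => f (x ⬝ y1) (y ⬝ r ⬝ 𝐭 (Γ s z)))))]
  · refine sw_congr _ fun x x' => ?_
    rw [sw_comm]
    refine sw_congr _ fun y y' => ?_
    rw [bull_apply, map_sw (φ := fun w => f (x ⬝ y) w) _ _ (by fun_prop)]
    refine sw_congr _ fun p q => ?_
    rw [map_sw (φ := fun w => f (x ⬝ y) w) _ _ (by fun_prop)]
  · fun_prop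
  · fun_prop
  · fun_prop
  · intro b x y z
    simp only [hb.mulL_assoc, hf.bal, lactL_apply]
  · intro b x y z
    refine sw_congr _ fun y1 y2 => ?_
    have := hH.trans_takeuchi (g := fun r s => f (x ⬝ y1) (y ⬝ r ⬝ 𝐭 (Γ s z))) ⟨by fun_prop,
      by fun_prop, fun b r s => by simp only [hΓ.bar_linear, hb.tgt_mul, hb.mulL_assoc]⟩ b y2
    simpa only [hb.mulL_assoc, hΓ.balanced] using this

theorem isPairing_bull : H.IsPairing H.lactL H.ractL H.comulLift H.lactL H.comulLift H.lactL
    H.comulLift (H.bull Γ) where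
  left b m n := hH.src_mul_bull hΓ b m n
  mid b m n := hH.mul_src_bull hΓ b m n
  coact hf m n := hH.comul_bull hΓ hf m n

theorem bal_dot_left (Y : L) : H.DBal H.lactL (fun x x' => sw (H.comulLift Y)
    (fun y y' => 𝐬 (Γ x y) ⬝ H.bull Γ x' y')) :=
  bal_twp_left hΓ hH.bialgebroid.isCom_regular (hH.isPairing_bull hΓ) Y

theorem bal_dot_right (X : L) : H.DBal H.lactL (fun y y' => sw (H.comulLift X)
    (fun x x' => 𝐬 (Γ x y) ⬝ H.bull Γ x' y')) :=
  bal_twp_right hΓ hH.bialgebroid.isCom_regular hH.bialgebroid.isCom_regular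
    (hH.isPairing_bull hΓ) X

theorem dot_assoc (X Y Z : L) : (H.twist Γ).mulL ((H.twist Γ).mulL X Y) Z =
    (H.twist Γ).mulL X ((H.twist Γ).mulL Y Z) := by
  rw [dot_eq_twp]
  exact (hH.isPairing_bull hΓ).twp_assoc hH.bialgebroid hΓ hH.bialgebroid.isCom_regular
    (hH.bull_assoc hΓ) X Y Z

/-- `Δ(X ·_Γ Y) = X₍₁₎ ⋆ Y₍₁₎ ⋄ X₍₂₎ • Y₍₂₎` -/
theorem comul_dot {f : L → L → V} (hf : H.DBal H.lactL f) (X Y : L) :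
    sw (H.comulLift ((H.twist Γ).mulL X Y)) f = sw (H.comulLift X) (fun x x' =>
      sw (H.comulLift Y) (fun y y' => f (H.star Γ x y) (H.bull Γ x' y'))) := by
  have hb := hH.bialgebroid
  rw [dot_eq_twp, (hH.isPairing_bull hΓ).twp_coact hb hΓ hb.isCom_regular hb.isCom_regular
    hb.isCom_regular hf]

theorem src_dot (a : B) (X : L) : (H.twist Γ).mulL (𝐬 a) X = H.star Γ (𝐬 a) X := by
  rw [dot_apply, hH.bialgebroid.comul_src (hH.bal_dot_left hΓ X), hH.bialgebroid.src_star hΓ]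
  simp only [hH.oneL_bull hΓ]

theorem dot_src (a : B) (X : L) : (H.twist Γ).mulL X (𝐬 a) = H.star Γ X (𝐬 a) := by
  rw [dot_apply, sw_comm, hH.bialgebroid.comul_src (hH.bal_dot_right hΓ X),
    hH.bialgebroid.star_src hΓ]
  simp only [hH.bull_oneL hΓ]

theorem tgt_dot (a : B) (X : L) : (H.twist Γ).mulL (𝐭 a) X = H.bull Γ (𝐭 a) X := by
  have hb := hH.bialgebroid
  rw [dot_apply, hb.comul_tgt (hH.bal_dot_left hΓ X)]
  simp only [hΓ.one_left, ← hH.src_mul_bull hΓ]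
  simp only [hb.src_tgt, hH.mul_src_bull hΓ]
  rw [← map_sw (φ := fun y => H.bull Γ (𝐭 a) y) _ (fun x y => 𝐬 (H.counit x) ⬝ y) (by fun_prop),
    hb.comul_counit_left]

theorem dot_tgt (a : B) (X : L) : (H.twist Γ).mulL X (𝐭 a) = H.bull Γ X (𝐭 a) := by
  have hb := hH.bialgebroid
  rw [dot_apply, sw_comm, hb.comul_tgt (hH.bal_dot_right hΓ X)]
  simp only [hΓ.one_right, ← hH.src_mul_bull hΓ]
  rw [← map_sw_left (φ := fun x y => H.bull Γ x y) _ (fun x y => 𝐬 (H.counit x) ⬝ y) (by fun_prop),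
    hb.comul_counit_left]

theorem oneL_dot (X : L) : (H.twist Γ).mulL H.oneL X = X := by
  rw [← hH.bialgebroid.src_one, hH.src_dot hΓ, hH.bialgebroid.src_one,
    hH.bialgebroid.oneL_star hΓ]

theorem dot_oneL (X : L) : (H.twist Γ).mulL X H.oneL = X := by
  rw [← hH.bialgebroid.src_one, hH.dot_src hΓ, hH.bialgebroid.src_one,
    hH.bialgebroid.star_oneL hΓ]

/-- `(X ·_Γ Y)₊ ⊗ (X ·_Γ Y)₋ = X₊ ⋆ Y₊ ⊗ Y₋ ⋆ X₋` -/
theorem trans_dot {g : L → L → V} (hg : H.BBal g) (X Y : L) :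
    sw (H.transLift ((H.twist Γ).mulL X Y)) g = sw (H.transLift X) (fun p q => sw (H.transLift Y)
      (fun r s => g (H.star Γ p r) (H.star Γ s q))) := by
  have hb := hH.bialgebroid
  have hl := hg.left
  have hr := hg.right
  have e0 : sw (H.transLift ((H.twist Γ).mulL X Y)) g = sw (H.comulLift X) (fun x x' =>
      sw (H.transLift x') (fun p q => sw (H.comulLift Y) (fun y y' => sw (H.transLift y')
        (fun r s => g (𝐬 (Γ x y) ⬝ (p ⬝ r)) (H.star Γ s q))))) := by
    rw [dot_apply, sw_sw_lin H.transLift _ hl hr]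
    refine sw_congr _ fun x x' => ?_
    rw [sw_sw_lin H.transLift _ hl hr, sw_comm (H.transLift x')]
    refine sw_congr _ fun y y' => ?_
    rw [hH.trans_src_mul hg, hH.trans_bull hΓ (g := fun p q => g (𝐬 (Γ x y) ⬝ p) q)]
    exact ⟨by fun_prop, by fun_prop, fun b m n => by rw [← hb.mulL_assoc, hg.bal]⟩
  rw [e0, ← hH.trans_comul_comm (f := fun x p q => sw (H.comulLift Y) (fun y y' =>
    sw (H.transLift y') (fun r s => g (𝐬 (Γ x y) ⬝ (p ⬝ r)) (H.star Γ s q))))]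
  · refine sw_congr _ fun p q => ?_
    have h := hH.trans_comul_comm (f := fun y r s => sw (H.comulLift p) (fun p p' =>
      g (𝐬 (Γ p y) ⬝ (p' ⬝ r)) (H.star Γ s q))) (by fun_prop) (by fun_prop) (by fun_prop)
      (fun b y r s => by
        simp only [← hΓ.balanced]
        rw [hb.comul_takeuchi (f := fun p p' => g (𝐬 (Γ p y) ⬝ (p' ⬝ r)) (H.star Γ s q))]
        · simp only [hb.mulL_assoc]
        · exact ⟨by fun_prop, by fun_prop, fun b x y => by
            simp only [hΓ.bar_linear, hb.src_mul, lactL_apply, hb.mulL_assoc]⟩)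
      (fun b y r s => by
        simp only [← hb.mulL_assoc, hg.bal, hb.tgt_mul_star hΓ]) Y
    rw [sw_comm (H.comulLift p)]
    refine Eq.trans (sw_congr _ fun y y' => sw_comm _ _ _) (h.symm.trans (sw_congr _ fun r s => ?_))
    rw [sw_comm, star_apply p r, map_sw_left (φ := g) _ _ hl]
    exact sw_congr _ fun p p' => (map_sw_left (φ := g) _ _ hl _).symm
  · fun_prop
  · fun_prop
  · fun_prop
  · intro b x y z
    simp only [hΓ.bar_linear, hb.src_mul, hb.mulL_assoc]
  · intro b x p q
    refine sw_congr _ fun y y' => ?_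
    have := hH.trans_takeuchi (g := fun r s => g (𝐬 (Γ x y) ⬝ (p ⬝ r)) (H.star Γ s q)) ⟨by fun_prop,
      by fun_prop, fun b r s => by
        simp only [hb.tgt_mul_star hΓ, ← hg.bal, hb.mulL_assoc]⟩ b y'
    simpa only [hb.mulL_assoc, hb.mul_tgt_star hΓ] using this

theorem counit_twist_dot (X Y : L) : (H.twist Γ).counit ((H.twist Γ).mulL X Y) =
    sw (H.transLift X) (fun p q => sw (H.transLift Y) (fun r s =>
      Γ (H.star Γ p r) (H.star Γ s q))) := by
  rw [counit_twist_apply, hH.trans_dot hΓ hΓ.bBal]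

/-- `X₊ ⋆ X₋ = ε^Γ(X)` -/
theorem trans_star (X : L) : sw (H.transLift X) (fun p q => H.star Γ p q) =
    𝐬 (sw (H.transLift X) (fun p q => Γ p q)) := by
  have hb := hH.bialgebroid
  simp only [star_apply]
  have := hH.trans_coassoc (f := fun p u v => sw (H.comulLift p) (fun p p' =>
    𝐬 (Γ p u) ⬝ (p' ⬝ v))) (by fun_prop) (by fun_prop) (by fun_prop) (fun b x y z => ?_)
      (fun b x y z => ?_) X
  · refine Eq.trans (sw_congr _ fun p q => sw_comm _ _ _) (this.trans ?_)
    rw [map_sw (φ := H.src) _ _ (by fun_prop)]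
    refine sw_congr _ fun p q => ?_
    rw [hH.trans_comul (f := fun x y => 𝐬 (Γ x q) ⬝ y), hb.mul_oneL]
    exact ⟨by fun_prop, by fun_prop, fun b x y => by
      rw [hΓ.bar_linear, hb.src_mul, lactL_apply, hb.mulL_assoc]⟩
  · rw [hb.comul_mul_tgt (f := fun p p' => 𝐬 (Γ p y) ⬝ (p' ⬝ z))]
    · simp only [hb.mulL_assoc]
    · exact ⟨by fun_prop, by fun_prop, fun b x y => by
        simp only [hΓ.bar_linear, hb.src_mul, lactL_apply, hb.mulL_assoc]⟩
  · simp only [← hΓ.balanced]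
    rw [hb.comul_takeuchi (f := fun p p' => 𝐬 (Γ p y) ⬝ (p' ⬝ z))]
    · simp only [hb.mulL_assoc]
    · exact ⟨by fun_prop, by fun_prop, fun b x y => by
        simp only [hΓ.bar_linear, hb.src_mul, lactL_apply, hb.mulL_assoc]⟩

end IsLeftHopfAlgebroid

end

/-! ### Weak invertibility and the twisted coaction -/

section

variable (H Γ) in
/-- `f` is a linear map on `L ⋄_{B^Γ} M`: the relation is `(t(b) · X) ⊗ m = X ⊗ (b ·_Γ m)`. -/
abbrev TBal (laM : B →ₗ[k] M →ₗ[k] M) (d : M →ₗ[k] L ⊗[k] M) (f : L → M → V) : Prop :=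
  Bal (k := k) (fun (b : B) X => H.bull Γ (H.tgt b) X) (fun (b : B) m => H.tla Γ laM d b m) f

variable (H Γ) in
/-- The map `J : L ⊗ M → L ⊗ M`, `X ⊗ m ↦ X₊ t(Γ(X₋, m₍₋₁₎)) ⊗ m₍₀₎`. -/
def sharpInv (d : M →ₗ[k] L ⊗[k] M) : L ⊗[k] M →ₗ[k] L ⊗[k] M :=
  sharp Γ H.invLift d H.lactI

variable (H Γ) in
/-- The pullback of a test map `f` along `sharpInv`. -/
def pull (d : M →ₗ[k] L ⊗[k] M) (f : L → M → V) (X : L) (m : M) : V :=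
  sw (H.transLift X) (fun p q => sw (d m) (fun u v => f (p ⬝ 𝐭 (Γ q u)) v))

theorem sw_sharpInv (z : L ⊗[k] M) {f : L → M → V} (h1 : ∀ n, IsLin k (fun m => f m n))
    (h2 : ∀ m, IsLin k (fun n => f m n)) :
    sw (H.sharpInv Γ d z) f = sw z (fun X m => H.pull Γ d f X m) := by
  rw [sharpInv, sw_sharp _ _ _ _ _ h1 h2]
  refine sw_congr _ fun X m => ?_
  rw [sw_invLift _ (by fun_prop) (by fun_prop)]
  rfl

section funProp
variable {f : L → M → V} {W : Type u} [AddCommGroup W] [Module k W]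

@[fun_prop] theorem IsLin.pull_left (h1 : ∀ n, IsLin k (fun m => f m n)) {φ : W → L} (hφ : IsLin k φ) (m : M) :
    IsLin k (fun x => H.pull Γ d f (φ x) m) := by
  unfold pull
  fun_prop

@[fun_prop] theorem IsLin.pull_right (h1 : ∀ n, IsLin k (fun m => f m n))
    (h2 : ∀ m, IsLin k (fun n => f m n)) (X : L) {φ : W → M} (hφ : IsLin k φ) :
    IsLin k (fun x => H.pull Γ d f X (φ x)) := by
  unfold pull
  fun_prop

end funProp

variable (H Γ) in
/-- A weakly invertible 2-cocycle: `Γ^#` is invertible on `L ⊗ M` for all comodules `M`, where `L`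
carries the coaction `X ↦ X₋ ⋄ X₊`. -/
structure WInv : Prop where
  cocycle : H.IsTwoCocycle Γ
  iso : ∀ {M : Type u} [AddCommGroup M] [Module k M] {la ra : B →ₗ[k] M →ₗ[k] M}
    {d : M →ₗ[k] L ⊗[k] M}, H.IsCom la ra d →
    InducesIso ((H.diamond (fun b m => la b m)).mkQ ∘ₗ H.sharpInv Γ d)
      (balancedRel k (fun b X => H.bull Γ (𝐭 b) X) (fun b m => H.tla Γ la d b m))

variable (H Γ) in
/-- A linear lift of the inverse of `J : L ⋄_{B^Γ} M → L ⋄_B M`. -/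
def sharpSection (la : B →ₗ[k] M →ₗ[k] M) (d : M →ₗ[k] L ⊗[k] M) : L ⊗[k] M →ₗ[k] L ⊗[k] M :=
  linSection ((H.diamond (fun b m => la b m)).mkQ ∘ₗ H.sharpInv Γ d) ∘ₗ
    (H.diamond (fun b m => la b m)).mkQ

variable (H Γ) in
/-- The extension of a test map along the inverse of `pull`. -/
def push (la : B →ₗ[k] M →ₗ[k] M) (d : M →ₗ[k] L ⊗[k] M) (g : L → M → V) (X : L) (m : M) : V :=
  sw (H.sharpSection Γ la d (X ⊗ₜ m)) g

variable (H Γ) in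
/-- A lift of the twisted coaction `m ↦ m₍[-1]₎ ⊗ m₍[0]₎`, the image of the coaction of `M`
under the inverse of `J`. -/
def tco (la : B →ₗ[k] M →ₗ[k] M) (d : M →ₗ[k] L ⊗[k] M) : M →ₗ[k] L ⊗[k] M :=
  H.sharpSection Γ la d ∘ₗ d

section funProp
variable {g : L → M → V} {W : Type u} [AddCommGroup W] [Module k W]

@[fun_prop] theorem IsLin.push_left (h1 : ∀ n, IsLin k (fun m => g m n))
    (h2 : ∀ m, IsLin k (fun n => g m n)) {φ : W → L} (hφ : IsLin k φ) (m : M) :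
    IsLin k (fun x => H.push Γ laM d g (φ x) m) := by
  unfold push
  fun_prop

@[fun_prop] theorem IsLin.push_right (h1 : ∀ n, IsLin k (fun m => g m n))
    (h2 : ∀ m, IsLin k (fun n => g m n)) (X : L) {φ : W → M} (hφ : IsLin k φ) :
    IsLin k (fun x => H.push Γ laM d g X (φ x)) := by
  unfold push
  fun_prop

@[fun_prop] theorem IsLin.push_fun {g : W → L → M → V} (h : ∀ m n, IsLin k (fun x => g x m n))
    (X : L) (m : M) : IsLin k (fun x => H.push Γ laM d (g x) X m) := by
  unfold push
  fun_prop

end funProp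

theorem sw_sharpSection (z : L ⊗[k] M) {g : L → M → V} (h1 : ∀ n, IsLin k (fun m => g m n))
    (h2 : ∀ m, IsLin k (fun n => g m n)) :
    sw (H.sharpSection Γ laM d z) g = sw z (fun X m => H.push Γ laM d g X m) := by
  rw [map_eq_sw (H.sharpSection Γ laM d) z, sw_sw _ _ h1 h2]
  rfl

theorem sw_tco (m : M) {g : L → M → V} (hg : H.TBal Γ laM d g) :
    sw (H.tco Γ laM d m) g = sw (d m) (fun X m => H.push Γ laM d g X m) :=
  sw_sharpSection _ hg.left hg.right

section
variable (hH : H.IsLeftHopfAlgebroid) (hW : H.WInv Γ) (hM : H.IsCom laM raM d)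
  (hN : H.IsCom laN raN e)

include hW hM in
theorem sw_sharpSection_pull (z : L ⊗[k] M) {f : L → M → V} (hf : H.DBal laM f) :
    sw (H.sharpSection Γ laM d z) (fun X m => H.pull Γ d f X m) = sw z f := by
  rw [← sw_sharpInv _ hf.left hf.right]
  exact hf.sw_congr_mkQ (linSection_spec _ (hW.iso hM).2 _)

include hW hM in
/-- `J(m₍[-1]₎ ⊗ m₍[0]₎) = m₍₋₁₎ ⋄ m₍₀₎` -/
theorem tco_pull (m : M) {f : L → M → V} (hf : H.DBal laM f) :
    sw (H.tco Γ laM d m) (fun X m => H.pull Γ d f X m) = sw (d m) f :=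
  sw_sharpSection_pull hW hM (d m) hf

include hW hM in
theorem push_pull {f : L → M → V} (hf : H.DBal laM f) (X : L) (m : M) :
    H.push Γ laM d (fun X m => H.pull Γ d f X m) X m = f X m := by
  rw [push, sw_sharpSection_pull hW hM _ hf, sw_tmul _ _ hf.bilin]

include hW hM in
theorem pull_push {g : L → M → V} (hg : H.TBal Γ laM d g) (X : L) (m : M) :
    H.pull Γ d (fun X m => H.push Γ laM d g X m) X m = g X m := by
  have hl := hg.left
  have hr := hg.right
  have h0 : H.pull Γ d (fun X m => H.push Γ laM d g X m) X m =
      sw (X ⊗ₜ[k] m) (fun X m => H.pull Γ d (fun X m => H.push Γ laM d g X m) X m) :=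
    (sw_tmul _ _ ⟨by fun_prop, by fun_prop⟩).symm
  have h1 : H.sharpSection Γ laM d (H.sharpInv Γ d (X ⊗ₜ[k] m)) - X ⊗ₜ[k] m ∈
      balancedRel k (fun b X => H.bull Γ (𝐭 b) X) (fun b m => H.tla Γ laM d b m) := by
    rw [← (hW.iso hM).1, LinearMap.mem_ker, map_sub, sub_eq_zero]
    exact linSection_spec _ (hW.iso hM).2 _
  rw [h0, ← sw_sharpInv _ (by fun_prop) (by fun_prop), ← sw_sharpSection _ hl hr, hg.sw_congr h1,
    sw_tmul _ _ hg.bilin]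

omit hW in
theorem bal_push {g : L → M → V} (hg : H.TBal Γ laM d g) :
    H.DBal laM (fun X m => H.push Γ laM d g X m) := by
  have hl := hg.left
  have hr := hg.right
  refine ⟨by fun_prop, by fun_prop, fun b x m => ?_⟩
  unfold push sharpSection
  simp only [LinearMap.comp_apply]
  congr 2
  exact (Submodule.Quotient.eq _).2 (Submodule.subset_span ⟨b, x, m, rfl⟩)

include hH in
theorem pull_src_mul (hΓ : H.IsTwoCocycle Γ) {f : L → M → V} (hf : H.DBal laM f) (b : B) (X : L)
    (m : M) : H.pull Γ d f (𝐬 b ⬝ X) m = H.pull Γ d (fun x m => f (𝐬 b ⬝ x) m) X m := by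
  have hl := hf.left
  have hr := hf.right
  have hb := hH.bialgebroid
  unfold pull
  rw [hH.trans_src_mul]
  · simp only [hb.mulL_assoc]
  · exact ⟨by fun_prop, by fun_prop, fun b p q => by
      simp only [hΓ.bar_linear, hb.tgt_mul, hb.mulL_assoc]⟩

include hH in
theorem bal_pull_left (hΓ : H.IsTwoCocycle Γ) {f : L → M → V} (hf : H.DBal laM f) (m : M) :
    H.BBal (fun p q => sw (d m) (fun u v => f (p ⬝ 𝐭 (Γ q u)) v)) := by
  have hl := hf.left
  have hr := hf.right
  have hb := hH.bialgebroid
  exact ⟨by fun_prop, by fun_prop, fun b p q => by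
    simp only [hΓ.bar_linear, hb.tgt_mul, hb.mulL_assoc]⟩

include hH in
theorem bal_pull_right (hΓ : H.IsTwoCocycle Γ) {f : L → M → V} (hf : H.DBal laM f) (X : L) :
    H.DBal laM (fun u v => sw (H.transLift X) (fun p q => f (p ⬝ 𝐭 (Γ q u)) v)) := by
  have hl := hf.left
  have hr := hf.right
  have hb := hH.bialgebroid
  refine ⟨by fun_prop, by fun_prop, fun b u v => ?_⟩
  have := hH.trans_takeuchi (g := fun p q => f (p ⬝ 𝐭 (Γ q u)) v) ⟨by fun_prop, by fun_prop,
    fun b p q => by simp only [hΓ.bar_linear, hb.tgt_mul, hb.mulL_assoc]⟩ b X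
  simpa only [hΓ.balanced, hb.mulL_assoc, hf.bal] using this.symm

include hH hM in
theorem bal_pull (hΓ : H.IsTwoCocycle Γ) {f : L → M → V} (hf : H.DBal laM f) :
    H.TBal Γ laM d (fun X m => H.pull Γ d f X m) := by
  have hl := hf.left
  have hr := hf.right
  have hb := hH.bialgebroid
  refine ⟨by fun_prop, by fun_prop, fun b x m => ?_⟩
  unfold pull
  rw [hH.trans_bull hΓ (bal_pull_left hH hΓ hf m), hH.trans_tgt, sw_comm (H.transLift x) (d (H.tla Γ laM d b m)),
    coact_tla hb hΓ hM (bal_pull_right hH hΓ hf x), sw_comm (d m)]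
  · simp only [hb.oneL_mul, hb.cocycle' hΓ]
  · refine ⟨by fun_prop, by fun_prop, fun c p q => ?_⟩
    have := hH.trans_takeuchi (g := fun r s => sw (d m) (fun u v =>
      f ((p ⬝ r) ⬝ 𝐭 (Γ (H.star Γ s q) u)) v)) ⟨by fun_prop, by fun_prop,
      fun b r s => by
        simp only [hb.tgt_mul_star hΓ, hΓ.bar_linear, hb.tgt_mul, hb.mulL_assoc]⟩ c x
    simpa only [hb.mulL_assoc, hb.mul_tgt_star hΓ] using this

include hH hM in
/-- `X₊ ⊗ X₋ ⋆ m₍₋₁₎ ⊗ m₍₀₎` in terms of the map `J`. -/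
theorem trans_star_coact (hΓ : H.IsTwoCocycle Γ) {h : L → L → M → V}
    (h1 : ∀ y z, IsLin k (fun x => h x y z)) (h2 : ∀ x z, IsLin k (fun y => h x y z))
    (h3 : ∀ x y, IsLin k (fun z => h x y z))
    (b1 : ∀ b x y m, h (x ⬝ 𝐭 b) y m = h x (𝐭 b ⬝ y) m)
    (b2 : ∀ b x y m, h (𝐭 b ⬝ x) y m = h x y (laM b m)) (X : L) (m : M) :
    sw (H.transLift X) (fun p q => sw (d m) (fun u v => h p (H.star Γ q u) v)) =
      H.pull Γ d (fun x v => sw (d v) (fun y w => sw (H.transLift x)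
        (fun r s => h r (s ⬝ y) w))) X m := by
  have hb := hH.bialgebroid
  have hB : ∀ y v, H.BBal (fun r s => h r (s ⬝ y) v) := fun y v =>
    ⟨by fun_prop, by fun_prop, fun b r s => by rw [b1, hb.mulL_assoc]⟩
  have hs : ∀ (c : B) (b : B) (z : L), 𝐬 c ⬝ (𝐭 b ⬝ z) = 𝐭 b ⬝ (𝐬 c ⬝ z) := fun c b z => by
    simp only [← hb.mulL_assoc, hb.src_tgt]
  have hD : ∀ p u y w, H.DBal H.lactL (fun q1 q2 => h p (𝐬 (Γ q1 u) ⬝ (q2 ⬝ y)) w) :=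
    fun p u y w => ⟨by fun_prop, by fun_prop, fun b x z => by
      simp only [hΓ.bar_linear, hb.src_mul, lactL_apply, hb.mulL_assoc]⟩
  have hf : H.Bal3 laM (fun u y w => sw (H.transLift X) (fun p q => sw (H.comulLift q)
      (fun q1 q2 => h p (𝐬 (Γ q1 u) ⬝ (q2 ⬝ y)) w))) := by
    refine ⟨by fun_prop, by fun_prop, by fun_prop, fun b x y m => ?_, fun b x y m => ?_⟩
    · simp only [← hΓ.balanced, ← hb.mulL_assoc]
      simp only [hb.mulL_assoc]
      refine sw_congr _ fun p q => (hb.comul_takeuchi (hD p x y m) b q).trans ?_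
      simp only [hb.mulL_assoc]
    · have := hH.trans_takeuchi (g := fun p q => sw (H.comulLift q)
        (fun q1 q2 => h p (𝐬 (Γ q1 x) ⬝ (q2 ⬝ y)) m)) ⟨by fun_prop, by fun_prop, fun b p q => by
          rw [hb.comul_tgt_mul (hD p x y m)]
          simp only [hb.mulL_assoc, hs, b1]⟩ b X
      simp only [b2] at this
      rw [this]
      refine sw_congr _ fun p q => ?_
      rw [hb.comul_mul_tgt (hD p x y m)]
      simp only [hb.mulL_assoc]
  have hT : ∀ u y w, sw (H.transLift X) (fun p q => sw (H.comulLift q)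
      (fun q1 q2 => h p (𝐬 (Γ q1 u) ⬝ (q2 ⬝ y)) w)) = sw (H.transLift X) (fun p q =>
        sw (H.transLift (p ⬝ 𝐭 (Γ q u))) (fun r s => h r (s ⬝ y) w)) := fun u y w => by
    rw [hH.trans_coassoc (f := fun p q1 q2 => h p (𝐬 (Γ q1 u) ⬝ (q2 ⬝ y)) w) (by fun_prop)
      (by fun_prop) (by fun_prop) (fun b x z z' => by rw [b1, hb.mulL_assoc, hs])
      (fun b x z z' => (hD _ _ _ _).bal _ _ _)]
    refine sw_congr _ fun p q => ?_
    rw [hH.trans_mul_tgt (hB y w)]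
    simp only [hb.mulL_assoc]
  unfold pull
  rw [sw_comm (H.transLift X), sw_comm (H.transLift X)]
  have e := hM.coassoc hf m
  refine Eq.trans (sw_congr _ fun u v => ?_) (e.trans (sw_congr _ fun u v => ?_))
  · have : ∀ p q, h p (H.star Γ q u) v = sw (H.comulLift u) fun y y' => sw (H.comulLift q) fun x x' =>
        h p (𝐬 (Γ x y) ⬝ (x' ⬝ y')) v := fun p q => by
      rw [star_apply, sw_comm, map_sw (φ := fun z => h p z v) _ _ (by fun_prop)]
      exact sw_congr _ fun y y' => map_sw (φ := fun z => h p z v) _ _ (by fun_prop)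
    simp only [this]
    rw [sw_comm (H.transLift X) (H.comulLift u)]
  · simp only [hT]
    rw [sw_comm]

include hH hW hM in
/-- If `X ⊗ m` represents the twisted coaction of `n`, then
`X₊ ⊗ X₋ ⋆ m₍₋₁₎ ⊗ m₍₀₎ = n₍₋₁₎ ⊗ 1 ⊗ n₍₀₎`. -/
theorem tco_star (n : M) {h : L → L → M → V}
    (h1 : ∀ y z, IsLin k (fun x => h x y z)) (h2 : ∀ x z, IsLin k (fun y => h x y z))
    (h3 : ∀ x y, IsLin k (fun z => h x y z))
    (b1 : ∀ b x y m, h (x ⬝ 𝐭 b) y m = h x (𝐭 b ⬝ y) m)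
    (b2 : ∀ b x y m, h (𝐭 b ⬝ x) y m = h x y (laM b m)) :
    sw (H.tco Γ laM d n) (fun X m => sw (H.transLift X) (fun p q => sw (d m) (fun u v =>
      h p (H.star Γ q u) v))) = sw (d n) (fun u v => h u H.oneL v) := by
  have hb := hH.bialgebroid
  have hB : ∀ y v, H.BBal (fun r s => h r (s ⬝ y) v) := fun y v =>
    ⟨by fun_prop, by fun_prop, fun b r s => by rw [b1, hb.mulL_assoc]⟩
  have hF3 : H.Bal3 laM (fun x y w => sw (H.transLift x) (fun r s => h r (s ⬝ y) w)) := by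
    refine ⟨by fun_prop, by fun_prop, by fun_prop, fun b x y m => ?_, fun b x y m => ?_⟩
    · rw [hH.trans_tgt_mul (hB y m)]
      simp only [hb.mulL_assoc]
    · have := hH.trans_takeuchi (hB y m) b x
      simpa only [hb.mulL_assoc, b2] using this.symm
  have e1 := tco_pull hW hM n (hM.bal_coact hF3)
  rw [← hM.coassoc hF3] at e1
  simp only [trans_star_coact hH hM hW.cocycle h1 h2 h3 b1 b2]
  refine e1.trans (sw_congr _ fun x v => ?_)
  have := hH.comul_trans (g := fun p q => h p q v) ⟨by fun_prop, by fun_prop,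
    fun b p q => b1 _ _ _ _⟩ x H.oneL
  simpa only [hb.mul_oneL] using this

end

end

/-! ### The twisted coaction and the structure of `L` -/

section

section
variable (hH : H.IsLeftHopfAlgebroid) (hW : H.WInv Γ) (hM : H.IsCom laM raM d)
  (hN : H.IsCom laN raN e)

include hW hM in
/-- `push` is the unique balanced inverse of `pull`; this is how properties of the inverse of `J`,
which is not given by a formula, are deduced from those of `J`. -/
theorem eq_push {F : L → M → V} (hF : H.DBal laM F) {g : L → M → V}
    (h : ∀ X m, H.pull Γ d F X m = g X m) (X : L) (m : M) : F X m = H.push Γ laM d g X m := by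
  rw [← push_pull hW hM hF X m]
  congr 1
  exact funext fun X => funext fun m => h X m

include hH hW hM in
/-- `m₍[-1]₎₍₁₎ ⊗ m₍[-1]₎₍₂₎ ⊗ m₍[0]₎ = m₍₋₁₎ ⊗ m₍₀₎₍[-1]₎ ⊗ m₍₀₎₍[0]₎` -/
theorem tco_comul {f : L → L → M → V}
    (h1 : ∀ y z, IsLin k (fun x => f x y z)) (h2 : ∀ x z, IsLin k (fun y => f x y z))
    (h3 : ∀ x y, IsLin k (fun z => f x y z))
    (b1 : ∀ b x y m, f (𝐭 b ⬝ x) y m = f x (𝐬 b ⬝ y) m)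
    (b2 : ∀ b x y m, f x (H.bull Γ (𝐭 b) y) m = f x y (H.tla Γ laM d b m)) (n : M) :
    sw (H.tco Γ laM d n) (fun x m => sw (H.comulLift x) (fun u v => f u v m)) =
      sw (d n) (fun x m => sw (H.tco Γ laM d m) (fun y m' => f x y m')) := by
  have hb := hH.bialgebroid
  have hΓ := hW.cocycle
  have hg : ∀ x, H.TBal Γ laM d (f x) := fun x => ⟨h2 x, h3 x, fun b y m => b2 b x y m⟩
  -- `f` is extended along the inverse of `J` in the last two arguments; the extension `F` is balanced
  -- as `J` is natural.
  let F : L → L → M → V := fun x y m => H.push Γ laM d (f x) y m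
  have hFd : ∀ x, H.DBal laM (F x) := fun x => bal_push (hg x)
  have hF : H.Bal3 laM F := by
    refine ⟨by simp only [F]; fun_prop, by simp only [F]; fun_prop, by simp only [F]; fun_prop,
      fun b x y m => ?_, fun b x y m => (hFd x).bal _ _ _⟩
    refine (eq_push hW hM ((hFd x).src_mul_left hb b) (fun X m => ?_) y m).symm
    rw [← pull_src_mul hH hΓ (hFd x), pull_push hW hM (hg x), b1]
  have l1 := hF.l1
  have l2 := hF.l2
  have l3 := hF.l3
  -- both sides of the claim are the sides of coassociativity tested on `F`
  have e := tco_pull hW hM n (hF.bal_comul hb)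
  rw [hM.coassoc hF] at e
  refine Eq.trans (sw_congr _ fun y m => ?_) (e.trans (sw_congr _ fun x v => ?_))
  · have e1 : ∀ u v, f u v m = H.pull Γ d (F u) v m := fun u v => (pull_push hW hM (hg u) v m).symm
    simp only [e1]
    unfold pull
    rw [← hH.trans_comul_comm (f := fun u p q => sw (d m) (fun a c => F u (p ⬝ 𝐭 (Γ q a)) c))
      (by fun_prop) (by fun_prop) (by fun_prop)
      (fun b x y z => by simp only [hF.b1, hb.mulL_assoc])
      (fun b x y z => by simp only [hΓ.bar_linear, hb.tgt_mul, hb.mulL_assoc])]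
    refine sw_congr _ fun p q => ?_
    rw [sw_comm]
    refine sw_congr _ fun a c => ?_
    dsimp only
    rw [hb.comul_mul_tgt (f := fun u v => F u v c)]
    exact ⟨by fun_prop, by fun_prop, fun b x y => hF.b1 _ _ _ _⟩
  · exact (sw_tco v (hg x)).symm

end

variable (H) in
/-- A left `B`-linear and colinear map of comodules. -/
structure IsColin (laM : B →ₗ[k] M →ₗ[k] M) (d : M →ₗ[k] L ⊗[k] M) (laN : B →ₗ[k] N →ₗ[k] N)
    (e : N →ₗ[k] L ⊗[k] N) (φ : M →ₗ[k] N) : Prop where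
  lact : ∀ b m, φ (laM b m) = laN b (φ m)
  coact : ∀ {V : Type u} [AddCommGroup V] [Module k V] {f : L → N → V}, H.DBal laN f → ∀ m,
    sw (e (φ m)) f = sw (d m) (fun x m' => f x (φ m'))

section
variable (hH : H.IsLeftHopfAlgebroid) (hΓ : H.IsTwoCocycle Γ) (hW : H.WInv Γ)
  (hM : H.IsCom laM raM d) (hN : H.IsCom laN raN e)

theorem IsLeftBialgebroid.isColin_tgt_mul (hb : H.IsLeftBialgebroid) (b : B) :
    H.IsColin H.lactL H.comulLift H.lactL H.comulLift (H.mulL (𝐭 b)) where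
  lact c m := by simp only [lactL_apply, ← hb.mulL_assoc, hb.src_tgt]
  coact hf m := hb.comul_tgt_mul hf b m

theorem IsLeftBialgebroid.isColin_mul_tgt (hb : H.IsLeftBialgebroid) (b : B) :
    H.IsColin H.lactL H.comulLift H.lactL H.comulLift (H.mulL.flip (𝐭 b)) where
  lact c m := by simp only [lactL_apply, hb.mulL_assoc, LinearMap.flip_apply]
  coact hf m := hb.comul_mul_tgt hf b m

include hH hΓ in
theorem pull_colin {φ : M →ₗ[k] N} (hφ : H.IsColin laM d laN e φ) {f : L → N → V}
    (hf : H.DBal laN f) (X : L) (m : M) :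
    H.pull Γ e f X (φ m) = H.pull Γ d (fun x n => f x (φ n)) X m := by
  unfold pull
  rw [sw_comm, hφ.coact (bal_pull_right hH hΓ hf X), sw_comm]

include hH hW hM hN in
/-- The twisted coaction is natural in colinear maps. -/
theorem IsColin.tco {φ : M →ₗ[k] N} (hφ : H.IsColin laM d laN e φ) {g : L → N → V}
    (hg : H.TBal Γ laN e g) (m : M) :
    sw (H.tco Γ laN e (φ m)) g = sw (H.tco Γ laM d m) (fun x m => g x (φ m)) := by
  have hF := bal_push (hg)
  rw [sw_tco _ hg, hφ.coact hF, ← tco_pull hW hM _ (hF.comp_right φ hφ.lact)]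
  exact sw_congr _ fun x m => by rw [← pull_colin hH hW.cocycle hφ hF, pull_push hW hN hg]

theorem IsLeftBialgebroid.tla_regular (hb : H.IsLeftBialgebroid) (hΓ : H.IsTwoCocycle Γ) (b : B)
    (X : L) : H.tla Γ H.lactL H.comulLift b X = H.star Γ (𝐬 b) X :=
  (hb.src_star hΓ b X).symm

theorem IsLeftBialgebroid.tra_regular (hb : H.IsLeftBialgebroid) (hΓ : H.IsTwoCocycle Γ) (b : B)
    (X : L) : H.tra Γ H.lactL H.comulLift b X = H.star Γ X (𝐬 b) :=
  (hb.star_src hΓ b X).symm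

include hH hΓ in
theorem tla_inv (b : B) (X : L) : H.tla Γ H.lactI H.invLift b X = H.bull Γ X (𝐭 b) := by
  rw [tla_apply, sw_invLift _ (by fun_prop) (by fun_prop), hH.bull_tgt hΓ]
  rfl

include hH hΓ in
theorem tra_inv (b : B) (X : L) : H.tra Γ H.lactI H.invLift b X = H.bull Γ (𝐭 b) X := by
  rw [tra_apply, sw_invLift _ (by fun_prop) (by fun_prop), hH.tgt_bull hΓ]
  rfl

include hH hW hM in
/-- `m₍[-1]₎ ⊗ m₍[0]₎₍₋₁₎ ⊗ m₍[0]₎₍₀₎ = m₍₋₁₎₍[1]₎ ⊗ m₍₋₁₎₍[2]₎ ⊗ m₍₀₎` -/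
theorem tco_coact {f : L → L → M → V}
    (h1 : ∀ y z, IsLin k (fun x => f x y z)) (h2 : ∀ x z, IsLin k (fun y => f x y z))
    (h3 : ∀ x y, IsLin k (fun z => f x y z))
    (b1 : ∀ b x y m, f (H.bull Γ (𝐭 b) x) y m = f x (H.star Γ (𝐬 b) y) m)
    (b2 : ∀ b x y m, f x (𝐭 b ⬝ y) m = f x y (laM b m)) (n : M) :
    sw (H.tco Γ laM d n) (fun x m => sw (d m) (fun y m' => f x y m')) =
      sw (d n) (fun x m => sw (H.tco Γ H.lactL H.comulLift x) (fun u v => f u v m)) := by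
  have hb := hH.bialgebroid
  have hΓ := hW.cocycle
  have hR := hb.isCom_regular
  have hg : ∀ m, H.TBal Γ H.lactL H.comulLift (fun x y => f x y m) := fun m =>
    ⟨fun y => h1 y m, fun x => h2 x m, fun b x y => by rw [hb.tla_regular hΓ, b1]⟩
  -- `f` is extended along the inverse of `J` in the first two arguments; the extension `F` is balanced
  -- as `J` is natural.
  let F : L → L → M → V := fun x y m => H.push Γ H.lactL H.comulLift (fun x y => f x y m) x y
  have hFd : ∀ m, H.DBal H.lactL (fun x y => F x y m) := fun m => bal_push (hg m)
  have hF : H.Bal3 laM F := by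
    refine ⟨by simp only [F]; fun_prop, by simp only [F]; fun_prop, by simp only [F]; fun_prop,
      fun b x y m => (hFd m).bal _ _ _, fun b x y m => ?_⟩
    refine eq_push hW hR ((hFd m).comp_right (H.mulL (𝐭 b)) (hb.isColin_tgt_mul b).lact)
      (fun X y => ?_) x y
    rw [← pull_colin hH hΓ (hb.isColin_tgt_mul b) (hFd m), pull_push hW hR (hg m), b2]
  have l1 := hF.l1
  have l2 := hF.l2
  have l3 := hF.l3
  have e := tco_pull hW hM n (hM.bal_coact hF)
  rw [← hM.coassoc hF] at e
  refine Eq.trans (sw_congr _ fun x m => ?_) (e.trans (sw_congr _ fun x v => ?_))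
  · have e1 : ∀ y m, f x y m = H.pull Γ H.comulLift (fun x y => F x y m) x y := fun y m =>
      (pull_push hW hR (hg m) x y).symm
    simp only [e1]
    unfold pull
    have e2 := hM.coassoc (f := fun u y m' => sw (H.transLift x) (fun p q =>
      F (p ⬝ 𝐭 (Γ q u)) y m')) ⟨by fun_prop, by fun_prop, by fun_prop, fun b u y m' =>
        (bal_pull_right hH hΓ (hFd m') x).bal b u y, fun b u y m' => by simp only [hF.b2]⟩ m
    rw [sw_comm (H.transLift x) (d m)]
    simp only [sw_comm (H.transLift x)]
    exact e2
  · exact (sw_tco x (hg v)).symm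

include hH hW in
/-- `X₍[1]₎ ⊗ X₍[2]₎₊ ⊗ X₍[2]₎₋ = X₊₍[1]₎ ⊗ X₊₍[2]₎ ⊗ X₋` -/
theorem tco_trans {f : L → L → L → V}
    (h1 : ∀ y z, IsLin k (fun x => f x y z)) (h2 : ∀ x z, IsLin k (fun y => f x y z))
    (h3 : ∀ x y, IsLin k (fun z => f x y z))
    (b1 : ∀ b x y z, f (H.bull Γ (𝐭 b) x) y z = f x (H.star Γ (𝐬 b) y) z)
    (b2 : ∀ b x y z, f x (y ⬝ 𝐭 b) z = f x y (𝐭 b ⬝ z)) (X : L) :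
    sw (H.tco Γ H.lactL H.comulLift X) (fun x y => sw (H.transLift y) (fun p q => f x p q)) =
      sw (H.transLift X) (fun p q => sw (H.tco Γ H.lactL H.comulLift p) (fun x y => f x y q)) := by
  have hb := hH.bialgebroid
  have hΓ := hW.cocycle
  have hR := hb.isCom_regular
  have hg : ∀ m, H.TBal Γ H.lactL H.comulLift (fun x y => f x y m) := fun m =>
    ⟨fun y => h1 y m, fun x => h2 x m, fun b x y => by rw [hb.tla_regular hΓ, b1]⟩
  -- `f` is extended along the inverse of `J` in the first two arguments; the extension `F` is balanced
  -- as `J` is natural.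
  let F : L → L → L → V := fun x y m => H.push Γ H.lactL H.comulLift (fun x y => f x y m) x y
  have l1 : ∀ y z, IsLin k (fun x => F x y z) := by simp only [F]; fun_prop
  have l2 : ∀ x z, IsLin k (fun y => F x y z) := by simp only [F]; fun_prop
  have l3 : ∀ x y, IsLin k (fun z => F x y z) := by simp only [F]; fun_prop
  have hFd : ∀ m, H.DBal H.lactL (fun x y => F x y m) := fun m => bal_push (hg m)
  have c2 : ∀ b x y z, F x (y ⬝ 𝐭 b) z = F x y (𝐭 b ⬝ z) := fun b x y z => by
    refine eq_push hW hR ((hFd z).comp_right (H.mulL.flip (𝐭 b)) (hb.isColin_mul_tgt b).lact)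
      (fun X y => ?_) x y
    rw [← pull_colin hH hΓ (hb.isColin_mul_tgt b) (hFd z), pull_push hW hR (hg z),
      LinearMap.flip_apply, b2]
  have hB : ∀ x, H.BBal (fun p q => F x p q) := fun x => ⟨by fun_prop, by fun_prop, fun b y z =>
    c2 b x y z⟩
  have hG : H.DBal H.lactL (fun x y => sw (H.transLift y) (fun p q => F x p q)) := by
    refine ⟨by fun_prop, by fun_prop, fun b x y => ?_⟩
    rw [lactL_apply, hH.trans_src_mul (hB x)]
    exact sw_congr _ fun p q => (hFd q).bal _ _ _
  have e := tco_pull hW hR X hG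
  rw [← hH.trans_comul_comm l1 l2 l3 (fun b x y z => (hFd z).bal b x y) c2] at e
  refine Eq.trans (sw_congr _ fun x y => ?_) (e.trans (sw_congr _ fun x v => ?_))
  · have e1 : ∀ y m, f x y m = H.pull Γ H.comulLift (fun x y => F x y m) x y := fun y m =>
      (pull_push hW hR (hg m) x y).symm
    simp only [e1]
    unfold pull
    have e2 := hH.trans_comul_comm (f := fun u p q => sw (H.transLift x) (fun r s =>
      F (r ⬝ 𝐭 (Γ s u)) p q)) (by fun_prop) (by fun_prop) (by fun_prop) (fun b u y m' =>
        (bal_pull_right hH hΓ (hFd m') x).bal b u y) (fun b u y m' => by simp only [c2]) y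
    refine (sw_congr _ fun p q => sw_comm _ _ _).trans (e2.trans ?_)
    refine Eq.trans (sw_congr _ fun p q => ?_) (sw_comm _ _ _)
    exact sw_comm _ _ _
  · exact (sw_tco x (hg v)).symm

end

end

/-! ### The axioms of a comodule for the twisted coaction -/

section

section
variable (hH : H.IsLeftHopfAlgebroid) (hΓ : H.IsTwoCocycle Γ) (hW : H.WInv Γ)
  (hM : H.IsCom laM raM d) (hN : H.IsCom laN raN e) (hP : H.IsCom laP raP dP)

include hH hΓ in
theorem IsLeftHopfAlgebroid.tgt_bull_src_mul (b c : B) (X : L) :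
    H.bull Γ (𝐭 b) (𝐬 c ⬝ X) = 𝐬 c ⬝ H.bull Γ (𝐭 b) X := by
  rw [← hH.mul_src_bull hΓ, ← hH.bialgebroid.src_tgt, hH.src_mul_bull hΓ]

include hΓ in
theorem IsLeftBialgebroid.src_star_tgt_mul (hb : H.IsLeftBialgebroid) (b c : B) (X : L) :
    H.star Γ (𝐬 b) (𝐭 c ⬝ X) = 𝐭 c ⬝ H.star Γ (𝐬 b) X := by
  rw [← hb.mul_tgt_star hΓ, hb.src_tgt, hb.tgt_mul_star hΓ]

include hΓ in
theorem cocycle_src_tgt_mul (hb : H.IsLeftBialgebroid) (b c : B) (X : L) :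
    Γ (𝐬 b) (𝐭 c ⬝ X) = H.mulB (Γ (𝐬 b) X) c := by
  rw [← hΓ.balanced, hb.src_tgt, hΓ.bar_linear]

include hH hΓ in
theorem TBal.src_mul_left {g : L → M → V} (hg : H.TBal Γ laM d g) (c : B) :
    H.TBal Γ laM d (fun x m => g (𝐬 c ⬝ x) m) :=
  have hl := hg.left
  have hr := hg.right
  ⟨by fun_prop, by fun_prop, fun b x m => by rw [← hH.tgt_bull_src_mul hΓ, hg.bal]⟩

include hH hΓ in
theorem IsLeftHopfAlgebroid.bBal_bull {g : L → L → V} (hg : H.BBal g) (X : L) :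
    H.BBal (fun p q => sw (H.transLift X) (fun r s => g (p ⬝ r) (H.star Γ s q))) := by
  have hb := hH.bialgebroid
  have hl := hg.left
  have hr := hg.right
  refine ⟨by fun_prop, by fun_prop, fun c p q => ?_⟩
  have := hH.trans_takeuchi (g := fun r s => g (p ⬝ r) (H.star Γ s q)) ⟨by fun_prop, by fun_prop,
    fun b r s => by rw [← hb.mulL_assoc, hg.bal, hb.tgt_mul_star hΓ]⟩ c X
  simpa only [hb.mulL_assoc, hb.mul_tgt_star hΓ] using this

include hH hΓ in
theorem IsLeftHopfAlgebroid.trans_src_star {g : L → L → V} (hg : H.BBal g) (b : B) (X : L) :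
    sw (H.transLift (H.star Γ (𝐬 b) X)) g =
      sw (H.transLift X) (fun p q => g (H.star Γ (𝐬 b) p) q) := by
  have hb := hH.bialgebroid
  have hl := hg.left
  have hr := hg.right
  rw [← hH.src_dot hΓ, hH.trans_dot hΓ hg, hH.trans_src]
  · simp only [hb.star_oneL hΓ]
  · refine ⟨by fun_prop, by fun_prop, fun c p q => ?_⟩
    have := hH.trans_takeuchi (g := fun r s => g (H.star Γ p r) (H.star Γ s q)) ⟨by fun_prop,
      by fun_prop, fun c r s => by rw [hb.star_mul_tgt hΓ, hg.bal, hb.tgt_mul_star hΓ]⟩ c X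
    simpa only [hb.mul_tgt_star hΓ] using this

include hH hW hM in
/-- `(b m)₍[-1]₎ ⊗ (b m)₍[0]₎ = s(b) m₍[-1]₎ ⊗ m₍[0]₎` -/
theorem tco_lact {g : L → M → V} (hg : H.TBal Γ laM d g) (b : B) (m : M) :
    sw (H.tco Γ laM d (laM b m)) g = sw (H.tco Γ laM d m) (fun x m => g (𝐬 b ⬝ x) m) := by
  have hb := hH.bialgebroid
  rw [sw_tco _ hg, hM.lact (bal_push hg), ← tco_pull hW hM _ ((bal_push hg).src_mul_left hb b)]
  refine sw_congr _ fun x m => ?_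
  rw [← pull_src_mul hH hW.cocycle (bal_push hg), pull_push hW hM hg]

include hH hW hM in
/-- The twisted coaction of `φ(m₍₋₁₎) m₍₀₎`. -/
theorem tco_twist_aux {g : L → M → V} (hg : H.TBal Γ laM d g) (φ : L →ₗ[k] B)
    (hφ : ∀ c u, φ (𝐭 c ⬝ u) = H.mulB (φ u) c) (m : M) :
    sw (H.tco Γ laM d (sw (d m) (fun x m' => laM (φ x) m'))) g =
      sw (H.tco Γ laM d m) (fun x m' => g (sw (H.comulLift x) (fun u v => 𝐬 (φ u) ⬝ v)) m') := by
  have hb := hH.bialgebroid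
  have hl := hg.left
  have hr := hg.right
  have e := tco_comul hH hW hM (f := fun u y m => g (𝐬 (φ u) ⬝ y) m) (by fun_prop) (by fun_prop)
    (by fun_prop) (fun b x y m => by rw [hφ, hb.src_mul, hb.mulL_assoc])
    (fun b x y m => (TBal.src_mul_left hH hW.cocycle hg _).bal _ _ _) m
  rw [sw_sw_lin (H.tco Γ laM d) _ hl hr]
  refine Eq.trans (sw_congr _ fun x m' => tco_lact hH hW hM hg _ _) (e.symm.trans ?_)
  exact sw_congr _ fun x m' => (map_sw_left (φ := g) _ _ hl _).symm

include hH hW hM in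
/-- `(b ·_Γ m)₍[-1]₎ ⊗ (b ·_Γ m)₍[0]₎ = b ·_Γ m₍[-1]₎ ⊗ m₍[0]₎` -/
theorem tco_tla {g : L → M → V} (hg : H.TBal Γ laM d g) (b : B) (m : M) :
    sw (H.tco Γ laM d (H.tla Γ laM d b m)) g =
      sw (H.tco Γ laM d m) (fun x m => g (H.star Γ (𝐬 b) x) m) := by
  have hb := hH.bialgebroid
  rw [tla_apply, tco_twist_aux hH hW hM hg (Γ (𝐬 b))
    (fun c u => cocycle_src_tgt_mul hW.cocycle hb b c u)]
  simp only [hb.src_star hW.cocycle]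

include hH hW hM in
/-- `(m ·_Γ b)₍[-1]₎ ⊗ (m ·_Γ b)₍[0]₎ = m₍[-1]₎ ·_Γ b ⊗ m₍[0]₎` -/
theorem tco_tra {g : L → M → V} (hg : H.TBal Γ laM d g) (b : B) (m : M) :
    sw (H.tco Γ laM d (H.tra Γ laM d b m)) g =
      sw (H.tco Γ laM d m) (fun x m => g (H.star Γ x (𝐬 b)) m) := by
  have hb := hH.bialgebroid
  refine (tco_twist_aux hH hW hM hg (Γ.flip (𝐬 b))
    (fun c u => by rw [LinearMap.flip_apply, hW.cocycle.bar_linear]; rfl) m).trans ?_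
  simp only [hb.star_src hW.cocycle, LinearMap.flip_apply]

include hH hW hM in
/-- `m₍[-1]₎ ·_Γ t(b) ⊗ m₍[0]₎ = m₍[-1]₎ ⊗ m₍[0]₎ ·_Γ b` -/
theorem tco_takeuchi {g : L → M → V} (hg : H.TBal Γ laM d g) (b : B) (n : M) :
    sw (H.tco Γ laM d n) (fun x m => g (H.bull Γ x (𝐭 b)) m) =
      sw (H.tco Γ laM d n) (fun x m => g x (H.tra Γ laM d b m)) := by
  have hb := hH.bialgebroid
  have hΓ := hW.cocycle
  let F : L → M → V := fun x m => H.push Γ laM d g x m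
  have hF : H.DBal laM F := bal_push hg
  have hl := hF.left
  have hr := hF.right
  have e : ∀ x m, g x m = H.pull Γ d F x m := fun x m => (pull_push hW hM hg x m).symm
  -- both sides of the claim are evaluated by `tco_star`, and both give `F(n₍₋₁₎ t(b), n₍₀₎)`
  have s1 := tco_star hH hW hM n (h := fun p y v => F (p ⬝ 𝐭 (Γ (𝐬 b) y)) v) (by fun_prop)
    (by fun_prop) (by fun_prop)
    (fun c x y m => by rw [cocycle_src_tgt_mul hΓ hb, hb.tgt_mul, hb.mulL_assoc])
    (fun c x y m => by rw [hb.mulL_assoc, hF.bal])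
  have s2 := tco_star hH hW hM n (h := fun p y v => F (p ⬝ 𝐭 (Γ y (𝐬 b))) v) (by fun_prop)
    (by fun_prop) (by fun_prop)
    (fun c x y m => by rw [hΓ.bar_linear, hb.tgt_mul, hb.mulL_assoc])
    (fun c x y m => by rw [hb.mulL_assoc, hF.bal])
  simp only [hΓ.one_left, hΓ.one_right, hb.counit_src] at s1 s2
  refine Eq.trans (sw_congr _ fun x m => ?_) ((s1.trans s2.symm).trans (sw_congr _ fun x m => ?_))
  · rw [e, pull, hH.trans_bull hΓ (bal_pull_left hH hΓ hF m)]
    refine sw_congr _ fun p q => ?_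
    rw [hH.trans_tgt]
    · simp only [hb.mul_oneL, hb.cocycle' hΓ]
    · exact ⟨by fun_prop, by fun_prop, fun c r s => by
        simp only [hb.tgt_mul_star hΓ, hΓ.bar_linear, hb.tgt_mul, hb.mulL_assoc]⟩
  · rw [e, pull, sw_comm (H.transLift x) (d (H.tra Γ laM d b m)),
      coact_tra hb hΓ hM (bal_pull_right hH hΓ hF x), sw_comm]
    simp only [hb.cocycle' hΓ]

include hH hW hM in
/-- The twisted coaction is coassociative over the twisted coproduct. -/
theorem tco_coassoc {f : L → L → M → V}
    (h1 : ∀ y z, IsLin k (fun x => f x y z)) (h2 : ∀ x z, IsLin k (fun y => f x y z))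
    (h3 : ∀ x y, IsLin k (fun z => f x y z))
    (b1 : ∀ b x y m, f (H.bull Γ (𝐭 b) x) y m = f x (H.star Γ (𝐬 b) y) m)
    (b2 : ∀ b x y m, f x (H.bull Γ (𝐭 b) y) m = f x y (H.tla Γ laM d b m)) (n : M) :
    sw (H.tco Γ laM d n) (fun x m => sw (H.tco Γ H.lactL H.comulLift x) (fun u v => f u v m)) =
      sw (H.tco Γ laM d n) (fun x m => sw (H.tco Γ laM d m) (fun y m' => f x y m')) := by
  have hb := hH.bialgebroid
  have hΓ := hW.cocycle
  have hR := hb.isCom_regular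
  have hg : ∀ x, H.TBal Γ laM d (f x) := fun x => ⟨h2 x, h3 x, fun b y m => b2 b x y m⟩
  -- by `tco_coact` the right-hand side is `F(n₍₋₁₎₍[1]₎, n₍₋₁₎₍[2]₎, n₍₀₎)` for the extension `F` of
  -- `f` along `J` in the last two arguments; `J` is made to appear there by `tco_pull`
  let F : L → L → M → V := fun x y m => H.push Γ laM d (f x) y m
  have l1 : ∀ y z, IsLin k (fun x => F x y z) := by simp only [F]; fun_prop
  have l2 : ∀ x z, IsLin k (fun y => F x y z) := by simp only [F]; fun_prop
  have l3 : ∀ x y, IsLin k (fun z => F x y z) := by simp only [F]; fun_prop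
  have hFd : ∀ x, H.DBal laM (F x) := fun x => bal_push (hg x)
  have c2 : ∀ b x y m, F x (𝐭 b ⬝ y) m = F x y (laM b m) := fun b x y m => (hFd x).bal b y m
  have c1 : ∀ b x y m, F (H.bull Γ (𝐭 b) x) y m = F x (H.star Γ (𝐬 b) y) m := fun b x y m => by
    refine (eq_push (g := f (H.bull Γ (𝐭 b) x)) (F := fun y m => F x (H.star Γ (𝐬 b) y) m) hW hM
      ⟨by fun_prop, by fun_prop, fun c y m => ?_⟩ (fun X m => ?_) y m).symm
    · rw [hb.src_star_tgt_mul hΓ, c2]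
    · rw [b1, ← pull_push hW hM (hg x)]
      unfold pull
      rw [hH.trans_src_star hΓ (bal_pull_left hH hΓ (hFd x) m)]
      simp only [hb.star_mul_tgt hΓ, F]
  have hT : ∀ v, H.TBal Γ H.lactL H.comulLift (fun x y => F x y v) := fun v =>
    ⟨by fun_prop, by fun_prop, fun b x y => by rw [hb.tla_regular hΓ, c1]⟩
  have hG : H.DBal laM (fun P v => sw (H.tco Γ H.lactL H.comulLift P) (fun x y => F x y v)) := by
    refine ⟨by fun_prop, by fun_prop, fun b P v => ?_⟩
    refine ((hb.isColin_tgt_mul b).tco hH hW hR hR (hT v) P).trans ?_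
    simp only [c2]
  have eR : sw (H.tco Γ laM d n) (fun x m => sw (H.tco Γ laM d m) (fun y m' => f x y m')) =
      sw (H.tco Γ laM d n) (fun x m => sw (d m) (fun y v => F x y v)) :=
    sw_congr _ fun x m => sw_tco m (hg x)
  rw [eR, tco_coact hH hW hM l1 l2 l3 c1 c2, ← tco_pull hW hM n hG]
  refine sw_congr _ fun X m => ?_
  have e1 : ∀ u v, f u v m = H.pull Γ d (F u) v m := fun u v => (pull_push hW hM (hg u) v m).symm
  simp only [e1]
  unfold pull
  rw [tco_trans hH hW (f := fun x p q => sw (d m) (fun u v => F x (p ⬝ 𝐭 (Γ q u)) v))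
    (by fun_prop) (by fun_prop) (by fun_prop)
    (fun b x y z => by simp only [c1, hb.star_mul_tgt hΓ])
    (fun b x y z => by simp only [hΓ.bar_linear, hb.tgt_mul, hb.mulL_assoc])]
  refine sw_congr _ fun p q => ?_
  rw [sw_comm]
  exact sw_congr _ fun u v => ((hb.isColin_mul_tgt _).tco hH hW hR hR (hT v) p).symm

include hH hW hM in
/-- `ε^Γ(m₍[-1]₎) ·_Γ m₍[0]₎ = m` -/
theorem tco_counit (m : M) :
    sw (H.tco Γ laM d m) (fun x m' => H.tla Γ laM d ((H.twist Γ).counit x) m') = m := by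
  have hb := hH.bialgebroid
  have hΓ := hW.cocycle
  -- `ε^Γ(X) ·_Γ m = Γ(X₊, X₋ ⋆ m₍₋₁₎) m₍₀₎`, which `tco_star` evaluates
  have e := tco_star hH hW hM m (h := fun p y v => laM (Γ p y) v) (by fun_prop)
    (by fun_prop) (by fun_prop) (fun c x y m => by rw [hΓ.balanced])
    (fun c x y m => by rw [hΓ.bar_linear, hM.la_mul])
  simp only [hΓ.one_right, hM.counit] at e
  refine Eq.trans (sw_congr _ fun x m' => ?_) e
  rw [tla_apply, counit_twist_apply, ← hH.trans_star hΓ, sw_comm]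
  refine sw_congr _ fun u v => ?_
  rw [map_sw (φ := fun z => laM (Γ z u) v) _ _ (by fun_prop)]
  simp only [hb.cocycle' hΓ]

include hH hW in
/-- `t(ε^Γ(X₍[2]₎)) ·_Γ X₍[1]₎ = X` -/
theorem tco_counit_right (X : L) :
    sw (H.tco Γ H.lactL H.comulLift X)
      (fun x y => H.bull Γ (𝐭 ((H.twist Γ).counit y)) x) = X := by
  have hb := hH.bialgebroid
  have hΓ := hW.cocycle
  have hR := hb.isCom_regular
  have e1 := tco_trans hH hW (f := fun x r s => sw (H.transLift x) (fun p q =>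
    p ⬝ 𝐭 (Γ (H.star Γ q r) s))) (by fun_prop) (by fun_prop) (by fun_prop) (fun b x y z => by
      have hB : H.BBal (fun p q => p ⬝ 𝐭 (Γ (H.star Γ q y) z)) := ⟨by fun_prop, by fun_prop,
        fun c p q => by simp only [hb.tgt_mul_star hΓ, hΓ.bar_linear, hb.tgt_mul, hb.mulL_assoc]⟩
      rw [hH.trans_bull hΓ hB, hH.trans_tgt (hH.bBal_bull hΓ hB x)]
      simp only [hb.oneL_mul, hb.star_assoc hΓ]) (fun b x y z => by simp only [hb.star_mul_tgt hΓ, hΓ.balanced]) X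
  have e2 : ∀ Q P, sw (H.tco Γ H.lactL H.comulLift P) (fun x y => sw (H.transLift x) (fun p q =>
      p ⬝ 𝐭 (Γ (H.star Γ q y) Q))) = P ⬝ 𝐭 (H.counit Q) := fun Q P => by
    have := tco_star hH hW hR P (h := fun p y v => 𝐭 (H.counit v) ⬝ p ⬝ 𝐭 (Γ y Q)) (by fun_prop)
      (by fun_prop) (by fun_prop) 
      (fun c x y m => by simp only [hΓ.bar_linear, hb.tgt_mul, hb.mulL_assoc])
      (fun c x y m => by
        simp only [lactL_apply, hb.counit_src_mul, hb.tgt_mul, hb.mulL_assoc])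
    simp only [hΓ.one_left] at this
    have hc := congrArg (fun x => x ⬝ 𝐭 (H.counit Q)) (hb.comul_counit_right P)
    rw [map_sw (φ := fun x => x ⬝ 𝐭 (H.counit Q)) _ _ (by fun_prop)] at hc
    rw [← hc, ← this]
    refine sw_congr _ fun x y => ?_
    conv_lhs => rw [← hb.comul_counit_right y]
    have e3 : ∀ p q, p ⬝ 𝐭 (Γ (H.star Γ q (sw (H.comulLift y) fun u v => 𝐭 (H.counit v) ⬝ u)) Q) =
        sw (H.comulLift y) (fun u v => p ⬝ 𝐭 (Γ (H.star Γ (q ⬝ 𝐭 (H.counit v)) u) Q)) := fun p q => by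
      rw [map_sw (φ := fun y => p ⬝ 𝐭 (Γ (H.star Γ q y) Q)) _ _ (by fun_prop)]
      simp only [hb.mul_tgt_star hΓ]
    simp only [e3]
    rw [sw_comm, sw_comm (H.transLift x)]
    refine sw_congr _ fun u v => ?_
    exact (hH.trans_takeuchi (g := fun p q => p ⬝ 𝐭 (Γ (H.star Γ q u) Q)) ⟨by fun_prop,
      by fun_prop, fun c p q => by
        simp only [hb.tgt_mul_star hΓ, hΓ.bar_linear, hb.tgt_mul, hb.mulL_assoc]⟩ _ x).symm
  refine Eq.trans (sw_congr _ fun x y => ?_) (e1.trans ?_)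
  · rw [hH.tgt_bull hΓ, counit_twist_apply, ← hH.trans_star hΓ, sw_comm]
    refine sw_congr _ fun p q => ?_
    rw [map_sw (φ := fun z => p ⬝ 𝐭 (Γ q z)) _ _ (by fun_prop)]
    simp only [hb.cocycle' hΓ]
  · simp only [e2]
    exact hH.trans_counit X

end

end

/-! ### The twisted coaction and products -/

section

section
variable (hH : H.IsLeftHopfAlgebroid) (hΓ : H.IsTwoCocycle Γ) (hW : H.WInv Γ)
  (hM : H.IsCom laM raM d) (hN : H.IsCom laN raN e) (hP : H.IsCom laP raP dP)
  (hμ : H.IsPairing laM raM d laN e laP dP μ)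

include hH hΓ in
theorem IsLeftHopfAlgebroid.comul_tgt_bull {f : L → L → V} (hf : H.DBal H.lactL f) (b : B) (X : L) :
    sw (H.comulLift (H.bull Γ (𝐭 b) X)) f =
      sw (H.comulLift X) (fun x y => f x (H.bull Γ (𝐭 b) y)) := by
  have hb := hH.bialgebroid
  have hl := hf.left
  have hr := hf.right
  rw [hH.comul_bull hΓ hf, hb.comul_tgt]
  · simp only [hb.oneL_mul]
  · refine ⟨by fun_prop, by fun_prop, fun c x y => ?_⟩
    refine sw_congr _ fun u v => ?_
    rw [hb.mulL_assoc, hf.bal, lactL_apply, lactL_apply, hH.src_mul_bull hΓ]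

include hH hΓ in
theorem IsLeftHopfAlgebroid.comul_bull_tgt {f : L → L → V} (hf : H.DBal H.lactL f) (b : B) (X : L) :
    sw (H.comulLift (H.bull Γ X (𝐭 b))) f =
      sw (H.comulLift X) (fun x y => f x (H.bull Γ y (𝐭 b))) := by
  have hb := hH.bialgebroid
  have hl := hf.left
  have hr := hf.right
  rw [hH.comul_bull hΓ hf, sw_comm, hb.comul_tgt]
  · simp only [hb.mul_oneL]
  · refine ⟨by fun_prop, by fun_prop, fun c x y => ?_⟩
    have := hb.comul_takeuchi (f := fun u v => f (u ⬝ x) (H.bull Γ v y)) ⟨by fun_prop, by fun_prop,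
      fun b u v => by rw [hb.mulL_assoc, hf.bal, lactL_apply, lactL_apply, hH.src_mul_bull hΓ]⟩ c X
    simpa only [hb.mulL_assoc, hH.mul_src_bull hΓ, lactL_apply] using this

include hH hΓ hM hP hμ hN in
theorem IsPairing.twp_tla (b : B) (m : M) (n : N) : twp Γ d e laP μ (H.tla Γ laM d b m) n =
    H.tla Γ laP dP b (twp Γ d e laP μ m n) := by
  have hb := hH.bialgebroid
  rw [twp_apply, coact_tla hb hΓ hM (bal_twp_left hΓ hP hμ n), tla_apply,
    hμ.twp_coact hb hΓ hM hN hP (bal_tla' hb hΓ hP b)]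
  simp only [hb.cocycle' hΓ]

include hH hΓ hM hP hμ hN in
theorem IsPairing.twp_tra (b : B) (m : M) (n : N) : twp Γ d e laP μ (H.tra Γ laM d b m) n =
    twp Γ d e laP μ m (H.tla Γ laN e b n) := by
  have hb := hH.bialgebroid
  rw [twp_apply, coact_tra hb hΓ hM (bal_twp_left hΓ hP hμ n), twp_apply, sw_comm (d m) (e (H.tla Γ laN e b n)),
    coact_tla hb hΓ hN (bal_twp_right hΓ hM hP hμ m), sw_comm (e n)]
  simp only [hb.cocycle' hΓ]

include hH hW hM hN hP hμ in
/-- `δ^Γ(μ(m, n)) = m₍[-1]₎ • n₍[-1]₎ ⊗ μ_Γ(m₍[0]₎, n₍[0]₎)` -/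
theorem IsPairing.tco_bull {g : L → P → V} (hg : H.TBal Γ laP dP g) (m : M) (n : N) :
    sw (H.tco Γ laP dP (μ m n)) g = sw (H.tco Γ laM d m) (fun x m' => sw (H.tco Γ laN e n)
      (fun y n' => g (H.bull Γ x y) (twp Γ d e laP μ m' n'))) := by
  have hb := hH.bialgebroid
  have hΓ := hW.cocycle
  let F : L → P → V := fun x m => H.push Γ laP dP g x m
  have hF : H.DBal laP F := bal_push hg
  have hl := hF.left
  have hr := hF.right
  have hG : H.DBal laN (fun y n' => sw (d m) (fun x m' => F (x ⬝ y) (μ m' n'))) := by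
    refine ⟨by fun_prop, by fun_prop, fun b y n => ?_⟩
    have := hM.tak (f := fun x m' => F (x ⬝ y) (μ m' n)) ⟨by fun_prop, by fun_prop, fun b x m => by
      rw [hb.mulL_assoc, hF.bal, hμ.left]⟩ b m
    simpa only [hb.mulL_assoc, hμ.mid] using this
  -- the coaction of `n` is written as `J` of its twisted coaction
  have e1 := tco_pull hW hN n hG
  rw [sw_tco _ hg]
  refine (hμ.coact hF m n).trans ?_
  rw [sw_comm, ← e1, sw_comm (H.tco Γ laM d m)]
  refine sw_congr _ fun Y n' => ?_
  -- and `m₍₋₁₎ ⊗ 1 ⊗ m₍₀₎` as an expression in the twisted coaction of `m`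
  have e2 := tco_star hH hW hM m (h := fun p Z v => sw (H.transLift Y) (fun r s => sw (e n')
    (fun y n'' => F ((p ⬝ r) ⬝ 𝐭 (Γ s (H.star Γ Z y))) (μ v n'')))) (by fun_prop) (by fun_prop)
    (by fun_prop) (fun b x y m => by
      have := hH.trans_takeuchi (g := fun r s => sw (e n')
        (fun z n'' => F ((x ⬝ r) ⬝ 𝐭 (Γ s (H.star Γ y z))) (μ m n''))) ⟨by fun_prop, by fun_prop,
        fun c r s => by simp only [hΓ.bar_linear, hb.tgt_mul, hb.mulL_assoc]⟩ b Y
      simpa only [hb.mulL_assoc, hΓ.balanced, hb.tgt_mul_star hΓ] using this)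
    (fun b x y m => by simp only [hb.mulL_assoc, hF.bal, hμ.left])
  simp only [hb.oneL_star hΓ] at e2
  refine Eq.trans ?_ (e2.symm.trans (sw_congr _ fun X m' => ?_))
  · unfold pull
    rw [sw_comm (d m)]
    refine sw_congr _ fun r s => ?_
    rw [sw_comm]
    simp only [hb.mulL_assoc]
  · rw [← pull_push hW hP hg, pull, sw_comm (H.transLift (H.bull Γ X Y)),
      hμ.twp_coact hb hΓ hM hN hP (bal_pull_right hH hΓ hF _), sw_comm (H.transLift X)]
    refine sw_congr _ fun u v => ?_
    have e3 : ∀ y n'', sw (H.transLift (H.bull Γ X Y)) (fun p q =>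
        F (p ⬝ 𝐭 (Γ q (H.star Γ u y))) (μ v n'')) = sw (H.transLift X) (fun p q =>
          sw (H.transLift Y) (fun r s =>
            F ((p ⬝ r) ⬝ 𝐭 (Γ s (H.star Γ (H.star Γ q u) y))) (μ v n''))) := fun y n'' => by
      rw [hH.trans_bull hΓ (g := fun p q => F (p ⬝ 𝐭 (Γ q (H.star Γ u y))) (μ v n''))]
      · simp only [← hb.cocycle' hΓ, hb.star_assoc hΓ]
      · exact ⟨by fun_prop, by fun_prop, fun c p q => by
          simp only [hΓ.bar_linear, hb.tgt_mul, hb.mulL_assoc]⟩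
    simp only [e3]
    refine Eq.trans ?_ (sw_comm _ _ _)
    exact sw_congr _ fun p q => sw_comm _ _ _

include hH hW hM hN hP hμ in
/-- `δ^Γ(μ_Γ(m, n)) = m₍[-1]₎ ·_Γ n₍[-1]₎ ⊗ μ_Γ(m₍[0]₎, n₍[0]₎)` -/
theorem IsPairing.tco_twp {g : L → P → V} (hg : H.TBal Γ laP dP g) (m : M) (n : N) :
    sw (H.tco Γ laP dP (twp Γ d e laP μ m n)) g = sw (H.tco Γ laM d m) (fun x m' =>
      sw (H.tco Γ laN e n) (fun y n' =>
        g ((H.twist Γ).mulL x y) (twp Γ d e laP μ m' n'))) := by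
  have hb := hH.bialgebroid
  have hΓ := hW.cocycle
  have hl := hg.left
  have hr := hg.right
  -- `tco_bull` applies to the components of degree zero; `tco_comul` for `m`, then for `n`, turns
  -- the iterated coactions into coproducts of `L`
  have e0 : sw (H.tco Γ laP dP (twp Γ d e laP μ m n)) g = sw (d m) (fun x m' =>
      sw (H.tco Γ laM d m') (fun X m'' => sw (e n) (fun y n' => sw (H.tco Γ laN e n')
        (fun Y n'' => g (𝐬 (Γ x y) ⬝ H.bull Γ X Y) (twp Γ d e laP μ m'' n''))))) := by
    rw [twp_apply, sw_sw_lin _ _ hl hr]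
    refine sw_congr _ fun x m' => ?_
    rw [sw_sw_lin _ _ hl hr, sw_comm (H.tco Γ laM d m')]
    refine sw_congr _ fun y n' => ?_
    rw [tco_lact hH hW hP hg, hμ.tco_bull hH hW hM hN hP (TBal.src_mul_left hH hΓ hg _)]
  rw [e0, ← tco_comul hH hW hM (f := fun x X m'' => sw (e n) (fun y n' => sw (H.tco Γ laN e n')
        (fun Y n'' => g (𝐬 (Γ x y) ⬝ H.bull Γ X Y) (twp Γ d e laP μ m'' n''))))
      (by fun_prop) (by fun_prop) (by fun_prop)
      (fun b x y m => by simp only [hΓ.bar_linear, hb.src_mul, hb.mulL_assoc, hH.src_mul_bull hΓ])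
      (fun b x y m => by
        simp only [hH.bull_assoc hΓ, ← hH.tgt_bull_src_mul hΓ, hg.bal,
          hμ.twp_tla hH hΓ hM hN hP])]
  have e1 := tco_comul hH hW hN (f := fun y Y n'' => sw (H.tco Γ laM d m) (fun X m'' =>
    sw (H.comulLift X) (fun x X' =>
      g (𝐬 (Γ x y) ⬝ H.bull Γ X' Y) (twp Γ d e laP μ m'' n''))))
      (by fun_prop) (by fun_prop) (by fun_prop)
      (fun b y Y n => by
        refine sw_congr _ fun X m => ?_
        have := hb.comul_takeuchi (f := fun x X' =>
          g (𝐬 (Γ x y) ⬝ H.bull Γ X' Y) (twp Γ d e laP μ m n)) ⟨by fun_prop, by fun_prop,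
            fun b u v => by simp only [hΓ.bar_linear, hb.src_mul, hb.mulL_assoc, lactL_apply,
              hH.src_mul_bull hΓ]⟩ b X
        simpa only [hΓ.balanced, hH.mul_src_bull hΓ] using this)
      (fun b y Y n' => by
        have hD : ∀ m, H.DBal H.lactL (fun x X' => g (𝐬 (Γ x y) ⬝ H.bull Γ X' Y)
            (twp Γ d e laP μ m n')) := fun m => ⟨by fun_prop, by fun_prop, fun b u v => by
              simp only [hΓ.bar_linear, hb.src_mul, hb.mulL_assoc, lactL_apply,
                hH.src_mul_bull hΓ]⟩
        have := tco_takeuchi hH hW hM (g := fun X m => sw (H.comulLift X) (fun x X' =>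
          g (𝐬 (Γ x y) ⬝ H.bull Γ X' Y) (twp Γ d e laP μ m n'))) ⟨by fun_prop, by fun_prop,
            fun b X m => by
              rw [hH.comul_tgt_bull hΓ (hD m)]
              simp only [hH.bull_assoc hΓ, ← hH.tgt_bull_src_mul hΓ, hg.bal,
                hμ.twp_tla hH hΓ hM hN hP]⟩ b m
        simp only [hH.comul_bull_tgt hΓ (hD _), hH.bull_assoc hΓ,
          hμ.twp_tra hH hΓ hM hN hP] at this
        exact this) n
  rw [sw_comm (H.tco Γ laM d m) (H.tco Γ laN e n)]
  refine Eq.trans ?_ (e1.symm.trans (sw_congr _ fun Y n' => ?_))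
  · have e2 : ∀ X m'', sw (H.comulLift X) (fun x X' => sw (e n) (fun y n' => sw (H.tco Γ laN e n')
        (fun Y n'' => g (𝐬 (Γ x y) ⬝ H.bull Γ X' Y) (twp Γ d e laP μ m'' n'')))) =
        sw (e n) (fun y n' => sw (H.tco Γ laN e n') (fun Y n'' => sw (H.comulLift X) (fun x X' =>
          g (𝐬 (Γ x y) ⬝ H.bull Γ X' Y) (twp Γ d e laP μ m'' n'')))) := fun X m'' => by
      rw [sw_comm]
      exact sw_congr _ fun y n' => sw_comm _ _ _
    simp only [e2]
    rw [sw_comm]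
    exact sw_congr _ fun y n' => sw_comm _ _ _
  · rw [sw_comm]
    refine sw_congr _ fun X m' => ?_
    rw [sw_comm, dot_apply, map_sw_left (φ := g) _ _ hl]
    exact sw_congr _ fun x x' => (map_sw_left (φ := g) _ _ hl _).symm

end

end

/-! ### The bialgebroid `L^Γ` -/

section

section
variable (hH : H.IsLeftHopfAlgebroid) (hΓ : H.IsTwoCocycle Γ) (hW : H.WInv Γ)
  (hM : H.IsCom laM raM d)

theorem toDiamond_eq_of_sw {z w : L ⊗[k] L} (h : sw z (fun x y => H.toDiamond (x ⊗ₜ[k] y)) =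
    sw w (fun x y => H.toDiamond (x ⊗ₜ[k] y))) : H.toDiamond z = H.toDiamond w := by
  rwa [map_eq_sw H.toDiamond z, map_eq_sw H.toDiamond w]

variable (H) in
theorem bal_toDiamond : H.DBal H.lactL (fun x y => H.toDiamond (x ⊗ₜ[k] y)) := bal_mkQ

/-- The coring and multiplicativity axioms of a bialgebroid, tested on balanced maps. -/
theorem IsLeftBialgebroid.of_sw
    (mulB_assoc : ∀ a b c, H.mulB (H.mulB a b) c = H.mulB a (H.mulB b c))
    (oneB_mul : ∀ a, H.mulB H.oneB a = a)
    (mul_oneB : ∀ a, H.mulB a H.oneB = a)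
    (mulL_assoc : ∀ X Y Z, H.mulL (H.mulL X Y) Z = H.mulL X (H.mulL Y Z))
    (oneL_mul : ∀ X, H.mulL H.oneL X = X)
    (mul_oneL : ∀ X, H.mulL X H.oneL = X)
    (src_one : H.src H.oneB = H.oneL)
    (src_mul : ∀ a b, H.src (H.mulB a b) = H.mulL (H.src a) (H.src b))
    (tgt_one : H.tgt H.oneB = H.oneL)
    (tgt_mul : ∀ a b, H.tgt (H.mulB a b) = H.mulL (H.tgt b) (H.tgt a))
    (src_tgt : ∀ a b, H.mulL (H.src a) (H.tgt b) = H.mulL (H.tgt b) (H.src a))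
    (comul_src_mul : ∀ {V : Type u} [AddCommGroup V] [Module k V] {f : L → L → V},
      H.DBal H.lactL f → ∀ b X,
      sw (H.comulLift (𝐬 b ⬝ X)) f = sw (H.comulLift X) (fun x y => f (𝐬 b ⬝ x) y))
    (comul_tgt_mul : ∀ {V : Type u} [AddCommGroup V] [Module k V] {f : L → L → V},
      H.DBal H.lactL f → ∀ b X,
      sw (H.comulLift (𝐭 b ⬝ X)) f = sw (H.comulLift X) (fun x y => f x (𝐭 b ⬝ y)))
    (counit_src_mul : ∀ b X, H.counit (𝐬 b ⬝ X) = H.mulB b (H.counit X))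
    (counit_tgt_mul : ∀ b X, H.counit (𝐭 b ⬝ X) = H.mulB (H.counit X) b)
    (coassoc : ∀ {V : Type u} [AddCommGroup V] [Module k V] {f : L → L → L → V},
      H.Bal3 H.lactL f → ∀ X,
      sw (H.comulLift X) (fun x z => sw (H.comulLift x) (fun y y' => f y y' z)) =
        sw (H.comulLift X) (fun x y => sw (H.comulLift y) (fun y z => f x y z)))
    (counit_left : ∀ X, sw (H.comulLift X) (fun x y => 𝐬 (H.counit x) ⬝ y) = X)
    (counit_right : ∀ X, sw (H.comulLift X) (fun x y => 𝐭 (H.counit y) ⬝ x) = X)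
    (takeuchi : ∀ {V : Type u} [AddCommGroup V] [Module k V] {f : L → L → V},
      H.DBal H.lactL f → ∀ b X,
      sw (H.comulLift X) (fun x y => f (x ⬝ 𝐭 b) y) =
        sw (H.comulLift X) (fun x y => f x (y ⬝ 𝐬 b)))
    (comul_one : ∀ {V : Type u} [AddCommGroup V] [Module k V] {f : L → L → V},
      H.DBal H.lactL f → sw (H.comulLift H.oneL) f = f H.oneL H.oneL)
    (comul_mul : ∀ {V : Type u} [AddCommGroup V] [Module k V] {f : L → L → V},
      H.DBal H.lactL f → ∀ X Y, sw (H.comulLift (X ⬝ Y)) f =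
      sw (H.comulLift X) (fun x x' => sw (H.comulLift Y) (fun y y' => f (x ⬝ y) (x' ⬝ y'))))
    (counit_one : H.counit H.oneL = H.oneB)
    (counit_mul_src : ∀ X Y, H.counit (H.mulL X Y) = H.counit (H.mulL X (H.src (H.counit Y))))
    (counit_mul_tgt : ∀ X Y, H.counit (H.mulL X Y) = H.counit (H.mulL X (H.tgt (H.counit Y)))) :
    H.IsLeftBialgebroid :=
  have hf' := H.bal_toDiamond
  have hl := hf'.left
  have hr := hf'.right
  { mulB_assoc, oneB_mul, mul_oneB, mulL_assoc, oneL_mul, mul_oneL, src_one, src_mul, tgt_one,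
    tgt_mul, src_tgt, counit_one, counit_mul_src, counit_mul_tgt
    comul_bimod := fun a b X => by
      rw [← toDiamond_comulLift]
      refine toDiamond_eq_of_sw ?_
      rw [mulL_assoc]
      refine (comul_src_mul hf' a _).trans (Eq.trans (comul_tgt_mul (f := fun x y => _) ?_ b X) ?_)
      · refine ⟨by fun_prop, by fun_prop, fun c x y => ?_⟩
        rw [← mulL_assoc, src_tgt, mulL_assoc]
        exact hf'.bal _ _ _
      · rw [sw_map _ _ _ (by fun_prop) (by fun_prop)]
    counit_bimod := fun a b X => by
      rw [mulL_assoc, counit_src_mul, counit_tgt_mul, mulB_assoc]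
    coassoc := fun X => by
      have h3 := H.bal3_mkQ H.lactL
      have e := coassoc h3 X
      rw [← sw_coassoc_left _ _ h3.l1 h3.l2 h3.l3, ← sw_coassoc_right _ _ h3.l1 h3.l2 h3.l3] at e
      exact mem_diamond3_of_sw (la := H.lactL) e
    counit_left := fun X => (map_eq_sw (H.mulT ∘ₗ TensorProduct.map (H.src ∘ₗ H.counit)
      LinearMap.id : L ⊗[k] L →ₗ[k] L) (H.comulLift X)).trans (counit_left X)
    counit_right := fun X => (map_eq_sw (H.mulT ∘ₗ (TensorProduct.comm k L L).toLinearMap ∘ₗ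
      TensorProduct.map LinearMap.id (H.tgt ∘ₗ H.counit) :
      L ⊗[k] L →ₗ[k] L) (H.comulLift X)).trans (counit_right X)
    takeuchi := fun b X => by
      refine toDiamond_eq_of_sw ?_
      rw [sw_map _ _ _ (by fun_prop) (by fun_prop), sw_map _ _ _ (by fun_prop) (by fun_prop)]
      exact takeuchi hf' b X
    comul_one := by
      rw [← toDiamond_comulLift]
      refine toDiamond_eq_of_sw ?_
      rw [sw_tmul _ _ ⟨by fun_prop, by fun_prop⟩]
      exact comul_one hf'
    comul_mul := fun X Y => by
      rw [← toDiamond_comulLift]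
      refine toDiamond_eq_of_sw ?_
      refine (comul_mul hf' X Y).trans ?_
      rw [sw_exch, sw_sw _ _ hl hr]
      refine sw_congr _ fun a b => ?_
      rw [sw_sw _ _ hl hr]
      exact sw_congr _ fun c d => (sw_tmul _ _ ⟨hl, hr⟩).symm }

include hH hΓ in
/-- `TBal` is `DBal` for `L^Γ` and the twisted left action. -/
theorem DBal.tBal {g : L → M → V} (hg : (H.twist Γ).DBal (H.tla Γ laM d) g) :
    H.TBal Γ laM d g :=
  ⟨hg.left, hg.right, fun b x m => by rw [← hg.bal, ← hH.tgt_dot hΓ]; rfl⟩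

include hH hΓ in
theorem TBal.dBal {g : L → M → V} (hg : H.TBal Γ laM d g) :
    (H.twist Γ).DBal (H.tla Γ laM d) g :=
  ⟨hg.left, hg.right, fun b x m => by rw [← hg.bal, ← hH.tgt_dot hΓ]; rfl⟩

include hH hΓ in
theorem twist_lactL : (H.twist Γ).lactL = H.tla Γ H.lactL H.comulLift :=
  LinearMap.ext₂ fun b X => by
    rw [hH.bialgebroid.tla_regular hΓ, ← hH.src_dot hΓ]
    rfl

include hH hW in
/-- The coproduct of `L^Γ` is the twisted coaction of `L`. -/
theorem sw_comul_twist {g : L → L → V} (hg : (H.twist Γ).DBal (H.twist Γ).lactL g) (X : L) :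
    sw ((H.twist Γ).comulLift X) g = sw (H.tco Γ H.lactL H.comulLift X) g := by
  refine hg.sw_congr_mkQ ((toDiamond_comulLift (H := H.twist Γ) X).trans ?_)
  have e : (H.diamond (fun b m => H.lactL b m)).mkQ (H.comulLift X) = H.comul X :=
    toDiamond_comulLift X
  unfold tco sharpSection
  simp only [LinearMap.comp_apply]
  rw [e]
  rfl

theorem IsLeftBialgebroid.src_star_src (hb : H.IsLeftBialgebroid) (hΓ : H.IsTwoCocycle Γ)
    (a b : B) : H.star Γ (𝐬 a) (𝐬 b) = 𝐬 (Γ (𝐬 a) (𝐬 b)) := by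
  rw [hb.src_star hΓ, hb.comul_src]
  · rw [hb.mul_oneL]
  · exact ⟨by fun_prop, by fun_prop, fun c x y => by
      rw [cocycle_src_tgt_mul hΓ hb, hb.src_mul, lactL_apply, hb.mulL_assoc]⟩

include hH hW hM in
/-- The twisted comodule of a comodule of `L`. -/
theorem isCom_tco : (H.twist Γ).IsCom (H.tla Γ laM d) (H.tra Γ laM d) (H.tco Γ laM d) := by
  have hb := hH.bialgebroid
  have hΓ := hW.cocycle
  refine
  { la_one := fun m => ?_
    la_mul := fun a b m => ?_
    ra_one := fun m => ?_
    ra_mul := fun a b m => ?_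
    la_ra := fun a b m => ?_
    lact := fun {V _ _ f} hf b m => ?_
    ract := fun {V _ _ f} hf b m => ?_
    tak := fun {V _ _ f} hf b m => ?_
    coassoc := fun {V _ _ f} hf m => ?_
    counit := fun m => tco_counit hH hW hM m }
  · show H.tla Γ laM d H.oneB m = m
    simp only [tla_apply, hb.src_one, hΓ.one_left, hM.counit]
  · show H.tla Γ laM d (Γ (𝐬 a) (𝐬 b)) m = _
    rw [tla_apply a, coact_tla hb hΓ hM (bal_tla' hb hΓ hM a), tla_apply]
    simp only [hb.cocycle' hΓ, hb.src_star_src hΓ]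
  · show H.tra Γ laM d H.oneB m = m
    simp only [tra_apply, hb.src_one, hΓ.one_right, hM.counit]
  · show H.tra Γ laM d (Γ (𝐬 a) (𝐬 b)) m = _
    rw [tra_apply b, coact_tra hb hΓ hM (bal_tra hb hΓ hM _), tra_apply]
    simp only [← hb.cocycle' hΓ, hb.src_star_src hΓ]
  · rw [tla_apply a, coact_tra hb hΓ hM (bal_tla' hb hΓ hM a), tra_apply b,
      coact_tla hb hΓ hM (bal_tra hb hΓ hM _)]
    simp only [hb.cocycle' hΓ]
  · rw [tco_tla hH hW hM (DBal.tBal hH hΓ hf)]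
    simp only [← hH.src_dot hΓ]
    rfl
  · rw [tco_tra hH hW hM (DBal.tBal hH hΓ hf)]
    simp only [← hH.dot_src hΓ]
    rfl
  · rw [← tco_takeuchi hH hW hM (DBal.tBal hH hΓ hf)]
    simp only [← hH.dot_tgt hΓ]
    rfl
  · have h1 := hf.l1
    have h2 := hf.l2
    have h3 := hf.l3
    have e : ∀ x n, sw ((H.twist Γ).comulLift x) (fun y z => f y z n) =
        sw (H.tco Γ H.lactL H.comulLift x) (fun y z => f y z n) := fun x n =>
      sw_comul_twist hH hW ⟨by fun_prop, by fun_prop, fun b x y => hf.b1 b x y n⟩ x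
    simp only [e]
    refine tco_coassoc hH hW hM h1 h2 h3 (fun b x y z => ?_) (fun b x y z => ?_) m
    · rw [← hH.tgt_dot hΓ, ← hH.src_dot hΓ]
      exact hf.b1 b x y z
    · rw [← hH.tgt_dot hΓ]
      exact hf.b2 b x y z

include hH hW in
theorem tco_oneL {g : L → L → V} (hg : H.TBal Γ H.lactL H.comulLift g) :
    sw (H.tco Γ H.lactL H.comulLift H.oneL) g = g H.oneL H.oneL := by
  have hb := hH.bialgebroid
  have hΓ := hW.cocycle
  have hF := bal_push hg
  rw [sw_tco _ hg, hb.comul_oneL hF, ← pull_push hW hb.isCom_regular hg, pull,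
    hH.trans_oneL (bal_pull_left hH hΓ hF _), hb.comul_oneL, hΓ.one_left, hb.counit_one, hb.tgt_one,
    hb.mul_oneL]
  have hl := hF.left
  have hr := hF.right
  exact ⟨by fun_prop, by fun_prop, fun c u v => by
    simp only [hΓ.one_left, hb.counit_tgt_mul, hb.oneL_mul, hb.tgt_mul, hF.bal]⟩

include hH hW in
theorem tco_tgt {g : L → L → V} (hg : H.TBal Γ H.lactL H.comulLift g) (b : B) :
    sw (H.tco Γ H.lactL H.comulLift (𝐭 b)) g = g H.oneL (𝐭 b) := by
  have hb := hH.bialgebroid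
  have hR := hb.isCom_regular
  have hl := hg.left
  have hr := hg.right
  have := (hb.isColin_mul_tgt b).tco hH hW hR hR hg H.oneL
  rw [LinearMap.flip_apply, hb.oneL_mul] at this
  rw [this]
  refine (tco_oneL hH hW (g := fun x y => g x (y ⬝ 𝐭 b)) ?_).trans (by rw [hb.oneL_mul])
  refine ⟨by fun_prop, by fun_prop, fun c x y => ?_⟩
  rw [hg.bal, hb.tla_regular hW.cocycle, hb.tla_regular hW.cocycle, hb.star_mul_tgt hW.cocycle]

include hH hW in
theorem tco_dot {g : L → L → V} (hg : H.TBal Γ H.lactL H.comulLift g) (X Y : L) :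
    sw (H.tco Γ H.lactL H.comulLift ((H.twist Γ).mulL X Y)) g =
      sw (H.tco Γ H.lactL H.comulLift X) (fun x x' => sw (H.tco Γ H.lactL H.comulLift Y)
        (fun y y' => g ((H.twist Γ).mulL x y) ((H.twist Γ).mulL x' y'))) := by
  have hR := hH.bialgebroid.isCom_regular
  have := (hH.isPairing_bull hW.cocycle).tco_twp hH hW hR hR hR hg X Y
  rwa [← dot_eq_twp] at this

include hH hW in
theorem isLeftBialgebroid_twist : (H.twist Γ).IsLeftBialgebroid := by
  have hb := hH.bialgebroid
  have hΓ := hW.cocycle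
  have hR := hb.isCom_regular
  have hC := isCom_tco hH hW hR
  rw [← twist_lactL hH hΓ] at hC
  have hI : Function.Injective H.src := Function.LeftInverse.injective hb.counit_src
  have hmB : ∀ a b, 𝐬 (Γ (𝐬 a) (𝐬 b)) = (H.twist Γ).mulL (𝐬 a) (𝐬 b) := fun a b => by
    rw [hH.src_dot hΓ, hb.src_star_src hΓ]
  have hmT : ∀ a b, 𝐭 (Γ (𝐬 a) (𝐬 b)) = (H.twist Γ).mulL (𝐭 b) (𝐭 a) := fun a b => by
    rw [hH.tgt_dot hΓ, hH.tgt_bull hΓ, hH.trans_tgt, hb.oneL_mul]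
    exact ⟨by fun_prop, by fun_prop, fun c p q => by
      rw [hΓ.bar_linear, hb.tgt_mul, hb.mulL_assoc]⟩
  have hst : ∀ a b, (H.twist Γ).mulL (𝐬 a) (𝐭 b) = (H.twist Γ).mulL (𝐭 b) (𝐬 a) := fun a b => by
    rw [hH.tgt_dot hΓ, hH.tgt_bull hΓ, hH.trans_src, hH.src_dot hΓ, hb.src_star hΓ, hb.comul_tgt,
      hΓ.one_left, hΓ.one_right, hb.counit_src, hb.counit_src]
    · exact ⟨by fun_prop, by fun_prop, fun c x y => by
        rw [cocycle_src_tgt_mul hΓ hb, hb.src_mul, lactL_apply, hb.mulL_assoc]⟩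
    · exact ⟨by fun_prop, by fun_prop, fun c p q => by
        rw [hΓ.bar_linear, hb.tgt_mul, hb.mulL_assoc]⟩
  have hA := hH.dot_assoc hΓ
  have htco : ∀ {V : Type u} [AddCommGroup V] [Module k V] {f : L → L → V},
      (H.twist Γ).DBal (H.twist Γ).lactL f → H.TBal Γ H.lactL H.comulLift f := fun hf => by
    rw [twist_lactL hH hΓ] at hf
    exact DBal.tBal hH hΓ hf
  have hbal : ∀ {V : Type u} [AddCommGroup V] [Module k V] {f : L → L → V},
      (H.twist Γ).DBal (H.twist Γ).lactL f → ∀ c x y,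
      f ((H.twist Γ).mulL (𝐭 c) x) y = f x ((H.twist Γ).mulL (𝐬 c) y) := fun hf c x y => hf.bal c x y
  have hcomul_mul : ∀ {V : Type u} [AddCommGroup V] [Module k V] {f : L → L → V},
      (H.twist Γ).DBal (H.twist Γ).lactL f → ∀ X Y,
      sw ((H.twist Γ).comulLift ((H.twist Γ).mulL X Y)) f = sw ((H.twist Γ).comulLift X)
        (fun x x' => sw ((H.twist Γ).comulLift Y)
        (fun y y' => f ((H.twist Γ).mulL x y) ((H.twist Γ).mulL x' y'))) := fun {V _ _ f} hf X Y => by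
    have hl := hf.left
    have hr := hf.right
    rw [sw_comul_twist hH hW hf, tco_dot hH hW (htco hf), sw_comul_twist hH hW
      (g := fun x x' => sw ((H.twist Γ).comulLift Y)
        (fun y y' => f ((H.twist Γ).mulL x y) ((H.twist Γ).mulL x' y')))]
    · rw [sw_comm, sw_comm _ ((H.twist Γ).comulLift Y), sw_comul_twist hH hW
        (g := fun y y' => sw (H.tco Γ H.lactL H.comulLift X)
        (fun x x' => f ((H.twist Γ).mulL x y) ((H.twist Γ).mulL x' y')))]
      refine ⟨by fun_prop, by fun_prop, fun c y y' => ?_⟩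
      have := hC.tak (f := fun x x' => f ((H.twist Γ).mulL x y) ((H.twist Γ).mulL x' y'))
        ⟨by fun_prop, by fun_prop, fun c x x' => (congrArg (f · _) (hA _ _ _)).trans
          ((hbal hf _ _ _).trans (congrArg (f _) (hA _ _ _).symm))⟩ c X
      simp only [hb.tra_regular hΓ, ← hH.dot_src hΓ, hA] at this
      exact this
    · refine ⟨by fun_prop, by fun_prop, fun c x x' => sw_congr _ fun y y' => ?_⟩
      exact (congrArg (f · _) (hA _ _ _)).trans
        ((hbal hf _ _ _).trans (congrArg (f _) (hA _ _ _).symm))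
  have hcomul_src_mul : ∀ {V : Type u} [AddCommGroup V] [Module k V] {f : L → L → V},
      (H.twist Γ).DBal (H.twist Γ).lactL f → ∀ b X,
      sw ((H.twist Γ).comulLift ((H.twist Γ).mulL (𝐬 b) X)) f = sw ((H.twist Γ).comulLift X)
        (fun x y => f ((H.twist Γ).mulL (𝐬 b) x) y) := fun {V _ _ f} hf b X => by
    have hl := hf.left
    have hr := hf.right
    rw [sw_comul_twist hH hW hf, sw_comul_twist hH hW (g := fun x y =>
      f ((H.twist Γ).mulL (𝐬 b) x) y)]
    · exact hC.lact hf b X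
    · refine ⟨by fun_prop, by fun_prop, fun c x y => Eq.trans ?_ (hbal hf _ _ _)⟩
      exact congrArg (f · _) ((hA _ _ _).symm.trans ((congrArg ((H.twist Γ).mulL · x)
        (hst b c)).trans (hA _ _ _)))
  have hcomul_tgt_mul : ∀ {V : Type u} [AddCommGroup V] [Module k V] {f : L → L → V},
      (H.twist Γ).DBal (H.twist Γ).lactL f → ∀ b X,
      sw ((H.twist Γ).comulLift ((H.twist Γ).mulL (𝐭 b) X)) f = sw ((H.twist Γ).comulLift X)
        (fun x y => f x ((H.twist Γ).mulL (𝐭 b) y)) := fun {V _ _ f} hf b X => by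
    have hl := hf.left
    have hr := hf.right
    rw [sw_comul_twist hH hW hf, sw_comul_twist hH hW (g := fun x y =>
      f x ((H.twist Γ).mulL (𝐭 b) y)), tco_dot hH hW (htco hf), tco_tgt hH hW]
    · simp only [hH.oneL_dot hΓ]
    · refine htco ⟨by fun_prop, by fun_prop, fun c x y => sw_congr _ fun u v => ?_⟩
      exact (congrArg (f · _) (hA _ _ _)).trans
        ((hbal hf _ _ _).trans (congrArg (f _) (hA _ _ _).symm))
    · refine ⟨by fun_prop, by fun_prop, fun c x y => (hbal hf _ _ _).trans ?_⟩
      exact congrArg (f _) ((hA _ _ _).symm.trans ((congrArg ((H.twist Γ).mulL · y)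
        (hst c b)).trans (hA _ _ _)))
  have hcs : ∀ b X, (H.twist Γ).counit ((H.twist Γ).mulL (𝐬 b) X) =
      Γ (𝐬 b) (𝐬 ((H.twist Γ).counit X)) := fun b X => by
    rw [hH.src_dot hΓ, counit_twist_apply, hH.trans_src_star hΓ hΓ.bBal, counit_twist_apply,
      ← hH.trans_star hΓ, map_sw (φ := fun z => Γ (𝐬 b) z) _ _ (by fun_prop)]
    simp only [hb.cocycle' hΓ]
  have hct : ∀ b X, (H.twist Γ).counit ((H.twist Γ).mulL (𝐭 b) X) =
      Γ (𝐬 ((H.twist Γ).counit X)) (𝐬 b) := fun b X => by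
    rw [hH.tgt_dot hΓ, counit_twist_apply, hH.trans_bull hΓ hΓ.bBal, counit_twist_apply,
      hH.trans_tgt (hH.bBal_bull hΓ hΓ.bBal X),
      ← hH.trans_star hΓ, map_sw (φ := fun z => Γ z (𝐬 b)) _ _ (by fun_prop)]
    simp only [hb.cocycle' hΓ, hb.oneL_mul]
  have hB : ∀ X, H.BBal (fun r s => sw (H.transLift X) (fun p q =>
      Γ (H.star Γ p r) (H.star Γ s q))) := fun X => ⟨by fun_prop, by fun_prop, fun c r s => by
    simp only [hb.star_mul_tgt hΓ, hΓ.balanced, hb.tgt_mul_star hΓ]⟩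
  have hms : ∀ b X, (H.twist Γ).counit ((H.twist Γ).mulL X (𝐬 b)) =
      sw (H.transLift X) (fun p q => Γ (H.star Γ p (𝐬 b)) q) := fun b X => by
    rw [hH.counit_twist_dot hΓ, sw_comm, hH.trans_src (hB X)]
    simp only [hb.oneL_star hΓ]
  have hmt : ∀ b X, (H.twist Γ).counit ((H.twist Γ).mulL X (𝐭 b)) =
      sw (H.transLift X) (fun p q => Γ (H.star Γ p (𝐬 b)) q) := fun b X => by
    rw [hH.counit_twist_dot hΓ, sw_comm, hH.trans_tgt (hB X)]
    simp only [hb.star_oneL hΓ, hb.cocycle' hΓ]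
  have hmm : ∀ X Y, (H.twist Γ).counit ((H.twist Γ).mulL X Y) =
      sw (H.transLift X) (fun p q => Γ (H.star Γ p (𝐬 ((H.twist Γ).counit Y))) q) := fun X Y => by
    rw [hH.counit_twist_dot hΓ, counit_twist_apply Y, ← hH.trans_star hΓ]
    refine sw_congr _ fun p q => ?_
    rw [map_sw (φ := fun z => Γ (H.star Γ p z) q) _ _ (by fun_prop)]
    simp only [hb.cocycle' hΓ, hb.star_assoc hΓ]
  refine IsLeftBialgebroid.of_sw (H := H.twist Γ) (fun a b c => ?_) (fun a => ?_) (fun a => ?_)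
    hA (hH.oneL_dot hΓ) (hH.dot_oneL hΓ) hb.src_one hmB hb.tgt_one
    hmT hst hcomul_src_mul hcomul_tgt_mul
    (fun b X => ?_) (fun b X => ?_) (fun {V _ _ f} hf X => ?_) (fun X => ?_) (fun X => ?_)
    (fun {V _ _ f} hf b X => ?_) (fun {V _ _ f} hf => ?_) hcomul_mul
    ?_ (fun X Y => ?_) (fun X Y => ?_)
  · refine hI ?_
    show 𝐬 (Γ (𝐬 (Γ (𝐬 a) (𝐬 b))) (𝐬 c)) = 𝐬 (Γ (𝐬 a) (𝐬 (Γ (𝐬 b) (𝐬 c))))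
    rw [hmB, hmB, hmB, hmB, hH.dot_assoc hΓ]
  · show Γ (𝐬 H.oneB) (𝐬 a) = a
    rw [hb.src_one, hΓ.one_left, hb.counit_src]
  · show Γ (𝐬 a) (𝐬 H.oneB) = a
    rw [hb.src_one, hΓ.one_right, hb.counit_src]
  · exact hcs b X
  · exact hct b X
  · have h1 := hf.l1
    have h2 := hf.l2
    have h3 := hf.l3
    rw [sw_comul_twist hH hW (g := fun x y => sw ((H.twist Γ).comulLift y) (fun y z => f x y z)),
      sw_comul_twist hH hW (g := fun x z => sw ((H.twist Γ).comulLift x) (fun y y' => f y y' z)),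
      hC.coassoc hf]
    · exact sw_congr _ fun x y => (sw_comul_twist hH hW ⟨by fun_prop, by fun_prop,
        fun b y z => hf.b2 b x y z⟩ y).symm
    · refine ⟨by fun_prop, by fun_prop, fun b x z => ?_⟩
      refine (hcomul_tgt_mul (f := fun y y' => f y y' z) ⟨by fun_prop, by fun_prop,
        fun b x y => hf.b1 b x y z⟩ b x).trans (sw_congr _ fun y y' => hf.b2 b y y' z)
    · refine ⟨by fun_prop, by fun_prop, fun b x y => ?_⟩
      exact (sw_congr _ fun y z => hf.b1 b x y z).trans (hcomul_src_mul (f := fun y z => f x y z)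
        ⟨by fun_prop, by fun_prop, fun b y z => hf.b2 b x y z⟩ b y).symm
  · refine (sw_comul_twist hH hW ⟨by fun_prop, by fun_prop, fun b x y => ?_⟩ X).trans (hC.counit X)
    exact (congrArg (fun z => (H.twist Γ).mulL (𝐬 z) y) (hct b x)).trans
      ((congrArg ((H.twist Γ).mulL · y) (hmB _ _)).trans (hA _ _ _))
  · refine (sw_comul_twist hH hW ⟨by fun_prop, by fun_prop, fun b x y => ?_⟩ X).trans ?_
    · exact ((congrArg (fun z => (H.twist Γ).mulL (𝐭 z) x) (hcs b y)).trans
        ((congrArg ((H.twist Γ).mulL · x) (hmT _ _)).trans (hA _ _ _))).symm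
    · refine Eq.trans (sw_congr _ fun x y => ?_) (tco_counit_right hH hW X)
      exact hH.tgt_dot hΓ _ _
  · have hl := hf.left
    have hr := hf.right
    rw [sw_comul_twist hH hW (g := fun x y => f ((H.twist Γ).mulL x ((H.twist Γ).tgt b)) y),
      sw_comul_twist hH hW (g := fun x y => f x ((H.twist Γ).mulL y ((H.twist Γ).src b)))]
    · refine (hC.tak hf b X).trans (sw_congr _ fun x y => ?_)
      rw [hb.tra_regular hΓ, ← hH.dot_src hΓ]
      rfl
    · refine ⟨by fun_prop, by fun_prop, fun c x y => ?_⟩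
      exact (hbal hf c x _).trans (congrArg (f x) (hA _ _ _).symm)
    · refine ⟨by fun_prop, by fun_prop, fun c x y => ?_⟩
      exact (congrArg (f · y) (hA _ _ _)).trans (hbal hf c _ y)
  · exact (sw_comul_twist hH hW hf _).trans (tco_oneL hH hW (htco hf))
  · show (H.twist Γ).counit H.oneL = H.oneB
    rw [counit_twist_apply, hH.trans_oneL hΓ.bBal, hΓ.one_left, hb.counit_one]
  · exact (hmm X Y).trans (hms _ X).symm
  · exact (hmm X Y).trans (hmt _ X).symm

end

end

/-! ### The translation map of `L^Γ` -/

section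

theorem galois_tmul (X Y : L) : H.galois (X ⊗ₜ[k] Y) =
    sw (H.comulLift X) (fun u v => H.toDiamond (u ⊗ₜ[k] (v ⬝ Y))) :=
  map_eq_sw (H.toDiamond ∘ₗ TensorProduct.map LinearMap.id H.mulT ∘ₗ
    (TensorProduct.assoc k L L L).toLinearMap ∘ₗ (TensorProduct.mk k _ _).flip Y) (H.comulLift X)

/-- A bialgebroid with a translation map is a Hopf algebroid. -/
theorem IsLeftBialgebroid.isLeftHopfAlgebroid (hb : H.IsLeftBialgebroid) (τ : L →ₗ[k] L ⊗[k] L)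
    (t1 : ∀ {V : Type u} [AddCommGroup V] [Module k V] {f : L → L → V}, H.DBal H.lactL f → ∀ X,
      sw (τ X) (fun x y => sw (H.comulLift x) (fun u v => f u (v ⬝ y))) = f X H.oneL)
    (t2 : ∀ {V : Type u} [AddCommGroup V] [Module k V] {g : L → L → V}, H.BBal g → ∀ X,
      sw (H.comulLift X) (fun x y => sw (τ x) (fun p q => g p (q ⬝ y))) = g X H.oneL)
    (t3 : ∀ {V : Type u} [AddCommGroup V] [Module k V] {g : L → L → V}, H.BBal g → ∀ b X,
      sw (τ (𝐭 b ⬝ X)) g = sw (τ X) (fun p q => g p (q ⬝ 𝐬 b))) : H.IsLeftHopfAlgebroid := by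
  refine ⟨hb, le_antisymm (fun z hz => ?_) ?_, fun w => ?_⟩
  · have hg : H.BBal (fun x y => H.barRel.mkQ (x ⊗ₜ[k] y)) := bal_mkQ
    have hl := hg.left
    have hr := hg.right
    have hg' : ∀ w, H.BBal (fun x y => H.barRel.mkQ (x ⊗ₜ[k] (y ⬝ w))) := fun w =>
      ⟨by fun_prop, by fun_prop, fun b x y => by rw [hg.bal, hb.mulL_assoc]⟩
    have hφ : H.DBal H.lactL (fun u v => sw (τ u) (fun p q => H.barRel.mkQ (p ⊗ₜ[k] (q ⬝ v)))) :=
      ⟨by fun_prop, by fun_prop, fun b u v => by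
        rw [t3 (hg' v)]
        simp only [lactL_apply, hb.mulL_assoc]⟩
    refine mem_of_sw ?_
    have e := sw_galois hφ (z := z) (w := 0) (by rw [map_zero]; exact hz)
    rw [sw_eq_lift (0 : L ⊗[k] L) hφ.bilin, map_zero] at e
    refine Eq.trans (sw_congr _ fun x y => ?_) e
    have := t2 (hg' y) x
    simp only [hb.oneL_mul, hb.mulL_assoc] at this
    exact this.symm
  · refine Submodule.span_le.2 ?_
    rintro _ ⟨b, x, y, rfl⟩
    rw [SetLike.mem_coe, LinearMap.mem_ker, map_sub, sub_eq_zero, galois_tmul, galois_tmul,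
      hb.comul_mul_tgt (f := fun u v => H.toDiamond (u ⊗ₜ[k] (v ⬝ y)))]
    · simp only [hb.mulL_assoc]
    · exact ⟨by fun_prop, by fun_prop, fun b u v => by
        rw [H.bal_toDiamond.bal, lactL_apply, lactL_apply, hb.mulL_assoc]⟩
  · obtain ⟨z, rfl⟩ := Submodule.mkQ_surjective _ w
    refine ⟨sw z (fun x y => sw (τ x) (fun p q => p ⊗ₜ[k] (q ⬝ y))), ?_⟩
    refine Eq.trans ?_ (map_eq_sw H.toDiamond z).symm
    rw [map_sw (φ := H.galois) _ _ (by fun_prop)]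
    refine sw_congr _ fun x y => ?_
    rw [map_sw (φ := H.galois) _ _ (by fun_prop)]
    have := t1 (f := fun u v => H.toDiamond (u ⊗ₜ[k] (v ⬝ y))) ⟨by fun_prop, by fun_prop,
      fun b u v => by rw [H.bal_toDiamond.bal, lactL_apply, lactL_apply, hb.mulL_assoc]⟩ x
    rw [hb.oneL_mul] at this
    rw [← this]
    simp only [galois_tmul, hb.mulL_assoc]

section
variable (hH : H.IsLeftHopfAlgebroid) (hΓ : H.IsTwoCocycle Γ) (hW : H.WInv Γ)
  (hM : H.IsCom laM raM d)

include hH hΓ hM in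
theorem pull_oneL_left {F : L → M → V} (hF : H.DBal laM F) (m : M) :
    H.pull Γ d F H.oneL m = F H.oneL m := by
  have hb := hH.bialgebroid
  have hl := hF.left
  have hr := hF.right
  unfold pull
  rw [hH.trans_oneL (bal_pull_left hH hΓ hF m)]
  have e : ∀ u v, F (H.oneL ⬝ 𝐭 (Γ H.oneL u)) v = F H.oneL (laM (H.counit u) v) := fun u v => by
    rw [hb.oneL_mul, hΓ.one_left, ← hF.bal, hb.mul_oneL]
  simp only [e]
  rw [← map_sw (φ := F H.oneL) _ _ (by fun_prop), hM.counit]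

include hH hΓ in
theorem pull_oneL_right {F : L → L → V} (hF : H.DBal H.lactL F) (X : L) :
    H.pull Γ H.comulLift F X H.oneL = F X H.oneL := by
  have hb := hH.bialgebroid
  have hl := hF.left
  have hr := hF.right
  unfold pull
  rw [sw_comm, hb.comul_oneL (bal_pull_right hH hΓ hF X)]
  simp only [hΓ.one_right]
  rw [← map_sw_left (φ := F) _ _ hl, hH.trans_counit]

include hH hW in
/-- `P₍[1]₎ ⊗ P₍[2]₎ ·_Γ Q = X ⊗ 1`, where `Q ⊗ P` is the twisted coaction of `X` for
`X ↦ X₋ ⋄ X₊`. -/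
theorem tco_inv_comul {f : L → L → V} (hf : H.TBal Γ H.lactL H.comulLift f) (X : L) :
    sw (H.tco Γ H.lactI H.invLift X) (fun Q P => sw (H.tco Γ H.lactL H.comulLift P)
      (fun u v => f u ((H.twist Γ).mulL v Q))) = f X H.oneL := by
  have hb := hH.bialgebroid
  have hΓ := hW.cocycle
  have hR := hb.isCom_regular
  let F : L → L → V := fun x m => H.push Γ H.lactL H.comulLift f x m
  have hF : H.DBal H.lactL F := bal_push hf
  have hl := hF.left
  have hr := hF.right
  -- the inner sum, by `tco_star`
  have e1 : ∀ Q P, sw (H.tco Γ H.lactL H.comulLift P) (fun u v => f u ((H.twist Γ).mulL v Q)) =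
      sw (H.comulLift P) (fun a c => F a (H.bull Γ c Q)) := fun Q P => by
    have hD : ∀ a' c' : L, H.DBal H.lactL (fun a c => F a (H.bull Γ c c')) := fun a' c' =>
      ⟨by fun_prop, by fun_prop, fun b a c => by
        rw [hF.bal, lactL_apply, lactL_apply, hH.src_mul_bull hΓ]⟩
    have e2 := tco_star hH hW hR P (h := fun p Z c => sw (H.comulLift Q) (fun a' c' =>
      F (p ⬝ 𝐭 (Γ Z a')) (H.bull Γ c c'))) (by fun_prop) (by fun_prop) (by fun_prop)
      (fun b x y m => by simp only [hΓ.bar_linear, hb.tgt_mul, hb.mulL_assoc])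
      (fun b x y m => by simp only [hb.mulL_assoc, hF.bal, lactL_apply, hH.src_mul_bull hΓ])
    refine Eq.trans (sw_congr _ fun u v => ?_) (e2.trans ?_)
    · rw [← pull_push hW hR hf, pull, sw_comm (H.transLift u),
        hH.comul_dot hΓ (bal_pull_right hH hΓ hF u)]
      simp only [hb.cocycle' hΓ]
      exact (sw_congr _ fun a c => sw_comm _ _ _).trans (sw_comm _ _ _)
    · simp only [hΓ.one_left]
      rw [sw_comm]
      have e3 : ∀ a' c' : L, sw (H.comulLift P) (fun a c => F (a ⬝ 𝐭 (H.counit a')) (H.bull Γ c c')) =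
          sw (H.comulLift P) (fun a c => F a (H.bull Γ c (𝐬 (H.counit a') ⬝ c'))) := fun a' c' => by
        rw [hb.comul_takeuchi (hD a' c')]
        simp only [hH.mul_src_bull hΓ]
      simp only [e3]
      rw [sw_comm]
      refine sw_congr _ fun a c => ?_
      rw [← map_sw (φ := fun z => F a (H.bull Γ c z)) _ (fun a' c' => 𝐬 (H.counit a') ⬝ c')
        (by fun_prop), hb.comul_counit_left]
  have hG : H.DBal H.lactI (fun y p => sw (H.comulLift p) (fun u v => F u (v ⬝ y))) :=
    ⟨by fun_prop, by fun_prop, fun b y p => by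
      rw [lactI_apply, hb.comul_mul_tgt]
      · simp only [hb.mulL_assoc]
      · exact ⟨by fun_prop, by fun_prop, fun b u v => by
          rw [hF.bal, lactL_apply, lactL_apply, hb.mulL_assoc]⟩⟩
  -- the outer sum is `J` of the twisted coaction, that is `X₋ ⋄ X₊`
  have e4 := tco_pull hW hH.isCom_inv X hG
  rw [sw_invLift _ (by fun_prop) (by fun_prop), hH.trans_comul hF] at e4
  simp only [e1]
  rw [← pull_push hW hR hf, pull_oneL_right hH hΓ hF]
  refine Eq.trans (sw_congr _ fun Q P => ?_) e4
  unfold pull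
  have e5 : ∀ a c, F a (H.bull Γ c Q) = sw (H.transLift c) (fun p q => sw (H.transLift Q)
      (fun r s => F a ((p ⬝ r) ⬝ 𝐭 (Γ s q)))) := fun a c => by
    rw [bull_apply, map_sw (φ := F a) _ _ (hr a)]
    exact sw_congr _ fun p q => map_sw (φ := F a) _ _ (hr a)
  simp only [e5]
  rw [← hH.trans_comul_comm (f := fun a p q => sw (H.transLift Q)
      (fun r s => F a ((p ⬝ r) ⬝ 𝐭 (Γ s q)))) (by fun_prop) (by fun_prop) (by fun_prop)
      (fun b a p q => by simp only [hF.bal, lactL_apply, hb.mulL_assoc])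
      (fun b a p q => by
        have := hH.trans_takeuchi (g := fun r s => F a ((p ⬝ r) ⬝ 𝐭 (Γ s q))) ⟨by fun_prop,
          by fun_prop, fun b r s => by simp only [hΓ.bar_linear, hb.tgt_mul, hb.mulL_assoc]⟩ b Q
        simpa only [hb.mulL_assoc, hΓ.balanced] using this)]
  refine Eq.trans ?_ (sw_congr _ fun r s =>
    (sw_invLift (H := H) (k := k) P (f := fun b a => sw (H.comulLift a) (fun u v =>
      F u (v ⬝ (r ⬝ 𝐭 (Γ s b))))) (by fun_prop) (by fun_prop)).symm)
  rw [sw_comm (H.transLift Q)]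
  refine sw_congr _ fun p q => ?_
  rw [sw_comm]
  simp only [hb.mulL_assoc]

include hH hW in
/-- `Q ·_Γ X₍[2]₎ ⊗ P = 1 ⊗ X`, where `Q ⊗ P` is the twisted coaction of `X₍[1]₎` for
`X ↦ X₋ ⋄ X₊`. -/
theorem tco_comul_inv {g : L → L → V} (hg : H.TBal Γ H.lactI H.invLift g) (X : L) :
    sw (H.tco Γ H.lactL H.comulLift X) (fun x y => sw (H.tco Γ H.lactI H.invLift x)
      (fun Q P => g ((H.twist Γ).mulL Q y) P)) = g H.oneL X := by
  have hb := hH.bialgebroid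
  have hΓ := hW.cocycle
  have hR := hb.isCom_regular
  have hI := hH.isCom_inv
  let F : L → L → V := fun x m => H.push Γ H.lactI H.invLift g x m
  have hF : H.DBal H.lactI F := bal_push hg
  have hl := hF.left
  have hr := hF.right
  -- the inner sum, by `tco_star`
  have e1 : ∀ x y, sw (H.tco Γ H.lactI H.invLift x) (fun Q P => g ((H.twist Γ).mulL Q y) P) =
      sw (H.transLift x) (fun p q => F (H.star Γ q y) p) := fun x y => by
    have e2 := tco_star hH hW hI x (h := fun p Z v => sw (H.transLift y) (fun r s =>
      F (H.star Γ p r ⬝ 𝐭 (Γ s Z)) v)) (by fun_prop) (by fun_prop) (by fun_prop)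
      (fun b p Z v => by
        have := hH.trans_takeuchi (g := fun r s => F (H.star Γ p r ⬝ 𝐭 (Γ s Z)) v) ⟨by fun_prop,
          by fun_prop, fun b r s => by
            simp only [hb.star_mul_tgt hΓ, hΓ.bar_linear, hb.tgt_mul, hb.mulL_assoc]⟩ b y
        simpa only [hb.mul_tgt_star hΓ, hΓ.balanced] using this)
      (fun b p Z v => by simp only [hb.tgt_mul_star hΓ, hb.mulL_assoc, hF.bal])
    refine Eq.trans (sw_congr _ fun Q P => ?_) (e2.trans ?_)
    · rw [← pull_push hW hI hg, pull, hH.trans_dot hΓ (bal_pull_left hH hΓ hF P)]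
      simp only [hb.cocycle' hΓ]
      exact sw_congr _ fun p q => sw_comm _ _ _
    · rw [sw_invLift _ (by fun_prop) (by fun_prop)]
      refine sw_congr _ fun p q => ?_
      simp only [hΓ.one_right, ← hb.star_mul_tgt hΓ]
      rw [← map_sw (φ := fun z => F (H.star Γ q z) p) _ (fun r s => r ⬝ 𝐭 (H.counit s))
        (by fun_prop), hH.trans_counit]
  -- the outer sum, again by `tco_star`
  have e3 := tco_star hH hW hR X (h := fun p Z v => F Z (𝐭 (H.counit v) ⬝ p)) (by fun_prop)
    (by fun_prop) (by fun_prop)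
    (fun b x y m => by rw [hF.bal, lactI_apply, hb.mulL_assoc])
    (fun b x y m => by rw [lactL_apply, hb.counit_src_mul, hb.tgt_mul, hb.mulL_assoc])
  rw [← map_sw (φ := fun z => F H.oneL z) _ (fun x y => 𝐭 (H.counit y) ⬝ x) (by fun_prop),
    hb.comul_counit_right] at e3
  rw [← pull_push hW hI hg, pull_oneL_left hH hΓ hI hF]
  refine Eq.trans (sw_congr _ fun x y => ?_) e3
  rw [e1]
  conv_lhs => rw [← hb.comul_counit_right y]
  have e4 : ∀ p q, F (H.star Γ q (sw (H.comulLift y) fun u v => 𝐭 (H.counit v) ⬝ u)) p =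
      sw (H.comulLift y) (fun u v => F (H.star Γ (q ⬝ 𝐭 (H.counit v)) u) p) := fun p q => by
    rw [map_sw (φ := fun y => F (H.star Γ q y) p) _ _ (by fun_prop)]
    simp only [hb.mul_tgt_star hΓ]
  simp only [e4]
  rw [sw_comm, sw_comm (H.transLift x)]
  refine sw_congr _ fun u v => ?_
  exact (hH.trans_takeuchi (g := fun p q => F (H.star Γ q u) p) ⟨by fun_prop,
    by fun_prop, fun c p q => by
      simp only [hb.tgt_mul_star hΓ, hF.bal, lactI_apply]⟩ _ x).symm

include hH hΓ in
theorem BBal.tBal {g : L → L → V} (hg : (H.twist Γ).BBal g) :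
    H.TBal Γ H.lactI H.invLift (fun x y => g y x) :=
  ⟨hg.right, hg.left, fun b x y => by
    rw [tla_inv hH hΓ, ← hH.tgt_dot hΓ, ← hH.dot_tgt hΓ]
    exact (hg.bal b y x).symm⟩

include hH hW in
theorem tco_inv_comul_twist {f : L → L → V} (hf : (H.twist Γ).DBal (H.twist Γ).lactL f) (X : L) :
    sw (TensorProduct.comm k L L (H.tco Γ H.lactI H.invLift X)) (fun x y =>
      sw ((H.twist Γ).comulLift x) (fun u v => f u ((H.twist Γ).mulL v y))) = f X H.oneL := by
  have hΓ := hW.cocycle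
  have hl := hf.left
  have hr := hf.right
  refine (sw_swap (k := k) _ (by fun_prop) (by fun_prop)).trans ?_
  have hf' := hf
  rw [twist_lactL hH hΓ] at hf'
  refine Eq.trans (sw_congr _ fun Q P => ?_) (tco_inv_comul hH hW (DBal.tBal hH hΓ hf') X)
  refine sw_comul_twist hH hW ⟨by fun_prop, by fun_prop, fun b u v => ?_⟩ P
  exact (hf.bal _ _ _).trans (congrArg (f u) (hH.dot_assoc hΓ _ _ _).symm)

include hH hW in
/-- The twist of a Hopf algebroid is a Hopf algebroid; the translation map is given by the twisted
coaction of `L` with the coaction `X ↦ X₋ ⋄ X₊`. -/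
theorem isLeftHopfAlgebroid_twist : (H.twist Γ).IsLeftHopfAlgebroid := by
  have hΓ := hW.cocycle
  have hI := hH.isCom_inv
  have h1 := isLeftBialgebroid_twist hH hW
  have t3 : ∀ {V : Type u} [AddCommGroup V] [Module k V] {g : L → L → V}, (H.twist Γ).BBal g →
      ∀ b X, sw (H.tco Γ H.lactI H.invLift ((H.twist Γ).mulL (𝐭 b) X)) (fun x y => g y x) =
        sw (H.tco Γ H.lactI H.invLift X) (fun x y => g y ((H.twist Γ).mulL x (𝐬 b))) :=
    fun {V _ _ g} hg b X => by
      have := tco_tra hH hW hI (BBal.tBal hH hΓ hg) b X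
      rw [tra_inv hH hΓ, ← hH.tgt_dot hΓ] at this
      simp only [← hH.dot_src hΓ] at this
      exact this
  refine h1.isLeftHopfAlgebroid
    ((TensorProduct.comm k L L).toLinearMap ∘ₗ H.tco Γ H.lactI H.invLift)
    (fun {V _ _ f} hf X => tco_inv_comul_twist hH hW hf X) (fun {V _ _ g} hg X => ?_)
    (fun {V _ _ g} hg b X => ?_)
  · have hl := hg.left
    have hr := hg.right
    have hB : ∀ y, (H.twist Γ).BBal (fun p q => g p ((H.twist Γ).mulL q y)) := fun y =>
      ⟨by fun_prop, by fun_prop, fun b p q =>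
        (hg.bal b p _).trans (congrArg (g p) (hH.dot_assoc hΓ _ _ _).symm)⟩
    refine Eq.trans (sw_congr _ fun x y => sw_swap (k := k) (H.tco Γ H.lactI H.invLift x)
      (by fun_prop) (by fun_prop)) ?_
    rw [sw_comul_twist hH hW (g := fun x y => sw (H.tco Γ H.lactI H.invLift x)
      (fun Q P => g P ((H.twist Γ).mulL Q y)))]
    · exact tco_comul_inv hH hW (BBal.tBal hH hΓ hg) X
    · refine ⟨by fun_prop, by fun_prop, fun b x y => (t3 (hB y) b x).trans ?_⟩
      simp only [hH.dot_assoc hΓ]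
      rfl
  · have hl := hg.left
    have hr := hg.right
    refine (sw_swap (k := k) _ (by fun_prop) (by fun_prop)).trans (Eq.trans ?_
      (sw_swap (k := k) (H.tco Γ H.lactI H.invLift X) (by fun_prop) (by fun_prop)).symm)
    exact t3 hg b X

include hH hW in
theorem sw_trans_twist {g : L → L → V} (hg : (H.twist Γ).BBal g) (X : L) :
    sw ((H.twist Γ).transLift X) g = sw (H.tco Γ H.lactI H.invLift X) (fun x y => g y x) :=
  ((isLeftHopfAlgebroid_twist hH hW).trans_eq (fun hf => tco_inv_comul_twist hH hW hf X) hg).trans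
    (sw_swap (k := k) (H.tco Γ H.lactI H.invLift X) hg.left hg.right)

end

end

/-! ### Invertible cocycles -/

section

variable (H Γ) in
/-- `Γ^# : M ⊗_{B^Γ} N → M ⊗_B N` is invertible. -/
def SharpIso (laM raM : B →ₗ[k] M →ₗ[k] M) (d : M →ₗ[k] L ⊗[k] M) (laN : B →ₗ[k] N →ₗ[k] N)
    (e : N →ₗ[k] L ⊗[k] N) : Prop :=
  InducesIso ((balancedRel k (fun b m => raM b m) (fun b n => laN b n)).mkQ ∘ₗ sharp Γ d e laM)
    (balancedRel k (fun b m => H.tra Γ laM d b m) (fun b n => H.tla Γ laN e b n))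

section
variable (hH : H.IsLeftHopfAlgebroid) (hb : H.IsLeftBialgebroid) (hΓ : H.IsTwoCocycle Γ)
  (hM : H.IsCom laM raM d) (hN : H.IsCom laN raN e)

omit [AddCommGroup N] [Module k N] in
include hΓ hM in
theorem bal_sharp_left {φ : M → V} (hφ : IsLin k φ) (y : L) :
    H.DBal laM (fun x m' => φ (laM (Γ x y) m')) :=
  ⟨by fun_prop, by fun_prop, fun b x m => by rw [hΓ.bar_linear, hM.la_mul]⟩

include hΓ hM in
theorem bal_sharp_right {f : M → N → V}
    (hf : Bal (k := k) (fun (b : B) m => raM b m) (fun (b : B) n => laN b n) f) (m : M) :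
    H.DBal laN (fun y n' => sw (d m) (fun x m' => f (laM (Γ x y) m') n')) := by
  have hl := hf.left
  have hr := hf.right
  refine ⟨by fun_prop, by fun_prop, fun b y n => ?_⟩
  have := hM.tak (bal_sharp_left hΓ hM (hl n) y) b m
  simpa only [hΓ.balanced, hM.la_ra, hf.bal] using this

include hΓ hM hN in
theorem sw_sharp_congr {d' : M →ₗ[k] L ⊗[k] M} {e' : N →ₗ[k] L ⊗[k] N}
    (hd : ∀ {V : Type u} [AddCommGroup V] [Module k V] {f : L → M → V}, H.DBal laM f → ∀ m,
      sw (d' m) f = sw (d m) f)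
    (he : ∀ {V : Type u} [AddCommGroup V] [Module k V] {f : L → N → V}, H.DBal laN f → ∀ n,
      sw (e' n) f = sw (e n) f)
    {f : M → N → V}
    (hf : Bal (k := k) (fun (b : B) m => raM b m) (fun (b : B) n => laN b n) f) (z : M ⊗[k] N) :
    sw (sharp Γ d' e' laM z) f = sw (sharp Γ d e laM z) f := by
  have hl := hf.left
  have hr := hf.right
  rw [sw_sharp _ _ _ _ _ hl hr, sw_sharp _ _ _ _ _ hl hr]
  refine sw_congr _ fun m n => ?_
  rw [sw_comm, sw_comm (d m)]
  have h1 : ∀ y n', sw (d' m) (fun x m' => f (laM (Γ x y) m') n') =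
      sw (d m) (fun x m' => f (laM (Γ x y) m') n') := fun y n' =>
    hd (bal_sharp_left hΓ hM (hl n') y) m
  simp only [h1]
  exact he (bal_sharp_right hΓ hM hf m) n

include hb hΓ hM hN in
/-- The invertibility of `Γ^#` does not depend on the lifts of the coactions. -/
theorem sharpIso_iff_of_lifts {d' : M →ₗ[k] L ⊗[k] M} {e' : N →ₗ[k] L ⊗[k] N}
    (hd : ∀ {V : Type u} [AddCommGroup V] [Module k V] {f : L → M → V}, H.DBal laM f → ∀ m,
      sw (d' m) f = sw (d m) f)
    (he : ∀ {V : Type u} [AddCommGroup V] [Module k V] {f : L → N → V}, H.DBal laN f → ∀ n,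
      sw (e' n) f = sw (e n) f) :
    H.SharpIso Γ laM raM d' laN e' ↔ H.SharpIso Γ laM raM d laN e := by
  have h1 : (balancedRel k (fun b m => raM b m) (fun b n => laN b n)).mkQ ∘ₗ sharp Γ d' e' laM =
      (balancedRel k (fun b m => raM b m) (fun b n => laN b n)).mkQ ∘ₗ sharp Γ d e laM :=
    LinearMap.ext fun z => mkQ_eq_of_sw (sw_sharp_congr hΓ hM hN hd he bal_mkQ z)
  have h2 : (fun b m => H.tra Γ laM d' b m) = fun b m => H.tra Γ laM d b m :=
    funext₂ fun b m => hd (bal_tra hb hΓ hM _) m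
  have h3 : (fun b m => H.tla Γ laN e' b m) = fun b m => H.tla Γ laN e b m :=
    funext₂ fun b m => he (bal_tla' hb hΓ hN b) m
  rw [SharpIso, SharpIso, h1, h2, h3]

theorem Comodule.twLact_eq (C : H.Comodule M) :
    C.twLact Γ = fun b m => H.tla Γ C.lact C.coactLift b m :=
  funext₂ fun b m => map_eq_sw (TensorProduct.lift C.lact ∘ₗ
    TensorProduct.map (Γ (H.src b)) LinearMap.id) (C.coactLift m)

theorem Comodule.twRact_eq (C : H.Comodule M) :
    C.twRact Γ = fun b m => H.tra Γ C.lact C.coactLift b m :=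
  funext₂ fun b m => map_eq_sw (TensorProduct.lift C.lact ∘ₗ
    TensorProduct.map (Γ.flip (H.src b)) LinearMap.id) (C.coactLift m)

/-- The invertibility of `Γ^#` for comodules given by a lift of the coaction. -/
theorem IsInvertibleTwoCocycle.sharpIso (hΓ : H.IsInvertibleTwoCocycle Γ)
    (hb : H.IsLeftBialgebroid) (hM : H.IsCom laM raM d) (hN : H.IsCom laN raN e) :
    H.SharpIso Γ laM raM d laN e := by
  have h := hΓ.sharp_iso M N (hM.toComodule hb) (hN.toComodule hb)
  rw [Comodule.twLact_eq, Comodule.twRact_eq] at h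
  exact (sharpIso_iff_of_lifts hb hΓ.isTwoCocycle hM hN (fun hf m => hM.toComodule_coactLift hb hf m)
    (fun hf m => hN.toComodule_coactLift hb hf m)).1 h

theorem IsTwoCocycle.isInvertible (hΓ : H.IsTwoCocycle Γ) (hb : H.IsLeftBialgebroid)
    (h : ∀ {M N : Type u} [AddCommGroup M] [Module k M] [AddCommGroup N] [Module k N]
      {laM raM : B →ₗ[k] M →ₗ[k] M} {d : M →ₗ[k] L ⊗[k] M} {laN raN : B →ₗ[k] N →ₗ[k] N}
      {e : N →ₗ[k] L ⊗[k] N}, H.IsCom laM raM d → H.IsCom laN raN e →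
      H.SharpIso Γ laM raM d laN e) : H.IsInvertibleTwoCocycle Γ where
  isTwoCocycle := hΓ
  sharp_iso M N _ _ _ _ C D := by
    rw [Comodule.twLact_eq, Comodule.twRact_eq]
    exact h (C.isCom hb) (D.isCom hb)

include hH in
/-- An invertible cocycle is weakly invertible: take `M = L` with the coaction `X ↦ X₋ ⋄ X₊`. -/
theorem IsInvertibleTwoCocycle.wInv (hΓ : H.IsInvertibleTwoCocycle Γ) : H.WInv Γ where
  cocycle := hΓ.isTwoCocycle
  iso hM := by
    have h := hΓ.sharpIso hH.bialgebroid hH.isCom_inv hM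
    have e : (fun b X => H.tra Γ H.lactI H.invLift b X) = fun b X => H.bull Γ (𝐭 b) X :=
      funext₂ fun b X => tra_inv hH hΓ.isTwoCocycle b X
    rw [SharpIso, e] at h
    exact h

include hb hM in
theorem sw_counit_mul_coact {f : M → N → V}
    (hf : Bal (k := k) (fun (b : B) m => raM b m) (fun (b : B) n => laN b n) f) (v : L) (m : M)
    (n : N) : sw (d m) (fun u m' => f (laM (H.counit (u ⬝ v)) m') n) =
      f m (laN (H.counit v) n) := by
  have hl := hf.left
  have hr := hf.right
  have hC : H.DBal laM (fun u m' => f (laM (H.counit u) m') n) :=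
    ⟨by fun_prop, by fun_prop, fun b u m' => by rw [hb.counit_tgt_mul, hM.la_mul]⟩
  have e : ∀ u, H.counit (u ⬝ v) = H.counit (u ⬝ 𝐭 (H.counit v)) := fun u =>
    hb.counit_mul_tgt u v
  simp only [e]
  refine (hM.tak hC _ m).trans ?_
  simp only [hM.la_ra, hf.bal]
  rw [← map_sw (φ := fun z => f z (laN (H.counit v) n)) _ _ (by fun_prop), hM.counit]

end

end

/-! ### The inverse cocycle -/

section

section
variable (hH : H.IsLeftHopfAlgebroid) (hW : H.WInv Γ)
  (hM : H.IsCom laM raM d) (hN : H.IsCom laN raN e)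

theorem cocycleInv_apply_sw (X Y : L) : H.cocycleInv Γ X Y = sw (H.transLift X) (fun p q =>
    sw (H.transLift Y) (fun r s => Γ (p ⬝ r) (H.star Γ s q))) := by
  have e1 : H.cocycleInv Γ X Y = TensorProduct.lift Γ (TensorProduct.map H.mulT
      (H.leftTwist Γ ∘ₗ (TensorProduct.comm k L L).toLinearMap)
      (exch (H.transLift X ⊗ₜ[k] H.transLift Y))) := rfl
  rw [e1, sw_exch, map_sw (φ := TensorProduct.lift Γ) _ _ (by fun_prop)]
  refine sw_congr _ fun a b => ?_
  rw [map_sw (φ := TensorProduct.lift Γ) _ _ (by fun_prop)]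
  rfl

include hH in
/-- The inverse cocycle is `(X, Y) ↦ ε^Γ(X • Y)`. -/
theorem cocycleInv_apply (hΓ : H.IsTwoCocycle Γ) (X Y : L) :
    H.cocycleInv Γ X Y = (H.twist Γ).counit (H.bull Γ X Y) := by
  rw [cocycleInv_apply_sw, counit_twist_apply, hH.trans_bull hΓ hΓ.bBal]

include hH hW in
/-- `Δ^Γ(X • Y) = X₍[1]₎ • Y₍[1]₎ ⊗ X₍[2]₎ ·_Γ Y₍[2]₎` -/
theorem comul_twist_bull {f : L → L → V} (hf : (H.twist Γ).DBal (H.twist Γ).lactL f) (X Y : L) :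
    sw ((H.twist Γ).comulLift (H.bull Γ X Y)) f = sw ((H.twist Γ).comulLift X)
      (fun x x' => sw ((H.twist Γ).comulLift Y)
        (fun y y' => f (H.bull Γ x y) ((H.twist Γ).mulL x' y'))) := by
  have hb := hH.bialgebroid
  have hΓ := hW.cocycle
  have hb1 := isLeftBialgebroid_twist hH hW
  have hR := hb.isCom_regular
  have hA := hH.dot_assoc hΓ
  have hl := hf.left
  have hr := hf.right
  have hbal : ∀ c x y, f (H.bull Γ (𝐭 c) x) y = f x ((H.twist Γ).mulL (𝐬 c) y) := fun c x y => by
    rw [← hH.tgt_dot hΓ]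
    exact hf.bal c x y
  have hD : ∀ y y', (H.twist Γ).DBal (H.twist Γ).lactL (fun x x' => f (H.bull Γ x y)
      ((H.twist Γ).mulL x' y')) := fun y y' => ⟨by fun_prop, by fun_prop, fun c x x' => by
    refine Eq.trans (congrArg (fun z => f (H.bull Γ z y) _) (hH.tgt_dot hΓ c x)) ?_
    rw [hH.bull_assoc hΓ, hbal]
    exact congrArg (f _) (hA _ _ _).symm⟩
  have hf' : H.TBal Γ H.lactL H.comulLift f := by
    rw [twist_lactL hH hΓ] at hf
    exact DBal.tBal hH hΓ hf
  have e1 := (hH.isPairing_bull hΓ).tco_bull hH hW hR hR hR hf' X Y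
  rw [← dot_eq_twp] at e1
  rw [sw_comul_twist hH hW hf, e1, sw_comm, sw_comm ((H.twist Γ).comulLift X),
    sw_comul_twist hH hW (g := fun y y' => sw ((H.twist Γ).comulLift X)
      (fun x x' => f (H.bull Γ x y) ((H.twist Γ).mulL x' y')))]
  · exact sw_congr _ fun y y' => (sw_comul_twist hH hW (hD y y') X).symm
  · refine ⟨by fun_prop, by fun_prop, fun c y y' => ?_⟩
    have e2 := hb1.comul_takeuchi (hD y y') c X
    refine Eq.trans (sw_congr _ fun x x' => ?_) (e2.trans (sw_congr _ fun x x' => ?_))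
    · refine congrArg (f · _) ?_
      refine Eq.trans (congrArg (H.bull Γ x) (hH.tgt_dot hΓ c y)) ?_
      rw [← hH.bull_assoc hΓ]
      exact congrArg (H.bull Γ · y) (hH.dot_tgt hΓ c x).symm
    · exact congrArg (f _) (hA _ _ _)

include hH hW in
/-- The left twist of `L^Γ` by the inverse cocycle is the right twist of `L`. -/
theorem star_cocycleInv : (H.twist Γ).star (H.cocycleInv Γ) = H.bull Γ := by
  have hb1 := isLeftBialgebroid_twist hH hW
  refine LinearMap.ext₂ fun X Y => ?_
  rw [star_apply, ← hb1.comul_counit_left (H.bull Γ X Y), comul_twist_bull hH hW]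
  · refine sw_congr _ fun x x' => sw_congr _ fun y y' => ?_
    rw [cocycleInv_apply hH hW.cocycle]
  · exact ⟨by fun_prop, by fun_prop, fun b x y => by
      rw [hb1.counit_tgt_mul, hb1.src_mul, lactL_apply, hb1.mulL_assoc]⟩

include hH hW in
/-- Since `Γ⁻¹ = ε^Γ ∘ •` and the left twist by `Γ⁻¹` is `•`, the cocycle identity is the
associativity of `•`. -/
theorem isTwoCocycle_cocycleInv : (H.twist Γ).IsTwoCocycle (H.cocycleInv Γ) := by
  have hΓ := hW.cocycle
  have hb1 := isLeftBialgebroid_twist hH hW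
  have hc := cocycleInv_apply hH hΓ
  have hs : ∀ X Y, (H.twist Γ).leftTwist (H.cocycleInv Γ) (X ⊗ₜ Y) = H.bull Γ X Y := fun X Y =>
    LinearMap.congr_fun₂ (star_cocycleInv hH hW) X Y
  refine ⟨fun b X Y => ?_, fun b X Y => ?_, fun X Y Z => ?_, fun X => ?_, fun X => ?_⟩
  · have e1 : (H.twist Γ).mulL X ((H.twist Γ).tgt b) = _ := hH.dot_tgt hΓ b X
    have e2 : (H.twist Γ).mulL ((H.twist Γ).tgt b) Y = _ := hH.tgt_dot hΓ b Y
    rw [hc, hc, e1, e2, hH.bull_assoc hΓ]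
  · have e1 : ∀ Y, (H.twist Γ).mulL ((H.twist Γ).tgt b) Y = _ := hH.tgt_dot hΓ b
    rw [hc, hc, ← hb1.counit_tgt_mul, e1, e1, hH.bull_assoc hΓ]
  · rw [hs, hs, hc, hc, hH.bull_assoc hΓ]
  · exact (hc _ _).trans (congrArg _ (hH.oneL_bull hΓ X))
  · exact (hc _ _).trans (congrArg _ (hH.bull_oneL hΓ X))

include hH hW hM hN in
/-- `Γ^# ∘ (Γ⁻¹)^# = id`. -/
theorem tco_cocycleInv {f : M → N → V}
    (hf : Bal (k := k) (fun (b : B) m => raM b m) (fun (b : B) n => laN b n) f) (m : M) (n : N) :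
    sw (H.tco Γ laM d m) (fun x m' => sw (H.tco Γ laN e n) (fun y n' =>
      sw (d (H.tla Γ laM d (H.cocycleInv Γ x y) m')) (fun u m'' => sw (e n') (fun v n'' =>
        f (laM (Γ u v) m'') n'')))) = f m n := by
  have hb := hH.bialgebroid
  have hΓ := hW.cocycle
  have hl := hf.left
  have hr := hf.right
  have hs : ∀ x y, 𝐬 (H.cocycleInv Γ x y) = sw (H.transLift x) (fun p q => sw (H.transLift y)
      (fun r s => H.star Γ (p ⬝ r) (H.star Γ s q))) := fun x y => by
    rw [cocycleInv_apply hH hΓ, counit_twist_apply, ← hH.trans_star hΓ, hH.trans_bull hΓ]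
    exact ⟨by fun_prop, by fun_prop, fun b p q => hb.mul_tgt_star hΓ b p q⟩
  have hA := hb.star_assoc hΓ
  -- the first use of `tco_star`, for `M`
  have e1 : ∀ y n', sw (H.tco Γ laM d m) (fun x m' =>
      sw (d (H.tla Γ laM d (H.cocycleInv Γ x y) m')) (fun u m'' => sw (e n') (fun v n'' =>
        f (laM (Γ u v) m'') n''))) = sw (d m) (fun u m' => sw (H.transLift y) (fun r s =>
        sw (e n') (fun v n'' => f (laM (Γ (u ⬝ r) (H.star Γ s v)) m') n''))) := fun y n' => by
    have := tco_star hH hW hM m (h := fun p Z w => sw (H.transLift y) (fun r s =>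
      sw (e n') (fun v n'' => f (laM (Γ (p ⬝ r) (H.star Γ (H.star Γ s Z) v)) w) n'')))
      (by fun_prop) (by fun_prop) (by fun_prop) (fun b p Z w => ?_) (fun b p Z w => ?_)
    · refine Eq.trans (sw_congr _ fun x m' => ?_) (this.trans (sw_congr _ fun u m' => ?_))
      · rw [coact_tla hb hΓ hM (f := fun u m'' => sw (e n') (fun v n'' =>
          f (laM (Γ u v) m'') n''))]
        · have e3 : ∀ u m'', sw (e n') (fun v n'' => f (laM (Γ (H.star Γ
              (𝐬 (H.cocycleInv Γ x y)) u) v) m'') n'') = sw (H.transLift x) (fun p q =>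
              sw (H.transLift y) (fun r s => sw (e n') (fun v n'' =>
                f (laM (Γ (p ⬝ r) (H.star Γ (H.star Γ s (H.star Γ q u)) v)) m'') n''))) :=
            fun u m'' => by
              have e4 : ∀ v n'', f (laM (Γ (H.star Γ (𝐬 (H.cocycleInv Γ x y)) u) v) m'') n'' =
                sw (H.transLift x) (fun p q => sw (H.transLift y) (fun r s =>
                  f (laM (Γ (p ⬝ r) (H.star Γ (H.star Γ s (H.star Γ q u)) v)) m'') n'')) :=
                fun v n'' => by
                  rw [hs, map_sw (φ := fun z => f (laM (Γ (H.star Γ z u) v) m'') n'') _ _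
                    (by fun_prop)]
                  refine sw_congr _ fun p q => ?_
                  rw [map_sw (φ := fun z => f (laM (Γ (H.star Γ z u) v) m'') n'') _ _
                    (by fun_prop)]
                  simp only [hb.cocycle' hΓ, hA]
              simp only [e4]
              rw [sw_comm]
              exact sw_congr _ fun p q => sw_comm _ _ _
          simp only [e3]
          rw [sw_comm]
        · refine ⟨by fun_prop, by fun_prop, fun b u m'' => sw_congr _ fun v n'' => ?_⟩
          rw [hΓ.bar_linear, hM.la_mul]
      · simp only [hb.star_oneL hΓ]
    · have := hH.trans_takeuchi (g := fun r s => sw (e n') (fun v n'' =>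
        f (laM (Γ (p ⬝ r) (H.star Γ (H.star Γ s Z) v)) w) n'')) ⟨by fun_prop, by fun_prop,
          fun b r s => sw_congr _ fun v n'' => by
            rw [← hb.mulL_assoc, hΓ.balanced, hb.tgt_mul_star hΓ, hb.tgt_mul_star hΓ]⟩ b y
      simpa only [hb.mulL_assoc, hb.mul_tgt_star hΓ] using this
    · simp only [hb.mulL_assoc, hΓ.bar_linear, hM.la_mul]
  -- the second use, for `N`
  have e2 := tco_star hH hW hN n (h := fun p Z w => sw (d m) (fun u m' =>
    f (laM (Γ (u ⬝ p) Z) m') w)) (by fun_prop) (by fun_prop) (by fun_prop)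
    (fun b p Z w => by simp only [← hb.mulL_assoc, hΓ.balanced])
    (fun b p Z w => by
      have hD' : H.DBal laM (fun u m' => f (laM (Γ (u ⬝ p) Z) m') w) :=
        ⟨by fun_prop, by fun_prop, fun b u m' => by rw [hb.mulL_assoc, hΓ.bar_linear, hM.la_mul]⟩
      have := hM.tak hD' b m
      simpa only [hb.mulL_assoc, hM.la_ra, hf.bal] using this)
  rw [sw_comm]
  simp only [e1]
  refine Eq.trans (sw_congr _ fun y n' => ?_) (e2.trans ?_)
  · rw [sw_comm]
    exact sw_congr _ fun r s => sw_comm _ _ _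
  · simp only [hΓ.one_right, sw_counit_mul_coact hb hM hf]
    rw [← map_sw (φ := f m) _ _ (by fun_prop), hN.counit]

end

end

/-! ### The trivial cocycle -/

section

/-- Two bialgebroid structures agree if their coproducts agree on representatives. -/
theorem ext_of_toDiamond {H H' : BialgebroidData k B L} (h1 : H.mulB = H'.mulB)
    (h2 : H.oneB = H'.oneB) (h3 : H.mulL = H'.mulL) (h4 : H.oneL = H'.oneL) (h5 : H.src = H'.src)
    (h6 : H.tgt = H'.tgt) (h7 : H.counit = H'.counit)
    (h8 : ∀ X, H.comul X = H.toDiamond (H'.comulLift X)) : H = H' := by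
  obtain ⟨mB, oB, mL, oL, s, t, Δ, ε⟩ := H
  obtain ⟨mB', oB', mL', oL', s', t', Δ', ε'⟩ := H'
  dsimp only at h1 h2 h3 h4 h5 h6 h7
  subst h1 h2 h3 h4 h5 h6 h7
  congr 1
  exact LinearMap.ext fun X => (h8 X).trans
    (toDiamond_comulLift (H := ⟨mB, oB, mL, oL, s, t, Δ', ε⟩) X)

section
variable (hH : H.IsLeftHopfAlgebroid) (hb : H.IsLeftBialgebroid)
  (hM : H.IsCom laM raM d) (hN : H.IsCom laN raN e)

theorem trivialCocycle_apply (X Y : L) : H.trivialCocycle X Y = H.counit (X ⬝ Y) := rfl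

include hb in
theorem star_trivialCocycle (X Y : L) : H.star H.trivialCocycle X Y = X ⬝ Y := by
  rw [star_apply]
  simp only [trivialCocycle_apply]
  rw [← hb.comul_mul' (f := fun x y => 𝐬 (H.counit x) ⬝ y), hb.comul_counit_left]
  exact ⟨by fun_prop, by fun_prop, fun b x y => by
    rw [hb.counit_tgt_mul, hb.src_mul, lactL_apply, hb.mulL_assoc]⟩

include hH in
theorem bull_trivialCocycle (X Y : L) : H.bull H.trivialCocycle X Y = X ⬝ Y := by
  have hb := hH.bialgebroid
  rw [bull_apply]
  simp only [trivialCocycle_apply]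
  rw [← hH.trans_mul (g := fun p q => p ⬝ 𝐭 (H.counit q)), hH.trans_counit]
  exact ⟨by fun_prop, by fun_prop, fun b p q => by
    rw [hb.counit_tgt_mul, hb.tgt_mul, hb.mulL_assoc]⟩

include hb in
theorem isTwoCocycle_trivialCocycle : H.IsTwoCocycle H.trivialCocycle := by
  have hs : ∀ X Y, H.leftTwist H.trivialCocycle (X ⊗ₜ Y) = X ⬝ Y := star_trivialCocycle hb
  refine ⟨fun b X Y => ?_, fun b X Y => ?_, fun X Y Z => ?_, fun X => ?_, fun X => ?_⟩ <;>
    simp only [hs, trivialCocycle_apply, hb.mulL_assoc, hb.counit_tgt_mul, hb.oneL_mul,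
      hb.mul_oneL]

include hb hM in
theorem tla_trivialCocycle (b : B) (m : M) : H.tla H.trivialCocycle laM d b m = laM b m := by
  simp only [tla_apply, trivialCocycle_apply, hb.counit_src_mul, hM.la_mul]
  rw [← map_sw (φ := laM b) _ _ (by fun_prop), hM.counit]

include hb hM in
theorem tra_trivialCocycle (b : B) (m : M) : H.tra H.trivialCocycle laM d b m = raM b m := by
  simp only [tra_apply, trivialCocycle_apply, hb.counit_src_eq_tgt]
  rw [hM.tak (f := fun u m' => laM (H.counit u) m')]
  · simp only [hM.la_ra]
    rw [← map_sw (φ := raM b) _ _ (by fun_prop), hM.counit]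
  · exact ⟨by fun_prop, by fun_prop, fun b u m' => by rw [hb.counit_tgt_mul, hM.la_mul]⟩

include hb hM hN in
theorem sw_sharp_trivialCocycle {f : M → N → V}
    (hf : Bal (k := k) (fun (b : B) m => raM b m) (fun (b : B) n => laN b n) f) (z : M ⊗[k] N) :
    sw (sharp H.trivialCocycle d e laM z) f = sw z f := by
  have hl := hf.left
  have hr := hf.right
  rw [sw_sharp _ _ _ _ _ hl hr]
  refine sw_congr _ fun m n => ?_
  rw [sw_comm]
  simp only [trivialCocycle_apply, sw_counit_mul_coact hb hM hf]
  rw [← map_sw (φ := f m) _ _ (by fun_prop), hN.counit]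

include hb in
theorem isInvertible_trivialCocycle : H.IsInvertibleTwoCocycle H.trivialCocycle := by
  refine (isTwoCocycle_trivialCocycle hb).isInvertible hb
    fun {M N _ _ _ _ laM raM d laN raN e} hM hN => ?_
  have h1 : (balancedRel k (fun b m => raM b m) (fun b n => laN b n)).mkQ ∘ₗ
      sharp H.trivialCocycle d e laM =
      (balancedRel k (fun b m => raM b m) (fun b n => laN b n)).mkQ :=
    LinearMap.ext fun z => mkQ_eq_of_sw (sw_sharp_trivialCocycle hb hM hN bal_mkQ z)
  have h2 : (fun b m => H.tra H.trivialCocycle laM d b m) = fun b m => raM b m :=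
    funext₂ fun b m => tra_trivialCocycle hb hM b m
  have h3 : (fun b n => H.tla H.trivialCocycle laN e b n) = fun b n => laN b n :=
    funext₂ fun b m => tla_trivialCocycle hb hN b m
  rw [SharpIso, h1, h2, h3]
  exact ⟨Submodule.ker_mkQ _, Submodule.mkQ_surjective _⟩

include hH in
theorem twist_trivialCocycle : H.twist H.trivialCocycle = H := by
  have hb := hH.bialgebroid
  have hR := hb.isCom_regular
  have hW := (isInvertible_trivialCocycle hb).wInv hH
  refine ext_of_toDiamond (LinearMap.ext₂ fun a b => ?_) rfl (LinearMap.ext₂ fun X Y => ?_) rfl rfl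
    rfl (LinearMap.ext fun X => ?_) fun X => ?_
  · show H.counit (𝐬 a ⬝ 𝐬 b) = _
    rw [hb.counit_src_mul, hb.counit_src]
  · refine Eq.trans ?_ (star_trivialCocycle hb X Y)
    rw [dot_apply, star_apply]
    simp only [bull_trivialCocycle hH]
  · rw [counit_twist_apply]
    simp only [trivialCocycle_apply]
    rw [← map_sw (φ := H.counit) _ _ (by fun_prop), hH.trans_mul_self, hb.counit_src]
  · rw [← toDiamond_comulLift]
    refine toDiamond_eq_of_sw ?_
    have hf := (H.twist H.trivialCocycle).bal_toDiamond
    rw [sw_comul_twist hH hW hf]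
    have hf' := hf
    rw [twist_lactL hH hW.cocycle] at hf'
    have hf2 : H.DBal H.lactL (fun x y => (H.twist H.trivialCocycle).toDiamond (x ⊗ₜ[k] y)) :=
      ⟨hf.left, hf.right, fun b x y => by
        have := (DBal.tBal hH hW.cocycle hf').bal b x y
        rwa [bull_trivialCocycle hH, tla_trivialCocycle hb hR] at this⟩
    rw [← tco_pull hW hR X hf2]
    refine sw_congr _ fun x y => ?_
    have hl := hf2.left
    have hr := hf2.right
    have e := sw_sharp_trivialCocycle hb hH.isCom_inv hR (raM := H.ractI) hf2 (x ⊗ₜ y)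
    exact ((sw_tmul _ _ hf2.bilin).symm.trans e.symm).trans
      ((sw_sharpInv _ hl hr).trans (sw_tmul _ _ ⟨by fun_prop, by fun_prop⟩))

end

end

/-! ### Composition of cocycles -/

section

variable {Θ : L →ₗ[k] L →ₗ[k] B}

theorem InducesIso.comp {V W U : Type u} [AddCommGroup V] [Module k V] [AddCommGroup W]
    [Module k W] [AddCommGroup U] [Module k U] {h : V →ₗ[k] W} {g : W →ₗ[k] U} {S : Submodule k V}
    {T : Submodule k W} (hg : InducesIso g T) (hh : InducesIso (T.mkQ ∘ₗ h) S) :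
    InducesIso (g ∘ₗ h) S := by
  refine ⟨?_, fun u => ?_⟩
  · rw [← hh.1, LinearMap.ker_comp, LinearMap.ker_comp, hg.1, Submodule.ker_mkQ]
  · obtain ⟨w, rfl⟩ := hg.2 u
    obtain ⟨v, hv⟩ := hh.2 (T.mkQ w)
    refine ⟨v, ?_⟩
    have : h v - w ∈ T := (Submodule.Quotient.eq T).1 hv
    rw [← hg.1, LinearMap.mem_ker, map_sub, sub_eq_zero] at this
    exact this

theorem InducesIso.of_comp {V W U : Type u} [AddCommGroup V] [Module k V] [AddCommGroup W]
    [Module k W] [AddCommGroup U] [Module k U] {h : V →ₗ[k] W} {g : W →ₗ[k] U} {S : Submodule k V}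
    {T : Submodule k W} (hT : T ≤ LinearMap.ker g) (hgh : InducesIso (g ∘ₗ h) S)
    (hh : InducesIso (T.mkQ ∘ₗ h) S) : InducesIso g T := by
  refine ⟨le_antisymm (fun w hw => ?_) hT, fun u => ?_⟩
  · obtain ⟨v, hv⟩ := hh.2 (T.mkQ w)
    have h1 : h v - w ∈ T := (Submodule.Quotient.eq T).1 hv
    have h2 : v ∈ S := by
      rw [← hgh.1, LinearMap.mem_ker, LinearMap.comp_apply]
      have := hT h1
      rwa [LinearMap.mem_ker, map_sub, LinearMap.mem_ker.1 hw, sub_zero] at this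
    rw [← hh.1, LinearMap.mem_ker, hv] at h2
    exact (Submodule.Quotient.mk_eq_zero T).1 h2
  · obtain ⟨v, rfl⟩ := hgh.2 u
    exact ⟨h v, rfl⟩

theorem cocycleComp_apply (X Y : L) : H.cocycleComp Θ Γ X Y = sw ((H.twist Γ).comulLift X)
    (fun x x' => sw ((H.twist Γ).comulLift Y) (fun y y' =>
      Γ ((H.twist Γ).mulL (𝐬 (Θ x y)) x') y')) := by
  let Φ : (L ⊗[k] L) ⊗[k] (L ⊗[k] L) →ₗ[k] B := TensorProduct.lift Γ ∘ₗ
    TensorProduct.map (H.twist Γ).mulT LinearMap.id ∘ₗ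
    (TensorProduct.assoc k L L L).symm.toLinearMap ∘ₗ
    TensorProduct.map (H.src ∘ₗ TensorProduct.lift Θ) LinearMap.id
  have e1 : H.cocycleComp Θ Γ X Y =
      Φ (exch ((H.twist Γ).comulLift X ⊗ₜ[k] (H.twist Γ).comulLift Y)) := rfl
  rw [e1]
  refine (map_eq_sw (Φ ∘ₗ exch ∘ₗ (TensorProduct.mk k _ _).flip _) _).trans
    (sw_congr _ fun x x' => ?_)
  exact map_eq_sw (Φ ∘ₗ exch ∘ₗ TensorProduct.mk k _ _ (x ⊗ₜ x')) _

section
variable (hH : H.IsLeftHopfAlgebroid) (hb : H.IsLeftBialgebroid) (hW : H.WInv Γ)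
  (hΘ : (H.twist Γ).IsTwoCocycle Θ)
  (hM : H.IsCom laM raM d) (hN : H.IsCom laN raN e) (hP : H.IsCom laP raP dP)

include hH hW in
/-- The coproduct of `L^Γ` may be computed by the twisted coaction in two arguments at once, if the
test map is balanced as expressions in a cocycle on `L^Γ` are. -/
theorem comul_twist_comul_twist {f : L → L → L → L → V}
    (l1 : ∀ x' y y', IsLin k (fun x => f x x' y y')) (l2 : ∀ x y y', IsLin k (fun x' => f x x' y y'))
    (l3 : ∀ x x' y', IsLin k (fun y => f x x' y y')) (l4 : ∀ x x' y, IsLin k (fun y' => f x x' y y'))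
    (b1 : ∀ b x x' y y', f (H.bull Γ (𝐭 b) x) x' y y' = f x (H.star Γ (𝐬 b) x') y y')
    (b2 : ∀ b x x' y y', f (H.bull Γ x (𝐭 b)) x' y y' = f x x' (H.bull Γ (𝐭 b) y) y')
    (b3 : ∀ b x x' y y', f x (H.star Γ x' (𝐬 b)) y y' = f x x' y (H.star Γ (𝐬 b) y')) (X Y : L) :
    sw ((H.twist Γ).comulLift X) (fun x x' => sw ((H.twist Γ).comulLift Y) (fun y y' =>
      f x x' y y')) = sw (H.tco Γ H.lactL H.comulLift X) (fun x x' =>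
        sw (H.tco Γ H.lactL H.comulLift Y) (fun y y' => f x x' y y')) := by
  have hb := hH.bialgebroid
  have hΓ := hW.cocycle
  have hT : ∀ y y', H.TBal Γ H.lactL H.comulLift (fun x x' => f x x' y y') := fun y y' =>
    ⟨by fun_prop, by fun_prop, fun b x x' => by rw [b1, hb.tla_regular hΓ]⟩
  have h1 : ∀ {g : L → L → V}, H.TBal Γ H.lactL H.comulLift g →
      (H.twist Γ).DBal (H.twist Γ).lactL g := fun hg => by
    rw [twist_lactL hH hΓ]
    exact TBal.dBal hH hΓ hg
  rw [sw_comm]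
  refine Eq.trans (sw_congr _ fun y y' => sw_comul_twist hH hW (h1 (hT y y')) X) ?_
  rw [sw_comm (H.tco Γ H.lactL H.comulLift X)]
  refine sw_comul_twist hH hW (h1 ⟨by fun_prop, by fun_prop, fun b y y' => ?_⟩) Y
  have := tco_takeuchi hH hW hb.isCom_regular (hT y y') b X
  simpa only [b2, hb.tra_regular hΓ, b3, hb.tla_regular hΓ] using this

include hH hW hΘ in
theorem IsTwoCocycle.tgt_bull (b : B) (x y : L) :
    𝐬 (Θ (H.bull Γ (𝐭 b) x) y) = H.star Γ (𝐬 (Θ x y)) (𝐬 b) := by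
  rw [hH.bialgebroid.src_star_src hW.cocycle, ← hH.tgt_dot hW.cocycle]
  exact congrArg H.src (hΘ.bar_linear b x y)

include hH hW hΘ in
theorem IsTwoCocycle.bull_tgt (b : B) (x y : L) :
    Θ (H.bull Γ x (𝐭 b)) y = Θ x (H.bull Γ (𝐭 b) y) := by
  rw [← hH.tgt_dot hW.cocycle, ← hH.dot_tgt hW.cocycle]
  exact hΘ.balanced b x y

include hH hW hΘ in
theorem cocycleComp_tco (X Y : L) : H.cocycleComp Θ Γ X Y =
    sw (H.tco Γ H.lactL H.comulLift X) (fun x x' => sw (H.tco Γ H.lactL H.comulLift Y)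
      (fun y y' => Γ (H.star Γ (𝐬 (Θ x y)) x') y')) := by
  have hb := hH.bialgebroid
  have hΓ := hW.cocycle
  rw [cocycleComp_apply]
  simp only [hH.src_dot hΓ]
  refine comul_twist_comul_twist hH hW (by fun_prop) (by fun_prop) (by fun_prop) (by fun_prop)
    (fun b x x' y y' => ?_) (fun b x x' y y' => ?_) (fun b x x' y y' => ?_) X Y
  · rw [hΘ.tgt_bull hH hW, hb.star_assoc hΓ]
  · rw [hΘ.bull_tgt hH hW]
  · rw [← hb.star_assoc hΓ, hb.cocycle' hΓ]

include hH hW hM hN hΘ in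
/-- `(Θ ∘ Γ)^# = Γ^# ∘ Θ^#` -/
theorem sw_cocycleComp {f : M → N → V}
    (hf : Bal (k := k) (fun (b : B) m => raM b m) (fun (b : B) n => laN b n) f) (m : M) (n : N) :
    sw (d m) (fun u m' => sw (e n) (fun v n' => f (laM (H.cocycleComp Θ Γ u v) m') n')) =
    sw (H.tco Γ laM d m) (fun x m' => sw (H.tco Γ laN e n) (fun y n' =>
      sw (d (H.tla Γ laM d (Θ x y) m')) (fun u m'' => sw (e n') (fun v n'' =>
        f (laM (Γ u v) m'') n'')))) := by
  have hb := hH.bialgebroid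
  have hΓ := hW.cocycle
  have hR := hb.isCom_regular
  have hl := hf.left
  have hr := hf.right
  have hA := hb.star_assoc hΓ
  -- coassociativity for `M`
  have e1 := tco_coact hH hW hM (f := fun x u m' => sw (H.tco Γ laN e n) (fun y n' =>
      sw (e n') (fun v n'' => f (laM (Γ (H.star Γ (𝐬 (Θ x y)) u) v) m') n'')))
    (by fun_prop) (by fun_prop) (by fun_prop)
    (fun b x u m' => by simp only [hΘ.tgt_bull hH hW, hA])
    (fun b x u m' => by
      simp only [hb.src_star_tgt_mul hΓ, hΓ.bar_linear, hM.la_mul]) m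
  -- coassociativity for `N`
  have hT : ∀ y v m' n', H.TBal Γ H.lactL H.comulLift (fun x x' =>
      f (laM (Γ (H.star Γ (𝐬 (Θ x y)) x') v) m') n') := fun y v m' n' =>
    ⟨by fun_prop, by fun_prop, fun b x x' => by
      rw [hΘ.tgt_bull hH hW, hA, hb.tla_regular hΓ]⟩
  have e2 := tco_coact hH hW hN (f := fun y v n' => sw (d m) (fun u m' =>
      sw (H.tco Γ H.lactL H.comulLift u) (fun x x' =>
        f (laM (Γ (H.star Γ (𝐬 (Θ x y)) x') v) m') n')))
    (by fun_prop) (by fun_prop) (by fun_prop)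
    (fun b y v n' => sw_congr _ fun u m' => by
      have := tco_takeuchi hH hW hR (hT y v m' n') b u
      simpa only [hΘ.bull_tgt hH hW, hb.tra_regular hΓ, ← hA, ← hb.cocycle' hΓ] using this)
    (fun b y v n' => by
      have e3 : ∀ u m', sw (H.tco Γ H.lactL H.comulLift u) (fun x x' =>
          f (laM (Γ (H.star Γ (𝐬 (Θ x y)) x') (𝐭 b ⬝ v)) m') n') =
          sw (H.tco Γ H.lactL H.comulLift (u ⬝ 𝐭 b)) (fun x x' =>
          f (laM (Γ (H.star Γ (𝐬 (Θ x y)) x') v) m') n') := fun u m' => by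
        have := (hb.isColin_mul_tgt b).tco hH hW hR hR (hT y v m' n') u
        rw [LinearMap.flip_apply] at this
        simp only [this, LinearMap.flip_apply, hb.star_mul_tgt hΓ, hΓ.balanced]
      simp only [e3]
      have := hM.tak (f := fun u m' => sw (H.tco Γ H.lactL H.comulLift u) (fun x x' =>
          f (laM (Γ (H.star Γ (𝐬 (Θ x y)) x') v) m') n')) ⟨by fun_prop, by fun_prop,
            fun c u m' => ?_⟩ b m
      · simpa only [hM.la_ra, hf.bal] using this
      · rw [(hb.isColin_tgt_mul c).tco hH hW hR hR (hT y v m' n') u]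
        simp only [hb.src_star_tgt_mul hΓ, hΓ.bar_linear, hM.la_mul]) n
  have e4 : ∀ x y m' n', (sw (d (H.tla Γ laM d (Θ x y) m')) fun u m'' => sw (e n') fun v n'' =>
      f (laM (Γ u v) m'') n'') = sw (d m') fun u m'' => sw (e n') fun v n'' =>
      f (laM (Γ (H.star Γ (𝐬 (Θ x y)) u) v) m'') n'' := fun x y m' n' => by
    refine coact_tla hb hΓ hM ⟨by fun_prop, by fun_prop, fun b u m'' => ?_⟩ _ m'
    simp only [hΓ.bar_linear, hM.la_mul]
  simp only [e4]
  refine Eq.trans ?_ (Eq.trans e1.symm (sw_congr _ fun x m' => sw_comm _ _ _))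
  have e5 : (sw (d m) fun u m' => sw (H.tco Γ H.lactL H.comulLift u) fun x x' =>
      sw (H.tco Γ laN e n) fun y n' => sw (e n') fun v n'' =>
        f (laM (Γ (H.star Γ (𝐬 (Θ x y)) x') v) m') n'') =
      sw (H.tco Γ laN e n) fun y n' => sw (e n') fun v n'' => sw (d m) fun u m' =>
        sw (H.tco Γ H.lactL H.comulLift u) fun x x' =>
        f (laM (Γ (H.star Γ (𝐬 (Θ x y)) x') v) m') n'' := by
    refine (sw_congr _ fun u m' => sw_comm _ _ _).trans ((sw_comm _ _ _).trans ?_)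
    refine sw_congr _ fun y n' => ?_
    exact (sw_congr _ fun u m' => sw_comm _ _ _).trans (sw_comm _ _ _)
  rw [e5, e2]
  refine (sw_comm (d m) (e n) _).trans (sw_congr _ fun v n' => ?_)
  refine Eq.trans (sw_congr _ fun u m' => ?_) (sw_comm _ _ _)
  rw [cocycleComp_tco hH hW hΘ, map_sw (φ := fun z => f (laM z m') n') _ _ (by fun_prop)]
  refine Eq.trans (sw_congr _ fun x x' => ?_) (sw_comm _ _ _)
  exact map_sw (φ := fun z => f (laM z m') n') _ _ (by fun_prop)

include hH hW hM hN hP hΘ in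
/-- Twisting a pairing by `Θ ∘ Γ` is twisting it by `Γ`, then by `Θ`. -/
theorem IsPairing.twp_cocycleComp (hμ : H.IsPairing laM raM d laN e laP dP μ) :
    twp (H.cocycleComp Θ Γ) d e laP μ =
      twp Θ (H.tco Γ laM d) (H.tco Γ laN e) (H.tla Γ laP dP) (twp Γ d e laP μ) :=
  LinearMap.ext₂ fun m n => by
    have hf : Bal (k := k) (fun (b : B) m => raM b m) (fun (b : B) n => laN b n)
      (fun m n => μ m n) := ⟨by fun_prop, by fun_prop, hμ.mid⟩
    have := sw_cocycleComp hH hW hΘ hM hN hf m n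
    simp only [hμ.left] at this
    rw [twp_apply, twp_apply, this]
    refine sw_congr _ fun x m' => sw_congr _ fun y n' => ?_
    rw [← hμ.twp_tla hH hW.cocycle hM hN hP, twp_apply]

end

end

/-! ### The composite is an invertible cocycle -/

section

variable {Θ : L →ₗ[k] L →ₗ[k] B}

section
variable (hH : H.IsLeftHopfAlgebroid) (hb : H.IsLeftBialgebroid) (hW : H.WInv Γ)
  (hΘ : (H.twist Γ).IsTwoCocycle Θ)
  (hM : H.IsCom laM raM d) (hN : H.IsCom laN raN e) (hP : H.IsCom laP raP dP)

include hH hW hM hN hP in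
/-- The twist of a pairing is a pairing of the twisted comodules. -/
theorem IsPairing.twist (hμ : H.IsPairing laM raM d laN e laP dP μ) :
    (H.twist Γ).IsPairing (H.tla Γ laM d) (H.tra Γ laM d) (H.tco Γ laM d) (H.tla Γ laN e)
      (H.tco Γ laN e) (H.tla Γ laP dP) (H.tco Γ laP dP) (twp Γ d e laP μ) where
  left := hμ.twp_tla hH hW.cocycle hM hN hP
  mid := hμ.twp_tra hH hW.cocycle hM hN hP
  coact hf := hμ.tco_twp hH hW hM hN hP (DBal.tBal hH hW.cocycle hf)

include hH hW hΘ in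
/-- The left twist of `L` by `Θ ∘ Γ` is the left twist by `Θ` of the left twist by `Γ`. -/
theorem star_cocycleComp : H.star (H.cocycleComp Θ Γ) =
    twp Θ (H.tco Γ H.lactL H.comulLift) (H.tco Γ H.lactL H.comulLift)
      (H.tla Γ H.lactL H.comulLift) (H.star Γ) := by
  have hR := hH.bialgebroid.isCom_regular
  have := hH.bialgebroid.isPairing_mul.twp_cocycleComp hH hW hΘ hR hR hR
  rwa [← star_eq_twp, ← star_eq_twp] at this

include hH hW hΘ in
theorem cocycleComp_eq_counit (X Y : L) :
    H.cocycleComp Θ Γ X Y = H.counit (H.star (H.cocycleComp Θ Γ) X Y) := by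
  have hb := hH.bialgebroid
  have hΓ := hW.cocycle
  rw [cocycleComp_tco hH hW hΘ, star_cocycleComp hH hW hΘ, twp_apply,
    map_sw (φ := H.counit) _ _ (by fun_prop)]
  refine sw_congr _ fun x x' => ?_
  rw [map_sw (φ := H.counit) _ _ (by fun_prop)]
  refine sw_congr _ fun y y' => ?_
  rw [hb.tla_regular hΓ, ← hb.star_assoc hΓ, hb.counit_star hΓ]

include hH hW hΘ in
theorem star_cocycleComp_assoc (X Y Z : L) : H.star (H.cocycleComp Θ Γ)
    (H.star (H.cocycleComp Θ Γ) X Y) Z =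
    H.star (H.cocycleComp Θ Γ) X (H.star (H.cocycleComp Θ Γ) Y Z) := by
  have hb := hH.bialgebroid
  have hR := hb.isCom_regular
  have h1 := hb.isPairing_mul.twist hH hW hR hR hR
  rw [← star_eq_twp] at h1
  rw [star_cocycleComp hH hW hΘ]
  exact h1.twp_assoc (isLeftBialgebroid_twist hH hW) hΘ (isCom_tco hH hW hR)
    (hb.star_assoc hW.cocycle) X Y Z

include hH hW hΘ in
theorem tBal_cocycleComp (y Y : L) :
    H.TBal Γ H.lactL H.comulLift (fun x x' => Γ (H.star Γ (𝐬 (Θ x y)) x') Y) := by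
  have hb := hH.bialgebroid
  have hΓ := hW.cocycle
  exact ⟨by fun_prop, by fun_prop, fun b x x' => by
    rw [hΘ.tgt_bull hH hW, hb.tla_regular hΓ, hb.star_assoc hΓ]⟩

include hH hW hΘ in
theorem tBal_cocycleComp_left (Y : L) : H.TBal Γ H.lactL H.comulLift (fun x x' =>
    sw (H.tco Γ H.lactL H.comulLift Y) (fun y y' => Γ (H.star Γ (𝐬 (Θ x y)) x') y')) :=
  ⟨by fun_prop, by fun_prop, fun b x x' => sw_congr _ fun y y' =>
    (tBal_cocycleComp hH hW hΘ y y').bal b x x'⟩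

include hH hW hΘ in
theorem tBal_cocycleComp_right (X : L) : H.TBal Γ H.lactL H.comulLift (fun y y' =>
    sw (H.tco Γ H.lactL H.comulLift X) (fun x x' => Γ (H.star Γ (𝐬 (Θ x y)) x') y')) := by
  have hb := hH.bialgebroid
  have hΓ := hW.cocycle
  refine ⟨by fun_prop, by fun_prop, fun b y y' => ?_⟩
  have := tco_takeuchi hH hW hb.isCom_regular (tBal_cocycleComp hH hW hΘ y y') b X
  simpa only [hΘ.bull_tgt hH hW, hb.tra_regular hΓ, hb.tla_regular hΓ, ← hb.star_assoc hΓ,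
    ← hb.cocycle' hΓ] using this

include hH hW hΘ in
/-- The cocycle identity is the counit applied to the associativity of the left twist by `Θ ∘ Γ`. -/
theorem isTwoCocycle_cocycleComp : H.IsTwoCocycle (H.cocycleComp Θ Γ) := by
  have hb := hH.bialgebroid
  have hΓ := hW.cocycle
  have hR := hb.isCom_regular
  have hc := cocycleComp_tco hH hW hΘ
  refine ⟨fun b X Y => ?_, fun b X Y => ?_, fun X Y Z => ?_, fun X => ?_, fun X => ?_⟩
  · have e1 := (hb.isColin_mul_tgt b).tco hH hW hR hR (tBal_cocycleComp_left hH hW hΘ Y) X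
    have e2 := (hb.isColin_tgt_mul b).tco hH hW hR hR (tBal_cocycleComp_right hH hW hΘ X) Y
    simp only [LinearMap.flip_apply, hb.star_mul_tgt hΓ, hΓ.balanced] at e1
    rw [hc, hc, e1, sw_comm _ (H.tco Γ H.lactL H.comulLift (𝐭 b ⬝ Y)), e2,
      sw_comm (H.tco Γ H.lactL H.comulLift X)]
  · have e1 := (hb.isColin_tgt_mul b).tco hH hW hR hR (tBal_cocycleComp_left hH hW hΘ Y) X
    simp only [hb.src_star_tgt_mul hΓ, hΓ.bar_linear] at e1
    rw [hc, hc, e1, map_sw (φ := fun z => H.mulB z b) _ _ (by fun_prop)]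
    exact sw_congr _ fun x x' => (map_sw (φ := fun z => H.mulB z b) _ _ (by fun_prop)).symm
  · show H.cocycleComp Θ Γ X (H.star (H.cocycleComp Θ Γ) Y Z) =
      H.cocycleComp Θ Γ (H.star (H.cocycleComp Θ Γ) X Y) Z
    rw [cocycleComp_eq_counit hH hW hΘ, cocycleComp_eq_counit hH hW hΘ (H.star _ X Y),
      star_cocycleComp_assoc hH hW hΘ]
  · rw [hc, tco_oneL hH hW (tBal_cocycleComp_left hH hW hΘ X)]
    refine Eq.trans (sw_congr _ fun y y' => ?_) ((map_sw (φ := H.counit) _ _ (by fun_prop)).symm.trans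
      (congrArg H.counit (tco_counit hH hW hR X)))
    rw [hb.star_oneL hΓ, hb.tla_regular hΓ, hb.counit_star hΓ]
    exact congrArg (fun z => Γ (𝐬 z) y') (hΘ.one_left y)
  · rw [hc, sw_comm, tco_oneL hH hW (tBal_cocycleComp_right hH hW hΘ X)]
    refine Eq.trans (sw_congr _ fun y y' => ?_) ((map_sw (φ := H.counit) _ _ (by fun_prop)).symm.trans
      (congrArg H.counit (tco_counit hH hW hR X)))
    rw [hΓ.one_right, hb.tla_regular hΓ]
    exact congrArg (fun z => H.counit (H.star Γ (𝐬 z) y')) (hΘ.one_right y)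

include hH hW in
theorem tco_src {g : L → L → V} (hg : H.TBal Γ H.lactL H.comulLift g) (b : B) :
    sw (H.tco Γ H.lactL H.comulLift (𝐬 b)) g = g (𝐬 b) H.oneL := by
  have hb := hH.bialgebroid
  have hR := hb.isCom_regular
  have := tco_lact hH hW hR hg b H.oneL
  rw [lactL_apply, hb.mul_oneL] at this
  rw [this, tco_oneL hH hW (hg.src_mul_left hH hW.cocycle b), hb.mul_oneL]

include hH hW hΘ in
theorem cocycleComp_src_left (b : B) (X : L) : H.cocycleComp Θ Γ (𝐬 b) X =
    sw (H.tco Γ H.lactL H.comulLift X) (fun y y' => Γ (𝐬 (Θ (𝐬 b) y)) y') := by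
  rw [cocycleComp_tco hH hW hΘ, tco_src hH hW (tBal_cocycleComp_left hH hW hΘ X)]
  simp only [hH.bialgebroid.star_oneL hW.cocycle]

include hH hW hΘ in
theorem cocycleComp_src_right (b : B) (X : L) : H.cocycleComp Θ Γ X (𝐬 b) =
    sw (H.tco Γ H.lactL H.comulLift X) (fun x x' => Γ (𝐬 (Θ x (𝐬 b))) x') := by
  have hb := hH.bialgebroid
  have hΓ := hW.cocycle
  rw [cocycleComp_tco hH hW hΘ, sw_comm, tco_src hH hW (tBal_cocycleComp_right hH hW hΘ X)]
  simp only [← hb.cocycle' hΓ, hb.star_oneL hΓ]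

include hH hW hΘ hM in
/-- The left action twisted by `Θ ∘ Γ` is the one twisted by `Γ`, then by `Θ`. -/
theorem tla_cocycleComp (b : B) (m : M) : H.tla (H.cocycleComp Θ Γ) laM d b m =
    (H.twist Γ).tla Θ (H.tla Γ laM d) (H.tco Γ laM d) b m := by
  have hb := hH.bialgebroid
  have hΓ := hW.cocycle
  rw [tla_apply, tla_apply]
  refine Eq.trans (sw_congr _ fun u m' => ?_) (tco_coact hH hW hM
    (f := fun y u m' => laM (Γ (𝐬 (Θ (𝐬 b) y)) u) m') (by fun_prop) (by fun_prop) (by fun_prop)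
    (fun c y u m' => ?_) (fun c y u m' => ?_) m).symm
  · rw [cocycleComp_src_left hH hW hΘ, map_sw (φ := fun z => laM z m') _ _ (by fun_prop)]
  · have e : 𝐬 (Θ (𝐬 b) (H.bull Γ (𝐭 c) y)) = H.star Γ (𝐬 (Θ (𝐬 b) y)) (𝐬 c) := by
      rw [← hΘ.bull_tgt hH hW, ← hΘ.tgt_bull hH hW, ← hH.dot_tgt hΓ, ← hH.tgt_dot hΓ]
      exact congrArg (fun z => 𝐬 (Θ z y)) ((isLeftBialgebroid_twist hH hW).src_tgt b c)
    rw [e, hb.cocycle' hΓ]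
  · rw [cocycle_src_tgt_mul hΓ hb, hM.la_mul]

include hH hW hΘ hM in
theorem tra_cocycleComp (b : B) (m : M) : H.tra (H.cocycleComp Θ Γ) laM d b m =
    (H.twist Γ).tra Θ (H.tla Γ laM d) (H.tco Γ laM d) b m := by
  have hb := hH.bialgebroid
  have hΓ := hW.cocycle
  rw [tra_apply, tra_apply]
  refine Eq.trans (sw_congr _ fun u m' => ?_) (tco_coact hH hW hM
    (f := fun x u m' => laM (Γ (𝐬 (Θ x (𝐬 b))) u) m') (by fun_prop) (by fun_prop) (by fun_prop)
    (fun c y u m' => ?_) (fun c y u m' => ?_) m).symm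
  · rw [cocycleComp_src_right hH hW hΘ, map_sw (φ := fun z => laM z m') _ _ (by fun_prop)]
  · rw [hΘ.tgt_bull hH hW, hb.cocycle' hΓ]
  · rw [cocycle_src_tgt_mul hΓ hb, hM.la_mul]

include hH hW hΘ hM hN in
theorem mkQ_sharp_cocycleComp :
    (balancedRel k (fun b m => raM b m) (fun b n => laN b n)).mkQ ∘ₗ
      sharp (H.cocycleComp Θ Γ) d e laM =
    ((balancedRel k (fun b m => raM b m) (fun b n => laN b n)).mkQ ∘ₗ sharp Γ d e laM) ∘ₗ
      sharp Θ (H.tco Γ laM d) (H.tco Γ laN e) (H.tla Γ laM d) := by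
  refine LinearMap.ext fun z => mkQ_eq_of_sw ?_
  have hf : Bal (k := k) (fun (b : B) m => raM b m) (fun (b : B) n => laN b n) _ := bal_mkQ
  have hl := hf.left
  have hr := hf.right
  rw [sw_sharp _ _ _ _ _ hl hr, sw_sharp _ _ _ _ _ hl hr,
    sw_sharp _ _ _ _ _ (by fun_prop) (by fun_prop)]
  exact sw_congr _ fun m n => sw_cocycleComp hH hW hΘ hM hN hf m n

include hH hW hΘ hM hN in
theorem SharpIso.cocycleComp (h1 : H.SharpIso Γ laM raM d laN e)
    (h2 : (H.twist Γ).SharpIso Θ (H.tla Γ laM d) (H.tra Γ laM d) (H.tco Γ laM d)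
      (H.tla Γ laN e) (H.tco Γ laN e)) : H.SharpIso (H.cocycleComp Θ Γ) laM raM d laN e := by
  have e1 : (fun b m => H.tra (H.cocycleComp Θ Γ) laM d b m) = _ :=
    funext₂ (tra_cocycleComp hH hW hΘ hM)
  have e2 : (fun b n => H.tla (H.cocycleComp Θ Γ) laN e b n) = _ :=
    funext₂ (tla_cocycleComp hH hW hΘ hN)
  rw [SharpIso, e1, e2, mkQ_sharp_cocycleComp hH hW hΘ hM hN]
  exact InducesIso.comp h1 h2

/-- The relations defining `M ⊗_{B^Γ} N` are respected by `Γ^#`. -/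
theorem balancedRel_le_ker_sharp (hb : H.IsLeftBialgebroid) (hΓ : H.IsTwoCocycle Γ)
    (hM : H.IsCom laM raM d) (hN : H.IsCom laN raN e) :
    balancedRel k (fun b m => H.tra Γ laM d b m) (fun b n => H.tla Γ laN e b n) ≤
      LinearMap.ker ((balancedRel k (fun b m => raM b m) (fun b n => laN b n)).mkQ ∘ₗ
        sharp Γ d e laM) := by
  refine Submodule.span_le.2 ?_
  rintro _ ⟨b, m, n, rfl⟩
  rw [SetLike.mem_coe, LinearMap.mem_ker, map_sub, sub_eq_zero]
  refine mkQ_eq_of_sw ?_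
  have hf : Bal (k := k) (fun (b : B) m => raM b m) (fun (b : B) n => laN b n)
    (fun m n => (balancedRel k (fun b m => raM b m) (fun b n => laN b n)).mkQ (m ⊗ₜ[k] n)) := bal_mkQ
  have hl := hf.left
  have hr := hf.right
  rw [sw_sharp _ _ _ _ _ hl hr, sw_sharp _ _ _ _ _ hl hr, sw_tmul _ _ ⟨by fun_prop, by fun_prop⟩,
    sw_tmul _ _ ⟨by fun_prop, by fun_prop⟩, coact_tra hb hΓ hM ⟨by fun_prop, by fun_prop, ?_⟩,
    sw_comm (d m) (e (H.tla Γ laN e b n)), coact_tla hb hΓ hN (bal_sharp_right hΓ hM hf m),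
    sw_comm (e n)]
  · simp only [hb.cocycle' hΓ]
  · intro c u m'
    simp only [hΓ.bar_linear, hM.la_mul]

include hH hW hΘ hM hN in
/-- If `Θ^#` and `(Θ ∘ Γ)^#` are invertible, then so is `Γ^#`. -/
theorem SharpIso.of_cocycleComp (h2 : (H.twist Γ).SharpIso Θ (H.tla Γ laM d) (H.tra Γ laM d)
      (H.tco Γ laM d) (H.tla Γ laN e) (H.tco Γ laN e))
    (h3 : H.SharpIso (H.cocycleComp Θ Γ) laM raM d laN e) : H.SharpIso Γ laM raM d laN e := by
  have e1 : (fun b m => H.tra (H.cocycleComp Θ Γ) laM d b m) = _ :=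
    funext₂ (tra_cocycleComp hH hW hΘ hM)
  have e2 : (fun b n => H.tla (H.cocycleComp Θ Γ) laN e b n) = _ :=
    funext₂ (tla_cocycleComp hH hW hΘ hN)
  rw [SharpIso, e1, e2, mkQ_sharp_cocycleComp hH hW hΘ hM hN] at h3
  exact InducesIso.of_comp (balancedRel_le_ker_sharp hH.bialgebroid hW.cocycle hM hN) h3 h2

include hH in
/-- Weak invertibility in terms of `SharpIso`. -/
theorem wInv_iff : H.WInv Γ ↔ H.IsTwoCocycle Γ ∧ ∀ {M : Type u} [AddCommGroup M] [Module k M]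
    {la ra : B →ₗ[k] M →ₗ[k] M} {d : M →ₗ[k] L ⊗[k] M}, H.IsCom la ra d →
    H.SharpIso Γ H.lactI H.ractI H.invLift la d := by
  have e (hΓ : H.IsTwoCocycle Γ) : (fun b X => H.tra Γ H.lactI H.invLift b X) =
    fun b X => H.bull Γ (𝐭 b) X := funext₂ fun b X => tra_inv hH hΓ b X
  refine ⟨fun hW => ⟨hW.cocycle, fun hM => ?_⟩, fun h => ⟨h.1, fun hM => ?_⟩⟩
  · rw [SharpIso, e hW.cocycle]
    exact hW.iso hM
  · have := h.2 hM
    rw [SharpIso, e h.1] at this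
    exact this

include hH hW in
theorem twist_lactI : (H.twist Γ).lactI = H.tla Γ H.lactI H.invLift :=
  LinearMap.ext₂ fun b X => by
    rw [tla_inv hH hW.cocycle, ← hH.dot_tgt hW.cocycle]
    rfl

include hH hW in
theorem twist_ractI : (H.twist Γ).ractI = H.tra Γ H.lactI H.invLift :=
  LinearMap.ext₂ fun b X => by
    rw [tra_inv hH hW.cocycle, ← hH.tgt_dot hW.cocycle]
    rfl

include hH hW in
theorem sw_inv_twist {g : L → L → V} (hg : (H.twist Γ).DBal (H.twist Γ).lactI g) (X : L) :
    sw ((H.twist Γ).invLift X) g = sw (H.tco Γ H.lactI H.invLift X) g := by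
  rw [sw_invLift _ hg.left hg.right]
  exact sw_trans_twist hH hW hg.inv X

include hH hW hΘ in
theorem sharpIso_inv_twist_iff {N : Type u} [AddCommGroup N] [Module k N]
    {laN raN : B →ₗ[k] N →ₗ[k] N} {e : N →ₗ[k] L ⊗[k] N}
    (hN : (H.twist Γ).IsCom laN raN e) :
    (H.twist Γ).SharpIso Θ (H.twist Γ).lactI (H.twist Γ).ractI (H.twist Γ).invLift laN e ↔
      (H.twist Γ).SharpIso Θ (H.tla Γ H.lactI H.invLift) (H.tra Γ H.lactI H.invLift)
        (H.tco Γ H.lactI H.invLift) laN e := by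
  have h1 := isLeftHopfAlgebroid_twist hH hW
  rw [← twist_lactI hH hW, ← twist_ractI hH hW]
  exact (sharpIso_iff_of_lifts h1.bialgebroid hΘ h1.isCom_inv hN
    (fun hf m => (sw_inv_twist hH hW hf m).symm) (fun _ _ => rfl)).symm

include hH hW in
theorem WInv.cocycleComp (hΘ : (H.twist Γ).WInv Θ) : H.WInv (H.cocycleComp Θ Γ) :=
  (wInv_iff hH).2 ⟨isTwoCocycle_cocycleComp hH hW hΘ.cocycle, fun hM =>
    SharpIso.cocycleComp hH hW hΘ.cocycle hH.isCom_inv hM (((wInv_iff hH).1 hW).2 hM)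
      ((sharpIso_inv_twist_iff hH hW hΘ.cocycle (isCom_tco hH hW hM)).1
        (((wInv_iff (isLeftHopfAlgebroid_twist hH hW)).1 hΘ).2 (isCom_tco hH hW hM)))⟩

end

end

/-! ### The product of the cotwist by a composite -/

section

variable {Θ : L →ₗ[k] L →ₗ[k] B}

section
variable (hH : H.IsLeftHopfAlgebroid) (hb : H.IsLeftBialgebroid) (hW : H.WInv Γ)
  (hΘ : (H.twist Γ).IsTwoCocycle Θ) (hΘW : (H.twist Γ).WInv Θ)
  (hM : H.IsCom laM raM d) (hN : H.IsCom laN raN e) (hP : H.IsCom laP raP dP)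

include hH hW in
/-- The translation map of `L^Γ` commutes with the coproduct of `L`. -/
theorem tco_inv_coact {f : L → L → L → V}
    (h1 : ∀ y z, IsLin k (fun x => f x y z)) (h2 : ∀ x z, IsLin k (fun y => f x y z))
    (h3 : ∀ x y, IsLin k (fun z => f x y z))
    (b1 : ∀ b x y z, f (𝐭 b ⬝ x) y z = f x y (𝐬 b ⬝ z))
    (b2 : ∀ b x y z, f x (H.bull Γ (𝐭 b) y) z = f x y (H.bull Γ z (𝐭 b))) (X : L) :
    sw (H.tco Γ H.lactI H.invLift X) (fun q p => sw (H.comulLift p) (fun u v => f u q v)) =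
      sw (H.comulLift X) (fun u v => sw (H.tco Γ H.lactI H.invLift v) (fun q p => f u q p)) := by
  have hb := hH.bialgebroid
  have hΓ := hW.cocycle
  have hI := hH.isCom_inv
  have hT : ∀ u, H.TBal Γ H.lactI H.invLift (fun q p => f u q p) := fun u =>
    ⟨by fun_prop, by fun_prop, fun b y z => by rw [tla_inv hH hΓ, b2]⟩
  let F : L → L → L → V := fun u q p => H.push Γ H.lactI H.invLift (fun q p => f u q p) q p
  have hF : ∀ u, H.DBal H.lactI (F u) := fun u => bal_push (hT u)
  have l1 : ∀ y z, IsLin k (fun x => F x y z) := by fun_prop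
  have l2 : ∀ x z, IsLin k (fun y => F x y z) := by fun_prop
  have l3 : ∀ x y, IsLin k (fun z => F x y z) := by fun_prop
  have e1 : ∀ b u q v, F (𝐭 b ⬝ u) q v = F u q (𝐬 b ⬝ v) := fun b u q v => by
    have hφ : H.IsColin H.lactI H.invLift H.lactI H.invLift (H.mulL (𝐬 b)) := by
      refine ⟨fun c X => ?_, fun {V _ _ f} hf X => ?_⟩
      · simp only [lactI_apply, hb.mulL_assoc]
      · have hl := hf.left
        have hr := hf.right
        rw [sw_invLift _ hl hr, sw_invLift _ (by fun_prop) (by fun_prop)]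
        exact hH.trans_src_mul hf.inv b X
    have e0 := eq_push hW hI (F := fun q v => F u q (𝐬 b ⬝ v)) (g := fun q v => f u q (𝐬 b ⬝ v))
      ⟨by fun_prop, by fun_prop, fun c q v => by
        rw [(hF u).bal, lactI_apply, lactI_apply, hb.mulL_assoc]⟩
      (fun q v => (pull_colin hH hΓ hφ (hF u) q v).symm.trans
        (pull_push hW hI (hT u) q (𝐬 b ⬝ v))) q v
    simp only [← b1] at e0
    exact e0.symm
  have hD : ∀ q, H.DBal H.lactL (fun u v => F u q v) := fun q =>
    ⟨by fun_prop, by fun_prop, fun b u v => e1 b u q v⟩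
  have hG : H.TBal Γ H.lactI H.invLift (fun q p => sw (H.comulLift p) (fun u v => f u q v)) := by
    refine ⟨by fun_prop, by fun_prop, fun b q p => ?_⟩
    rw [tla_inv hH hΓ, hH.comul_bull_tgt hΓ ⟨by fun_prop, by fun_prop, fun c u v => b1 c u q v⟩]
    simp only [b2]
  have e2 : ∀ q p, sw (H.comulLift p) (fun u v => F u q v) =
      H.push Γ H.lactI H.invLift (fun q p => sw (H.comulLift p) (fun u v => f u q v)) q p := by
    refine eq_push hW hI (F := fun q p => sw (H.comulLift p) (fun u v => F u q v))
      ⟨by fun_prop, by fun_prop, fun c q p => ?_⟩ fun X m => ?_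
    · rw [lactI_apply, hb.comul_mul_tgt (hD q)]
      exact sw_congr _ fun u v => (hF u).bal c q v
    · unfold pull
      rw [sw_comm, sw_invLift _ (by fun_prop) (by fun_prop)]
      refine Eq.trans (sw_congr _ fun p q => sw_comm _ _ _)
        ((hH.trans_comul_comm (f := fun u v y => sw (H.transLift X)
        (fun a b => F u (a ⬝ 𝐭 (Γ b y)) v)) (by fun_prop) (by fun_prop) (by fun_prop)
        (fun b u v y => by simp only [e1])
        (fun b u v y => ((bal_pull_right hH hΓ (hF u) X).bal b y v).symm) m).trans
        (sw_congr _ fun u v => ?_))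
      refine Eq.trans ?_ (pull_push hW hI (hT u) X v)
      rw [sw_comm]
      exact sw_congr _ fun p q => (sw_invLift (H := H) (k := k) v
        (f := fun y v => F u (p ⬝ 𝐭 (Γ q y)) v) (by fun_prop) (by fun_prop)).symm
  rw [sw_tco _ hG]
  simp only [← e2]
  rw [sw_invLift _ (by fun_prop) (by fun_prop), hH.trans_comul_comm (f := fun u v q => F u q v)
    (by fun_prop) (by fun_prop) (by fun_prop) (fun b u v q => e1 b u q v)
    (fun b u v q => ((hF u).bal b q v).symm)]
  refine sw_congr _ fun u v => ?_
  rw [sw_tco _ (hT u), sw_invLift _ (by fun_prop) (by fun_prop)]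

include hH hW hΘ in
/-- The right twist of `L` by `Θ ∘ Γ` is a twist of `•` by `Θ`. -/
theorem bull_cocycleComp_apply (X Y : L) : H.bull (H.cocycleComp Θ Γ) X Y =
    sw (H.tco Γ H.lactI H.invLift X) (fun q p => sw (H.tco Γ H.lactI H.invLift Y) (fun s r =>
      H.bull Γ (H.bull Γ p r) (𝐭 (Θ s q)))) := by
  have hI := hH.isCom_inv
  have hΓ := hW.cocycle
  rw [bull_eq_twp, LinearMap.flip_apply, hH.isPairing_inv.twp_cocycleComp hH hW hΘ hI hI hI,
    twp_apply, sw_comm]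
  refine sw_congr _ fun q p => sw_congr _ fun s r => ?_
  have e : H.bull Γ p r = twp Γ H.invLift H.invLift H.lactI H.mulL.flip r p :=
    LinearMap.congr_fun₂ bull_eq_twp p r
  rw [tla_inv hH hΓ, e]

include hH hW hΘ in
/-- The right twist of `L^Γ` by `Θ` is the same twist of the product of `L^Γ`. -/
theorem bull_twist_apply (X Y : L) : (H.twist Γ).bull Θ X Y =
    sw (H.tco Γ H.lactI H.invLift X) (fun q p => sw (H.tco Γ H.lactI H.invLift Y) (fun s r =>
      H.bull Γ ((H.twist Γ).mulL p r) (𝐭 (Θ s q)))) := by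
  have hΓ := hW.cocycle
  have h1 := isLeftHopfAlgebroid_twist hH hW
  have hb1 := h1.bialgebroid
  rw [bull_apply, sw_trans_twist hH hW (h1.bal_bull_left hΘ Y)]
  refine sw_congr _ fun q p => (sw_trans_twist hH hW ⟨by fun_prop, by fun_prop, fun b r s => ?_⟩
    Y).trans (sw_congr _ fun s r => hH.dot_tgt hΓ _ _)
  rw [hΘ.bar_linear, hb1.tgt_mul]
  simp only [hb1.mulL_assoc]

include hH hW hΘ in
/-- Twisting the right twist by `Θ ∘ Γ` on the left by `Γ` gives the right twist of `L^Γ` by `Θ`. -/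
theorem twp_bull_cocycleComp : twp Γ H.comulLift H.comulLift H.lactL (H.bull (H.cocycleComp Θ Γ)) =
    (H.twist Γ).bull Θ := by
  have hb := hH.bialgebroid
  have hΓ := hW.cocycle
  have hI := hH.isCom_inv
  have h1 := isLeftHopfAlgebroid_twist hH hW
  refine LinearMap.ext₂ fun X Y => ?_
  rw [bull_twist_apply hH hW hΘ, twp_apply]
  let K : L → L → L → L → L → L → L := fun x y p r q s =>
    𝐬 (Γ x y) ⬝ H.bull Γ (H.bull Γ p r) (𝐭 (Θ s q))
  have hm := fun b X => hH.src_mul_bull hΓ b X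
  have eK : ∀ p r q s, H.bull Γ ((H.twist Γ).mulL p r) (𝐭 (Θ s q)) =
      sw (H.comulLift p) (fun x p' => sw (H.comulLift r) (fun y r' => K x y p' r' q s)) :=
    fun p r q s => by
      rw [dot_apply, map_sw (φ := fun z => H.bull Γ z (𝐭 (Θ s q))) _ _ (by fun_prop)]
      refine sw_congr _ fun x p' => ?_
      rw [map_sw (φ := fun z => H.bull Γ z (𝐭 (Θ s q))) _ _ (by fun_prop)]
      exact sw_congr _ fun y r' => hm _ _ _
  have hT : ∀ b s q, 𝐭 (Θ (H.bull Γ (𝐭 b) s) q) = H.bull Γ (𝐭 b) (𝐭 (Θ s q)) := fun b s q => by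
    rw [← hH.tgt_dot hΓ, ← hH.tgt_dot hΓ]
    exact (congrArg H.tgt (hΘ.bar_linear b s q)).trans (h1.bialgebroid.tgt_mul _ _)
  have hA := hH.bull_assoc hΓ
  have hs : ∀ a b X, 𝐬 (H.mulB a b) ⬝ X = 𝐬 a ⬝ (𝐬 b ⬝ X) := fun a b X => by
    rw [hb.src_mul, hb.mulL_assoc]
  have hD : ∀ s r q y, H.DBal H.lactL (fun x p' => K x y p' r q s) := fun s r q y =>
    ⟨by fun_prop, by fun_prop, fun b x p' => by
      simp only [K, hΓ.bar_linear, hs, hm, lactL_apply]⟩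
  have hTs : ∀ x y p q, H.TBal Γ H.lactI H.invLift (fun s r => K x y p r q s) := fun x y p q =>
    ⟨by fun_prop, by fun_prop, fun b s r => by
      simp only [K, hT, tla_inv hH hΓ, hA]⟩
  have e1 := tco_inv_coact hH hW (f := fun x q p => sw (H.comulLift Y) (fun y y' =>
      sw (H.tco Γ H.lactI H.invLift y') (fun s r => K x y p r q s)))
    (by fun_prop) (by fun_prop) (by fun_prop)
    (fun b x q p => sw_congr _ fun y y' => sw_congr _ fun s r => (hD s r q y).bal b x p)
    (fun b x q p => sw_congr _ fun y y' => by
      have := tco_takeuchi hH hW hI (hTs x y p q) b y'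
      simpa only [K, tra_inv hH hΓ, hΘ.bull_tgt hH hW, hA] using this) X
  have e2 := fun q p => tco_inv_coact hH hW (f := fun y s r => sw (H.comulLift p)
      (fun x p' => K x y p' r q s)) (by fun_prop) (by fun_prop) (by fun_prop)
    (fun b y s r => by
      have := hb.comul_takeuchi (hD s r q y) b p
      simpa only [K, hΓ.balanced, hH.mul_src_bull hΓ] using this)
    (fun b y s r => sw_congr _ fun x p' => by
      have := (hTs x y p' q).bal b s r
      rwa [tla_inv hH hΓ] at this) Y
  have e3 : ∀ x y x' y', 𝐬 (Γ x y) ⬝ H.bull (H.cocycleComp Θ Γ) x' y' =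
      sw (H.tco Γ H.lactI H.invLift x') (fun q p => sw (H.tco Γ H.lactI H.invLift y')
        (fun s r => K x y p r q s)) := fun x y x' y' => by
    rw [bull_cocycleComp_apply hH hW hΘ, map_sw (φ := fun z => 𝐬 (Γ x y) ⬝ z) _ _ (by fun_prop)]
    exact sw_congr _ fun q p => map_sw (φ := fun z => 𝐬 (Γ x y) ⬝ z) _ _ (by fun_prop)
  simp only [lactL_apply, e3, eK]
  refine Eq.trans (sw_congr _ fun x x' => sw_comm _ _ _) (e1.symm.trans (sw_congr _ fun q p => ?_))
  refine Eq.trans ?_ ((e2 q p).symm.trans (sw_congr _ fun s r => sw_comm _ _ _))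
  exact (sw_comm _ _ _).trans (sw_congr _ fun y y' => sw_comm _ _ _)

end

end

/-! ### The cotwist by a composite -/

section

variable {Θ : L →ₗ[k] L →ₗ[k] B}

/-- The counit of a bialgebroid is determined by the other structure maps. -/
theorem counit_eq_of_comul {H H' : BialgebroidData k B L} (hb : H.IsLeftBialgebroid)
    (hb' : H'.IsLeftBialgebroid) (h1 : H.mulB = H'.mulB) (h3 : H.mulL = H'.mulL)
    (h5 : H.src = H'.src) (h6 : H.tgt = H'.tgt)
    (h8 : ∀ {V : Type u} [AddCommGroup V] [Module k V] {f : L → L → V}, H.DBal H.lactL f → ∀ X,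
      sw (H'.comulLift X) f = sw (H.comulLift X) f) : H.counit = H'.counit := by
  refine LinearMap.ext fun X => ?_
  -- both counits of `X` equal `ε'(X₍₁₎) ε(X₍₂₎)` for the common coproduct
  have e1 : sw (H'.comulLift X) (fun x y => H.mulB (H'.counit x) (H.counit y)) = H.counit X := by
    conv_rhs => rw [← hb'.comul_counit_left X, map_sw (φ := H.counit) _ _ (by fun_prop)]
    exact sw_congr _ fun x y => by rw [← hb.counit_src_mul, h5, h3]
  have e2 : sw (H.comulLift X) (fun x y => H.mulB (H'.counit x) (H.counit y)) = H'.counit X := by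
    conv_rhs => rw [← hb.comul_counit_right X, map_sw (φ := H'.counit) _ _ (by fun_prop)]
    exact sw_congr _ fun x y => by rw [h1, ← hb'.counit_tgt_mul, h6, h3]
  rw [← e1, ← e2]
  refine h8 ⟨by fun_prop, by fun_prop, fun b x y => ?_⟩ X
  rw [lactL_apply, hb.counit_src_mul, h6, h3, hb'.counit_tgt_mul, ← h1, hb.mulB_assoc]

section
variable (hH : H.IsLeftHopfAlgebroid) (hb : H.IsLeftBialgebroid) (hW : H.WInv Γ)
  (hΘ : (H.twist Γ).IsTwoCocycle Θ) (hΘW : (H.twist Γ).WInv Θ)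
  (hM : H.IsCom laM raM d) (hN : H.IsCom laN raN e) (hP : H.IsCom laP raP dP)

include hH hW hΘ hM in
/-- `J_{Θ ∘ Γ} = J_Γ J_Θ` -/
theorem pull_cocycleComp {F : L → M → V} (hF : H.DBal laM F) (X : L) (m : M) :
    H.pull (H.cocycleComp Θ Γ) d F X m =
      (H.twist Γ).pull Θ (H.tco Γ laM d) (fun x n => H.pull Γ d F x n) X m := by
  have hΓ := hW.cocycle
  have h1 := isLeftHopfAlgebroid_twist hH hW
  have hl := hF.left
  have hr := hF.right
  have e1 := sw_cocycleComp hH hW hΘ hH.isCom_inv hM (f := F) (raM := H.ractI) hF X m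
  rw [sw_invLift _ (by fun_prop) (by fun_prop)] at e1
  refine e1.trans (Eq.symm ?_)
  have hG := TBal.dBal hH hΓ (bal_pull hH hM hΓ hF)
  have hGl := hG.left
  have hGr := hG.right
  refine (sw_trans_twist hH hW (bal_pull_left h1 hΘ hG m) X).trans ?_
  refine sw_congr _ fun q p => sw_congr _ fun u v => ?_
  rw [sw_invLift _ (by fun_prop) (by fun_prop)]
  rw [tla_inv hH hΓ, ← hH.dot_tgt hΓ]
  rfl

include hH hW hΘW hM in
/-- Twisting a coaction by `Θ ∘ Γ` is twisting by `Γ`, then by `Θ`. -/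
theorem tco_cocycleComp {g : L → M → V} (hg : H.TBal (H.cocycleComp Θ Γ) laM d g) (m : M) :
    sw (H.tco (H.cocycleComp Θ Γ) laM d m) g =
      sw ((H.twist Γ).tco Θ (H.tla Γ laM d) (H.tco Γ laM d) m) g := by
  have hΓ := hW.cocycle
  have hΘ := hΘW.cocycle
  have hΞ := hW.cocycleComp hH hΘW
  let F : L → M → V := fun x n => H.push (H.cocycleComp Θ Γ) laM d g x n
  have hF : H.DBal laM F := bal_push hg
  have hG := TBal.dBal hH hΓ (bal_pull hH hM hΓ hF)
  have e : ∀ x n, g x n = (H.twist Γ).pull Θ (H.tco Γ laM d) (fun x n => H.pull Γ d F x n) x n :=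
    fun x n => by
      rw [← pull_cocycleComp hH hW hΘ hM hF]
      exact (pull_push hΞ hM hg x n).symm
  rw [sw_tco m hg, sw_congr _ e, tco_pull hΘW (isCom_tco hH hW hM) m hG, tco_pull hW hM m hF]

include hH hW hM in
/-- The twisted coaction does not depend on the lift of the coaction. -/
theorem tco_congr {d' : M →ₗ[k] L ⊗[k] M} (hM' : H.IsCom laM raM d')
    (hd : ∀ {V : Type u} [AddCommGroup V] [Module k V] {f : L → M → V}, H.DBal laM f → ∀ m,
      sw (d' m) f = sw (d m) f) {g : L → M → V} (hg : H.TBal Γ laM d g) (m : M) :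
    sw (H.tco Γ laM d' m) g = sw (H.tco Γ laM d m) g := by
  have hΓ := hW.cocycle
  let F : L → M → V := fun x n => H.push Γ laM d g x n
  have hF : H.DBal laM F := bal_push hg
  have e : ∀ x n, g x n = H.pull Γ d' F x n := fun x n => by
    rw [← pull_push hW hM hg x n, pull, pull, sw_comm, sw_comm (H.transLift x)]
    exact (hd (bal_pull_right hH hΓ hF x) n).symm
  rw [sw_congr _ e, tco_pull hW hM' m hF, hd hF, ← sw_tco m hg, sw_congr _ e]

include hH hW hΘW in
/-- Both products are the twist by `Θ`, on the left, of the right twist of `L^Γ` by `Θ`. -/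
theorem mulL_twist_cocycleComp :
    (H.twist (H.cocycleComp Θ Γ)).mulL = ((H.twist Γ).twist Θ).mulL := by
  have hb := hH.bialgebroid
  have hΓ := hW.cocycle
  have hΘ := hΘW.cocycle
  have hR := hb.isCom_regular
  have h1 := isLeftHopfAlgebroid_twist hH hW
  have hb1 := h1.bialgebroid
  rw [dot_eq_twp, (hH.isPairing_bull (isTwoCocycle_cocycleComp hH hW hΘ)).twp_cocycleComp hH hW hΘ
    hR hR hR, twp_bull_cocycleComp hH hW hΘ, ← twist_lactL hH hΓ]
  refine LinearMap.ext₂ fun X Y => ?_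
  rw [dot_apply, twp_apply]
  refine (comul_twist_comul_twist hH hW (f := fun x x' y y' =>
    (H.twist Γ).mulL (𝐬 (Θ x y)) ((H.twist Γ).bull Θ x' y')) (by fun_prop) (by fun_prop)
    (by fun_prop) (by fun_prop) (fun b x x' y y' => ?_) (fun b x x' y y' => ?_)
    (fun b x x' y y' => ?_) X Y).symm
  · rw [hΘ.tgt_bull hH hW, ← hH.src_dot hΓ b x', ← hH.dot_src hΓ, hb1.mulL_assoc]
    exact congrArg _ (h1.src_mul_bull hΘ b x' y').symm
  · rw [hΘ.bull_tgt hH hW]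
  · rw [← hH.src_dot hΓ, ← hH.dot_src hΓ]
    exact congrArg _ (h1.mul_src_bull hΘ b x' y')

include hH hW hΘW in
/-- `L^{Θ ∘ Γ} = (L^Γ)^Θ` -/
theorem twist_cocycleComp : H.twist (H.cocycleComp Θ Γ) = (H.twist Γ).twist Θ := by
  have hb := hH.bialgebroid
  have hΓ := hW.cocycle
  have hΘ := hΘW.cocycle
  have hR := hb.isCom_regular
  have h1 := isLeftHopfAlgebroid_twist hH hW
  have hΞ := hW.cocycleComp hH hΘW
  have hbΞ := isLeftBialgebroid_twist hH hΞ
  have hb2 := isLeftBialgebroid_twist h1 hΘW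
  have hmul := mulL_twist_cocycleComp hH hW hΘW
  -- the products of the bases are the restrictions of the products along the source map
  have hmulB : (H.twist (H.cocycleComp Θ Γ)).mulB = ((H.twist Γ).twist Θ).mulB := by
    refine LinearMap.ext₂ fun a b => ?_
    have hI : Function.Injective H.src := Function.LeftInverse.injective hb.counit_src
    refine hI ((hbΞ.src_mul a b).trans (Eq.trans ?_ (hb2.src_mul a b).symm))
    rw [hmul]
    rfl
  have hcomul : ∀ {V : Type u} [AddCommGroup V] [Module k V] {f : L → L → V},
      (H.twist (H.cocycleComp Θ Γ)).DBal (H.twist (H.cocycleComp Θ Γ)).lactL f → ∀ X,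
      sw (((H.twist Γ).twist Θ).comulLift X) f =
        sw ((H.twist (H.cocycleComp Θ Γ)).comulLift X) f := fun {V _ _ f} hf X => by
    have hf2 : ((H.twist Γ).twist Θ).DBal ((H.twist Γ).twist Θ).lactL f :=
      ⟨hf.left, hf.right, fun b x y => by
        have := hf.bal b x y
        rw [lactL_apply, hmul] at this
        exact this⟩
    have hfT : H.TBal (H.cocycleComp Θ Γ) H.lactL H.comulLift f := by
      rw [twist_lactL hH hΞ.cocycle] at hf
      exact DBal.tBal hH hΞ.cocycle hf
    rw [sw_comul_twist hH hΞ hf, sw_comul_twist h1 hΘW hf2, tco_cocycleComp hH hW hΘW hR hfT]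
    rw [twist_lactL h1 hΘ] at hf2
    have hC := isCom_tco hH hW hR
    rw [← twist_lactL hH hΓ] at hC ⊢
    refine (tco_congr h1 hΘW h1.bialgebroid.isCom_regular (raM := (H.twist Γ).ractL) ?_ ?_
      (DBal.tBal h1 hΘ hf2) X).symm
    · exact h1.bialgebroid.isCom_regular.congr h1.bialgebroid
        fun hf X => (sw_comul_twist hH hW hf X).symm
    · exact fun hf X => (sw_comul_twist hH hW hf X).symm
  refine ext_of_toDiamond hmulB rfl hmul rfl rfl rfl
    (counit_eq_of_comul hbΞ hb2 hmulB hmul rfl rfl hcomul) fun X => ?_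
  rw [← toDiamond_comulLift]
  exact toDiamond_eq_of_sw (hcomul (bal_toDiamond _) X).symm

end

end

/-! ### Inverting the coproduct of `L^Γ` -/

section

variable {Θ : L →ₗ[k] L →ₗ[k] B}

variable (H Γ) in
/-- The map `L ⊗ L → L`, `Y ⊗ Z ↦ ε(Y₊ t(Γ(Y₋, Z₍₁₎))) Z₍₂₎`, which inverts the coproduct of
`L^Γ` on its image. -/
def cancel (Y Z : L) : L := H.pull Γ H.comulLift (fun x y => 𝐬 (H.counit x) ⬝ y) Y Z

variable (H Γ) in
/-- A retraction `L ⊗ N → N`, `Y ⊗ n ↦ ε^Γ(cancel(Y, n₍₋₁₎)) n₍₀₎`, of the coaction of a comodule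
`N` of `L^Γ`. -/
def retract (laN : B →ₗ[k] N →ₗ[k] N) (e : N →ₗ[k] L ⊗[k] N) (Y : L) (n : N) : N :=
  sw (e n) (fun z n' => laN ((H.twist Γ).counit (H.cancel Γ Y z)) n')

section funProp
variable {W : Type u} [AddCommGroup W] [Module k W]

@[fun_prop] theorem IsLin.cancel_left {φ : W → L} (hφ : IsLin k φ) (Z : L) :
    IsLin k (fun x => H.cancel Γ (φ x) Z) := by
  unfold cancel
  fun_prop

@[fun_prop] theorem IsLin.cancel_right (Y : L) {φ : W → L} (hφ : IsLin k φ) :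
    IsLin k (fun x => H.cancel Γ Y (φ x)) := by
  unfold cancel
  fun_prop

@[fun_prop] theorem IsLin.retract_left {φ : W → L} (hφ : IsLin k φ) (n : N) :
    IsLin k (fun x => H.retract Γ laN e (φ x) n) := by
  unfold retract
  fun_prop

@[fun_prop] theorem IsLin.retract_right (Y : L) {φ : W → N} (hφ : IsLin k φ) :
    IsLin k (fun x => H.retract Γ laN e Y (φ x)) := by
  unfold retract
  fun_prop

end funProp

section
variable (hH : H.IsLeftHopfAlgebroid) (hb : H.IsLeftBialgebroid) (hΓ : H.IsTwoCocycle Γ)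
  (hW : H.WInv Γ) (hM : H.IsCom laM raM d)

include hH hΓ in
theorem IsLeftHopfAlgebroid.isColin_tgt_bull (b : B) :
    H.IsColin H.lactL H.comulLift H.lactL H.comulLift (H.bull Γ (𝐭 b)) where
  lact c X := hH.tgt_bull_src_mul hΓ b c X
  coact hf X := hH.comul_tgt_bull hΓ hf b X

include hH hW hM in
theorem push_colin {laN raN : B →ₗ[k] N →ₗ[k] N} {e : N →ₗ[k] L ⊗[k] N} (hN : H.IsCom laN raN e)
    {φ : M →ₗ[k] N} (hφ : H.IsColin laM d laN e φ) {g : L → N → V} (hg : H.TBal Γ laN e g)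
    (X : L) (m : M) :
    H.push Γ laN e g X (φ m) = H.push Γ laM d (fun x n => g x (φ n)) X m := by
  have hl := hg.left
  have hr := hg.right
  exact eq_push hW hM (F := fun x n => H.push Γ laN e g x (φ n))
    ⟨by fun_prop, by fun_prop, fun b x m => by rw [hφ.lact, (bal_push hg).bal]⟩
    (fun x m => (pull_colin hH hW.cocycle hφ (bal_push hg) x m).symm.trans
      (pull_push hW hN hg x (φ m))) X m

include hb in
theorem bal_counit_src_mul : H.DBal H.lactL (fun x y => 𝐬 (H.counit x) ⬝ y) :=
  ⟨by fun_prop, by fun_prop, fun b x y => by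
    rw [hb.counit_tgt_mul, hb.src_mul, lactL_apply, hb.mulL_assoc]⟩

include hH hW in
/-- `cancel(X₍[1]₎, X₍[2]₎) = X` -/
theorem tco_cancel (X : L) :
    sw (H.tco Γ H.lactL H.comulLift X) (fun y z => H.cancel Γ y z) = X := by
  have hb := hH.bialgebroid
  exact (tco_pull hW hb.isCom_regular X (bal_counit_src_mul hb)).trans (hb.comul_counit_left X)

include hH hΓ in
theorem cancel_src_mul (b : B) (Y Z : L) :
    H.cancel Γ (𝐬 b ⬝ Y) Z = 𝐬 b ⬝ H.cancel Γ Y Z := by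
  have hb := hH.bialgebroid
  rw [cancel, pull_src_mul hH hΓ (bal_counit_src_mul hb), cancel, pull, pull,
    map_sw (φ := fun z => 𝐬 b ⬝ z) _ _ (by fun_prop)]
  refine sw_congr _ fun p q => ?_
  rw [map_sw (φ := fun z => 𝐬 b ⬝ z) _ _ (by fun_prop)]
  refine sw_congr _ fun u v => ?_
  rw [hb.counit_src_mul, hb.src_mul, hb.mulL_assoc]

include hH hΓ in
theorem cancel_tgt_bull (b : B) (Y Z : L) :
    H.cancel Γ (H.bull Γ (𝐭 b) Y) Z = H.cancel Γ Y (H.star Γ (𝐬 b) Z) := by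
  have hb := hH.bialgebroid
  rw [← hb.tla_regular hΓ]
  exact (bal_pull hH hb.isCom_regular hΓ (bal_counit_src_mul hb)).bal b Y Z

include hH hΓ in
theorem cancel_bull (b : B) (Y Z : L) :
    H.cancel Γ Y (H.bull Γ (𝐭 b) Z) = H.bull Γ (𝐭 b) (H.cancel Γ Y Z) := by
  have hb := hH.bialgebroid
  rw [cancel, pull_colin hH hΓ (hH.isColin_tgt_bull hΓ b) (bal_counit_src_mul hb), cancel, pull,
    pull, map_sw (φ := H.bull Γ (𝐭 b)) _ _ (by fun_prop)]
  refine sw_congr _ fun p q => ?_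
  rw [map_sw (φ := H.bull Γ (𝐭 b)) _ _ (by fun_prop)]
  exact sw_congr _ fun u v => (hH.tgt_bull_src_mul hΓ _ _ _).symm

include hH hW in
/-- `Δ^Γ(cancel(Y, Z)) = cancel(Y, Z₍[1]₎) ⊗ Z₍[2]₎` -/
theorem tco_cancel_right {g : L → L → V} (hg : H.TBal Γ H.lactL H.comulLift g) (Y Z : L) :
    sw (H.tco Γ H.lactL H.comulLift (H.cancel Γ Y Z)) g =
      sw (H.tco Γ H.lactL H.comulLift Z) (fun z z' => g (H.cancel Γ Y z) z') := by
  have hb := hH.bialgebroid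
  have hΓ := hW.cocycle
  have hR := hb.isCom_regular
  have hl := hg.left
  have hr := hg.right
  have hF : ∀ z, H.DBal H.lactL (fun x y => g (𝐬 (H.counit x) ⬝ y) z) := fun z =>
    ⟨by fun_prop, by fun_prop, fun b x y => by rw [(bal_counit_src_mul hb).bal]⟩
  have e1 := tco_comul hH hW hR (f := fun u x y => sw (H.transLift Y) (fun p q =>
      g (𝐬 (H.counit (p ⬝ 𝐭 (Γ q u))) ⬝ x) y)) (by fun_prop) (by fun_prop) (by fun_prop)
    (fun b u x y => (bal_pull_right hH hΓ (hF y) Y).bal b u x)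
    (fun b u x y => sw_congr _ fun p q => (hg.src_mul_left hH hΓ _).bal b x y) Z
  have e2 : ∀ z z', g (H.cancel Γ Y z) z' = sw (H.comulLift z) (fun u x =>
      sw (H.transLift Y) (fun p q => g (𝐬 (H.counit (p ⬝ 𝐭 (Γ q u))) ⬝ x) z')) := fun z z' => by
    rw [cancel, pull, sw_comm, map_sw_left (φ := g) _ _ hl]
    exact sw_congr _ fun u x => map_sw_left (φ := g) _ _ hl z'
  simp only [e2]
  refine Eq.trans ?_ (e1.symm)
  rw [cancel, pull, sw_comm, sw_sw_lin (H.tco Γ H.lactL H.comulLift) _ hl hr]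
  refine sw_congr _ fun u x => ?_
  rw [sw_sw_lin (H.tco Γ H.lactL H.comulLift) _ hl hr, sw_comm]
  exact sw_congr _ fun p q => tco_lact hH hW hR hg _ x

include hH hW hM in
/-- `(m b)₍[-1]₎ ⊗ (m b)₍[0]₎ = m₍[-1]₎ s(b) ⊗ m₍[0]₎` -/
theorem tco_ract {g : L → M → V} (hg : H.TBal Γ laM d g) (b : B) (m : M) :
    sw (H.tco Γ laM d (raM b m)) g = sw (H.tco Γ laM d m) (fun x m => g (x ⬝ 𝐬 b) m) := by
  have hb := hH.bialgebroid
  have hΓ := hW.cocycle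
  have hF := bal_push hg
  have hl := hF.left
  have hr := hF.right
  rw [sw_tco _ hg, hM.ract hF, ← tco_pull hW hM _ (hF.mul_right hb _)]
  refine sw_congr _ fun x m => ?_
  rw [← pull_push hW hM hg, pull, pull, hH.trans_mul_src (bal_pull_left hH hΓ hF m)]
  simp only [hb.mulL_assoc, hb.src_tgt]

include hH hW in
/-- The right twist of `L^Γ` by the inverse cocycle multiplies with `t(b)` as `L` does. -/
theorem tgt_bull_cocycleInv (b : B) (X : L) :
    (H.twist Γ).bull (H.cocycleInv Γ) (𝐭 b) X = 𝐭 b ⬝ X := by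
  have hb := hH.bialgebroid
  have hΓ := hW.cocycle
  have h1 := isLeftHopfAlgebroid_twist hH hW
  have hb1 := h1.bialgebroid
  have hB : (H.twist Γ).BBal (fun p q => (H.twist Γ).mulL p (𝐭 ((H.twist Γ).counit q))) :=
    ⟨by fun_prop, by fun_prop, fun b p q => by
      rw [hb1.counit_tgt_mul]
      exact (hb1.mulL_assoc _ _ _).trans (congrArg _ (hb1.tgt_mul _ _).symm)⟩
  have e1 := h1.trans_counit (𝐭 b ⬝ X)
  refine (h1.tgt_bull (isTwoCocycle_cocycleInv hH hW) b X).trans (Eq.trans ?_ e1)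
  have hT := BBal.tBal hH hΓ hB
  have hB' : (H.twist Γ).BBal (fun p q => (H.twist Γ).mulL p (𝐭 (H.cocycleInv Γ q (𝐬 b)))) :=
    ⟨by fun_prop, by fun_prop, fun c p q => by
      rw [(isTwoCocycle_cocycleInv hH hW).bar_linear]
      exact (hb1.mulL_assoc _ _ _).trans (congrArg _ (hb1.tgt_mul _ _).symm)⟩
  refine (sw_trans_twist hH hW hB' X).trans (Eq.trans ?_ (sw_trans_twist hH hW hB _).symm)
  refine Eq.trans (sw_congr _ fun q p => ?_) (tco_ract hH hW hH.isCom_inv hT b X).symm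
  have e2 := hH.bull_mul_src hΓ b q H.oneL
  rw [hb.oneL_mul, hH.bull_oneL hΓ] at e2
  rw [cocycleInv_apply hH hΓ, e2]

include hH hW in
/-- `(Γ⁻¹)^#` is the inverse of `Γ^#` on `L ⊗ L`. -/
theorem pull_cocycleInv {g : L → L → V} (hg : H.TBal Γ H.lactL H.comulLift g) (X Z : L) :
    (H.twist Γ).pull (H.cocycleInv Γ) (H.tco Γ H.lactL H.comulLift) g X Z =
      H.push Γ H.lactL H.comulLift g X Z := by
  have hb := hH.bialgebroid
  have hΓ := hW.cocycle
  have hR := hb.isCom_regular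
  have h1 := isLeftHopfAlgebroid_twist hH hW
  have hF := bal_push hg
  have hl := hF.left
  have hr := hF.right
  have e1 := tco_cocycleInv hH hW hH.isCom_inv hR (f := fun x m => H.push Γ H.lactL H.comulLift g x m)
    (raM := H.ractI) hF X Z
  refine Eq.trans ?_ e1
  have hG : (H.twist Γ).DBal (H.tla Γ H.lactL H.comulLift) g := TBal.dBal hH hΓ hg
  refine (sw_trans_twist hH hW (bal_pull_left h1 (isTwoCocycle_cocycleInv hH hW) hG Z) X).trans ?_
  refine sw_congr _ fun q p => sw_congr _ fun u v => ?_
  rw [sw_invLift _ (by fun_prop) (by fun_prop), tla_inv hH hΓ, ← hH.dot_tgt hΓ]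
  exact (pull_push hW hR hg _ _).symm

end

end

/-! ### A retraction of the coaction of a comodule of `L^Γ` -/

section

@[fun_prop] theorem IsLin.pull_fun {W : Type u} [AddCommGroup W] [Module k W]
    {g : W → L → M → V} (h : ∀ m n, IsLin k (fun x => g x m n)) (X : L) (m : M) :
    IsLin k (fun x => H.pull Γ d (g x) X m) := by
  unfold pull
  fun_prop

section
variable (hH : H.IsLeftHopfAlgebroid) (hW : H.WInv Γ) (hN : (H.twist Γ).IsCom laN raN e)

include hH hW in
/-- Coassociativity of a comodule of `L^Γ`, in terms of the twisted coaction of `L`. -/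
theorem sw_coassoc_twist (hN : (H.twist Γ).IsCom laN raN e) {f : L → L → N → V}
    (h1 : ∀ y z, IsLin k (fun x => f x y z)) (h2 : ∀ x z, IsLin k (fun y => f x y z))
    (h3 : ∀ x y, IsLin k (fun z => f x y z))
    (b1 : ∀ b x y n, f (H.bull Γ (𝐭 b) x) y n = f x (H.star Γ (𝐬 b) y) n)
    (b2 : ∀ b x y n, f x (H.bull Γ (𝐭 b) y) n = f x y (laN b n)) (n : N) :
    sw (e n) (fun x n' => sw (e n') (fun y n'' => f x y n'')) =
      sw (e n) (fun x n' => sw (H.tco Γ H.lactL H.comulLift x) (fun y z => f y z n')) := by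
  have hΓ := hW.cocycle
  have b1' : ∀ b x y n, f ((H.twist Γ).mulL (𝐭 b) x) y n = f x ((H.twist Γ).mulL (𝐬 b) y) n :=
    fun b x y n => by rw [hH.tgt_dot hΓ, hH.src_dot hΓ, b1]
  have b2' : ∀ b x y n, f x ((H.twist Γ).mulL (𝐭 b) y) n = f x y (laN b n) :=
    fun b x y n => by rw [hH.tgt_dot hΓ, b2]
  refine (hN.coassoc ⟨h1, h2, h3, b1', b2'⟩ n).symm.trans (sw_congr _ fun x n' => ?_)
  exact sw_comul_twist hH hW ⟨by fun_prop, by fun_prop, fun b y z => b1' b y z n'⟩ x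

include hH hW in
theorem dBal_twist_iff {f : L → N → V} (h1 : ∀ n, IsLin k (fun x => f x n))
    (h2 : ∀ x, IsLin k (fun n => f x n)) : (H.twist Γ).DBal laN f ↔
      ∀ b x n, f (H.bull Γ (𝐭 b) x) n = f x (laN b n) := by
  have hΓ := hW.cocycle
  refine ⟨fun h b x n => ?_, fun h => ⟨h1, h2, fun b x n => ?_⟩⟩
  · rw [← hH.tgt_dot hΓ]
    exact h.bal b x n
  · rw [← h, ← hH.tgt_dot hΓ]
    rfl

include hH hW in
theorem counit_twist_tgt_bull (b : B) (X : L) : (H.twist Γ).counit (H.bull Γ (𝐭 b) X) =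
    (H.twist Γ).mulB ((H.twist Γ).counit X) b := by
  rw [← hH.tgt_dot hW.cocycle]
  exact (isLeftBialgebroid_twist hH hW).counit_tgt_mul b X

include hH hW in
theorem counit_twist_src_star (b : B) (X : L) : (H.twist Γ).counit (H.star Γ (𝐬 b) X) =
    (H.twist Γ).mulB b ((H.twist Γ).counit X) := by
  rw [← hH.src_dot hW.cocycle]
  exact (isLeftBialgebroid_twist hH hW).counit_src_mul b X

include hH hW in
theorem star_src_mulB_twist (a b : B) (X : L) : H.star Γ (𝐬 ((H.twist Γ).mulB a b)) X =
    H.star Γ (𝐬 a) (H.star Γ (𝐬 b) X) := by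
  have hb := hH.bialgebroid
  rw [← hb.star_assoc hW.cocycle, hb.src_star_src hW.cocycle]
  rfl

include hH hW hN in
theorem bal_retract (Y : L) (b : B) (z : L) (n : N) :
    laN ((H.twist Γ).counit (H.cancel Γ Y (H.bull Γ (𝐭 b) z))) n =
      laN ((H.twist Γ).counit (H.cancel Γ Y z)) (laN b n) := by
  rw [cancel_bull hH hW.cocycle, counit_twist_tgt_bull hH hW, hN.la_mul]

include hH hW hN in
/-- `retract` is a left inverse of the coaction. -/
theorem retract_coact (n : N) : sw (e n) (fun y n' => H.retract Γ laN e y n') = n := by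
  have hΓ := hW.cocycle
  -- by coassociativity the left-hand side is `ε^Γ(cancel(n₍₋₁₎₍[1]₎, n₍₋₁₎₍[2]₎)) n₍₀₎`
  refine Eq.trans (sw_coassoc_twist hH hW hN
    (f := fun y z n => laN ((H.twist Γ).counit (H.cancel Γ y z)) n) (by fun_prop) (by fun_prop)
    (by fun_prop) (fun b y z n => by rw [cancel_tgt_bull hH hΓ])
    (fun b y z n => bal_retract hH hW hN y b z n) n) (Eq.trans (sw_congr _ fun x n' => ?_)
    (hN.counit n))
  rw [← map_sw (φ := fun z => laN ((H.twist Γ).counit z) n') _ _ (by fun_prop), tco_cancel hH hW]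

include hH hW hN in
theorem retract_tgt_bull (b : B) (Y : L) (n : N) :
    H.retract Γ laN e (H.bull Γ (𝐭 b) Y) n = H.retract Γ laN e Y (laN b n) := by
  have hΓ := hW.cocycle
  refine Eq.symm ((hN.lact ((dBal_twist_iff hH hW (by fun_prop) (by fun_prop)).2
    (bal_retract hH hW hN Y)) b n).trans (sw_congr _ fun z n' => ?_))
  rw [cancel_tgt_bull hH hΓ, ← hH.src_dot hΓ]
  rfl

include hH hW hN in
/-- `δ(retract(Y, n)) = cancel(Y, n₍₋₁₎) ⊗ n₍₀₎` -/
theorem coact_retract {f : L → N → V} (hf : (H.twist Γ).DBal laN f) (Y : L) (n : N) :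
    sw (e (H.retract Γ laN e Y n)) f = sw (e n) (fun z n' => f (H.cancel Γ Y z) n') := by
  have hΓ := hW.cocycle
  have hb := hH.bialgebroid
  have hb1 := isLeftBialgebroid_twist hH hW
  have hl := hf.left
  have hr := hf.right
  have hbal := (dBal_twist_iff hH hW hl hr).1 hf
  have hst : ∀ b c X, H.star Γ (𝐬 c) (H.bull Γ (𝐭 b) X) = H.bull Γ (𝐭 b) (H.star Γ (𝐬 c) X) :=
    fun b c X => by
      rw [← hH.tgt_dot hΓ, ← hH.tgt_dot hΓ, ← hH.src_dot hΓ, ← hH.src_dot hΓ]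
      have := congrArg (fun z => (H.twist Γ).mulL z X) (hb1.src_tgt c b)
      simp only [hb1.mulL_assoc] at this
      exact this
  rw [retract, sw_sw_lin e _ hl hr]
  refine Eq.trans (sw_congr _ fun z n' => (hN.lact hf _ n').trans (sw_congr _ fun y n'' =>
    congrArg (f · n'') (hH.src_dot hΓ _ y))) ?_
  refine (sw_coassoc_twist hH hW hN
    (f := fun z y n => f (H.star Γ (𝐬 ((H.twist Γ).counit (H.cancel Γ Y z))) y) n) (by fun_prop)
    (by fun_prop) (by fun_prop) (fun b z y n => ?_) (fun b z y n => ?_) n).trans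
    (sw_congr _ fun x n' => ?_)
  · rw [cancel_bull hH hΓ, counit_twist_tgt_bull hH hW, star_src_mulB_twist hH hW]
  · rw [hst, hbal]
  · have hT : H.TBal Γ H.lactL H.comulLift (fun w y =>
        f (H.star Γ (𝐬 ((H.twist Γ).counit w)) y) n') := ⟨by fun_prop, by fun_prop, fun b w y => by
      rw [counit_twist_tgt_bull hH hW, star_src_mulB_twist hH hW, hb.tla_regular hΓ]⟩
    rw [← tco_cancel_right hH hW hT, ← map_sw_left (φ := f) _ _ hl]
    refine congrArg (f · n') ?_
    refine Eq.trans (sw_congr _ fun w y => ?_) (tco_counit hH hW hb.isCom_regular _)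
    rw [hb.tla_regular hΓ]

include hH hW hN in
theorem tla_retract (b : B) (Y : L) (n : N) :
    (H.twist Γ).tla (H.cocycleInv Γ) laN e b (H.retract Γ laN e Y n) =
      H.retract Γ laN e (𝐬 b ⬝ Y) n := by
  have hΓ := hW.cocycle
  have hb := hH.bialgebroid
  rw [tla_apply, coact_retract hH hW hN (bal_tla' (isLeftBialgebroid_twist hH hW)
    (isTwoCocycle_cocycleInv hH hW) hN b)]
  refine sw_congr _ fun z n' => ?_
  have e1 : H.bull Γ (𝐬 b) (H.cancel Γ Y z) = H.cancel Γ (𝐬 b ⬝ Y) z := by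
    have := hH.src_mul_bull hΓ b H.oneL (H.cancel Γ Y z)
    rwa [hb.mul_oneL, hH.oneL_bull hΓ, ← cancel_src_mul hH hΓ] at this
  exact congrArg (laN · n') ((cocycleInv_apply hH hΓ _ _).trans (congrArg _ e1))

variable (H Γ) in
/-- The candidate for the inverse of `pull` for the inverse cocycle. -/
def unpull (laN : B →ₗ[k] N →ₗ[k] N) (e : N →ₗ[k] L ⊗[k] N) (g : L → N → V) (X : L) (n : N) : V :=
  sw (e n) (fun z n' => H.pull Γ H.comulLift (fun x y => g x (H.retract Γ laN e y n')) X z)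

include hH hW hN in
theorem bal_retract_test {g : L → N → V} (hg : (H.twist Γ).TBal (H.cocycleInv Γ) laN e g) (n : N) :
    H.DBal H.lactL (fun x y => g x (H.retract Γ laN e y n)) := by
  have hl := hg.left
  have hr := hg.right
  refine ⟨by fun_prop, by fun_prop, fun b x y => ?_⟩
  rw [lactL_apply, ← tla_retract hH hW hN, ← tgt_bull_cocycleInv hH hW]
  exact hg.bal b x _

include hH hW hN in
theorem pull_retract_bull {g : L → N → V} (hg : (H.twist Γ).TBal (H.cocycleInv Γ) laN e g) (b : B)
    (X z : L) (n : N) :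
    H.pull Γ H.comulLift (fun x y => g x (H.retract Γ laN e y n)) X (H.bull Γ (𝐭 b) z) =
      H.pull Γ H.comulLift (fun x y => g x (H.retract Γ laN e y (laN b n))) X z := by
  rw [pull_colin hH hW.cocycle (hH.isColin_tgt_bull hW.cocycle b) (bal_retract_test hH hW hN hg n)]
  simp only [retract_tgt_bull hH hW hN]

include hH hW hN in
theorem unpull_lact {g : L → N → V} (hg : (H.twist Γ).TBal (H.cocycleInv Γ) laN e g) (b : B)
    (X : L) (n : N) : H.unpull Γ laN e g X (laN b n) = sw (e n) (fun z n' =>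
      H.pull Γ H.comulLift (fun x y => g x (H.retract Γ laN e y n')) X (H.star Γ (𝐬 b) z)) := by
  have hl := hg.left
  have hr := hg.right
  refine (hN.lact ((dBal_twist_iff hH hW (by fun_prop) (by fun_prop)).2 fun c z n' =>
    pull_retract_bull hH hW hN hg c X z n') b n).trans (sw_congr _ fun z n' => ?_)
  exact congrArg _ (hH.src_dot hW.cocycle b z)

include hH hW hN in
theorem bal_unpull {g : L → N → V} (hg : (H.twist Γ).TBal (H.cocycleInv Γ) laN e g) :
    (H.twist Γ).DBal laN (fun X n => H.unpull Γ laN e g X n) := by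
  have hb := hH.bialgebroid
  have hΓ := hW.cocycle
  have hl := hg.left
  have hr := hg.right
  refine (dBal_twist_iff hH hW (by unfold unpull; fun_prop) (by unfold unpull; fun_prop)).2
    fun b X n => ?_
  rw [unpull_lact hH hW hN hg, unpull]
  refine sw_congr _ fun z n' => ?_
  rw [← hb.tla_regular hΓ]
  exact (bal_pull hH hb.isCom_regular hΓ (bal_retract_test hH hW hN hg n')).bal b X z

end

end

/-! ### Weak invertibility of the inverse cocycle -/

section

section
variable (hH : H.IsLeftHopfAlgebroid) (hW : H.WInv Γ) (hN : (H.twist Γ).IsCom laN raN e)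

include hH hW hN in
theorem tBal_counit_twist {f : L → N → V} (hf : (H.twist Γ).DBal laN f) (n : N) :
    H.TBal Γ H.lactL H.comulLift (fun x y => f x (laN ((H.twist Γ).counit y) n)) := by
  have hb := hH.bialgebroid
  have hl := hf.left
  have hr := hf.right
  refine ⟨by fun_prop, by fun_prop, fun b x y => ?_⟩
  rw [hb.tla_regular hW.cocycle, counit_twist_src_star hH hW, hN.la_mul,
    (dBal_twist_iff hH hW hl hr).1 hf]

include hH hW hN in
/-- `(Γ⁻¹)^#` for a comodule of `L^Γ`, in terms of the inverse of `Γ^#` on `L ⊗ L`. -/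
theorem pull_cocycleInv_coact {f : L → N → V} (hf : (H.twist Γ).DBal laN f) (X : L) (n : N) :
    (H.twist Γ).pull (H.cocycleInv Γ) e f X n = sw (e n) (fun z n' =>
      H.push Γ H.lactL H.comulLift (fun x y => f x (laN ((H.twist Γ).counit y) n')) X z) := by
  have h1 := isLeftHopfAlgebroid_twist hH hW
  have hl := hf.left
  have hr := hf.right
  have hG := bal_pull_right h1 (isTwoCocycle_cocycleInv hH hW) hf X
  have hG' := (dBal_twist_iff hH hW hG.left hG.right).1 hG
  have e1 := sw_coassoc_twist hH hW hN (f := fun u y n => sw ((H.twist Γ).transLift X) (fun p q =>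
      f ((H.twist Γ).mulL p ((H.twist Γ).tgt (H.cocycleInv Γ q u)))
        (laN ((H.twist Γ).counit y) n))) (by fun_prop) (by fun_prop) (by fun_prop)
    (fun b u y n => by rw [counit_twist_src_star hH hW, hN.la_mul, hG'])
    (fun b u y n => by rw [counit_twist_tgt_bull hH hW, hN.la_mul]) n
  refine Eq.trans ?_ (e1.trans (sw_congr _ fun z n' => ?_))
  · rw [pull, sw_comm]
    refine sw_congr _ fun u n' => ?_
    rw [sw_comm]
    refine sw_congr _ fun p q => ?_
    rw [← map_sw (φ := f _) _ _ (hr _), hN.counit]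
  · rw [← pull_cocycleInv hH hW (tBal_counit_twist hH hW hN hf n'), pull, sw_comm]

include hH hW hN in
/-- `unpull` is a left inverse of `pull` for `Γ⁻¹`. -/
theorem unpull_pull {f : L → N → V} (hf : (H.twist Γ).DBal laN f) (X : L) (n : N) :
    H.unpull Γ laN e (fun x n => (H.twist Γ).pull (H.cocycleInv Γ) e f x n) X n = f X n := by
  have hb := hH.bialgebroid
  have hΓ := hW.cocycle
  have hR := hb.isCom_regular
  have hl := hf.left
  have hr := hf.right
  have hT := tBal_counit_twist hH hW hN hf
  have hTl := fun n => (hT n).left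
  have hTr := fun n => (hT n).right
  -- the tests `(w, n) ↦ Γ^#⁻¹(x ⊗ w)` are balanced over `L^Γ`
  have hp : ∀ b x w n, H.push Γ H.lactL H.comulLift (fun x y => f x (laN ((H.twist Γ).counit y) n)) x
      (H.bull Γ (𝐭 b) w) = H.push Γ H.lactL H.comulLift
        (fun x y => f x (laN ((H.twist Γ).counit y) (laN b n))) x w := fun b x w n => by
    rw [push_colin hH hW hR hR (hH.isColin_tgt_bull hΓ b) (hT n)]
    simp only [counit_twist_tgt_bull hH hW, hN.la_mul]
  have e1 : ∀ x y n, (H.twist Γ).pull (H.cocycleInv Γ) e f x (H.retract Γ laN e y n) =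
      sw (e n) (fun z n' => H.push Γ H.lactL H.comulLift
        (fun x y => f x (laN ((H.twist Γ).counit y) n')) x (H.cancel Γ y z)) := fun x y n => by
    rw [pull_cocycleInv_coact hH hW hN hf, coact_retract hH hW hN]
    exact (dBal_twist_iff hH hW (by fun_prop) (by fun_prop)).2 fun b w n => hp b x w n
  simp only [unpull, e1]
  have hD : ∀ n', H.DBal H.lactL fun x w => H.push Γ H.lactL H.comulLift
      (fun x y => f x (laN ((H.twist Γ).counit y) n')) x w := fun n' => bal_push (hT n')
  have hC : ∀ n w, H.DBal H.lactL (fun x y => H.push Γ H.lactL H.comulLift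
      (fun x y => f x (laN ((H.twist Γ).counit y) n)) x (H.cancel Γ y w)) := fun n w =>
    ⟨by fun_prop, by fun_prop, fun b x y => by
      rw [(hD n).bal, lactL_apply, lactL_apply, cancel_src_mul hH hΓ]⟩
  have e2 := sw_coassoc_twist hH hW hN (f := fun z w n => H.pull Γ H.comulLift (fun x y =>
      H.push Γ H.lactL H.comulLift
        (fun x y => f x (laN ((H.twist Γ).counit y) n)) x (H.cancel Γ y w)) X z)
      (by fun_prop) (by fun_prop) (by fun_prop) (fun b z w n => by
        rw [pull_colin hH hΓ (hH.isColin_tgt_bull hΓ b) (hC n w)]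
        simp only [cancel_tgt_bull hH hΓ])
      (fun b z w n => by simp only [cancel_bull hH hΓ, hp]) n
  refine Eq.trans ?_ (e2.trans ?_)
  · refine sw_congr _ fun z n' => ?_
    unfold pull
    refine Eq.trans ?_ (sw_comm _ _ _)
    exact sw_congr _ fun p q => sw_comm _ _ _
  · rw [← hN.counit n, map_sw (φ := f X) _ _ (hr X), hN.counit]
    refine sw_congr _ fun x n' => ?_
    rw [← pull_push hW hR (hT n')]
    have e3 := tco_comul hH hW hR (f := fun u v w => sw (H.transLift X) (fun p q =>
      H.push Γ H.lactL H.comulLift (fun x y => f x (laN ((H.twist Γ).counit y) n'))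
        (p ⬝ 𝐭 (Γ q u)) (H.cancel Γ v w))) (by fun_prop) (by fun_prop) (by fun_prop)
      (fun b u v w => (bal_pull_right hH hΓ (hC n' w) X).bal b u v)
      (fun b u v w => by simp only [cancel_tgt_bull hH hΓ, hb.tla_regular hΓ]) x
    refine Eq.trans (sw_congr _ fun z w => ?_) (e3.trans ?_)
    · exact sw_comm _ _ _
    · rw [pull, sw_comm]
      refine sw_congr _ fun u y => ?_
      rw [sw_comm]
      refine sw_congr _ fun p q => ?_
      rw [← map_sw (φ := H.push Γ H.lactL H.comulLift
        (fun x y => f x (laN ((H.twist Γ).counit y) n')) (p ⬝ 𝐭 (Γ q u))) _ _ (by fun_prop),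
        tco_cancel hH hW]

include hH hW hN in
/-- `unpull` is a right inverse of `pull` for `Γ⁻¹`. -/
theorem pull_unpull {g : L → N → V} (hg : (H.twist Γ).TBal (H.cocycleInv Γ) laN e g) (X : L)
    (n : N) : (H.twist Γ).pull (H.cocycleInv Γ) e (fun x n => H.unpull Γ laN e g x n) X n =
      g X n := by
  have hb := hH.bialgebroid
  have hΓ := hW.cocycle
  have hR := hb.isCom_regular
  have h1 := isLeftHopfAlgebroid_twist hH hW
  have hb1 := h1.bialgebroid
  have hl := hg.left
  have hr := hg.right
  have hU := bal_unpull hH hW hN hg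
  have hUl := hU.left
  have hUr := hU.right
  have hD := bal_retract_test hH hW hN hg
  have hP : ∀ n, H.TBal Γ H.lactL H.comulLift (fun x y =>
      H.pull Γ H.comulLift (fun x y => g x (H.retract Γ laN e y n)) x y) := fun n =>
    bal_pull hH hR hΓ (hD n)
  have hst : ∀ b c X, H.star Γ (𝐬 c) (H.bull Γ (𝐭 b) X) = H.bull Γ (𝐭 b) (H.star Γ (𝐬 c) X) :=
    fun b c X => by
      rw [← hH.tgt_dot hΓ, ← hH.tgt_dot hΓ, ← hH.src_dot hΓ, ← hH.src_dot hΓ]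
      have := congrArg (fun z => (H.twist Γ).mulL z X) (hb1.src_tgt c b)
      simp only [hb1.mulL_assoc] at this
      exact this
  have hS : ∀ n w, H.TBal Γ H.lactL H.comulLift (fun x y => H.pull Γ H.comulLift
      (fun x y => g x (H.retract Γ laN e y n)) x
        (H.star Γ (𝐬 ((H.twist Γ).counit y)) w)) := fun n w =>
    ⟨by fun_prop, by fun_prop, fun b x y => by
      rw [(hP n).bal, hb.tla_regular hΓ, hb.tla_regular hΓ, counit_twist_src_star hH hW,
        star_src_mulB_twist hH hW]⟩
  rw [pull_cocycleInv_coact hH hW hN hU]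
  have e1 : ∀ z n, H.push Γ H.lactL H.comulLift
      (fun x y => H.unpull Γ laN e g x (laN ((H.twist Γ).counit y) n)) X z =
      sw (e n) (fun w n' => H.push Γ H.lactL H.comulLift (fun x y => H.pull Γ H.comulLift
        (fun x y => g x (H.retract Γ laN e y n')) x
          (H.star Γ (𝐬 ((H.twist Γ).counit y)) w)) X z) := fun z n => by
    simp only [unpull_lact hH hW hN hg]
    unfold push
    rw [sw_comm]
  simp only [e1]
  refine (sw_coassoc_twist hH hW hN (f := fun z w n => H.push Γ H.lactL H.comulLift
    (fun x y => H.pull Γ H.comulLift (fun x y => g x (H.retract Γ laN e y n)) x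
      (H.star Γ (𝐬 ((H.twist Γ).counit y)) w)) X z) (by fun_prop) (by fun_prop) (by fun_prop)
    (fun b z w n => ?_) (fun b z w n => ?_) n).trans ?_
  · rw [push_colin hH hW hR hR (hH.isColin_tgt_bull hΓ b) (hS n w)]
    simp only [counit_twist_tgt_bull hH hW, star_src_mulB_twist hH hW]
  · simp only [hst, pull_retract_bull hH hW hN hg]
  · rw [← retract_coact hH hW hN n, map_sw (φ := g X) _ _ (hr X), retract_coact hH hW hN]
    refine sw_congr _ fun x n' => ?_
    rw [← push_pull hW hR (hD n') X x, ← pull_cocycleInv hH hW (hP n')]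
    simp only [← pull_cocycleInv hH hW (hS n' _)]
    have hB := bal_pull_right h1 (isTwoCocycle_cocycleInv hH hW) (TBal.dBal hH hΓ (hP n')) X
    have e3 := tco_coassoc hH hW hR (f := fun u y w => sw ((H.twist Γ).transLift X) (fun p q =>
      H.pull Γ H.comulLift (fun x y => g x (H.retract Γ laN e y n'))
        ((H.twist Γ).mulL p ((H.twist Γ).tgt (H.cocycleInv Γ q u)))
        (H.star Γ (𝐬 ((H.twist Γ).counit y)) w))) (by fun_prop) (by fun_prop) (by fun_prop)
      (fun b u y w => by
        rw [counit_twist_src_star hH hW, star_src_mulB_twist hH hW, ← hb.tla_regular hΓ b]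
        exact (hB.tBal hH hΓ).bal b u _)
      (fun b u y w => by
        rw [counit_twist_tgt_bull hH hW, star_src_mulB_twist hH hW, hb.tla_regular hΓ]) x
    refine Eq.trans (sw_congr _ fun z w => ?_) (e3.trans ?_)
    · rw [pull, sw_comm]
    · rw [pull, sw_comm]
      refine sw_congr _ fun u y => ?_
      rw [sw_comm]
      refine sw_congr _ fun p q => ?_
      rw [← map_sw (φ := H.pull Γ H.comulLift (fun x y => g x (H.retract Γ laN e y n')) _) _ _
        (by fun_prop)]
      exact congrArg _ ((sw_congr _ fun _ _ => (hb.tla_regular hΓ _ _).symm).trans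
        (tco_counit hH hW hR y))

include hH hW in
/-- The inverse of `J` for `Γ⁻¹` on a comodule `N` of `L^Γ` is dual to `unpull`. -/
theorem wInv_cocycleInv : (H.twist Γ).WInv (H.cocycleInv Γ) where
  cocycle := isTwoCocycle_cocycleInv hH hW
  iso {N} _ _ laN raN e hN := by
    have h1 := isLeftHopfAlgebroid_twist hH hW
    have hΓ' := isTwoCocycle_cocycleInv hH hW
    set D : Submodule k (L ⊗[k] N) := (H.twist Γ).diamond (fun b m => laN b m)
    set S : Submodule k (L ⊗[k] N) := balancedRel k
      (fun b X => (H.twist Γ).bull (H.cocycleInv Γ) ((H.twist Γ).tgt b) X)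
      (fun b m => (H.twist Γ).tla (H.cocycleInv Γ) laN e b m)
    have hS : (H.twist Γ).TBal (H.cocycleInv Γ) laN e (fun X n => S.mkQ (X ⊗ₜ[k] n)) := bal_mkQ
    have hD : (H.twist Γ).DBal laN (fun X n => D.mkQ (X ⊗ₜ[k] n)) := bal_mkQ
    have e0 : ∀ z, (D.mkQ ∘ₗ (H.twist Γ).sharpInv (H.cocycleInv Γ) e) z =
        sw z (fun X n => (H.twist Γ).pull (H.cocycleInv Γ) e
          (fun X n => D.mkQ (X ⊗ₜ[k] n)) X n) := fun z =>
      (map_eq_sw D.mkQ _).trans (sw_sharpInv z hD.left hD.right)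
    refine ⟨le_antisymm (fun z hz => ?_) (fun z hz => ?_), fun w => ?_⟩
    · refine mem_of_sw ?_
      refine (sw_congr z fun X n => (pull_unpull hH hW hN hS X n).symm).trans ?_
      have hU := bal_unpull hH hW hN hS
      rw [← sw_sharpInv _ hU.left hU.right]
      exact hU.sw_eq_zero ((Submodule.Quotient.mk_eq_zero _).1 hz)
    · rw [LinearMap.mem_ker, e0]
      exact (bal_pull h1 hN hΓ' hD).sw_eq_zero hz
    · obtain ⟨w, rfl⟩ := D.mkQ_surjective w
      have hP := bal_pull h1 hN hΓ' hD
      have hl := hP.left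
      have hr := hP.right
      refine ⟨sw w (fun X n => H.unpull Γ laN e (fun X n => X ⊗ₜ[k] n) X n), ?_⟩
      rw [e0, map_eq_sw D.mkQ w]
      set G : L → N → _ := fun X n => (H.twist Γ).pull (H.cocycleInv Γ) e
          (fun X n => D.mkQ (X ⊗ₜ[k] n)) X n
      rw [map_sw (φ := fun z => sw z G) _ _ (by fun_prop)]
      refine sw_congr _ fun X n => ?_
      rw [← unpull_pull hH hW hN hD]
      unfold unpull
      rw [map_sw (φ := fun z => sw z G) _ _ (by fun_prop)]
      refine sw_congr _ fun z n' => ?_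
      unfold pull
      rw [map_sw (φ := fun z => sw z G) _ _ (by fun_prop)]
      refine sw_congr _ fun p q => ?_
      rw [map_sw (φ := fun z => sw z G) _ _ (by fun_prop)]
      exact sw_congr _ fun u v => sw_tmul _ _ ⟨hl, hr⟩

end

end

/-! ### The groupoid laws -/

section

variable {Θ Λ : L →ₗ[k] L →ₗ[k] B}

section
variable (hH : H.IsLeftHopfAlgebroid) (hW : H.WInv Γ)

include hH hW in
/-- `Γ⁻¹ ∘ Γ` is trivial. -/
theorem cocycleComp_cocycleInv_left : H.cocycleComp (H.cocycleInv Γ) Γ = H.trivialCocycle :=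
  LinearMap.ext₂ fun X Y => by
    have hb := hH.bialgebroid
    have hΓ := hW.cocycle
    have hR := hb.isCom_regular
    have hf : Bal (k := k) (fun (b : B) X => H.ractL b X) (fun (b : B) Y => H.lactL b Y)
        (fun X Y => H.counit (X ⬝ Y)) := ⟨by fun_prop, by fun_prop, fun b X Y => by
      rw [ractL_apply, lactL_apply, hb.mulL_assoc]⟩
    refine Eq.trans ?_ ((tco_cocycleInv hH hW hR hR hf X Y).trans
      (trivialCocycle_apply X Y).symm)
    rw [cocycleComp_tco hH hW (isTwoCocycle_cocycleInv hH hW)]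
    refine sw_congr _ fun x x' => sw_congr _ fun y y' => ?_
    rw [← hb.counit_star hΓ, star_apply, map_sw (φ := H.counit) _ _ (by fun_prop),
      hb.tla_regular hΓ]
    refine sw_congr _ fun u v => ?_
    rw [map_sw (φ := H.counit) _ _ (by fun_prop)]
    refine sw_congr _ fun u' v' => ?_
    rw [lactL_apply, hb.mulL_assoc]

include hH hW in
theorem twist_cocycleInv : (H.twist Γ).twist (H.cocycleInv Γ) = H := by
  rw [← twist_cocycleComp hH hW (wInv_cocycleInv hH hW), cocycleComp_cocycleInv_left hH hW,
    twist_trivialCocycle hH]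

include hH hW in
/-- `Γ ∘ Γ⁻¹` is trivial. -/
theorem cocycleComp_cocycleInv_right :
    (H.twist Γ).cocycleComp Γ (H.cocycleInv Γ) = (H.twist Γ).trivialCocycle :=
  LinearMap.ext₂ fun X Y => by
    have hΓ := hW.cocycle
    rw [cocycleComp_apply, twist_cocycleInv hH hW, trivialCocycle_apply, dot_apply,
      map_sw (φ := (H.twist Γ).counit) _ _ (by fun_prop)]
    refine sw_congr _ fun x x' => ?_
    rw [map_sw (φ := (H.twist Γ).counit) _ _ (by fun_prop)]
    refine sw_congr _ fun y y' => ?_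
    rw [cocycleInv_apply hH hΓ, ← hH.src_mul_bull hΓ]
    rfl

include hH in
/-- By `wInv_cocycleInv`, comodules of `L^Γ` have twists, which are comodules of `(L^Γ)^{Γ⁻¹} = L`. On
these `Γ^#` is invertible, and `(Γ ∘ Γ⁻¹)^#` is the composite of `(Γ⁻¹)^#` and `Γ^#`. -/
theorem isInvertible_cocycleInv (hΓ : H.IsInvertibleTwoCocycle Γ) :
    (H.twist Γ).IsInvertibleTwoCocycle (H.cocycleInv Γ) := by
  have hW := hΓ.wInv hH
  have h1 := isLeftHopfAlgebroid_twist hH hW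
  have hW' := wInv_cocycleInv hH hW
  have e := twist_cocycleInv hH hW
  have hΓ2 : ((H.twist Γ).twist (H.cocycleInv Γ)).IsInvertibleTwoCocycle Γ := by rwa [e]
  have hb2 : ((H.twist Γ).twist (H.cocycleInv Γ)).IsLeftBialgebroid := by
    rw [e]
    exact hH.bialgebroid
  refine (isTwoCocycle_cocycleInv hH hW).isInvertible h1.bialgebroid fun hM hN => ?_
  refine SharpIso.of_cocycleComp h1 hW' hΓ2.isTwoCocycle hM hN
    (hΓ2.sharpIso hb2 (isCom_tco h1 hW' hM) (isCom_tco h1 hW' hN)) ?_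
  rw [cocycleComp_cocycleInv_right hH hW]
  exact (isInvertible_trivialCocycle h1.bialgebroid).sharpIso h1.bialgebroid hM hN

include hH in
theorem isInvertible_cocycleComp (hΓ : H.IsInvertibleTwoCocycle Γ)
    (hΘ : (H.twist Γ).IsInvertibleTwoCocycle Θ) :
    H.IsInvertibleTwoCocycle (H.cocycleComp Θ Γ) := by
  have hW := hΓ.wInv hH
  have hb1 := isLeftBialgebroid_twist hH hW
  refine (isTwoCocycle_cocycleComp hH hW hΘ.isTwoCocycle).isInvertible hH.bialgebroid
    fun hM hN => ?_
  exact SharpIso.cocycleComp hH hW hΘ.isTwoCocycle hM hN (hΓ.sharpIso hH.bialgebroid hM hN)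
    (hΘ.sharpIso hb1 (isCom_tco hH hW hM) (isCom_tco hH hW hN))

include hH hW in
theorem cocycleComp_trivialCocycle_left :
    H.cocycleComp (H.twist Γ).trivialCocycle Γ = Γ := LinearMap.ext₂ fun X Y => by
  have hb := hH.bialgebroid
  have hb1 := isLeftBialgebroid_twist hH hW
  have hΓ := hW.cocycle
  have hC := isCom_tco hH hW hb.isCom_regular
  have hf : Bal (k := k) (fun (b : B) X => H.tra Γ H.lactL H.comulLift b X)
      (fun (b : B) Y => H.tla Γ H.lactL H.comulLift b Y) (fun X Y => Γ X Y) :=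
    ⟨by fun_prop, by fun_prop, fun b X Y => by
      rw [hb.tra_regular hΓ, hb.tla_regular hΓ, hb.cocycle' hΓ]⟩
  have e := sw_sharp_trivialCocycle hb1 hC hC hf (X ⊗ₜ[k] Y)
  rw [sw_tmul _ _ hf.bilin, sw_sharp _ _ _ _ _ hf.left hf.right,
    sw_tmul _ _ ⟨by fun_prop, by fun_prop⟩] at e
  simp only [hb.tla_regular hΓ] at e
  rw [cocycleComp_tco hH hW (isTwoCocycle_trivialCocycle hb1), e]

include hH in
theorem cocycleComp_trivialCocycle_right (hΓ : H.IsTwoCocycle Γ) :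
    H.cocycleComp Γ H.trivialCocycle = Γ := LinearMap.ext₂ fun X Y => by
  rw [cocycleComp_apply, twist_trivialCocycle hH]
  have hb := hH.bialgebroid
  rw [← hb.counit_star hΓ, star_apply, map_sw (φ := H.counit) _ _ (by fun_prop)]
  refine sw_congr _ fun x x' => ?_
  rw [map_sw (φ := H.counit) _ _ (by fun_prop)]
  refine sw_congr _ fun y y' => ?_
  rw [trivialCocycle_apply, hb.mulL_assoc]

include hH hW in
/-- The composition of cocycles is associative. -/
theorem cocycleComp_assoc (hΘ : (H.twist Γ).WInv Θ) (hΛ : ((H.twist Γ).twist Θ).WInv Λ) :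
    H.cocycleComp ((H.twist Γ).cocycleComp Λ Θ) Γ = H.cocycleComp Λ (H.cocycleComp Θ Γ) := by
  have hb := hH.bialgebroid
  have hR := hb.isCom_regular
  have h1 := isLeftHopfAlgebroid_twist hH hW
  have hΞ := hW.cocycleComp hH hΘ
  have e := twist_cocycleComp hH hW hΘ
  have hΛ' : (H.twist (H.cocycleComp Θ Γ)).WInv Λ := by rwa [e]
  have hΛΘ := hΘ.cocycleComp h1 hΛ
  -- the left twists of `L` by the two composites agree
  have hs : H.star (H.cocycleComp ((H.twist Γ).cocycleComp Λ Θ) Γ) =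
      H.star (H.cocycleComp Λ (H.cocycleComp Θ Γ)) := by
    have hC := isCom_tco hH hW hR
    have hC2 := isCom_tco h1 hΘ hC
    have hμ := hb.isPairing_mul.twist hH hW hR hR hR
    rw [← star_eq_twp] at hμ
    have hμ2 := hμ.twist h1 hΘ hC hC hC
    -- twisting the coaction of `L` by `Θ ∘ Γ`, or by `Γ` and then by `Θ`, has the same result
    have hd : ∀ {V : Type u} [AddCommGroup V] [Module k V] {f : L → L → V},
        ((H.twist Γ).twist Θ).DBal ((H.twist Γ).tla Θ (H.tla Γ H.lactL H.comulLift)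
          (H.tco Γ H.lactL H.comulLift)) f → ∀ X,
        sw (H.tco (H.cocycleComp Θ Γ) H.lactL H.comulLift X) f =
          sw ((H.twist Γ).tco Θ (H.tla Γ H.lactL H.comulLift)
            (H.tco Γ H.lactL H.comulLift) X) f := fun {V _ _ f} hf X => by
      refine tco_cocycleComp hH hW hΘ hR ?_ X
      have ht : H.tla (H.cocycleComp Θ Γ) H.lactL H.comulLift = (H.twist Γ).tla Θ
          (H.tla Γ H.lactL H.comulLift) (H.tco Γ H.lactL H.comulLift) :=
        LinearMap.ext₂ (tla_cocycleComp hH hW hΘ.cocycle hR)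
      refine DBal.tBal hH hΞ.cocycle ?_
      rw [ht, e]
      exact hf
    rw [star_cocycleComp hH hW hΛΘ.cocycle, star_cocycleComp hH hΞ hΛ'.cocycle,
      star_cocycleComp hH hW hΘ.cocycle, hμ.twp_cocycleComp h1 hΘ hΛ.cocycle hC hC hC]
    refine LinearMap.ext₂ fun X Y => ?_
    set P := twp Θ (H.tco Γ H.lactL H.comulLift) (H.tco Γ H.lactL H.comulLift)
      (H.tla Γ H.lactL H.comulLift) (H.star Γ)
    have hf : Bal (k := k) (fun (b : B) X => (H.twist Γ).tra Θ (H.tla Γ H.lactL H.comulLift)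
          (H.tco Γ H.lactL H.comulLift) b X)
        (fun (b : B) Y => (H.twist Γ).tla Θ (H.tla Γ H.lactL H.comulLift)
          (H.tco Γ H.lactL H.comulLift) b Y) (fun X Y => P X Y) :=
      ⟨by fun_prop, by fun_prop, hμ2.mid⟩
    have e1 := sw_sharp_congr hΛ.cocycle hC2 hC2 hd hd hf (X ⊗ₜ[k] Y)
    rw [sw_sharp _ _ _ _ _ hf.left hf.right, sw_sharp _ _ _ _ _ hf.left hf.right,
      sw_tmul _ _ ⟨by fun_prop, by fun_prop⟩, sw_tmul _ _ ⟨by fun_prop, by fun_prop⟩] at e1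
    simp only [hμ2.left] at e1
    rw [twp_apply, twp_apply, ← e1]
    simp only [tla_cocycleComp hH hW hΘ.cocycle hR]
  refine LinearMap.ext₂ fun X Y => ?_
  rw [cocycleComp_eq_counit hH hW hΛΘ.cocycle, cocycleComp_eq_counit hH hΞ hΛ'.cocycle, hs]

end

end

end BialgebroidData
end HopfAlgebroidTwist
end

/-! ### The groupoid -/

noncomputable section

namespace HopfAlgebroidTwist
namespace CocycleHom
open BialgebroidData

variable {k : Type u} [Field k]

theorem mk_congr {B L : Type u} [AddCommGroup B] [Module k B] [AddCommGroup L] [Module k L]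
    {H H' : BialgebroidData k B L} {hH : H.IsLeftHopfAlgebroid} {hH' : H'.IsLeftHopfAlgebroid}
    {Γ Θ : L →ₗ[k] L →ₗ[k] B} (hΓ : H.IsInvertibleTwoCocycle Γ) (ht : H.twist Γ = H')
    (hΘ : H.IsInvertibleTwoCocycle Θ) (ht' : H.twist Θ = H') (h : Γ = Θ) :
    (CocycleHom.mk Γ hΓ ht : CocycleHom ⟨B, L, H, hH⟩ ⟨B, L, H', hH'⟩) =
      CocycleHom.mk Θ hΘ ht' := by
  subst h
  rfl

/-- The identity of `H`, the trivial cocycle. -/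
def id (X : LeftHopfAlgebroid k) : CocycleHom X X :=
  .mk (hH := X.isLeftHopfAlgebroid) (hH' := X.isLeftHopfAlgebroid) X.data.trivialCocycle
    (isInvertible_trivialCocycle X.isLeftHopfAlgebroid.bialgebroid)
    (twist_trivialCocycle X.isLeftHopfAlgebroid)

/-- The composite of `Γ : H → H^Γ` and `Θ : H^Γ → (H^Γ)^Θ`, the cocycle `Θ ∘ Γ`. -/
def comp : ∀ {X Y Z : LeftHopfAlgebroid k}, CocycleHom X Y → CocycleHom Y Z → CocycleHom X Z
  | _, _, _, @mk _ _ _ _ _ _ _ _ H _ hH _ Γ hΓ ht, @mk _ _ _ _ _ _ _ _ _ _ _ _ Θ hΘ ht' =>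
    .mk (H.cocycleComp Θ Γ) (isInvertible_cocycleComp hH hΓ (ht ▸ hΘ)) (by
      subst ht ht'
      exact twist_cocycleComp hH (hΓ.wInv hH)
        (hΘ.wInv (isLeftHopfAlgebroid_twist hH (hΓ.wInv hH))))

/-- The inverse of `Γ : H → H^Γ`, the cocycle `Γ⁻¹` on `H^Γ`. -/
def inv : ∀ {X Y : LeftHopfAlgebroid k}, CocycleHom X Y → CocycleHom Y X
  | _, _, @mk _ _ _ _ _ _ _ _ H _ hH _ Γ hΓ ht =>
    .mk (H.cocycleInv Γ) (ht ▸ isInvertible_cocycleInv hH hΓ) (by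
      subst ht
      exact twist_cocycleInv hH (hΓ.wInv hH))

end CocycleHom

open BialgebroidData in
/-- Left Hopf algebroids and invertible 2-cocycles form a groupoid. -/
@[reducible] def cocycleGroupoid (k : Type u) [Field k] :
    CategoryTheory.Groupoid.{u + 1} (LeftHopfAlgebroid k) where
  Hom := CocycleHom
  id := CocycleHom.id
  comp := CocycleHom.comp
  inv := CocycleHom.inv
  id_comp := by
    rintro _ _ @⟨B, L, _, _, _, _, H, _, hH, _, Γ, hΓ, rfl⟩
    exact CocycleHom.mk_congr _ _ _ _ (cocycleComp_trivialCocycle_right hH hΓ.isTwoCocycle)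
  comp_id := by
    rintro _ _ @⟨B, L, _, _, _, _, H, _, hH, _, Γ, hΓ, rfl⟩
    exact CocycleHom.mk_congr _ _ _ _ (cocycleComp_trivialCocycle_left hH (hΓ.wInv hH))
  assoc := by
    rintro _ _ _ _ @⟨B, L, _, _, _, _, H, _, hH, h1, Γ, hΓ, rfl⟩ @⟨_, _, _, _, _, _, _, _, _, h2, Θ, hΘ, rfl⟩
      @⟨_, _, _, _, _, _, _, _, _, _, Λ, hΛ, rfl⟩
    exact CocycleHom.mk_congr _ _ _ _ (cocycleComp_assoc hH (hΓ.wInv hH) (hΘ.wInv h1)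
      (hΛ.wInv h2)).symm
  inv_comp := by
    rintro _ _ @⟨B, L, _, _, _, _, H, _, hH, _, Γ, hΓ, rfl⟩
    exact CocycleHom.mk_congr _ _ _ _ (cocycleComp_cocycleInv_right hH (hΓ.wInv hH))
  comp_inv := by
    rintro _ _ @⟨B, L, _, _, _, _, H, _, hH, _, Γ, hΓ, rfl⟩
    exact CocycleHom.mk_congr _ _ _ _ (cocycleComp_cocycleInv_left hH (hΓ.wInv hH))

end HopfAlgebroidTwist
end

open HopfAlgebroidTwist BialgebroidData in
theorem mainTheorem8 (k : Type u) [Field k] :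
    -- the trivial cocycle, the inverse and the composition are invertible cocycles, with the
    -- expected cotwists
    (∀ (B L : Type u) [AddCommGroup B] [Module k B] [AddCommGroup L] [Module k L]
      (H : HopfAlgebroidTwist.BialgebroidData k B L), H.IsLeftHopfAlgebroid →
      (H.IsInvertibleTwoCocycle H.trivialCocycle ∧ H.twist H.trivialCocycle = H) ∧
      ∀ Γ : L →ₗ[k] L →ₗ[k] B, H.IsInvertibleTwoCocycle Γ →
        (H.twist Γ).IsLeftHopfAlgebroid ∧
        ((H.twist Γ).IsInvertibleTwoCocycle (H.cocycleInv Γ) ∧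
          (H.twist Γ).twist (H.cocycleInv Γ) = H) ∧
        ∀ Θ : L →ₗ[k] L →ₗ[k] B, (H.twist Γ).IsInvertibleTwoCocycle Θ →
          H.IsInvertibleTwoCocycle (H.cocycleComp Θ Γ) ∧
          H.twist (H.cocycleComp Θ Γ) = (H.twist Γ).twist Θ) ∧
    -- they make left Hopf algebroids and invertible cocycles a groupoid
    ∃ (G : CategoryTheory.Groupoid.{u + 1} (HopfAlgebroidTwist.LeftHopfAlgebroid k))
      (e : ∀ X Y : HopfAlgebroidTwist.LeftHopfAlgebroid k,
        G.Hom X Y ≃ HopfAlgebroidTwist.CocycleHom X Y),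
      ∀ (B L : Type u) [AddCommGroup B] [Module k B] [AddCommGroup L] [Module k L]
        (H H' H'' : HopfAlgebroidTwist.BialgebroidData k B L) (hH : H.IsLeftHopfAlgebroid)
        (hH' : H'.IsLeftHopfAlgebroid) (hH'' : H''.IsLeftHopfAlgebroid),
        (∃ (h₁ : H.IsInvertibleTwoCocycle H.trivialCocycle) (h₂ : H.twist H.trivialCocycle = H),
          e ⟨B, L, H, hH⟩ ⟨B, L, H, hH⟩ (G.id ⟨B, L, H, hH⟩) =
            HopfAlgebroidTwist.CocycleHom.mk H.trivialCocycle h₁ h₂) ∧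
        ∀ (Γ : L →ₗ[k] L →ₗ[k] B) (hΓ : H.IsInvertibleTwoCocycle Γ) (hΓ' : H.twist Γ = H'),
          (∃ (h₁ : H'.IsInvertibleTwoCocycle (H.cocycleInv Γ))
            (h₂ : H'.twist (H.cocycleInv Γ) = H),
            e ⟨B, L, H', hH'⟩ ⟨B, L, H, hH⟩ (G.inv ((e ⟨B, L, H, hH⟩ ⟨B, L, H', hH'⟩).symm
                (HopfAlgebroidTwist.CocycleHom.mk Γ hΓ hΓ'))) =
              HopfAlgebroidTwist.CocycleHom.mk (H.cocycleInv Γ) h₁ h₂) ∧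
          ∀ (Θ : L →ₗ[k] L →ₗ[k] B) (hΘ : H'.IsInvertibleTwoCocycle Θ) (hΘ' : H'.twist Θ = H''),
            ∃ (h₁ : H.IsInvertibleTwoCocycle (H.cocycleComp Θ Γ))
              (h₂ : H.twist (H.cocycleComp Θ Γ) = H''),
              e ⟨B, L, H, hH⟩ ⟨B, L, H'', hH''⟩
                (G.comp
                  ((e ⟨B, L, H, hH⟩ ⟨B, L, H', hH'⟩).symm
                    (HopfAlgebroidTwist.CocycleHom.mk Γ hΓ hΓ'))
                  ((e ⟨B, L, H', hH'⟩ ⟨B, L, H'', hH''⟩).symm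
                    (HopfAlgebroidTwist.CocycleHom.mk Θ hΘ hΘ'))) =
              HopfAlgebroidTwist.CocycleHom.mk (H.cocycleComp Θ Γ) h₁ h₂ := by
  refine ⟨fun B L _ _ _ _ H hH => ⟨⟨isInvertible_trivialCocycle hH.bialgebroid,
    twist_trivialCocycle hH⟩, fun Γ hΓ => ?_⟩, cocycleGroupoid k, fun _ _ => Equiv.refl _, ?_⟩
  · have hW := hΓ.wInv hH
    have h1 := isLeftHopfAlgebroid_twist hH hW
    exact ⟨h1, ⟨isInvertible_cocycleInv hH hΓ, twist_cocycleInv hH hW⟩, fun Θ hΘ =>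
      ⟨isInvertible_cocycleComp hH hΓ hΘ, twist_cocycleComp hH hW (hΘ.wInv h1)⟩⟩
  · intro B L _ _ _ _ H H' H'' hH hH' hH''
    refine ⟨⟨isInvertible_trivialCocycle hH.bialgebroid, twist_trivialCocycle hH, rfl⟩,
      fun Γ hΓ hΓ' => ?_⟩
    subst hΓ'
    have hW := hΓ.wInv hH
    refine ⟨⟨isInvertible_cocycleInv hH hΓ, twist_cocycleInv hH hW, rfl⟩, fun Θ hΘ hΘ' => ?_⟩
    subst hΘ'
    exact ⟨isInvertible_cocycleComp hH hΓ hΘ, twist_cocycleComp hH hW (hΘ.wInv hH'), rfl⟩
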